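/- Let $1\le a<b$ and $k\ge 1$ be integers with $\gcd(a,b)=1$ and $ka>1$, and let $\beta\in\mathbb C$. **Notation.** For a row $A=(a_1,\dots,a_n)$ of integers $0<a_1<\dots<a_n$ and $\beta'\in\mathbb C$, let $Y=\{x_n=0\}\subset\mathbb C^n$, $Z=\{x_{n-1}=0\}$, and let $\mathrm{Sol}_s(A,\beta')_p$ be the space of germs at $p\in Y$ of formal series $\sum_{m\ge0} f_m(x_1,\dots,x_{n-1})x_n^m$, all $f_m$ holomorphic in a common neighbourhood of $p$, that are Gevrey of order $\le s$ along $Y$ (i.e. $\sum_m f_m x_n^m/(m!)^{s-1}$ converges near $p$) and are annihilated by all $\partial^u-\partial^v$ ($u,v\in\mathbb N^n$, $Au=Av$) and by $\sum_j a_jx_j\partial_j-\beta'$. Write $\mathrm{Sol}=\mathrm{Sol}_{a_n/a_{n-1}}$. Fix arguments $\theta_1,\theta_2\in\mathbb R$ for $x_{n-1}$ and $x_n$. A rapid decay cycle is a path in $\mathbb C^*$ with a branch of $\log t$, both ends of which go to infinity with limiting arguments $\varphi$ such that $\cos(\theta_1+a_{n-1}\varphi)<0$ and $\cos(\theta_2+a_n\varphi)<0$.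 For such a path $\gamma$, $\Phi_\gamma(A,\beta')$ denotes the asymptotic expansion, as $x_n\to0$ in a sector around the direction $\theta_2$, uniformly for $(x_1,\dots,x_{n-1})$ near a point with $\arg x_{n-1}=\theta_1$, of $\int_\gamma t^{-\beta'-1}\exp(\sum_j x_jt^{a_j})\,dt$. If $\beta'\in\mathbb Z\setminus\mathbb NA$, half lines $e^{i\varphi}[0,+\infty[$ with $\varphi$ as above are also admitted as cycles, and $\Phi$ is then the expansion of $\int t^{-\beta'-1}\bigl(\exp(\sum_j x_jt^{a_j})-P_{\beta'}(x,t)\bigr)dt$, where $P_{\beta'}$ is the Taylor polynomial in $t$, of degree $\le\beta'$, of the exponential ($P_{\beta'}=0$ if $\beta'<0$). $\Phi$ is extended linearly to formal linear combinations of cycles. Use coordinates $(x_1,x_2)$ for $(a,b)$ and $(x_0,x_1,x_2)$ for $(1,ka,kb)$, and let $$\varpi_\beta:\ \mathrm{Sol}((1,ka,kb),\beta)_{(0,\varepsilon,0)}\to\bigoplus_{\ell=0}^{k-1}\mathrm{Sol}\bigl((a,b),\tfrac{\beta-\ell}{k}\bigr)_{(\varepsilon,0)},\qquad \varphi\mapsto\Bigl(\tfrac{\partial^\ell\varphi}{\partial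 x_0^\ell}(0,x_1,x_2)\Bigr)_{\ell}.$$ **Statement.** Let $\theta_1,\theta_2\in\mathbb R$. (0) There are cycles $\gamma_{\tau,r}$ ($1\le\tau\le a$, $0\le r<k$) for $(a,b)$ such that for each $r$ and each $\varepsilon$ with $\arg\varepsilon=\theta_1$ the expansions $\Phi_{\gamma_{\tau,r}}((a,b),\frac{\beta-r}{k})$, $1\le\tau\le a$, form a basis of $\mathrm{Sol}((a,b),\frac{\beta-r}{k})_{(\varepsilon,0)}$; all $\gamma_{\tau,r}$ are rapid decay cycles, except that, if $\frac{\beta-r}{k}\in\mathbb Z\setminus(\mathbb Na+\mathbb Nb)$, exactly one of $\gamma_{1,r},\dots,\gamma_{a,r}$ is a half line. For every such family $(\gamma_{\tau,r})$ there are linear combinations $\widetilde\gamma_{\tau,r}$ of cycles for $(1,ka,kb)$ and $\beta$ such that: (1) If $\gamma_{\tau,r}$ is a rapid decay path, $\widetilde\gamma_{\tau,r}$ is a linear combination of the paths $e^{-2\pi i\nu/k}\gamma_{\tau,r}^{1/k}$, $0\le\nu<k$, with the induced branches of the logarithm. (2) The space $E$ spanned by the $\widetilde\gamma_{\tau,r}$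 has dimension $ka$, and for all $x_0\in\mathbb C$, all $\varepsilon$ with $\arg\varepsilon=\theta_1$ and all real $s\ge b/a$, the map $\gamma\mapsto\Phi_\gamma((1,ka,kb),\beta)$ is an isomorphism from $E$ onto $\mathrm{Sol}_s((1,ka,kb),\beta)_{(x_0,\varepsilon,0)}$. (3) $\varpi_\beta$ is well defined. If it is an isomorphism, then for all $(\tau,r)$ $$\varpi_\beta\bigl(\Phi_{\widetilde\gamma_{\tau,r}}((1,ka,kb),\beta)\bigr)=\Bigl(0,\dots,0,\tfrac1k\Phi_{\gamma_{\tau,r}}\bigl((a,b),\tfrac{\beta-r}{k}\bigr),0,\dots,0\Bigr)$$ with the nonzero entry in position $r$; moreover, if $\gamma_{\tau,r}=e^{i\varphi}[0,+\infty[$, then $\widetilde\gamma_{\tau,r}-e^{i\varphi/k}[0,+\infty[$ is a linear combination of the other $\widetilde\gamma_{\tau',r'}$. (4) If $\varpi_\beta$ is not an isomorphism, there is exactly one pair $(\tau_0,r_0)$ for which $(0,\dots,\Phi_{\gamma_{\tau_0,r_0}},\dots,0)$ (entry in position $r_0$) is not in the image of $\varpi_\beta$; it satisfies $\beta=r_0+kq_0$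 with $q_0\in\mathbb N$; the formula of (3) holds for all other pairs; and $\Phi_{\widetilde\gamma_{\tau_0,r_0}}((1,ka,kb),\beta)$ is a polynomial. -/

import Mathlib

open Filter Topology MeasureTheory

namespace Hypergeo

noncomputable section

/-! ### Germs of formal series along a coordinate hyperplane

Points of `ℂ^(n+1)` are written `(x', z)` with `x' : Fin n → ℂ` and `z` the last coordinate; the
hyperplane `Y` is `z = 0`, and a point of `Y` is a point `p : Fin n → ℂ`. -/

/-- The stalk at `(p, 0)` of the completion of the sheaf of holomorphic functions along `z = 0`:
germs at `p` of sequences `(f_0, f_1, …)`, standing for `∑ f_m(x') z^m`, whose members are all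
holomorphic in one common neighbourhood of `p`. -/
def HolGerm {n : ℕ} (p : Fin n → ℂ) : Submodule ℂ (Germ (𝓝 p) (ℕ → ℂ)) where
  carrier := {φ | ∃ f : (Fin n → ℂ) → ℕ → ℂ, (f : Germ (𝓝 p) (ℕ → ℂ)) = φ ∧
    ∀ᶠ x in 𝓝 p, ∀ m, AnalyticAt ℂ (fun y => f y m) x}
  zero_mem' := ⟨0, rfl, Eventually.of_forall fun _ _ => analyticAt_const⟩
  add_mem' := by
    rintro _ _ ⟨f, rfl, hf⟩ ⟨g, rfl, hg⟩
    refine ⟨f + g, rfl, ?_⟩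
    filter_upwards [hf, hg] with x h1 h2 m
    exact (h1 m).add (h2 m)
  smul_mem' := by
    rintro c _ ⟨f, rfl, hf⟩
    refine ⟨c • f, rfl, ?_⟩
    filter_upwards [hf] with x h1 m
    exact analyticAt_const.mul (h1 m)

/-- `f` represents a member of the stalk at `(p, 0)`. -/
def IsHol {n : ℕ} (p : Fin n → ℂ) (f : (Fin n → ℂ) → ℕ → ℂ) : Prop :=
  ∀ᶠ x in 𝓝 p, ∀ m, AnalyticAt ℂ (fun y => f y m) x

/-- The linear map between stalks that is given on representatives by `T`. -/
def liftOp {n n' : ℕ} {p : Fin n → ℂ} {q : Fin n' → ℂ}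
    (T : ((Fin n → ℂ) → ℕ → ℂ) → ((Fin n' → ℂ) → ℕ → ℂ))
    (hcongr : ∀ f g, f =ᶠ[𝓝 p] g → T f =ᶠ[𝓝 q] T g)
    (hhol : ∀ f, IsHol p f → IsHol q (T f))
    (hadd : ∀ f g, IsHol p f → IsHol p g → T (f + g) =ᶠ[𝓝 q] T f + T g)
    (hsmul : ∀ (c : ℂ) f, IsHol p f → T (c • f) =ᶠ[𝓝 q] c • T f) :
    HolGerm p →ₗ[ℂ] HolGerm q where
  toFun φ := ⟨Germ.map' T (fun f g h => hcongr f g h) φ.1, by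
    obtain ⟨_, f, rfl, hf⟩ := φ
    exact ⟨T f, rfl, hhol f hf⟩⟩
  map_add' := by
    rintro ⟨_, f, rfl, hf⟩ ⟨_, g, rfl, hg⟩
    exact Subtype.ext (Germ.coe_eq.2 (hadd f g hf hg))
  map_smul' := by
    rintro c ⟨_, f, rfl, hf⟩
    exact Subtype.ext (Germ.coe_eq.2 (hsmul c f hf))

/-- The partial derivative with respect to the `i`-th coordinate of `x'`. -/
def pd {n : ℕ} {p : Fin n → ℂ} (i : Fin n) : Module.End ℂ (HolGerm p) :=
  liftOp (fun f x m => fderiv ℂ (fun y => f y m) x (Pi.single i 1))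
    (by
      intro f g h
      filter_upwards [h.eventually_nhds] with x hx
      funext m
      have : (fun y => f y m) =ᶠ[𝓝 x] fun y => g y m := by
        filter_upwards [hx] with y hy
        rw [hy]
      rw [this.fderiv_eq])
    (by
      intro f hf
      filter_upwards [hf] with x hx m
      exact (ContinuousLinearMap.apply ℂ ℂ (Pi.single i 1 : Fin n → ℂ)).analyticAt _
        |>.comp (hx m).fderiv)
    (by
      intro f g hf hg
      filter_upwards [hf, hg] with x h1 h2
      funext m
      have := fderiv_add (h1 m).differentiableAt (h2 m).differentiableAt
      exact congrArg (fun L => L (Pi.single i 1 : Fin n → ℂ)) this)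
    (by
      intro c f hf
      filter_upwards [hf] with x h1
      funext m
      have := fderiv_const_smul (h1 m).differentiableAt c
      exact congrArg (fun L => L (Pi.single i 1 : Fin n → ℂ)) this)

/-- The derivative with respect to `z`: `∑ f_m z^m ↦ ∑ (m+1) f_{m+1} z^m`. -/
def dz {n : ℕ} {p : Fin n → ℂ} : Module.End ℂ (HolGerm p) :=
  liftOp (fun f x m => ((m : ℂ) + 1) * f x (m + 1))
    (by
      intro f g h
      filter_upwards [h] with x hx
      rw [hx])
    (by
      intro f hf
      filter_upwards [hf] with x hx m
      exact analyticAt_const.mul (hx (m + 1)))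
    (fun f g _ _ => Eventually.of_forall fun x => funext fun m => mul_add _ _ _)
    (fun c f _ => Eventually.of_forall fun x => funext fun m => mul_left_comm _ _ _)

/-- Multiplication by the `i`-th coordinate of `x'`. -/
def mulX {n : ℕ} {p : Fin n → ℂ} (i : Fin n) : Module.End ℂ (HolGerm p) :=
  liftOp (fun f x m => x i * f x m)
    (by
      intro f g h
      filter_upwards [h] with x hx
      rw [hx])
    (by
      intro f hf
      filter_upwards [hf] with x hx m
      exact ((ContinuousLinearMap.proj (R := ℂ) (φ := fun _ : Fin n => ℂ) i).analyticAt x).mul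
        (hx m))
    (fun f g _ _ => Eventually.of_forall fun x => funext fun m => mul_add _ _ _)
    (fun c f _ => Eventually.of_forall fun x => funext fun m => mul_left_comm _ _ _)

/-- Multiplication by `z`: `∑ f_m z^m ↦ ∑ f_m z^(m+1)`. -/
def mulZ {n : ℕ} {p : Fin n → ℂ} : Module.End ℂ (HolGerm p) :=
  liftOp (fun f x m => if m = 0 then 0 else f x (m - 1))
    (by
      intro f g h
      filter_upwards [h] with x hx
      rw [hx])
    (by
      intro f hf
      filter_upwards [hf] with x hx m
      by_cases hm : m = 0
      · simpa [hm] using analyticAt_const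
      · simpa [hm] using hx (m - 1))
    (by
      intro f g _ _
      refine Eventually.of_forall fun x => funext fun m => ?_
      by_cases hm : m = 0 <;> simp [hm])
    (by
      intro c f _
      refine Eventually.of_forall fun x => funext fun m => ?_
      by_cases hm : m = 0 <;> simp [hm])

/-- `∂_j` for all `n + 1` coordinates `(x', z)`. -/
def partialD {n : ℕ} {p : Fin n → ℂ} (j : Fin (n + 1)) : Module.End ℂ (HolGerm p) :=
  Fin.lastCases (motive := fun _ => Module.End ℂ (HolGerm p)) dz pd j

/-- Multiplication by the `j`-th of all `n + 1` coordinates `(x', z)`. -/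
def mulCoord {n : ℕ} {p : Fin n → ℂ} (j : Fin (n + 1)) : Module.End ℂ (HolGerm p) :=
  Fin.lastCases (motive := fun _ => Module.End ℂ (HolGerm p)) mulZ mulX j

/-- The monomial `∂^u = ∂_0^(u_0) ⋯ ∂_n^(u_n)`. -/
def Dmon {n : ℕ} {p : Fin n → ℂ} (u : Fin (n + 1) → ℕ) : Module.End ℂ (HolGerm p) :=
  (List.ofFn fun j => partialD j ^ u j).prod

/-- The Euler operator `∑ a_j x_j ∂_j` of the one-row matrix `A`. -/
def euler {n : ℕ} {p : Fin n → ℂ} (A : Fin (n + 1) → ℕ) : Module.End ℂ (HolGerm p) :=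
  ∑ j, (A j : ℂ) • (mulCoord j * partialD j)

/-- Gevrey series of order at most `s` along `z = 0`: the series `∑ f_m(x') / (m!)^(s-1) z^m`
converges (normally) for `(x', z)` in a neighbourhood of `(p, 0)`; by Cauchy's estimates this is a
bound `C K^m (m!)^(s-1)` on `f_m`, for all `m`, in a neighbourhood of `p`. -/
def gevrey {n : ℕ} (p : Fin n → ℂ) (s : ℝ) : Submodule ℂ (HolGerm p) where
  carrier := {φ | ∃ f : (Fin n → ℂ) → ℕ → ℂ, (f : Germ (𝓝 p) (ℕ → ℂ)) = φ.1 ∧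
    ∃ C K : ℝ, ∀ᶠ x in 𝓝 p, ∀ m : ℕ, ‖f x m‖ ≤ C * K ^ m * (m.factorial : ℝ) ^ (s - 1)}
  zero_mem' := ⟨0, rfl, 0, 0, Eventually.of_forall fun x m => by simp⟩
  add_mem' := by
    rintro φ ψ ⟨f, hf, C, K, h⟩ ⟨g, hg, C', K', h'⟩
    refine ⟨f + g, by rw [Submodule.coe_add, ← hf, ← hg]; rfl, |C| + |C'|, |K| + |K'|, ?_⟩
    filter_upwards [h, h'] with x h1 h2 m
    have hF : 0 ≤ (m.factorial : ℝ) ^ (s - 1) := by positivity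
    have key : ∀ c k : ℝ, |k| ≤ |K| + |K'| → c * k ^ m * (m.factorial : ℝ) ^ (s - 1) ≤
        |c| * (|K| + |K'|) ^ m * (m.factorial : ℝ) ^ (s - 1) := by
      intro c k hk
      refine mul_le_mul_of_nonneg_right ?_ hF
      calc c * k ^ m ≤ |c * k ^ m| := le_abs_self _
        _ = |c| * |k| ^ m := by rw [abs_mul, abs_pow]
        _ ≤ _ := by gcongr
    calc ‖(f + g) x m‖ ≤ ‖f x m‖ + ‖g x m‖ := norm_add_le _ _
      _ ≤ _ := add_le_add ((h1 m).trans (key C K (by simp))) ((h2 m).trans (key C' K' (by simp)))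
      _ = _ := by ring
  smul_mem' := by
    rintro c φ ⟨f, hf, C, K, h⟩
    refine ⟨c • f, by rw [Submodule.coe_smul, ← hf]; rfl, ‖c‖ * C, K, ?_⟩
    filter_upwards [h] with x h1 m
    calc ‖(c • f) x m‖ = ‖c‖ * ‖f x m‖ := norm_mul _ _
      _ ≤ ‖c‖ * (C * K ^ m * (m.factorial : ℝ) ^ (s - 1)) := by gcongr; exact h1 m
      _ = _ := by ring

/-- The stalk at `(p, 0)` of the sheaf of Gevrey solutions, of order at most `s` along `z = 0`, of
the hypergeometric system of the one-row matrix `A` with parameter `β`: the Gevrey series that are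
annihilated by the generators `∂^u - ∂^v` (`A u = A v`) and `∑ a_j x_j ∂_j - β` of the
hypergeometric ideal. -/
def Sol {n : ℕ} (A : Fin (n + 1) → ℕ) (β : ℂ) (s : ℝ) (p : Fin n → ℂ) :
    Submodule ℂ (HolGerm p) :=
  gevrey p s ⊓
  (⨅ (u : Fin (n + 1) → ℕ) (v : Fin (n + 1) → ℕ) (_ : ∑ j, A j * u j = ∑ j, A j * v j),
    LinearMap.ker (Dmon u - Dmon v : Module.End ℂ (HolGerm p))) ⊓
  LinearMap.ker (euler A - β • 1 : Module.End ℂ (HolGerm p))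

/-- The series is a polynomial in all the coordinates `(x', z)`. -/
def IsPolySeries {n : ℕ} {p : Fin n → ℂ} (φ : HolGerm p) : Prop :=
  ∃ P : Polynomial (MvPolynomial (Fin n) ℂ),
    φ.1 = ((fun x m => MvPolynomial.eval x (P.coeff m) : (Fin n → ℂ) → ℕ → ℂ) :
      Germ (𝓝 p) (ℕ → ℂ))

/-- Restriction to `x_0 = 0`. -/
def restrictZero {n : ℕ} (q : Fin n → ℂ) :
    HolGerm (Fin.cons 0 q : Fin (n + 1) → ℂ) →ₗ[ℂ] HolGerm q :=
  have hcont : Tendsto (fun y : Fin n → ℂ => (Fin.cons 0 y : Fin (n + 1) → ℂ)) (𝓝 q)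
      (𝓝 (Fin.cons 0 q)) := by
    refine Continuous.tendsto ?_ q
    refine continuous_pi fun j => ?_
    refine Fin.cases ?_ (fun i => ?_) j
    · simpa using continuous_const
    · simpa using continuous_apply i
  liftOp (fun f y m => f (Fin.cons 0 y) m)
    (by
      intro f g h
      filter_upwards [hcont.eventually h] with y hy
      rw [hy])
    (by
      intro f hf
      filter_upwards [hcont.eventually hf] with y hy m
      have hcons : AnalyticAt ℂ (fun y : Fin n → ℂ => (Fin.cons 0 y : Fin (n + 1) → ℂ)) y := by
        rw [analyticAt_pi_iff]
        intro j
        refine Fin.cases ?_ (fun i => ?_) j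
        · simpa using analyticAt_const
        · simp only [Fin.cons_succ]
          exact (ContinuousLinearMap.proj (R := ℂ) (φ := fun _ : Fin n => ℂ) i).analyticAt y
      exact (hy m).comp hcons)
    (fun f g _ _ => Eventually.of_forall fun x => rfl)
    (fun c f _ => Eventually.of_forall fun x => rfl)

/-- The map `φ ↦ (∂_0^ℓ φ (0, x_1, …))_{0 ≤ ℓ < k}`. -/
def varpi (k : ℕ) {n : ℕ} (q : Fin n → ℂ) :
    HolGerm (Fin.cons 0 q : Fin (n + 1) → ℂ) →ₗ[ℂ] (Fin k → HolGerm q) :=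
  LinearMap.pi fun ℓ => restrictZero q ∘ₗ (pd 0 ^ (ℓ : ℕ) : Module.End ℂ _)

/-! ### Cycles and hypergeometric integrals -/

/-- A path in `ℂ^*` that comes from infinity and goes to infinity, with a limit of its argument at
both ends, together with a branch of the logarithm along it. The path is `u ↦ exp (w u)` and the
branch is `w`. The path is parametrised so that `w` is continuously differentiable with bounded
derivative and `|exp (w u)|` grows at least exponentially. -/
structure LogPath where
  /-- The logarithm of the path. -/
  w : ℝ → ℂ
  contDiff : ContDiff ℝ 1 w
  bounded : ∃ L : ℝ, ∀ u, ‖deriv w u‖ ≤ L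
  growth : ∃ c > 0, ∃ C : ℝ, ∀ u, c * |u| - C ≤ (w u).re
  argBot : ∃ φ : ℝ, Tendsto (fun u => (w u).im) atBot (𝓝 φ)
  argTop : ∃ φ : ℝ, Tendsto (fun u => (w u).im) atTop (𝓝 φ)

/-- Geometric cycles: paths as above, and half lines `e^{iφ}·[0, +∞[`. -/
inductive GeomCycle where
  | path (γ : LogPath)
  | ray (φ : ℝ)

/-- The exponent `∑ x_j t^(a_j)`. -/
def phase {n : ℕ} (A : Fin n → ℕ) (x : Fin n → ℂ) (t : ℂ) : ℂ := ∑ j, x j * t ^ A j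

/-- The Taylor polynomial in `t` of degree at most `β` of `exp (∑ x_j t^(a_j))`, for `β` real and
all `a_j > 0`; it is zero if `β < 0`. -/
def taylorPoly {n : ℕ} (A : Fin n → ℕ) (β : ℝ) (x : Fin n → ℂ) (t : ℂ) : ℂ :=
  ∑ l ∈ (Fintype.piFinset fun _ : Fin n => Finset.range (⌊β⌋₊ + 1)).filter
      (fun l => ((∑ j, A j * l j : ℕ) : ℝ) ≤ β),
    (∏ j, x j ^ l j / ((l j).factorial : ℂ)) * t ^ (∑ j, A j * l j)

/-- The integrand, in the real parameter `u` of the cycle, of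
`∫ t^(-β-1) exp (∑ x_j t^(a_j)) dt` for a path (with `t = exp (w u)`) and of
`∫ t^(-β-1) (exp (∑ x_j t^(a_j)) - P_β(x, t)) dt` for a half line (with `t = e^{iφ} u`, `u > 0`).
Half lines are only used for integers `β`. -/
def GeomCycle.integrand {n : ℕ} (A : Fin n → ℕ) (β : ℂ) (x : Fin n → ℂ) : GeomCycle → ℝ → ℂ
  | .path γ, u => Complex.exp (-β * γ.w u) * Complex.exp (phase A x (Complex.exp (γ.w u))) *
      deriv γ.w u
  | .ray φ, u => Set.indicator (Set.Ioi (0 : ℝ)) (fun r : ℝ =>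
      (Complex.exp (φ * Complex.I) * r) ^ (-β - 1) *
      (Complex.exp (phase A x (Complex.exp (φ * Complex.I) * r)) -
        taylorPoly A β.re x (Complex.exp (φ * Complex.I) * r)) * Complex.exp (φ * Complex.I)) u

/-- The integral along a formal linear combination of geometric cycles. -/
def cycleIntegral {n : ℕ} (A : Fin n → ℕ) (β : ℂ) (C : GeomCycle →₀ ℂ) (x : Fin n → ℂ) : ℂ :=
  C.sum fun c a => a * ∫ u, c.integrand A β x u

/-- The open sector of radius `ρ` and half-width `δ` around the half line of argument `θ`. -/
def sector (θ δ ρ : ℝ) : Set ℂ :=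
  {z | z ≠ 0 ∧ ‖z‖ < ρ ∧ |(z * Complex.exp (-(θ * Complex.I))).arg| < δ}

/-- The integral along `C` converges and is holomorphic for `x'` near `p` and `z` in a sector
around the direction `θ`, and it has there the asymptotic expansion `Φ` as `z → 0`, uniformly in
`x'`. -/
def HasExpansion {n : ℕ} (A : Fin (n + 1) → ℕ) (β : ℂ) (θ : ℝ) {p : Fin n → ℂ}
    (C : GeomCycle →₀ ℂ) (Φ : HolGerm p) : Prop :=
  ∃ ρ > 0, ∃ δ > 0,
    (∀ x ∈ Metric.ball p ρ, ∀ z ∈ sector θ δ ρ, ∀ c ∈ C.support,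
      Integrable (c.integrand A β (Fin.snoc x z : Fin (n + 1) → ℂ))) ∧
    DifferentiableOn ℂ
      (fun y : (Fin n → ℂ) × ℂ => cycleIntegral A β C (Fin.snoc y.1 y.2 : Fin (n + 1) → ℂ))
      (Metric.ball p ρ ×ˢ sector θ δ ρ) ∧
    ∃ f : (Fin n → ℂ) → ℕ → ℂ, (f : Germ (𝓝 p) (ℕ → ℂ)) = Φ.1 ∧
      ∀ N : ℕ, ∃ K : ℝ, ∀ x ∈ Metric.ball p ρ, ∀ z ∈ sector θ δ ρ,
        ‖cycleIntegral A β C (Fin.snoc x z : Fin (n + 1) → ℂ) - ∑ m ∈ Finset.range N, f x m * z ^ m‖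
          ≤ K * ‖z‖ ^ N

/-- On the half line of argument `φ`, the leading monomials `x_{n-1} t^(a_{n-1})` and
`x_n t^(a_n)` have negative real part, if the last two variables have arguments `θ₁` and `θ₂`. -/
def Decays {n : ℕ} (A : Fin (n + 2) → ℕ) (θ₁ θ₂ φ : ℝ) : Prop :=
  Real.cos (θ₁ + A (Fin.last n).castSucc * φ) < 0 ∧ Real.cos (θ₂ + A (Fin.last (n + 1)) * φ) < 0

/-- `β` is an integer that is not in the semigroup generated by the `a_j`. -/
def IsExceptional {n : ℕ} (A : Fin n → ℕ) (β : ℂ) : Prop :=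
  ∃ N : ℤ, β = N ∧ ¬ ∃ l : Fin n → ℕ, N = ∑ j, (A j : ℤ) * l j

/-- The geometric cycles that are used for `A` and `β` when the last two variables have arguments
near `θ₁` and `θ₂`: paths of rapid decay for both the full exponential and its restriction to
`x_n = 0`, and, only for exceptional `β`, half lines in a direction of decay. -/
def Admissible {n : ℕ} (A : Fin (n + 2) → ℕ) (β : ℂ) (θ₁ θ₂ : ℝ) : GeomCycle → Prop
  | .path γ => ∃ φ₁ φ₂ : ℝ, Tendsto (fun u => (γ.w u).im) atBot (𝓝 φ₁) ∧
      Tendsto (fun u => (γ.w u).im) atTop (𝓝 φ₂) ∧ Decays A θ₁ θ₂ φ₁ ∧ Decays A θ₁ θ₂ φ₂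
  | .ray φ => IsExceptional A β ∧ Decays A θ₁ θ₂ φ

/-- `γ'` is a `k`-th root of the path `γ`, multiplied by a power `e^{-2πiν/k}` of the root of
unity; the branch of the logarithm is carried along. -/
def IsRoot (k : ℕ) (γ γ' : LogPath) : Prop :=
  ∃ ν : Fin k, ∀ u, (k : ℂ) * γ'.w u = γ.w u - 2 * Real.pi * Complex.I * (ν : ℕ)

/-- The point of argument `θ` and modulus `ρ` on the line of the variable `x_1`. -/
def pt (θ ρ : ℝ) : Fin 1 → ℂ := fun _ => ρ * Complex.exp (θ * Complex.I)

/-- `ϖ_β`, as a map from the Gevrey solutions for `(1, ka, kb)` and `β` to the direct sum of those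
for `(a, b)` and `(β - ℓ) / k`, `0 ≤ ℓ < k`, is an isomorphism of stalks. -/
def VarpiIso (a b k : ℕ) (β : ℂ) (q : Fin 1 → ℂ) : Prop :=
  Set.BijOn (varpi k q) (Sol ![1, k * a, k * b] β (b / a) (Fin.cons 0 q))
    {v | ∀ ℓ : Fin k, v ℓ ∈ Sol ![a, b] ((β - (ℓ : ℕ)) / k) (b / a) q}

/-- A family of cycles `γ_{τ,r}` for the matrix `(a, b)`: for each `r` the asymptotic expansions of
the integrals with parameter `(β - r) / k` along `γ_{1,r}, …, γ_{a,r}` form a basis of the Gevrey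
solutions; all the cycles are rapid decay paths, except that exactly one of them is a half line
when `(β - r) / k` is an integer outside the semigroup generated by `a` and `b`. -/
def IsBasicFamily (a b k : ℕ) (β : ℂ) (θ₁ θ₂ : ℝ) (γ : Fin a → Fin k → GeomCycle) : Prop :=
  (∀ (τ : Fin a) (r : Fin k), Admissible ![a, b] ((β - (r : ℕ)) / k) θ₁ θ₂ (γ τ r)) ∧
  (∀ r : Fin k, IsExceptional ![a, b] ((β - (r : ℕ)) / k) →
    ∃! τ, ∃ φ, γ τ r = GeomCycle.ray φ) ∧
  ∀ ρ : ℝ, 0 < ρ → ∀ r : Fin k, ∃ Φ : Fin a → HolGerm (pt θ₁ ρ),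
    (∀ τ, HasExpansion ![a, b] ((β - (r : ℕ)) / k) θ₂ (Finsupp.single (γ τ r) 1) (Φ τ)) ∧
    LinearIndependent ℂ Φ ∧
    Submodule.span ℂ (Set.range Φ) = Sol ![a, b] ((β - (r : ℕ)) / k) (b / a) (pt θ₁ ρ)

end

end Hypergeo

open Hypergeo

/-! Everything is encoded by moments. Differentiation in x_i multiplies the integrand by t^(a_i), so
with M_j(x') = ∫ t^(j-β-1) exp(∑ x_i t^(a_i)) dt, taken at x_n = 0, the expansion along x_n = 0 is ∑
M_{a_n m} z^m / m!. The monomial ∂^u shifts the index of the moments by Au, which gives the toric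
equations; the integral of a total derivative gives the Euler equation; exponential decay gives
|M_j| ≤ C K^j (j!)^(1/a_{n-1}), hence Gevrey order a_n / a_{n-1} (`momGerm_mem_Sol`,
`CycleData.hasExpansion`).

Upper bounds for dimensions do not involve cycles. For (1, ka, kb) a solution is given by the
moments M_j = ∂_0^j f_0; the Euler recursion reduces them to the first ka, and these satisfy a
linear differential equation along segments, so their values at one point determine the solution
(`evalCoeff_pd_injective`). For (a, b) the values at one point of the first a coefficients suffice
(`evalCoeff_injective`). It is therefore always enough to exhibit as many independent solutions as
the bound allows, and the space cannot grow with s.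

Lifting: at x_0 = 0 the substitution of a k-th root turns the moment of index kj + l for (1, ka, kb)
into the moment of index j for (a, b) and (β - l)/k, up to a phase depending on the chosen root and
on l. The components of ϖ_β are precisely the residue classes of the index modulo k, and a discrete
Fourier combination of the k roots of a path isolates the class r (`exists_root_combination`).

At most one cycle of a basic family is a half line; then β = r_0 + kN with N outside the semigroup
of a and b. If N < 0, the k-th root of the half line has the right component r_0, and its other
components are removed by subtracting lifted paths (`exists_rayLift`). If N ≥ 0, a loop around the
origin takes its place: its moments are residues, so its expansion is a non-zero polynomial, and ϖ_β
kills it because N is a gap (`exists_loop`). Thus ϖ_β fails to be an isomorphism exactly in the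
second case. Independence of the ka expansions is read off from ϖ_β at x_0 = 0 and carried to every
x_0 by the differential equation (`IsLift.linearIndependent`).

Existence of basic families: take arcs joining adjacent sectors of decay. Rotation by 2π/a
multiplies the m-th coefficient by exp(2πi(bm - β)/a); for m < a these multipliers are distinct
since a and b are coprime, so a Vandermonde argument applies once the coefficients of the first arc
are non-zero. These come from Gamma values or a residue, and vanish only when bm - β is a positive
multiple of a. For some m < a this happens precisely for exceptional β, and a half line supplies the
missing coefficient (`exists_basis`). Its regularised integral for a positive gap N reduces to N - a
and N - b by integration by parts (`ray_parts`, `exists_hasExpansion_ray`). -/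

namespace Hypergeo

/-! ### Germs given by moments -/

/-- The member of the stalk that is represented by `f`. -/
noncomputable def mkGerm {n : ℕ} {p : Fin n → ℂ} (f : (Fin n → ℂ) → ℕ → ℂ) (hf : IsHol p f) : HolGerm p :=
  ⟨(f : Germ (𝓝 p) (ℕ → ℂ)), f, rfl, hf⟩

theorem exists_eq_mkGerm {n : ℕ} {p : Fin n → ℂ} (φ : HolGerm p) :
    ∃ f, ∃ hf : IsHol p f, φ = mkGerm f hf := by
  obtain ⟨_, f, rfl, hf⟩ := φ
  exact ⟨f, hf, rfl⟩

theorem mkGerm_eq_iff {n : ℕ} {p : Fin n → ℂ} {f g : (Fin n → ℂ) → ℕ → ℂ} {hf : IsHol p f}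
    {hg : IsHol p g} : mkGerm f hf = mkGerm g hg ↔ f =ᶠ[𝓝 p] g := by
  rw [Subtype.ext_iff]
  exact Germ.coe_eq

/-- The series `∑ M_{dm} z^m / m!`. -/
noncomputable def momSer {n : ℕ} (d : ℕ) (M : ℕ → (Fin n → ℂ) → ℂ) (x : Fin n → ℂ) (m : ℕ) : ℂ :=
  M (d * m) x / (m.factorial : ℂ)

/-- A sequence of functions that behaves near `p` like the moments
`M_j(x) = ∫ t^(j-β-1) exp (∑ x_i t^(a_i)) dt`, for the indices `j ∈ S`. -/
def IsMom {n : ℕ} (A : Fin (n + 1) → ℕ) (β : ℂ) (S : Set ℕ) (p : Fin n → ℂ)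
    (M : ℕ → (Fin n → ℂ) → ℂ) : Prop :=
  ∀ᶠ x in 𝓝 p, ∀ j ∈ S, AnalyticAt ℂ (M j) x ∧
    (∀ i : Fin n, fderiv ℂ (M j) x (Pi.single i 1) = M (j + A i.castSucc) x) ∧
    ∑ i : Fin n, (A i.castSucc : ℂ) * x i * M (j + A i.castSucc) x + (j - β) * M j x = 0

/-- The set of indices contains `0` and is stable under translation by the entries of `A`. -/
def IsStable {n : ℕ} (A : Fin (n + 1) → ℕ) (S : Set ℕ) : Prop :=
  0 ∈ S ∧ ∀ j ∈ S, ∀ i, j + A i ∈ S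

theorem isStable_univ {n : ℕ} (A : Fin (n + 1) → ℕ) : IsStable A Set.univ :=
  ⟨trivial, fun _ _ _ => trivial⟩

theorem IsStable.mul_mem {n : ℕ} {A : Fin (n + 1) → ℕ} {S : Set ℕ} (hS : IsStable A S) {j : ℕ}
    (hj : j ∈ S) (i : Fin (n + 1)) (m : ℕ) : j + A i * m ∈ S := by
  induction m with
  | zero => simpa using hj
  | succ m ih => rw [Nat.mul_succ, ← add_assoc]; exact hS.2 _ ih i

theorem IsMom.isHol {n : ℕ} {A : Fin (n + 1) → ℕ} {β : ℂ} {S : Set ℕ} {p : Fin n → ℂ}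
    {M : ℕ → (Fin n → ℂ) → ℂ} (h : IsMom A β S p M) (hS : IsStable A S) :
    IsHol p (momSer (A (Fin.last n)) M) := by
  filter_upwards [h] with x hx m
  have := (hx (A (Fin.last n) * m) (by simpa using hS.mul_mem hS.1 (Fin.last n) m)).1
  exact this.div analyticAt_const (by exact_mod_cast m.factorial_ne_zero)

/-- The germ `∑ M_{a_n m} z^m / m!`. -/
noncomputable def momGerm {n : ℕ} {A : Fin (n + 1) → ℕ} {β : ℂ} {S : Set ℕ} {p : Fin n → ℂ}
    {M : ℕ → (Fin n → ℂ) → ℂ} (h : IsMom A β S p M) (hS : IsStable A S) : HolGerm p :=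
  mkGerm (momSer (A (Fin.last n)) M) (h.isHol hS)

theorem partialD_last {n : ℕ} {p : Fin n → ℂ} :
    (partialD (Fin.last n) : Module.End ℂ (HolGerm p)) = dz := by
  simp [partialD]

theorem partialD_castSucc {n : ℕ} {p : Fin n → ℂ} (i : Fin n) :
    (partialD i.castSucc : Module.End ℂ (HolGerm p)) = pd i := by
  simp [partialD]

theorem mulCoord_last {n : ℕ} {p : Fin n → ℂ} :
    (mulCoord (Fin.last n) : Module.End ℂ (HolGerm p)) = mulZ := by
  simp [mulCoord]

theorem mulCoord_castSucc {n : ℕ} {p : Fin n → ℂ} (i : Fin n) :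
    (mulCoord i.castSucc : Module.End ℂ (HolGerm p)) = mulX i := by
  simp [mulCoord]

/-- `φ` is represented by the series of the moments shifted by `e`. -/
def RepShift {n : ℕ} {p : Fin n → ℂ} (d : ℕ) (M : ℕ → (Fin n → ℂ) → ℂ) (φ : HolGerm p)
    (e : ℕ) : Prop :=
  φ.1 = (momSer d (fun j => M (j + e)) : Germ (𝓝 p) (ℕ → ℂ))

theorem RepShift.unique {n : ℕ} {p : Fin n → ℂ} {d : ℕ} {M : ℕ → (Fin n → ℂ) → ℂ}
    {φ ψ : HolGerm p} {e : ℕ} (h : RepShift d M φ e) (h' : RepShift d M ψ e) : φ = ψ :=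
  Subtype.ext (Eq.trans h (Eq.symm h'))

section
variable {n : ℕ} {A : Fin (n + 1) → ℕ} {β : ℂ} {S : Set ℕ} {p : Fin n → ℂ}
  {M : ℕ → (Fin n → ℂ) → ℂ}

theorem repShift_momGerm (h : IsMom A β S p M) (hS : IsStable A S) :
    RepShift (A (Fin.last n)) M (momGerm h hS) 0 := rfl

/-- The derivative in z turns M_{d(m+1)} / (m+1)! into M_{dm+d} / m!. So z behaves like the other
variables: each ∂_j shifts the moments by its own entry of the row. -/
theorem repShift_partialD (h : IsMom A β S p M) (hS : IsStable A S) (φ : HolGerm p) {e : ℕ}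
    (he : e ∈ S) (hφ : RepShift (A (Fin.last n)) M φ e) (j : Fin (n + 1)) :
    RepShift (A (Fin.last n)) M (partialD j φ) (e + A j) := by
  obtain ⟨f, hf, rfl⟩ := exists_eq_mkGerm φ
  have hφ' : f =ᶠ[𝓝 p] momSer (A (Fin.last n)) (fun j => M (j + e)) := Germ.coe_eq.1 hφ
  refine Fin.lastCases ?_ (fun i => ?_) j
  · rw [partialD_last]
    refine Germ.coe_eq.2 ?_
    filter_upwards [hφ'] with x hx
    funext m
    simp only [hx, momSer]
    have h1 : ((m.factorial : ℕ) : ℂ) ≠ 0 := by exact_mod_cast m.factorial_ne_zero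
    have h2 : (m : ℂ) + 1 ≠ 0 := by exact_mod_cast m.succ_ne_zero
    rw [Nat.factorial_succ, Nat.mul_succ, add_right_comm, add_assoc]
    push_cast
    field_simp
  · rw [partialD_castSucc]
    refine Germ.coe_eq.2 ?_
    filter_upwards [hφ'.eventually_nhds, h] with x hx hm
    funext m
    have h1 : (fun y => f y m) =ᶠ[𝓝 x]
        fun y => momSer (A (Fin.last n)) (fun j => M (j + e)) y m := by
      filter_upwards [hx] with y hy
      rw [hy]
    have hmem : A (Fin.last n) * m + e ∈ S := by
      rw [add_comm]; exact hS.mul_mem he _ _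
    obtain ⟨h2, h3, -⟩ := hm _ hmem
    have h4 : fderiv ℂ (fun y => momSer (A (Fin.last n)) (fun j => M (j + e)) y m) x
        = (m.factorial : ℂ)⁻¹ • fderiv ℂ (M (A (Fin.last n) * m + e)) x := by
      rw [← fderiv_const_smul h2.differentiableAt]
      congr 1
      funext y
      simp [momSer, div_eq_inv_mul]
    show fderiv ℂ (fun y => f y m) x (Pi.single i 1) = _
    rw [h1.fderiv_eq, h4]
    simp only [_root_.smul_apply, h3 i, momSer, smul_eq_mul, add_assoc]
    rw [div_eq_inv_mul]

theorem repShift_partialD_pow (h : IsMom A β S p M) (hS : IsStable A S) (φ : HolGerm p) {e : ℕ}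
    (he : e ∈ S) (hφ : RepShift (A (Fin.last n)) M φ e) (j : Fin (n + 1)) (u : ℕ) :
    RepShift (A (Fin.last n)) M ((partialD j ^ u) φ) (e + A j * u) := by
  induction u with
  | zero => simpa using hφ
  | succ u ih =>
    rw [pow_succ', Module.End.mul_apply, Nat.mul_succ, ← add_assoc]
    exact repShift_partialD h hS _ (hS.mul_mem he _ _) ih j

theorem repShift_Dmon (h : IsMom A β S p M) (hS : IsStable A S) (φ : HolGerm p)
    (hφ : RepShift (A (Fin.last n)) M φ 0) (u : Fin (n + 1) → ℕ) :
    RepShift (A (Fin.last n)) M (Dmon u φ) (∑ j, A j * u j) := by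
  have key : ∀ l : List (Fin (n + 1)), (l.map fun j => A j * u j).sum ∈ S ∧
      RepShift (A (Fin.last n)) M ((l.map fun j => partialD j ^ u j).prod φ)
        (l.map fun j => A j * u j).sum := by
    intro l
    induction l with
    | nil => exact ⟨hS.1, by simpa using hφ⟩
    | cons j l ih =>
      simp only [List.map_cons, List.prod_cons, List.sum_cons, Module.End.mul_apply]
      rw [add_comm]
      exact ⟨hS.mul_mem ih.1 _ _, repShift_partialD_pow h hS _ ih.1 ih.2 _ _⟩
  have := (key (List.finRange (n + 1))).2
  rwa [← List.ofFn_eq_map, ← List.ofFn_eq_map, List.sum_ofFn] at this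

/-- A monomial ∂^u acts as the index shift by Au, hence depends on u only through Au. -/
theorem momGerm_mem_toric (h : IsMom A β S p M) (hS : IsStable A S) (u v : Fin (n + 1) → ℕ)
    (huv : ∑ j, A j * u j = ∑ j, A j * v j) :
    momGerm h hS ∈ LinearMap.ker (Dmon u - Dmon v : Module.End ℂ (HolGerm p)) := by
  rw [LinearMap.mem_ker, LinearMap.sub_apply, sub_eq_zero]
  have h1 := repShift_Dmon h hS _ (repShift_momGerm h hS) u
  have h2 := repShift_Dmon h hS _ (repShift_momGerm h hS) v
  rw [← huv] at h2
  exact h1.unique h2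

/-- On the coefficient of z^m the operator d z ∂_z is multiplication by dm, so the equation is the
moment relation at the single index dm, divided by m!. -/
theorem momGerm_mem_euler (h : IsMom A β S p M) (hS : IsStable A S) :
    momGerm h hS ∈ LinearMap.ker (euler A - β • 1 : Module.End ℂ (HolGerm p)) := by
  rw [LinearMap.mem_ker, LinearMap.sub_apply, sub_eq_zero]
  have hr := fun j => repShift_partialD h hS _ hS.1 (repShift_momGerm h hS) j
  simp only [zero_add] at hr
  have hex : ∀ j : Fin (n + 1), ∃ g, ∃ hg : IsHol p g, partialD j (momGerm h hS) = mkGerm g hg ∧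
      g =ᶠ[𝓝 p] momSer (A (Fin.last n)) (fun i => M (i + A j)) := by
    intro j
    obtain ⟨g, hg, he⟩ := exists_eq_mkGerm (partialD j (momGerm h hS))
    refine ⟨g, hg, he, ?_⟩
    have := hr j
    rw [he] at this
    exact Germ.coe_eq.1 this
  choose g hg hge hgs using hex
  have hsum : (euler A (momGerm h hS)).1 =
      ((fun x m => ∑ i : Fin n, (A i.castSucc : ℂ) * (x i * g i.castSucc x m) +
        (A (Fin.last n) : ℂ) * (if m = 0 then 0 else g (Fin.last n) x (m - 1)) :
        (Fin n → ℂ) → ℕ → ℂ) : Germ (𝓝 p) (ℕ → ℂ)) := by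
    rw [euler, LinearMap.sum_apply, Fin.sum_univ_castSucc]
    simp only [LinearMap.smul_apply, Module.End.mul_apply, mulCoord_last, mulCoord_castSucc, hge]
    rw [Submodule.coe_add, Submodule.coe_sum]
    have e1 : ∀ i : Fin n, (((A i.castSucc : ℂ) • mulX i (mkGerm (g i.castSucc) (hg i.castSucc)) :
        HolGerm p)).1 = ((fun x m => (A i.castSucc : ℂ) * (x i * g i.castSucc x m) :
        (Fin n → ℂ) → ℕ → ℂ) : Germ (𝓝 p) (ℕ → ℂ)) := fun i => rfl
    simp only [e1]
    have e2 : ∀ (s : Finset (Fin n)) (F : Fin n → (Fin n → ℂ) → ℕ → ℂ),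
        ∑ i ∈ s, (F i : Germ (𝓝 p) (ℕ → ℂ)) = ((fun x m => ∑ i ∈ s, F i x m :
          (Fin n → ℂ) → ℕ → ℂ) : Germ (𝓝 p) (ℕ → ℂ)) := by
      intro s F
      induction s using Finset.cons_induction with
      | empty => simp; rfl
      | cons i s hi ih => simp only [Finset.sum_cons, ih]; rfl
    rw [e2]
    rfl
  refine Subtype.ext (hsum.trans ?_)
  refine Germ.coe_eq.2 ?_
  filter_upwards [h, eventually_all.2 hgs] with x hx hgx
  funext m
  have hmem : A (Fin.last n) * m ∈ S := by simpa using hS.mul_mem hS.1 (Fin.last n) m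
  have hrel := (hx _ hmem).2.2
  have h1 : ((m.factorial : ℕ) : ℂ) ≠ 0 := by exact_mod_cast m.factorial_ne_zero
  have hlast : (if m = 0 then 0 else g (Fin.last n) x (m - 1)) =
      m * momSer (A (Fin.last n)) M x m := by
    rcases m with _ | m
    · simp
    · simp only [Nat.succ_ne_zero, if_false, Nat.add_sub_cancel, hgx, momSer]
      have h1 : ((m.factorial : ℕ) : ℂ) ≠ 0 := by exact_mod_cast m.factorial_ne_zero
      have h2 : (m : ℂ) + 1 ≠ 0 := by exact_mod_cast m.succ_ne_zero
      rw [Nat.factorial_succ, Nat.mul_succ]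
      push_cast
      field_simp
  rw [hlast]
  show _ = β * momSer (A (Fin.last n)) M x m
  simp only [hgx, momSer]
  have : ∑ i : Fin n, (A i.castSucc : ℂ) * (x i * (M (A (Fin.last n) * m + A i.castSucc) x /
      (m.factorial : ℂ))) = (∑ i : Fin n, (A i.castSucc : ℂ) * x i *
      M (A (Fin.last n) * m + A i.castSucc) x) / (m.factorial : ℂ) := by
    rw [Finset.sum_div]
    exact Finset.sum_congr rfl fun i _ => by ring
  rw [this]
  push_cast at hrel
  field_simp
  linear_combination hrel

end

end Hypergeo

namespace Hypergeo

/-! ### Growth of moments and Gevrey bounds -/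

/-- Combines (dm)! ≤ (dm)^(dm) with m^m ≤ e^m m!. Only the exponent d of m! matters later; geometric
factors disappear in the constants. -/
theorem factorial_mul_le (d m : ℕ) :
    ((d * m).factorial : ℝ) ≤ ((d * Real.exp 1) ^ d) ^ m * (m.factorial : ℝ) ^ d := by
  have h1 : ((d * m).factorial : ℝ) ≤ ((d * m : ℕ) : ℝ) ^ (d * m) := by
    exact_mod_cast Nat.factorial_le_pow (d * m)
  have h2 : (m : ℝ) ^ m ≤ Real.exp 1 ^ m * m.factorial := by
    have := Real.pow_div_factorial_le_exp (m : ℝ) (Nat.cast_nonneg m) m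
    rw [div_le_iff₀ (by positivity)] at this
    rwa [← Real.exp_nat_mul, mul_one]
  calc ((d * m).factorial : ℝ) ≤ ((d * m : ℕ) : ℝ) ^ (d * m) := h1
    _ = ((d : ℝ) ^ d) ^ m * ((m : ℝ) ^ m) ^ d := by
      push_cast
      rw [mul_pow, ← pow_mul, ← pow_mul, mul_comm m d]
    _ ≤ ((d : ℝ) ^ d) ^ m * (Real.exp 1 ^ m * m.factorial) ^ d := by gcongr
    _ = _ := by
      rw [mul_pow, mul_pow, mul_pow, ← pow_mul, ← pow_mul, ← pow_mul, mul_comm m d]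
      ring

theorem factorial_mul_add_le (d m l : ℕ) :
    ((d * m + l).factorial : ℝ) ≤
      (2 ^ l * l.factorial) * (2 ^ d * (d * Real.exp 1) ^ d) ^ m * (m.factorial : ℝ) ^ d := by
  have h1 : ((d * m + l).factorial : ℝ) ≤ 2 ^ (d * m + l) * ((d * m).factorial * l.factorial) := by
    rw [← Nat.add_choose_mul_factorial_mul_factorial]
    push_cast
    rw [mul_assoc]
    gcongr
    exact_mod_cast Nat.choose_le_two_pow _ _
  calc _ ≤ _ := h1
    _ ≤ 2 ^ (d * m + l) * ((((d * Real.exp 1) ^ d) ^ m * (m.factorial : ℝ) ^ d) * l.factorial) := by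
      gcongr; exact factorial_mul_le d m
    _ = _ := by rw [pow_add, pow_mul, mul_pow]; ring

/-- Up to geometric factors, passing from j to kj + l raises j! to the power k, which turns the
exponent 1/(ka) into 1/a. This matches the growth for (1, ka, kb) with that for (a, b). -/
theorem rpow_factorial_le (a k l : ℕ) (ha : 1 ≤ a) (hk : 1 ≤ k) : ∃ C K : ℝ, 0 ≤ C ∧ 1 ≤ K ∧
    ∀ j : ℕ, ((k * j + l).factorial : ℝ) ^ (1 / (k * a : ℕ) : ℝ) ≤
      C * K ^ j * (j.factorial : ℝ) ^ (1 / a : ℝ) := by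
  have hk0 : (k : ℝ) ≠ 0 := by exact_mod_cast (by omega : k ≠ 0)
  have ha0 : (a : ℝ) ≠ 0 := by exact_mod_cast (by omega : a ≠ 0)
  set e : ℝ := 1 / (k * a : ℕ) with he
  have he0 : 0 ≤ e := by positivity
  set D : ℝ := 2 ^ k * (k * Real.exp 1) ^ k
  have hD : 0 ≤ D := by positivity
  refine ⟨(2 ^ l * l.factorial : ℝ) ^ e, max 1 (D ^ e), by positivity, le_max_left _ _, fun j => ?_⟩
  have h1 := Real.rpow_le_rpow (by positivity) (factorial_mul_add_le k j l) he0
  refine h1.trans ?_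
  rw [Real.mul_rpow (by positivity) (by positivity), Real.mul_rpow (by positivity) (by positivity),
    ← Real.rpow_natCast (j.factorial : ℝ) k, ← Real.rpow_mul (by positivity),
    ← Real.rpow_natCast D j, ← Real.rpow_mul (by positivity), mul_comm (j : ℝ) e,
    Real.rpow_mul (by positivity), Real.rpow_natCast]
  have : (k : ℝ) * e = 1 / a := by
    rw [he]; push_cast; field_simp
  rw [this]
  gcongr
  exact le_max_right _ _

/-- Moments of growth `C K^j (j!)^(1/a)` near `p`. -/
def HasGrowth {n : ℕ} (a : ℕ) (S : Set ℕ) (p : Fin n → ℂ) (M : ℕ → (Fin n → ℂ) → ℂ) : Prop :=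
  ∃ C K : ℝ, 0 ≤ C ∧ 1 ≤ K ∧ ∀ᶠ x in 𝓝 p, ∀ j ∈ S,
    ‖M j x‖ ≤ C * K ^ j * (j.factorial : ℝ) ^ (1 / a : ℝ)

/-- Growth (j!)^(1/a) at j = dm means (m!)^(d/a) up to a geometric factor; dividing by m! leaves the
exponent d/a - 1 ≤ s - 1. -/
theorem momGerm_mem_gevrey {n : ℕ} {A : Fin (n + 1) → ℕ} {β : ℂ} {S : Set ℕ} {p : Fin n → ℂ}
    {M : ℕ → (Fin n → ℂ) → ℂ} (h : IsMom A β S p M) (hS : IsStable A S) {a : ℕ}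
    (hg : HasGrowth a S p M) (ha : 1 ≤ a) {s : ℝ} (hs : (A (Fin.last n) : ℝ) / a ≤ s) :
    momGerm h hS ∈ gevrey p s := by
  obtain ⟨C, K, hC, hK, hM⟩ := hg
  set d := A (Fin.last n) with hd
  have ha0 : (0 : ℝ) < a := by exact_mod_cast ha
  set D : ℝ := ((d * Real.exp 1) ^ d)
  have hD : 0 ≤ D := by positivity
  refine ⟨momSer d M, rfl, C, K ^ d * D ^ (1 / a : ℝ), ?_⟩
  filter_upwards [hM] with x hx m
  have hmem : d * m ∈ S := by simpa using hS.mul_mem hS.1 (Fin.last n) m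
  have hf : (1 : ℝ) ≤ m.factorial := by exact_mod_cast m.factorial_pos
  have h1 : ((d * m).factorial : ℝ) ^ (1 / a : ℝ) ≤
      (D ^ (1 / a : ℝ)) ^ m * (m.factorial : ℝ) ^ (d / a : ℝ) := by
    refine (Real.rpow_le_rpow (by positivity) (factorial_mul_le d m) (by positivity)).trans ?_
    rw [Real.mul_rpow (by positivity) (by positivity),
      ← Real.rpow_natCast (m.factorial : ℝ) d, ← Real.rpow_mul (by positivity),
      ← Real.rpow_natCast _ m, ← Real.rpow_mul (by positivity), mul_comm (m : ℝ),
      Real.rpow_mul (by positivity), Real.rpow_natCast, mul_one_div]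
  have h2 : (m.factorial : ℝ) ^ (d / a : ℝ) / m.factorial ≤ (m.factorial : ℝ) ^ (s - 1) := by
    rw [← Real.rpow_sub_one (by positivity)]
    exact Real.rpow_le_rpow_of_exponent_le hf (by linarith)
  rw [momSer, norm_div, Complex.norm_natCast]
  calc ‖M (d * m) x‖ / m.factorial
      ≤ C * K ^ (d * m) * ((D ^ (1 / a : ℝ)) ^ m * (m.factorial : ℝ) ^ (d / a : ℝ)) /
        m.factorial := by
        gcongr
        exact (hx _ hmem).trans (by gcongr)
    _ = C * (K ^ d * D ^ (1 / a : ℝ)) ^ m * ((m.factorial : ℝ) ^ (d / a : ℝ) / m.factorial) := by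
        rw [mul_pow, ← pow_mul]; ring
    _ ≤ _ := by gcongr

theorem momGerm_mem_Sol {n : ℕ} {A : Fin (n + 1) → ℕ} {β : ℂ} {S : Set ℕ} {p : Fin n → ℂ}
    {M : ℕ → (Fin n → ℂ) → ℂ} (h : IsMom A β S p M) (hS : IsStable A S) {a : ℕ}
    (hg : HasGrowth a S p M) (ha : 1 ≤ a) {s : ℝ} (hs : (A (Fin.last n) : ℝ) / a ≤ s) :
    momGerm h hS ∈ Sol A β s p := by
  refine ⟨⟨momGerm_mem_gevrey h hS hg ha hs, ?_⟩, momGerm_mem_euler h hS⟩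
  simp only [SetLike.mem_coe, Submodule.mem_iInf]
  exact fun u v huv => momGerm_mem_toric h hS u v huv

/-! ### Linear combinations and restriction -/

theorem IsMom.sum {n : ℕ} {A : Fin (n + 1) → ℕ} {β : ℂ} {S : Set ℕ} {p : Fin n → ℂ}
    {ι : Type*} (s : Finset ι) (c : ι → ℂ) {M : ι → ℕ → (Fin n → ℂ) → ℂ}
    (h : ∀ i ∈ s, IsMom A β S p (M i)) : IsMom A β S p fun j x => ∑ i ∈ s, c i * M i j x := by
  have h' := (Finset.eventually_all s).2 h
  filter_upwards [h'] with x hx j hj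
  refine ⟨Finset.analyticAt_fun_sum _ fun i hi => analyticAt_const.mul (hx i hi j hj).1,
    fun l => ?_, ?_⟩
  · rw [fderiv_fun_sum fun i hi => ((hx i hi j hj).1.differentiableAt.const_mul _),
      _root_.sum_apply]
    refine Finset.sum_congr rfl fun i hi => ?_
    rw [fderiv_const_mul (hx i hi j hj).1.differentiableAt]
    simp [(hx i hi j hj).2.1 l]
  · have : ∀ i ∈ s, c i * (∑ l : Fin n, (A l.castSucc : ℂ) * x l * M i (j + A l.castSucc) x +
        (j - β) * M i j x) = 0 := fun i hi => by rw [(hx i hi j hj).2.2, mul_zero]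
    have h2 := Finset.sum_eq_zero this
    rw [← h2]
    simp only [mul_add, Finset.mul_sum, Finset.sum_add_distrib]
    rw [Finset.sum_comm]
    congr 1
    · exact Finset.sum_congr rfl fun i _ => Finset.sum_congr rfl fun l _ => by ring
    · exact Finset.sum_congr rfl fun i _ => by ring

/-- The embedding `y ↦ (0, y)`. -/
noncomputable def consZero (n : ℕ) : (Fin n → ℂ) →L[ℂ] (Fin (n + 1) → ℂ) :=
  ContinuousLinearMap.pi (Fin.cons 0 fun i => ContinuousLinearMap.proj i)

theorem consZero_apply {n : ℕ} (y : Fin n → ℂ) : consZero n y = Fin.cons 0 y := by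
  funext j
  refine Fin.cases ?_ (fun i => ?_) j <;> simp [consZero]

theorem consZero_single {n : ℕ} (i : Fin n) :
    consZero n (Pi.single i 1) = Pi.single i.succ 1 := by
  rw [consZero_apply]
  funext j
  refine Fin.cases ?_ (fun i' => ?_) j
  · simp [(Fin.succ_ne_zero i).symm]
  · simp [Pi.single_apply]

theorem tendsto_cons_zero {n : ℕ} (q : Fin n → ℂ) :
    Tendsto (fun y : Fin n → ℂ => (Fin.cons 0 y : Fin (n + 1) → ℂ)) (𝓝 q) (𝓝 (Fin.cons 0 q)) := by
  have e : (fun y : Fin n → ℂ => (Fin.cons 0 y : Fin (n + 1) → ℂ)) = consZero n :=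
    funext fun y => (consZero_apply y).symm
  rw [e, ← consZero_apply]
  exact (consZero n).continuous.tendsto q

/-- At x_0 = 0 the term of index j + 1 drops out of the relation. What remains links indices of a
single residue class modulo k, and division by k produces the relation for (a, b) with parameter (β
- l)/k. -/
theorem IsMom.restrict {a b k : ℕ} (hk : 1 ≤ k) {β : ℂ} {q : Fin 1 → ℂ}
    {M : ℕ → (Fin 2 → ℂ) → ℂ}
    (h : IsMom ![1, k * a, k * b] β Set.univ (Fin.cons 0 q : Fin 2 → ℂ) M) (l : ℕ) :
    IsMom ![a, b] ((β - l) / k) Set.univ q fun j y => M (k * j + l) (Fin.cons 0 y) := by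
  have hk0 : (k : ℂ) ≠ 0 := by exact_mod_cast (by omega : k ≠ 0)
  filter_upwards [(tendsto_cons_zero q).eventually h] with y hy j _
  obtain ⟨h1, h2, h3⟩ := hy (k * j + l) trivial
  rw [← consZero_apply] at h1
  refine ⟨?_, fun i => ?_, ?_⟩
  · have := h1.comp ((consZero 1).analyticAt y)
    refine this.congr (Eventually.of_forall fun z => ?_)
    simp [consZero_apply]
  · have e : (fun y : Fin 1 → ℂ => M (k * j + l) (Fin.cons 0 y : Fin 2 → ℂ)) =
        M (k * j + l) ∘ consZero 1 := by
      funext z; simp [consZero_apply]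
    rw [e, fderiv_comp _ h1.differentiableAt (consZero 1).differentiableAt,
      ContinuousLinearMap.fderiv, ContinuousLinearMap.comp_apply, consZero_single, consZero_apply]
    have hi : i = 0 := Subsingleton.elim _ _
    subst hi
    rw [h2 (Fin.succ 0)]
    have : k * j + l + (![1, k * a, k * b] : Fin 3 → ℕ) (Fin.castSucc (Fin.succ 0)) =
        k * (j + (![a, b] : Fin 2 → ℕ) (Fin.castSucc 0)) + l := by
      show k * j + l + k * a = k * (j + a) + l
      ring
    rw [this]
  · rw [Fin.sum_univ_two] at h3
    have e1 : (![1, k * a, k * b] : Fin 3 → ℕ) (Fin.castSucc 0) = 1 := rfl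
    have e2 : (![1, k * a, k * b] : Fin 3 → ℕ) (Fin.castSucc 1) = k * a := rfl
    have e3 : (![a, b] : Fin 2 → ℕ) (Fin.castSucc 0) = a := rfl
    have e4 : (Fin.cons 0 y : Fin 2 → ℂ) 0 = 0 := rfl
    have e5 : (Fin.cons 0 y : Fin 2 → ℂ) 1 = y 0 := rfl
    rw [e1, e2, e4, e5] at h3
    rw [Fin.sum_univ_one, e3]
    have e6 : k * (j + a) + l = k * j + l + k * a := by ring
    rw [e6]
    push_cast at h3
    field_simp
    linear_combination h3

theorem HasGrowth.restrict {a k : ℕ} (ha : 1 ≤ a) (hk : 1 ≤ k) {q : Fin 1 → ℂ}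
    {M : ℕ → (Fin 2 → ℂ) → ℂ}
    (h : HasGrowth (k * a) Set.univ (Fin.cons 0 q : Fin 2 → ℂ) M) (l : ℕ) :
    HasGrowth a Set.univ q fun j y => M (k * j + l) (Fin.cons 0 y) := by
  obtain ⟨C, K, hC, hK, hM⟩ := h
  obtain ⟨C', K', hC', hK', h'⟩ := rpow_factorial_le a k l ha hk
  refine ⟨C * K ^ l * C', K ^ k * K', by positivity, one_le_mul_of_one_le_of_one_le
    (one_le_pow₀ hK) hK', ?_⟩
  filter_upwards [(tendsto_cons_zero q).eventually hM] with y hy j _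
  refine (hy (k * j + l) trivial).trans ?_
  calc _ ≤ C * K ^ (k * j + l) * (C' * K' ^ j * (j.factorial : ℝ) ^ (1 / a : ℝ)) := by
        gcongr; exact h' j
    _ = _ := by rw [pow_add, mul_pow, pow_mul]; ring

/-- Since ∂_0 shifts the index by 1, the components of ϖ_β are the moments sorted by the residue
class of their index modulo k. -/
theorem varpi_momGerm {a b k : ℕ} (hk : 1 ≤ k) {β : ℂ} {q : Fin 1 → ℂ} {M : ℕ → (Fin 2 → ℂ) → ℂ}
    (h : IsMom ![1, k * a, k * b] β Set.univ (Fin.cons 0 q : Fin 2 → ℂ) M) (l : Fin k) :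
    varpi k q (momGerm h (isStable_univ _)) l = momGerm (h.restrict hk l) (isStable_univ _) := by
  have h1 := repShift_partialD_pow h (isStable_univ _) _ (Set.mem_univ 0)
    (repShift_momGerm h (isStable_univ _)) (Fin.castSucc 0) l
  rw [partialD_castSucc] at h1
  have e1 : (0 + (![1, k * a, k * b] : Fin 3 → ℕ) (Fin.castSucc 0) * (l : ℕ)) = l := by
    show 0 + 1 * (l : ℕ) = l
    ring
  rw [e1] at h1
  show restrictZero q ((pd 0 ^ (l : ℕ) : Module.End ℂ (HolGerm (Fin.cons 0 q : Fin 2 → ℂ)))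
    (momGerm h (isStable_univ _))) = _
  obtain ⟨g, hg, he⟩ := exists_eq_mkGerm ((pd 0 ^ (l : ℕ) :
    Module.End ℂ (HolGerm (Fin.cons 0 q : Fin 2 → ℂ))) (momGerm h (isStable_univ _)))
  rw [he]
  have h2 : g =ᶠ[𝓝 _] _ := Germ.coe_eq.1 ((congrArg Subtype.val he).symm.trans h1)
  refine Subtype.ext (Germ.coe_eq.2 ?_)
  filter_upwards [(tendsto_cons_zero q).eventually h2] with y hy
  funext m
  show g (Fin.cons 0 y) m = M (k * (b * m) + l) (Fin.cons 0 y) / (m.factorial : ℂ)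
  rw [hy, ← mul_assoc]
  rfl

end Hypergeo

namespace Hypergeo

/-! ### Uniqueness -/

/-- A function whose derivative is bounded by a multiple of itself on a segment vanishes at the end
if it vanishes at the beginning. -/
theorem eq_zero_of_segment {E F : Type*} [NormedAddCommGroup E] [NormedSpace ℂ E]
    [NormedAddCommGroup F] [NormedSpace ℂ F] {f : E → F} {p q : E} {C : ℝ}
    (hd : ∀ t ∈ Set.Icc (0 : ℝ) 1, DifferentiableAt ℂ f (p + (t : ℂ) • (q - p)))
    (hb : ∀ t ∈ Set.Icc (0 : ℝ) 1, ‖fderiv ℂ f (p + (t : ℂ) • (q - p)) (q - p)‖ ≤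
      C * ‖f (p + (t : ℂ) • (q - p))‖) (hp : f p = 0) : f q = 0 := by
  have hder : ∀ t ∈ Set.Icc (0 : ℝ) 1, HasDerivAt (fun t : ℝ => f (p + (t : ℂ) • (q - p)))
      (fderiv ℂ f (p + (t : ℂ) • (q - p)) (q - p)) t := by
    intro t ht
    have h1 : HasDerivAt (fun t : ℝ => p + (t : ℂ) • (q - p)) (q - p) t := by
      have := (Complex.ofRealCLM.hasDerivAt (x := t)).smul_const (q - p)
      simpa using this.const_add p
    let _ : NormedSpace ℝ E := NormedSpace.restrictScalars ℝ ℂ E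
    let _ : NormedSpace ℝ F := NormedSpace.restrictScalars ℝ ℂ F
    exact ((hd t ht).hasFDerivAt.restrictScalars ℝ).comp_hasDerivAt t h1
  have := eq_zero_of_abs_deriv_le_mul_abs_self_of_eq_zero_right (K := C)
    (f := fun t : ℝ => f (p + (t : ℂ) • (q - p))) (a := 0) (b := 1)
    (fun t ht => (hder t ht).continuousAt.continuousWithinAt)
    (fun t ht => (hder t (Set.Ico_subset_Icc_self ht)).hasDerivWithinAt) (by simpa using hp)
    (fun t ht => hb t (Set.Ico_subset_Icc_self ht)) 1 (by simp)
  simpa using this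

theorem fderiv_apply_eq_sum {n : ℕ} (g : (Fin n → ℂ) → ℂ) (x v : Fin n → ℂ) :
    fderiv ℂ g x v = ∑ i, v i * fderiv ℂ g x (Pi.single i 1) := by
  have h := LinearMap.pi_apply_eq_sum_univ (fderiv ℂ g x).toLinearMap v
  rw [ContinuousLinearMap.coe_coe] at h
  rw [h]
  refine Finset.sum_congr rfl fun i _ => ?_
  rw [smul_eq_mul]
  congr 2
  funext j
  simp [Pi.single_apply, eq_comm]

/-- Solutions of `x g' = κ g` that vanish at a point vanish. -/
theorem eq_zero_of_euler_segment {g : (Fin 1 → ℂ) → ℂ} {κ : ℂ} {p q : Fin 1 → ℂ}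
    (hx : ∀ t ∈ Set.Icc (0 : ℝ) 1, (p + (t : ℂ) • (q - p)) 0 ≠ 0)
    (hd : ∀ t ∈ Set.Icc (0 : ℝ) 1, DifferentiableAt ℂ g (p + (t : ℂ) • (q - p)))
    (hg : ∀ t ∈ Set.Icc (0 : ℝ) 1, (p + (t : ℂ) • (q - p)) 0 *
      fderiv ℂ g (p + (t : ℂ) • (q - p)) (Pi.single 0 1) = κ * g (p + (t : ℂ) • (q - p)))
    (hp : g p = 0) : g q = 0 := by
  have hcont : ContinuousOn (fun t : ℝ => ‖((p + (t : ℂ) • (q - p)) 0)⁻¹‖) (Set.Icc 0 1) := by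
    refine ContinuousOn.norm (ContinuousOn.inv₀ (Continuous.continuousOn ?_) hx)
    simp only [Pi.add_apply, Pi.smul_apply, smul_eq_mul]
    fun_prop
  obtain ⟨B, hB⟩ := isCompact_Icc.bddAbove_image hcont
  refine eq_zero_of_segment (C := ‖(q - p) 0‖ * (B * ‖κ‖)) hd (fun t ht => ?_) hp
  rw [fderiv_apply_eq_sum, Fin.sum_univ_one, norm_mul, mul_assoc]
  gcongr
  have h1 : fderiv ℂ g (p + (t : ℂ) • (q - p)) (Pi.single 0 1) =
      ((p + (t : ℂ) • (q - p)) 0)⁻¹ * (κ * g (p + (t : ℂ) • (q - p))) := by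
    rw [← hg t ht, inv_mul_cancel_left₀ (hx t ht)]
  rw [h1, norm_mul, norm_mul, mul_assoc]
  gcongr
  exact hB ⟨t, ht, rfl⟩

theorem IsMom.rel_three {c d : ℕ} {β : ℂ} {p : Fin 2 → ℂ} {M : ℕ → (Fin 2 → ℂ) → ℂ}
    (h : IsMom ![1, c, d] β Set.univ p M) : ∀ᶠ x in 𝓝 p, ∀ j, AnalyticAt ℂ (M j) x ∧
      fderiv ℂ (M j) x (Pi.single 0 1) = M (j + 1) x ∧
      fderiv ℂ (M j) x (Pi.single 1 1) = M (j + c) x ∧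
      x 0 * M (j + 1) x + c * x 1 * M (j + c) x + (j - β) * M j x = 0 := by
  filter_upwards [h] with x hx j
  obtain ⟨h1, h2, h3⟩ := hx j trivial
  refine ⟨h1, h2 0, h2 1, ?_⟩
  rw [Fin.sum_univ_two] at h3
  have e1 : (![1, c, d] : Fin 3 → ℕ) (Fin.castSucc 0) = 1 := rfl
  have e2 : (![1, c, d] : Fin 3 → ℕ) (Fin.castSucc 1) = c := rfl
  rw [e1, e2] at h3
  simpa using h3

/-- As x_1 ≠ 0, the relation solves for M_{j+c} in terms of M_{j+1} and M_j, both of smaller index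
because c ≥ 2. Uniformity over X is what the Grönwall argument along a segment needs. -/
theorem mom_bound {c : ℕ} (hc : 2 ≤ c) {β : ℂ} {M : ℕ → (Fin 2 → ℂ) → ℂ} {X : Set (Fin 2 → ℂ)}
    {R B : ℝ} (hR : ∀ x ∈ X, ‖x 0‖ ≤ R) (hB : ∀ x ∈ X, ‖(x 1)⁻¹‖ ≤ B) (h0 : ∀ x ∈ X, x 1 ≠ 0)
    (hM : ∀ x ∈ X, ∀ j : ℕ, x 0 * M (j + 1) x + c * x 1 * M (j + c) x + (j - β) * M j x = 0)
    (j : ℕ) : ∃ C : ℝ, 0 ≤ C ∧ ∀ x ∈ X, ‖M j x‖ ≤ C * ‖fun i : Fin c => M i x‖ := by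
  induction j using Nat.strong_induction_on with
  | _ j ih =>
    by_cases hj : j < c
    · exact ⟨1, zero_le_one, fun x _ => by
        rw [one_mul]; exact norm_le_pi_norm (fun i : Fin c => M i x) ⟨j, hj⟩⟩
    · obtain ⟨i, rfl⟩ : ∃ i, j = i + c := ⟨j - c, by omega⟩
      obtain ⟨C₁, hC₁, h₁⟩ := ih (i + 1) (by omega)
      obtain ⟨C₂, hC₂, h₂⟩ := ih i (by omega)
      refine ⟨|B| * (|R| * C₁ + ‖(i : ℂ) - β‖ * C₂), by positivity, fun x hx => ?_⟩
      have hc0 : (c : ℂ) ≠ 0 := by exact_mod_cast (by omega : c ≠ 0)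
      have e : M (i + c) x = -((x 1)⁻¹ * ((c : ℂ)⁻¹ * (x 0 * M (i + 1) x + (i - β) * M i x))) := by
        have := hM x hx i
        have := h0 x hx
        field_simp
        linear_combination hM x hx i
      have hcn : ‖(c : ℂ)⁻¹‖ ≤ 1 := by
        rw [norm_inv, Complex.norm_natCast]
        exact inv_le_one_of_one_le₀ (by exact_mod_cast (by omega : 1 ≤ c))
      rw [e, norm_neg, norm_mul, norm_mul]
      calc _ ≤ |B| * (1 * (‖x 0‖ * ‖M (i + 1) x‖ + ‖(i : ℂ) - β‖ * ‖M i x‖)) := by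
            gcongr
            · exact (hB x hx).trans (le_abs_self _)
            · exact (norm_add_le _ _).trans (by rw [norm_mul, norm_mul])
        _ ≤ |B| * (1 * (|R| * (C₁ * ‖fun i : Fin c => M i x‖) +
            ‖(i : ℂ) - β‖ * (C₂ * ‖fun i : Fin c => M i x‖))) := by
            gcongr
            · exact (hR x hx).trans (le_abs_self _)
            · exact h₁ x hx
            · exact h₂ x hx
        _ = _ := by ring

/-- Moments for `(1, c, d)` that vanish at one end of a segment vanish at the other. -/
theorem mom_eq_zero_of_segment {c : ℕ} (hc : 2 ≤ c) {β : ℂ} {M : ℕ → (Fin 2 → ℂ) → ℂ}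
    {p q : Fin 2 → ℂ}
    (h0 : ∀ t ∈ Set.Icc (0 : ℝ) 1, (p + (t : ℂ) • (q - p)) 1 ≠ 0)
    (hM : ∀ t ∈ Set.Icc (0 : ℝ) 1, ∀ j : ℕ, AnalyticAt ℂ (M j) (p + (t : ℂ) • (q - p)) ∧
      fderiv ℂ (M j) (p + (t : ℂ) • (q - p)) (Pi.single 0 1) =
        M (j + 1) (p + (t : ℂ) • (q - p)) ∧
      fderiv ℂ (M j) (p + (t : ℂ) • (q - p)) (Pi.single 1 1) =
        M (j + c) (p + (t : ℂ) • (q - p)) ∧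
      (p + (t : ℂ) • (q - p)) 0 * M (j + 1) (p + (t : ℂ) • (q - p)) +
        c * (p + (t : ℂ) • (q - p)) 1 * M (j + c) (p + (t : ℂ) • (q - p)) +
        (j - β) * M j (p + (t : ℂ) • (q - p)) = 0)
    (hp : ∀ j < c, M j p = 0) : ∀ j, M j q = 0 := by
  set γ : ℝ → Fin 2 → ℂ := fun t => p + (t : ℂ) • (q - p) with hγ
  have hγc : Continuous γ := by fun_prop
  have hγ1 : γ 1 = q := by simp [hγ]
  obtain ⟨R, hR⟩ := (isCompact_Icc (a := (0 : ℝ)) (b := 1)).bddAbove_image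
    (f := fun t => ‖γ t 0‖) (by fun_prop)
  obtain ⟨B, hB⟩ := (isCompact_Icc (a := (0 : ℝ)) (b := 1)).bddAbove_image
    (f := fun t => ‖(γ t 1)⁻¹‖) (ContinuousOn.norm (ContinuousOn.inv₀ (by fun_prop) h0))
  have hbd := mom_bound hc (M := M) (β := β) (X := γ '' Set.Icc 0 1) (R := R) (B := B)
    (by rintro _ ⟨t, ht, rfl⟩; exact hR ⟨t, ht, rfl⟩)
    (by rintro _ ⟨t, ht, rfl⟩; exact hB ⟨t, ht, rfl⟩)
    (by rintro _ ⟨t, ht, rfl⟩; exact h0 t ht)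
    (by rintro _ ⟨t, ht, rfl⟩ j; exact (hM t ht j).2.2.2)
  choose C hC hbd using hbd
  -- Grönwall for the vector of the first c moments: its derivative involves only M_{i+1} and
  -- M_{i+c}, which are bounded by the vector itself.
  have hz : (fun x => fun i : Fin c => M i x) q = 0 := by
    refine eq_zero_of_segment (f := fun x => fun i : Fin c => M i x) (p := p)
      (C := ∑ i : Fin c, (‖(q - p) 0‖ * C (i + 1) + ‖(q - p) 1‖ * C (i + c)))
      (fun t ht => differentiableAt_pi.2 fun i => (hM t ht i).1.differentiableAt)
      (fun t ht => ?_) (funext fun i => hp i i.2)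
    rw [show fderiv ℂ (fun x => fun i : Fin c => M i x) (p + (t : ℂ) • (q - p)) =
      ContinuousLinearMap.pi fun i : Fin c => fderiv ℂ (M i) (p + (t : ℂ) • (q - p)) from
      fderiv_pi (φ := fun i : Fin c => M i) fun i => (hM t ht i).1.differentiableAt]
    have hs0 : 0 ≤ ∑ i : Fin c, (‖(q - p) 0‖ * C (i + 1) + ‖(q - p) 1‖ * C (i + c)) :=
      Finset.sum_nonneg fun i _ => by have := hC (i + 1); have := hC (i + c); positivity
    refine (pi_norm_le_iff_of_nonneg (by positivity)).2 fun i => ?_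
    rw [ContinuousLinearMap.pi_apply, fderiv_apply_eq_sum, Fin.sum_univ_two, (hM t ht i).2.1,
      (hM t ht i).2.2.1]
    refine (norm_add_le _ _).trans ?_
    rw [norm_mul, norm_mul]
    calc _ ≤ ‖(q - p) 0‖ * (C (i + 1) * ‖fun i : Fin c => M i (γ t)‖) +
          ‖(q - p) 1‖ * (C (i + c) * ‖fun i : Fin c => M i (γ t)‖) := by
          gcongr
          · exact hbd _ _ ⟨t, ht, rfl⟩
          · exact hbd _ _ ⟨t, ht, rfl⟩
      _ = (‖(q - p) 0‖ * C (i + 1) + ‖(q - p) 1‖ * C (i + c)) *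
          ‖fun i : Fin c => M i (γ t)‖ := by ring
      _ ≤ _ := by
          gcongr
          exact Finset.single_le_sum (f := fun i : Fin c =>
            ‖(q - p) 0‖ * C (i + 1) + ‖(q - p) 1‖ * C (i + c))
            (fun i _ => by have := hC (i + 1); have := hC (i + c); positivity) (Finset.mem_univ i)
  intro j
  have := hbd j q ⟨1, by simp, hγ1⟩
  have h2 : (fun i : Fin c => M i q) = 0 := hz
  rw [h2, norm_zero, mul_zero] at this
  exact norm_le_zero_iff.1 this

theorem segment_mem_ball {n : ℕ} {p q : Fin n → ℂ} {r : ℝ} {x : Fin n → ℂ}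
    (hp : p ∈ Metric.ball x r) (hq : q ∈ Metric.ball x r) {t : ℝ} (ht : t ∈ Set.Icc (0 : ℝ) 1) :
    p + (t : ℂ) • (q - p) ∈ Metric.ball x r := by
  have := (convex_ball x r).add_smul_sub_mem hp hq ht
  exact this

theorem momGerm_eq_zero_of_lt {c d : ℕ} (hc : 2 ≤ c) {β : ℂ} {M : ℕ → (Fin 2 → ℂ) → ℂ}
    {p : Fin 2 → ℂ} (h : IsMom ![1, c, d] β Set.univ p M) (h0 : p 1 ≠ 0)
    (hp : ∀ j < c, M j p = 0) : momGerm h (isStable_univ _) = 0 := by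
  have h1 : ∀ᶠ x in 𝓝 p, x 1 ≠ 0 := (continuous_apply 1).continuousAt.eventually_ne h0
  obtain ⟨r, hr, hball⟩ := Metric.eventually_nhds_iff_ball.1 (h1.and h.rel_three)
  refine Subtype.ext (Germ.coe_eq.2 ?_)
  filter_upwards [Metric.ball_mem_nhds p hr] with x hx
  funext m
  have := mom_eq_zero_of_segment (M := M) (β := β) hc
    (fun t ht => (hball _ (segment_mem_ball (Metric.mem_ball_self hr) hx ht)).1)
    (fun t ht => (hball _ (segment_mem_ball (Metric.mem_ball_self hr) hx ht)).2) hp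
  simp [momSer, this]

/-! ### The dimension of the spaces of solutions -/

/-- The value at `p` of the coefficient of `z^m`. -/
noncomputable def evalCoeff {n : ℕ} {p : Fin n → ℂ} (m : ℕ) : HolGerm p →ₗ[ℂ] ℂ where
  toFun φ := Germ.value φ.1 m
  map_add' := by
    rintro ⟨_, f, rfl, hf⟩ ⟨_, g, rfl, hg⟩
    rfl
  map_smul' := by
    rintro c ⟨_, f, rfl, hf⟩
    rfl

theorem evalCoeff_mkGerm {n : ℕ} {p : Fin n → ℂ} (m : ℕ) {f : (Fin n → ℂ) → ℕ → ℂ}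
    (hf : IsHol p f) : evalCoeff m (mkGerm f hf) = f p m := rfl

/-- The partial derivative of a function. -/
noncomputable def dirD {n : ℕ} (i : Fin n) (g : (Fin n → ℂ) → ℂ) : (Fin n → ℂ) → ℂ :=
  fun x => fderiv ℂ g x (Pi.single i 1)

theorem dirD_congr {n : ℕ} (i : Fin n) {g h : (Fin n → ℂ) → ℂ} {N : Set (Fin n → ℂ)}
    (hN : IsOpen N) (hgh : ∀ x ∈ N, g x = h x) : ∀ x ∈ N, dirD i g x = dirD i h x := by
  intro x hx
  have : g =ᶠ[𝓝 x] h := by filter_upwards [hN.mem_nhds hx] with y hy using hgh y hy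
  simp only [dirD, this.fderiv_eq]

theorem dirD_iter_congr {n : ℕ} (i : Fin n) {g h : (Fin n → ℂ) → ℂ} {N : Set (Fin n → ℂ)}
    (hN : IsOpen N) (hgh : ∀ x ∈ N, g x = h x) (j : ℕ) :
    ∀ x ∈ N, (dirD i)^[j] g x = (dirD i)^[j] h x := by
  induction j with
  | zero => exact hgh
  | succ j ih =>
    rw [Function.iterate_succ_apply', Function.iterate_succ_apply']
    exact dirD_congr i hN ih

theorem dirD_analytic {n : ℕ} (i : Fin n) {g : (Fin n → ℂ) → ℂ} {x : Fin n → ℂ}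
    (hg : AnalyticAt ℂ g x) : AnalyticAt ℂ (dirD i g) x :=
  (ContinuousLinearMap.apply ℂ ℂ (Pi.single i 1 : Fin n → ℂ)).analyticAt _ |>.comp hg.fderiv

theorem dirD_iter_analytic {n : ℕ} (i : Fin n) {g : (Fin n → ℂ) → ℂ} {x : Fin n → ℂ}
    (hg : AnalyticAt ℂ g x) (j : ℕ) : AnalyticAt ℂ ((dirD i)^[j] g) x := by
  induction j with
  | zero => exact hg
  | succ j ih => rw [Function.iterate_succ_apply']; exact dirD_analytic i ih

theorem dirD_const_mul {n : ℕ} (i : Fin n) (c : ℂ) (g : (Fin n → ℂ) → ℂ) :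
    dirD i (fun x => c * g x) = fun x => c * dirD i g x := by
  funext x
  have := congrFun (fderiv_const_smul_field (𝕜 := ℂ) (f := g) c) x
  exact congrArg (fun L => L (Pi.single i 1 : Fin n → ℂ)) this

theorem dirD_iter_const_mul {n : ℕ} (i : Fin n) (c : ℂ) (g : (Fin n → ℂ) → ℂ) (j : ℕ) :
    (dirD i)^[j] (fun x => c * g x) = fun x => c * (dirD i)^[j] g x := by
  induction j with
  | zero => rfl
  | succ j ih =>
    rw [Function.iterate_succ_apply', ih, dirD_const_mul, Function.iterate_succ_apply']

theorem dirD_comm {n : ℕ} (i j : Fin n) {g : (Fin n → ℂ) → ℂ} {x : Fin n → ℂ}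
    (hg : AnalyticAt ℂ g x) : dirD i (dirD j g) x = dirD j (dirD i g) x := by
  have h2 : ∀ i j : Fin n, dirD i (dirD j g) x =
      fderiv ℂ (fderiv ℂ g) x (Pi.single i 1) (Pi.single j 1) := by
    intro i j
    have h3 := (ContinuousLinearMap.apply ℂ ℂ (Pi.single j 1 : Fin n → ℂ)).hasFDerivAt.comp x
      hg.fderiv.differentiableAt.hasFDerivAt
    have h4 : fderiv ℂ (dirD j g) x = _ := h3.fderiv
    show fderiv ℂ (dirD j g) x (Pi.single i 1) = _
    rw [h4]
    rfl
  rw [h2, h2]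
  exact (hg.contDiffAt.isSymmSndFDerivAt_of_omega).eq _ _

theorem pd_pow_mkGerm {n : ℕ} {p : Fin n → ℂ} (i : Fin n) (j : ℕ) {f : (Fin n → ℂ) → ℕ → ℂ}
    (hf : IsHol p f) : ∃ h, (pd i ^ j : Module.End ℂ (HolGerm p)) (mkGerm f hf) =
      mkGerm (fun x m => (dirD i)^[j] (fun y => f y m) x) h := by
  induction j with
  | zero => exact ⟨hf, rfl⟩
  | succ j ih =>
    obtain ⟨h, he⟩ := ih
    refine ⟨?_, ?_⟩
    · filter_upwards [hf] with x hx m using dirD_iter_analytic i (hx m) _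
    · rw [pow_succ', Module.End.mul_apply, he]
      simp only [Function.iterate_succ_apply']
      rfl

theorem dz_pow_mkGerm {n : ℕ} {p : Fin n → ℂ} (j : ℕ) {f : (Fin n → ℂ) → ℕ → ℂ}
    (hf : IsHol p f) : ∃ h, (dz ^ j : Module.End ℂ (HolGerm p)) (mkGerm f hf) =
      mkGerm (fun x m => ((m + j).factorial / m.factorial : ℂ) * f x (m + j)) h := by
  induction j with
  | zero =>
    have e : (fun x m => ((m + 0).factorial / m.factorial : ℂ) * f x (m + 0)) = f := by
      funext x m
      rw [add_zero, div_self (by exact_mod_cast m.factorial_ne_zero), one_mul]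
    exact ⟨by rwa [e], by rw [pow_zero]; exact Subtype.ext (Germ.coe_eq.2 (by rw [e]))⟩
  | succ j ih =>
    obtain ⟨h, he⟩ := ih
    have h' : IsHol p (fun x m => ((m + (j + 1)).factorial / m.factorial : ℂ) *
        f x (m + (j + 1))) := by
      filter_upwards [hf] with x hx m using analyticAt_const.mul (hx _)
    refine ⟨h', ?_⟩
    rw [pow_succ', Module.End.mul_apply, he]
    refine Subtype.ext (Germ.coe_eq.2 (Eventually.of_forall fun x => funext fun m => ?_))
    show ((m : ℂ) + 1) * (((m + 1 + j).factorial / (m + 1).factorial : ℂ) * f x (m + 1 + j)) = _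
    have h1 : ((m.factorial : ℕ) : ℂ) ≠ 0 := by exact_mod_cast m.factorial_ne_zero
    have h2 : (m : ℂ) + 1 ≠ 0 := by exact_mod_cast m.succ_ne_zero
    rw [Nat.factorial_succ m, add_right_comm m 1 j, add_assoc m j 1]
    push_cast
    field_simp

theorem Sol_toric {n : ℕ} {A : Fin (n + 1) → ℕ} {β : ℂ} {s : ℝ} {p : Fin n → ℂ} {φ : HolGerm p}
    (h : φ ∈ Sol A β s p) (u v : Fin (n + 1) → ℕ) (huv : ∑ j, A j * u j = ∑ j, A j * v j) :
    Dmon u φ = Dmon v φ := by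
  have h1 := h.1.2
  simp only [SetLike.mem_coe, Submodule.mem_iInf] at h1
  have := h1 u v huv
  rwa [LinearMap.mem_ker, LinearMap.sub_apply, sub_eq_zero] at this

theorem Sol_euler {n : ℕ} {A : Fin (n + 1) → ℕ} {β : ℂ} {s : ℝ} {p : Fin n → ℂ} {φ : HolGerm p}
    (h : φ ∈ Sol A β s p) : euler A φ = β • φ := by
  have h1 := LinearMap.mem_ker.1 h.2
  rwa [LinearMap.sub_apply, sub_eq_zero] at h1

/-- The solutions for `(1, c, d)` are given by moments. -/
theorem exists_isMom_of_mem_Sol {c d : ℕ} {β : ℂ} {s : ℝ} {p : Fin 2 → ℂ} {φ : HolGerm p}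
    (hφ : φ ∈ Sol ![1, c, d] β s p) :
    ∃ M, ∃ h : IsMom ![1, c, d] β Set.univ p M, φ = momGerm h (isStable_univ _) := by
  -- Because the first entry is 1, the toric equations contain ∂_z = ∂_0^d and ∂_1 = ∂_0^c. They
  -- reduce the whole series to the x_0-derivatives of f_0, which serve as moments.
  have t1 := Sol_toric hφ ![0, 0, 1] ![d, 0, 0] (by simp [Fin.sum_univ_three])
  have t2 := Sol_toric hφ ![0, 1, 0] ![c, 0, 0] (by simp [Fin.sum_univ_three])
  have t3 := Sol_euler hφ
  obtain ⟨f, hf, rfl⟩ := exists_eq_mkGerm φ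
  have p0 : (partialD 0 : Module.End ℂ (HolGerm p)) = pd 0 := partialD_castSucc 0
  have p1 : (partialD 1 : Module.End ℂ (HolGerm p)) = pd 1 := partialD_castSucc 1
  have p2 : (partialD 2 : Module.End ℂ (HolGerm p)) = dz := partialD_last
  have m0 : (mulCoord 0 : Module.End ℂ (HolGerm p)) = mulX 0 := mulCoord_castSucc 0
  have m1 : (mulCoord 1 : Module.End ℂ (HolGerm p)) = mulX 1 := mulCoord_castSucc 1
  have m2 : (mulCoord 2 : Module.End ℂ (HolGerm p)) = mulZ := mulCoord_last
  simp [Dmon, List.ofFn_succ] at t1 t2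
  rw [p2, p0] at t1
  change (partialD 1) (mkGerm f hf) = _ at t2
  rw [p1, p0] at t2
  obtain ⟨hd, ed⟩ := pd_pow_mkGerm 0 d hf
  obtain ⟨hc, ec⟩ := pd_pow_mkGerm 0 c hf
  rw [ed] at t1
  rw [ec] at t2
  have t1' := Germ.coe_eq.1 (congrArg Subtype.val t1)
  have t2' := Germ.coe_eq.1 (congrArg Subtype.val t2)
  rw [show euler ![1, c, d] (mkGerm f hf) = (((1 : ℕ) : ℂ) • mulCoord 0 (partialD 0 (mkGerm f hf)) +
    (c : ℂ) • mulCoord 1 (partialD 1 (mkGerm f hf)) +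
    (d : ℂ) • mulCoord 2 (partialD 2 (mkGerm f hf))) by
      rw [euler, Fin.sum_univ_three]; rfl, p0, p1, p2, m0, m1, m2] at t3
  have t3' := Germ.coe_eq.1 (congrArg Subtype.val t3)
  obtain ⟨N, hN, hNo, hpN⟩ := eventually_nhds_iff.1 ((hf.and t1').and (t2'.and t3'))
  set M : ℕ → (Fin 2 → ℂ) → ℂ := fun j => (dirD 0)^[j] fun y => f y 0 with hM
  have hMs : ∀ j, dirD 0 (M j) = M (j + 1) := fun j => by
    rw [hM]; exact (Function.iterate_succ_apply' _ _ _).symm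
  have han : ∀ j, ∀ x ∈ N, AnalyticAt ℂ (M j) x := fun j x hx =>
    dirD_iter_analytic 0 ((hN x hx).1.1 0) j
  have hcoef : ∀ m, ∀ x ∈ N, f x m = (m.factorial : ℂ)⁻¹ * M (d * m) x := by
    intro m
    induction m with
    | zero => intro x _; simp [hM]
    | succ m ih =>
      intro x hx
      have h1 := congrFun (hN x hx).1.2 m
      change ((m : ℂ) + 1) * f x (m + 1) = (dirD 0)^[d] (fun y => f y m) x at h1
      rw [dirD_iter_congr 0 hNo ih d x hx, dirD_iter_const_mul, hM] at h1
      dsimp only at h1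
      rw [← Function.iterate_add_apply] at h1
      have h2 : (m : ℂ) + 1 ≠ 0 := by exact_mod_cast m.succ_ne_zero
      have h3 : ((m.factorial : ℕ) : ℂ) ≠ 0 := by exact_mod_cast m.factorial_ne_zero
      rw [Nat.factorial_succ, Nat.mul_succ, add_comm (d * m) d]
      push_cast
      field_simp
      field_simp at h1
      linear_combination h1
  have hd1 : ∀ j, ∀ x ∈ N, dirD 1 (M j) x = M (j + c) x := by
    intro j
    induction j with
    | zero =>
      intro x hx
      have h1 := congrFun (hN x hx).2.1 0
      rw [zero_add]
      exact h1
    | succ j ih =>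
      intro x hx
      rw [← hMs, dirD_comm 1 0 (han j x hx), dirD_congr 0 hNo ih x hx, hMs, add_right_comm]
  have hrel : ∀ j, ∀ x ∈ N, x 0 * M (j + 1) x + c * x 1 * M (j + c) x + (j - β) * M j x = 0 := by
    intro j
    induction j with
    | zero =>
      intro x hx
      have h1 := congrFun (hN x hx).2.2 0
      change ((1 : ℕ) : ℂ) * (x 0 * dirD 0 (M 0) x) + (c : ℂ) * (x 1 * dirD 1 (M 0) x) +
        (d : ℂ) * 0 = β * M 0 x at h1
      rw [hd1 0 x hx, hMs] at h1
      push_cast at h1 ⊢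
      linear_combination h1
    | succ j ih =>
      intro x hx
      -- The relation for j + 1 is the x_0-derivative of the relation for j; differentiating the
      -- factor x_0 supplies the additional M_{j+1}.
      have h1 := dirD_congr 0 hNo (h := fun _ => 0) ih x hx
      have e0 : HasFDerivAt (fun x : Fin 2 → ℂ => x 0)
          (ContinuousLinearMap.proj 0 : (Fin 2 → ℂ) →L[ℂ] ℂ) x :=
        (ContinuousLinearMap.proj 0 : (Fin 2 → ℂ) →L[ℂ] ℂ).hasFDerivAt
      have e1 : HasFDerivAt (fun x : Fin 2 → ℂ => x 1)
          (ContinuousLinearMap.proj 1 : (Fin 2 → ℂ) →L[ℂ] ℂ) x :=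
        (ContinuousLinearMap.proj 1 : (Fin 2 → ℂ) →L[ℂ] ℂ).hasFDerivAt
      have hA := fun j => (han j x hx).differentiableAt.hasFDerivAt
      have h2 := ((e0.mul (hA (j + 1))).add ((e1.const_mul (c : ℂ)).mul (hA (j + c)))).add
        ((hA j).const_mul ((j : ℂ) - β))
      have h3 : dirD 0 (fun x => x 0 * M (j + 1) x + c * x 1 * M (j + c) x + (j - β) * M j x) x =
          M (j + 1) x + x 0 * dirD 0 (M (j + 1)) x + c * x 1 * dirD 0 (M (j + c)) x +
          (j - β) * dirD 0 (M j) x := by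
        have h4 := congrArg (fun L => L (Pi.single 0 1 : Fin 2 → ℂ)) h2.fderiv
        refine h4.trans ?_
        simp [dirD]
        ring
      rw [h3, hMs, hMs, hMs] at h1
      have h5 : dirD 0 (fun _ : Fin 2 → ℂ => (0 : ℂ)) x = 0 := by simp [dirD]
      rw [h5] at h1
      push_cast
      rw [show j + 1 + c = j + c + 1 by ring]
      linear_combination h1
  have hmom : IsMom ![1, c, d] β Set.univ p M := by
    filter_upwards [hNo.mem_nhds hpN] with x hx j _
    refine ⟨han j x hx, fun i => ?_, ?_⟩
    · fin_cases i
      · exact congrFun (hMs j) x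
      · exact hd1 j x hx
    · rw [Fin.sum_univ_two]
      have := hrel j x hx
      change ((1 : ℕ) : ℂ) * x 0 * M (j + 1) x + c * x 1 * M (j + c) x + (j - β) * M j x = 0
      rwa [Nat.cast_one, one_mul]
  refine ⟨M, hmom, mkGerm_eq_iff.2 ?_⟩
  filter_upwards [hNo.mem_nhds hpN] with x hx
  funext m
  rw [hcoef m x hx, inv_mul_eq_div]
  rfl

theorem evalCoeff_pd_momGerm {c d : ℕ} {β : ℂ} {p : Fin 2 → ℂ} {M : ℕ → (Fin 2 → ℂ) → ℂ}
    (h : IsMom ![1, c, d] β Set.univ p M) (j : ℕ) :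
    evalCoeff 0 ((pd 0 ^ j : Module.End ℂ (HolGerm p)) (momGerm h (isStable_univ _))) = M j p := by
  have h1 := repShift_partialD_pow h (isStable_univ _) _ (Set.mem_univ 0)
    (repShift_momGerm h (isStable_univ _)) (Fin.castSucc 0) j
  rw [partialD_castSucc] at h1
  have h2 : evalCoeff 0 ((pd 0 ^ j : Module.End ℂ (HolGerm p)) (momGerm h (isStable_univ _))) =
      M (d * 0 + (0 + 1 * j)) p / ((0 : ℕ).factorial : ℂ) :=
    congrArg (fun g : Germ (𝓝 p) (ℕ → ℂ) => Germ.value g 0) h1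
  rw [h2]
  simp

/-- The functionals are the values M_0(p), …, M_{c-1}(p), and moments whose first c values vanish at
p vanish near p. This yields the bound c for the dimension, for every s. -/
theorem evalCoeff_pd_injective {c d : ℕ} (hc : 2 ≤ c) {β : ℂ} {s : ℝ} {p : Fin 2 → ℂ}
    (h0 : p 1 ≠ 0) : Function.Injective ((LinearMap.pi fun j : Fin c =>
      evalCoeff 0 ∘ₗ (pd 0 ^ (j : ℕ) : Module.End ℂ (HolGerm p))) ∘ₗ
        (Sol ![1, c, d] β s p).subtype) := by
  refine (injective_iff_map_eq_zero _).2 ?_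
  rintro ⟨φ, hφ⟩ h
  obtain ⟨M, hM, rfl⟩ := exists_isMom_of_mem_Sol hφ
  refine Subtype.ext (momGerm_eq_zero_of_lt hc hM h0 fun j hj => ?_)
  have := congrFun h ⟨j, hj⟩
  rw [← evalCoeff_pd_momGerm hM j]
  exact this

theorem finiteDimensional_Sol_three {c d : ℕ} (hc : 2 ≤ c) {β : ℂ} {s : ℝ} {p : Fin 2 → ℂ}
    (h0 : p 1 ≠ 0) : FiniteDimensional ℂ (Sol ![1, c, d] β s p) ∧
      Module.finrank ℂ (Sol ![1, c, d] β s p) ≤ c := by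
  have h := evalCoeff_pd_injective hc (d := d) (β := β) (s := s) h0
  refine ⟨Module.Finite.of_injective _ h, ?_⟩
  simpa using LinearMap.finrank_le_finrank_of_injective h

/-- For each m the Euler equation is the scalar equation a x f_m' = (β - bm) f_m, so f_m is
determined by its value at p; and ∂_z^a = ∂_x^b expresses f_{m+a} through f_m. Hence f_0(p), …,
f_{a-1}(p) determine the solution. -/
theorem evalCoeff_injective {a b : ℕ} (ha : 1 ≤ a) {β : ℂ} {s : ℝ} {p : Fin 1 → ℂ}
    (h0 : p 0 ≠ 0) : Function.Injective ((LinearMap.pi fun j : Fin a =>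
      (evalCoeff (j : ℕ) : HolGerm p →ₗ[ℂ] ℂ)) ∘ₗ (Sol ![a, b] β s p).subtype) := by
  refine (injective_iff_map_eq_zero _).2 ?_
  rintro ⟨φ, hφ⟩ h
  have hev : ∀ j < a, evalCoeff j φ = 0 := fun j hj => congrFun h ⟨j, hj⟩
  have t1 := Sol_toric hφ ![0, a] ![b, 0] (by simp [Fin.sum_univ_two, mul_comm])
  have t3 := Sol_euler hφ
  obtain ⟨f, hf, rfl⟩ := exists_eq_mkGerm φ
  have p0 : (partialD 0 : Module.End ℂ (HolGerm p)) = pd 0 := partialD_castSucc 0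
  have p1 : (partialD 1 : Module.End ℂ (HolGerm p)) = dz := partialD_last
  have m0 : (mulCoord 0 : Module.End ℂ (HolGerm p)) = mulX 0 := mulCoord_castSucc 0
  have m1 : (mulCoord 1 : Module.End ℂ (HolGerm p)) = mulZ := mulCoord_last
  simp only [Dmon, List.ofFn_succ, List.ofFn_zero, List.prod_cons, List.prod_nil, mul_one] at t1
  change ((partialD 0 ^ 0 * partialD 1 ^ a : Module.End ℂ (HolGerm p))) (mkGerm f hf) =
    ((partialD 0 ^ b * partialD 1 ^ 0 : Module.End ℂ (HolGerm p))) (mkGerm f hf) at t1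
  rw [p0, p1, pow_zero, pow_zero, one_mul, mul_one] at t1
  obtain ⟨hb, eb⟩ := pd_pow_mkGerm 0 b hf
  obtain ⟨ha', ea⟩ := dz_pow_mkGerm a hf
  rw [eb, ea] at t1
  have t1' := Germ.coe_eq.1 (congrArg Subtype.val t1)
  rw [show euler ![a, b] (mkGerm f hf) = ((a : ℂ) • mulCoord 0 (partialD 0 (mkGerm f hf)) +
    (b : ℂ) • mulCoord 1 (partialD 1 (mkGerm f hf))) by
      rw [euler, Fin.sum_univ_two]; rfl, p0, p1, m0, m1] at t3
  have t3' := Germ.coe_eq.1 (congrArg Subtype.val t3)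
  have hne : ∀ᶠ x in 𝓝 p, x 0 ≠ 0 := (continuous_apply 0).continuousAt.eventually_ne h0
  obtain ⟨r, hr, hball⟩ := Metric.eventually_nhds_iff_ball.1 ((hf.and hne).and (t1'.and t3'))
  have hode : ∀ m, f p m = 0 → ∀ x ∈ Metric.ball p r, f x m = 0 := by
    intro m hm x hx
    have hseg := fun t ht => hball _ (segment_mem_ball (t := t) (Metric.mem_ball_self hr) hx ht)
    refine eq_zero_of_euler_segment (g := fun y => f y m) (κ := (β - b * m) / a)
      (fun t ht => (hseg t ht).1.2) (fun t ht => ((hseg t ht).1.1 m).differentiableAt)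
      (fun t ht => ?_) hm
    have h1 := congrFun (hseg t ht).2.2 m
    set y := p + (t : ℂ) • (x - p)
    change (a : ℂ) * (y 0 * dirD 0 (fun y => f y m) y) + (b : ℂ) *
      (if m = 0 then 0 else ((m - 1 : ℕ) + 1 : ℂ) * f y (m - 1 + 1)) = β * f y m at h1
    have h2 : (if m = 0 then 0 else ((m - 1 : ℕ) + 1 : ℂ) * f y (m - 1 + 1)) = m * f y m := by
      rcases m with _ | m <;> simp
    rw [h2] at h1
    have ha0 : (a : ℂ) ≠ 0 := by exact_mod_cast (by omega : a ≠ 0)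
    change y 0 * dirD 0 (fun y => f y m) y = _
    field_simp
    linear_combination h1
  have hall : ∀ m, ∀ x ∈ Metric.ball p r, f x m = 0 := by
    intro m
    induction m using Nat.strong_induction_on with
    | _ m ih =>
      intro x hx
      by_cases hm : m < a
      · exact hode m (hev m hm) x hx
      · obtain ⟨i, rfl⟩ : ∃ i, m = i + a := ⟨m - a, by omega⟩
        have h1 := congrFun (hball x hx).2.1 i
        change ((i + a).factorial / i.factorial : ℂ) * f x (i + a) =
          (dirD 0)^[b] (fun y => f y i) x at h1
        -- Zero is written as 0 * 0 so that `dirD_iter_const_mul` computes its iterated derivatives.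
        rw [dirD_iter_congr 0 Metric.isOpen_ball (h := fun _ => 0 * 0)
          (fun y hy => by rw [ih i (by omega) y hy, mul_zero]) b x hx,
          dirD_iter_const_mul 0 0 (fun _ => 0)] at h1
        simp only [zero_mul] at h1
        have h2 : ((i.factorial : ℕ) : ℂ) ≠ 0 := by exact_mod_cast i.factorial_ne_zero
        have h3 : (((i + a).factorial : ℕ) : ℂ) ≠ 0 := by
          exact_mod_cast (i + a).factorial_ne_zero
        exact (mul_eq_zero.1 h1).resolve_left (div_ne_zero h3 h2)
  refine Subtype.ext (Subtype.ext (Germ.coe_eq.2 ?_))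
  filter_upwards [Metric.ball_mem_nhds p hr] with x hx
  funext m
  exact hall m x hx

theorem finiteDimensional_Sol_two {a b : ℕ} (ha : 1 ≤ a) {β : ℂ} {s : ℝ} {p : Fin 1 → ℂ}
    (h0 : p 0 ≠ 0) : FiniteDimensional ℂ (Sol ![a, b] β s p) ∧
      Module.finrank ℂ (Sol ![a, b] β s p) ≤ a := by
  have h := evalCoeff_injective ha (b := b) (β := β) (s := s) h0
  refine ⟨Module.Finite.of_injective _ h, ?_⟩
  simpa using LinearMap.finrank_le_finrank_of_injective h

end Hypergeo

namespace Hypergeo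

/-! ### Integrals of exponentials of linear forms are analytic -/

section
variable {E : Type*} [NormedAddCommGroup E] [NormedSpace ℂ E]

/-- The multilinear form `(v_1, …, v_n) ↦ ℓ v_1 ⋯ ℓ v_n`. -/
noncomputable def powForm (n : ℕ) (ℓ : E →L[ℂ] ℂ) : E [×n]→L[ℂ] ℂ :=
  (ContinuousMultilinearMap.mkPiAlgebraFin ℂ n ℂ).compContinuousLinearMap fun _ => ℓ

theorem powForm_apply (n : ℕ) (ℓ : E →L[ℂ] ℂ) (v : E) : powForm n ℓ (fun _ => v) = ℓ v ^ n := by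
  simp [powForm]

theorem norm_powForm_le (n : ℕ) (ℓ : E →L[ℂ] ℂ) : ‖powForm n ℓ‖ ≤ ‖ℓ‖ ^ n := by
  refine (ContinuousMultilinearMap.norm_compContinuousLinearMap_le _ _).trans ?_
  simp

theorem continuous_powForm (n : ℕ) : Continuous (powForm n : (E →L[ℂ] ℂ) → E [×n]→L[ℂ] ℂ) := by
  have h := (ContinuousMultilinearMap.compContinuousLinearMapContinuousMultilinear ℂ
    (fun _ : Fin n => E) (fun _ : Fin n => ℂ) ℂ).cont
  exact (ContinuousLinearMap.apply ℂ _ (ContinuousMultilinearMap.mkPiAlgebraFin ℂ n ℂ)).continuous.comp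
    (h.comp (continuous_pi fun _ => continuous_id))

/-- Expand exp(ℓ(x - p)) under the integral sign. As ∑ r^n ‖ℓ‖^n / n! = exp(r ‖ℓ‖), the single
integrability hypothesis dominates all terms on the ball of radius r, and the linear term of the
resulting power series is the derivative. -/
theorem analyticAt_integral_exp {g : ℝ → ℂ} {ℓ : ℝ → E →L[ℂ] ℂ} {p : E} {r : ℝ} (hr : 0 < r)
    (hg : AEStronglyMeasurable g) (hℓ : Continuous ℓ)
    (hint : Integrable fun u => ‖g u‖ * ‖Complex.exp (ℓ u p)‖ * Real.exp (r * ‖ℓ u‖)) :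
    AnalyticAt ℂ (fun x => ∫ u, g u * Complex.exp (ℓ u x)) p ∧
      ∀ v, fderiv ℂ (fun x => ∫ u, g u * Complex.exp (ℓ u x)) p v =
        ∫ u, g u * Complex.exp (ℓ u p) * ℓ u v := by
  set G : ℝ → ℂ := fun u => g u * Complex.exp (ℓ u p) with hG
  have hℓp : ∀ v, Continuous fun u => ℓ u v := fun v => by fun_prop
  have hGm : AEStronglyMeasurable G :=
    hg.mul (Complex.continuous_exp.comp (hℓp p)).aestronglyMeasurable
  have hGn : ∀ u, ‖G u‖ = ‖g u‖ * ‖Complex.exp (ℓ u p)‖ := fun u => norm_mul _ _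
  simp only [← hGn] at hint
  set F : (n : ℕ) → ℝ → E [×n]→L[ℂ] ℂ := fun n u => (G u / (n.factorial : ℂ)) • powForm n (ℓ u)
    with hF
  have hGd : ∀ n : ℕ, AEStronglyMeasurable fun u => G u / (n.factorial : ℂ) := fun n => by
    simpa only [div_eq_mul_inv] using hGm.mul_const ((n.factorial : ℂ)⁻¹)
  have hFm : ∀ n, AEStronglyMeasurable (F n) := fun n =>
    (hGd n).smul ((continuous_powForm n).comp hℓ).aestronglyMeasurable
  have hFb : ∀ n u, ‖F n u‖ ≤ ‖G u‖ * (‖ℓ u‖ ^ n / n.factorial) := by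
    intro n u
    rw [hF, norm_smul, norm_div, Complex.norm_natCast]
    calc _ ≤ ‖G u‖ / n.factorial * ‖ℓ u‖ ^ n := by gcongr; exact norm_powForm_le n _
      _ = _ := by ring
  have hexp : ∀ (n : ℕ) u, r ^ n * (‖ℓ u‖ ^ n / n.factorial) ≤ Real.exp (r * ‖ℓ u‖) := by
    intro n u
    have := Real.pow_div_factorial_le_exp (r * ‖ℓ u‖) (by positivity) n
    rwa [mul_pow, mul_div_assoc] at this
  have hFb' : ∀ n u, r ^ n * ‖F n u‖ ≤ ‖G u‖ * Real.exp (r * ‖ℓ u‖) := by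
    intro n u
    calc r ^ n * ‖F n u‖ ≤ r ^ n * (‖G u‖ * (‖ℓ u‖ ^ n / n.factorial)) := by
          gcongr; exact hFb n u
      _ = ‖G u‖ * (r ^ n * (‖ℓ u‖ ^ n / n.factorial)) := by ring
      _ ≤ _ := by gcongr; exact hexp n u
  have hFi : ∀ n, Integrable (F n) := by
    intro n
    refine Integrable.mono' (hint.const_mul ((r ^ n)⁻¹)) (hFm n) (Eventually.of_forall fun u => ?_)
    rw [← div_eq_inv_mul, le_div_iff₀ (by positivity), mul_comm]
    exact hFb' n u
  set P : FormalMultilinearSeries ℂ E ℂ := fun n => ∫ u, F n u with hP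
  have happ : ∀ n v, P n (fun _ => v) = ∫ u, G u / (n.factorial : ℂ) * ℓ u v ^ n := by
    intro n v
    have := (ContinuousMultilinearMap.apply ℂ (fun _ : Fin n => E) ℂ
      (fun _ => v)).integral_comp_comm (hFi n)
    rw [ContinuousMultilinearMap.apply_apply] at this
    rw [hP]
    dsimp only
    rw [← this]
    refine integral_congr_ae (Eventually.of_forall fun u => ?_)
    simp [hF, powForm_apply]
  have hps : HasFPowerSeriesOnBall (fun x => ∫ u, g u * Complex.exp (ℓ u x)) P p
      (ENNReal.ofReal r) := by
    refine ⟨?_, by simpa using hr, ?_⟩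
    · refine P.le_radius_of_bound (r := r.toNNReal) (∫ u, ‖G u‖ * Real.exp (r * ‖ℓ u‖))
        fun n => ?_
      rw [Real.coe_toNNReal r hr.le, mul_comm]
      calc r ^ n * ‖P n‖ ≤ r ^ n * ∫ u, ‖F n u‖ := by
            gcongr; exact norm_integral_le_integral_norm _
        _ = ∫ u, r ^ n * ‖F n u‖ := (integral_const_mul _ _).symm
        _ ≤ _ := integral_mono ((hFi n).norm.const_mul _) hint fun u => hFb' n u
    · intro y hy
      have hy' : ‖y‖ < r := by
        rw [Metric.mem_eball, edist_zero_right, ← ofReal_norm] at hy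
        exact (ENNReal.ofReal_lt_ofReal_iff hr).1 hy
      simp only [happ]
      have hb : ∀ n u, ‖ℓ u y‖ ^ n / n.factorial ≤ (r * ‖ℓ u‖) ^ n / n.factorial := by
        intro n u
        gcongr
        calc ‖ℓ u y‖ ≤ ‖ℓ u‖ * ‖y‖ := (ℓ u).le_opNorm y
          _ ≤ ‖ℓ u‖ * r := by gcongr
          _ = _ := mul_comm _ _
      have hsum : ∀ u, HasSum (fun n : ℕ => ‖G u‖ * ((r * ‖ℓ u‖) ^ n / n.factorial))
          (‖G u‖ * Real.exp (r * ‖ℓ u‖)) := by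
        intro u
        refine HasSum.mul_left _ ?_
        rw [Real.exp_eq_exp_ℝ]
        exact NormedSpace.exp_series_hasSum_exp' (𝕂 := ℝ) (r * ‖ℓ u‖) |>.congr_fun
          (by intro n; simp [div_eq_inv_mul])
      refine hasSum_integral_of_dominated_convergence
        (bound := fun n u => ‖G u‖ * ((r * ‖ℓ u‖) ^ n / n.factorial)) (fun n => ?_)
        (fun n => Eventually.of_forall fun u => ?_)
        (Eventually.of_forall fun u => (hsum u).summable) ?_ (Eventually.of_forall fun u => ?_)
      · exact (hGd n).mul ((hℓp y).pow n).aestronglyMeasurable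
      · rw [norm_mul, norm_div, Complex.norm_natCast, norm_pow]
        calc _ = ‖G u‖ * (‖ℓ u y‖ ^ n / n.factorial) := by ring
          _ ≤ _ := by gcongr ?_ * ?_; exact hb n u
      · exact hint.congr (Eventually.of_forall fun u => ((hsum u).tsum_eq).symm)
      · have h1 : HasSum (fun n : ℕ => ℓ u y ^ n / (n.factorial : ℂ)) (Complex.exp (ℓ u y)) := by
          rw [Complex.exp_eq_exp_ℂ]
          exact NormedSpace.expSeries_div_hasSum_exp (ℓ u y)
        have h2 := h1.mul_left (G u)
        rw [hG] at h2
        dsimp only at h2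
        rw [mul_assoc, ← Complex.exp_add, ← map_add] at h2
        refine h2.congr_fun fun n => ?_
        rw [hG]; ring
  refine ⟨⟨P, _, hps⟩, fun v => ?_⟩
  rw [hps.hasFPowerSeriesAt.hasFDerivAt.fderiv]
  have := happ 1 v
  simp only [Nat.factorial_one, Nat.cast_one, div_one, pow_one] at this
  rw [← this]
  simp only [continuousMultilinearCurryFin1_apply]
  refine congrArg (P 1) (funext fun i => ?_)
  obtain rfl : i = Fin.last 0 := Fin.ext (by have := i.2; simp only [Fin.val_last]; omega)
  exact Fin.snoc_last (α := fun _ => E) v 0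
end

/-! ### Estimates -/

/-- The remainder of order N + 1 vanishes at 0 and has the remainder of order N as derivative, so
the mean value inequality on the segment from 0 to w gives the induction. The exponent contains Re w
rather than |w|, so the bound stays useful when w = z t^b goes to infinity in a left half plane. -/
theorem norm_exp_sub_sum_le (N : ℕ) (w : ℂ) :
    ‖Complex.exp w - ∑ m ∈ Finset.range N, w ^ m / (m.factorial : ℂ)‖ ≤
      ‖w‖ ^ N * Real.exp (max 0 w.re) := by
  induction N generalizing w with
  | zero =>
    simp only [Finset.range_zero, Finset.sum_empty, sub_zero, pow_zero, one_mul, Complex.norm_exp]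
    gcongr
    exact le_max_right _ _
  | succ N ih =>
    set R : ℕ → ℂ → ℂ := fun N w => Complex.exp w - ∑ m ∈ Finset.range N, w ^ m / (m.factorial : ℂ)
    have hd : ∀ z : ℂ, HasDerivAt (R (N + 1)) (R N z) z := by
      intro z
      have h1 : ∀ m : ℕ, HasDerivAt (fun z : ℂ => z ^ (m + 1) / ((m + 1).factorial : ℂ))
          (z ^ m / (m.factorial : ℂ)) z := by
        intro m
        have := (hasDerivAt_pow (m + 1) z).div_const ((m + 1).factorial : ℂ)
        convert! this using 1
        have h3 : ((m.factorial : ℕ) : ℂ) ≠ 0 := by exact_mod_cast m.factorial_ne_zero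
        have h2 : (m : ℂ) + 1 ≠ 0 := by exact_mod_cast m.succ_ne_zero
        rw [Nat.factorial_succ]
        push_cast
        field_simp
      have h2 : HasDerivAt (fun z : ℂ => ∑ m ∈ Finset.range (N + 1), z ^ m / (m.factorial : ℂ))
          (∑ m ∈ Finset.range N, z ^ m / (m.factorial : ℂ)) z := by
        simp only [Finset.sum_range_succ']
        have := (HasDerivAt.fun_sum fun m (_ : m ∈ Finset.range N) => h1 m).add_const
          ((z : ℂ) ^ 0 / ((0 : ℕ).factorial : ℂ))
        simpa using this
      exact (Complex.hasDerivAt_exp z).sub h2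
    have h0 : R (N + 1) 0 = 0 := by
      simp [R, Finset.sum_range_succ']
    have hder : ∀ t ∈ Set.Icc (0 : ℝ) 1, HasDerivWithinAt (fun t : ℝ => R (N + 1) (t * w))
        (R N (t * w) * w) (Set.Icc 0 1) t := by
      intro t _
      have h1 : HasDerivAt (fun t : ℝ => (t : ℂ) * w) w t := by
        simpa using (Complex.ofRealCLM.hasDerivAt (x := t)).mul_const w
      exact ((hd (t * w)).comp t h1).hasDerivWithinAt
    have hb : ∀ t ∈ Set.Ico (0 : ℝ) 1, ‖R N (t * w) * w‖ ≤
        ‖w‖ ^ (N + 1) * Real.exp (max 0 w.re) := by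
      intro t ht
      rw [norm_mul, pow_succ, mul_right_comm]
      gcongr
      refine (ih (t * w)).trans ?_
      have e1 : ‖(t : ℂ) * w‖ ≤ ‖w‖ := by
        rw [norm_mul, Complex.norm_real, Real.norm_of_nonneg ht.1]
        exact mul_le_of_le_one_left (norm_nonneg _) ht.2.le
      have e2 : max 0 ((t : ℂ) * w).re ≤ max 0 w.re := by
        rw [Complex.re_ofReal_mul]
        refine max_le (le_max_left _ _) ?_
        rcases le_total 0 w.re with h | h
        · exact (mul_le_of_le_one_left h ht.2.le).trans (le_max_right _ _)
        · exact (mul_nonpos_of_nonneg_of_nonpos ht.1 h).trans (le_max_left _ _)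
      gcongr
    have := norm_image_sub_le_of_norm_deriv_le_segment_01' hder hb
    simpa [h0] using this

theorem exists_lower_le {i a : ℕ} (hi : i < a) (R : ℝ) {e : ℝ} (he : 0 < e) :
    ∃ K : ℝ, 0 ≤ K ∧ ∀ τ : ℝ, 0 ≤ τ → R * τ ^ i ≤ e * τ ^ a + K := by
  set τ₀ : ℝ := max 1 (|R| / e)
  have hτ₀ : 0 ≤ τ₀ := by positivity
  refine ⟨|R| * τ₀ ^ i, by positivity, fun τ hτ => ?_⟩
  rcases le_total τ τ₀ with h | h
  · have h1 : R * τ ^ i ≤ |R| * τ₀ ^ i := by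
      gcongr
      exact le_abs_self R
    have : 0 ≤ e * τ ^ a := by positivity
    linarith
  · have h1 : 1 ≤ τ := (le_max_left _ _).trans h
    have h2 : |R| ≤ e * τ := by
      have := (le_max_right 1 (|R| / e)).trans h
      rwa [div_le_iff₀ he, mul_comm] at this
    calc R * τ ^ i ≤ |R| * τ ^ i := by gcongr; exact le_abs_self R
      _ ≤ e * τ * τ ^ i := by gcongr
      _ = e * τ ^ (i + 1) := by ring
      _ ≤ e * τ ^ a := by gcongr; exact hi
      _ ≤ _ := by have : 0 ≤ |R| * τ₀ ^ i := by positivity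
                  linarith

/-- Raise to the power a and use x^j / j! ≤ e^x with x = c a τ^a. This is the origin of the exponent
1/a in the growth of moments. -/
theorem pow_mul_exp_le {a : ℕ} (ha : 1 ≤ a) {c : ℝ} (hc : 0 < c) :
    ∃ K : ℝ, 1 ≤ K ∧ ∀ (j : ℕ) (τ : ℝ), 0 ≤ τ →
      τ ^ j * Real.exp (-c * τ ^ a) ≤ K ^ j * (j.factorial : ℝ) ^ (1 / a : ℝ) := by
  have ha0 : (0 : ℝ) < a := by exact_mod_cast ha
  set D : ℝ := 1 / (c * a)
  have hD : 0 < D := by positivity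
  refine ⟨max 1 (D ^ (1 / a : ℝ)), le_max_left _ _, fun j τ hτ => ?_⟩
  have h1 : (τ ^ j * Real.exp (-c * τ ^ a)) ^ a ≤ D ^ j * j.factorial := by
    have h2 := Real.pow_div_factorial_le_exp (c * a * τ ^ a) (by positivity) j
    rw [div_le_iff₀ (by positivity)] at h2
    have h3 : (τ ^ j * Real.exp (-c * τ ^ a)) ^ a =
        D ^ j * ((c * a * τ ^ a) ^ j * Real.exp (-(c * a * τ ^ a))) := by
      have h4 : (τ ^ a) ^ j = D ^ j * (c * a * τ ^ a) ^ j := by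
        rw [← mul_pow]
        congr 1
        simp only [D]
        field_simp
      rw [mul_pow, ← Real.exp_nat_mul, ← pow_mul, mul_comm j a, pow_mul, h4, mul_assoc]
      ring_nf
    rw [h3]
    gcongr
    calc _ ≤ Real.exp (c * a * τ ^ a) * j.factorial * Real.exp (-(c * a * τ ^ a)) := by gcongr
      _ = j.factorial * (Real.exp (c * a * τ ^ a) * Real.exp (-(c * a * τ ^ a))) := by ring
      _ = _ := by rw [← Real.exp_add, add_neg_cancel, Real.exp_zero, mul_one]
  have h2 := Real.rpow_le_rpow (by positivity) h1 (by positivity : (0 : ℝ) ≤ 1 / a)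
  rw [← Real.rpow_natCast (τ ^ j * Real.exp (-c * τ ^ a)) a, ← Real.rpow_mul (by positivity),
    mul_one_div_cancel ha0.ne', Real.rpow_one, Real.mul_rpow (by positivity) (by positivity),
    ← Real.rpow_natCast D j, ← Real.rpow_mul hD.le, mul_comm (j : ℝ), Real.rpow_mul hD.le,
    Real.rpow_natCast] at h2
  refine h2.trans ?_
  gcongr
  exact le_max_right _ _

end Hypergeo

namespace Hypergeo

/-! ### Moments of cycles and asymptotic expansions -/

/-- The entry `a_{n-1}`. -/
def pen {n : ℕ} (A : Fin (n + 2) → ℕ) : ℕ := A (Fin.last n).castSucc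

/-- Rows `a_0, …, a_{n-2} < a_{n-1} < a_n` with `0 < a_{n-1}`. -/
structure IsRow {n : ℕ} (A : Fin (n + 2) → ℕ) : Prop where
  pos : 1 ≤ pen A
  lt : ∀ i : Fin n, A i.castSucc.castSucc < pen A
  lt_last : pen A < A (Fin.last (n + 1))

/-- A weight `W` and a path `T` such that the integrals of `W T^j exp (∑ x_i T^(a_i))` converge
uniformly if `x_{n-1}` and `x_n` have arguments near `θ₁` and `θ₂`. -/
structure CycleData {n : ℕ} (A : Fin (n + 2) → ℕ) (θ₁ θ₂ : ℝ) (W T : ℝ → ℂ) : Prop where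
  cont : Continuous T
  meas : AEStronglyMeasurable W
  decay : ∃ η > 0, ∃ B ≥ 0, ∀ u,
    (T u ^ pen A * Complex.exp (θ₁ * Complex.I)).re ≤ -η * ‖T u‖ ^ pen A + B ∧
    (T u ^ A (Fin.last (n + 1)) * Complex.exp (θ₂ * Complex.I)).re ≤
      -η * ‖T u‖ ^ A (Fin.last (n + 1)) + B
  int : ∀ j : ℕ, ∀ c > 0, Integrable fun u => ‖W u‖ * ‖T u‖ ^ j * Real.exp (-c * ‖T u‖ ^ pen A)

/-- The row without its last entry. -/
def trunc {n : ℕ} (A : Fin (n + 1) → ℕ) : Fin n → ℕ := fun i => A i.castSucc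

/-- The moments `∫ W T^j exp (∑ x_i T^(a_i))`. -/
noncomputable def mom {n : ℕ} (A : Fin (n + 1) → ℕ) (W T : ℝ → ℂ) (j : ℕ) (x : Fin n → ℂ) : ℂ :=
  ∫ u, W u * T u ^ j * Complex.exp (phase (trunc A) x (T u))

/-- The linear form `x ↦ ∑ x_i t^(a_i)`. -/
noncomputable def phaseL {n : ℕ} (A : Fin n → ℕ) (t : ℂ) : (Fin n → ℂ) →L[ℂ] ℂ :=
  ∑ i, t ^ A i • (ContinuousLinearMap.proj i : (Fin n → ℂ) →L[ℂ] ℂ)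

theorem phaseL_apply {n : ℕ} (A : Fin n → ℕ) (t : ℂ) (x : Fin n → ℂ) :
    phaseL A t x = phase A x t := by
  simp [phaseL, phase, mul_comm]

theorem norm_phaseL_le {n : ℕ} (A : Fin n → ℕ) (t : ℂ) : ‖phaseL A t‖ ≤ ∑ i, ‖t‖ ^ A i := by
  refine ContinuousLinearMap.opNorm_le_bound _ (by positivity) fun x => ?_
  rw [phaseL_apply, phase, Finset.sum_mul]
  refine (norm_sum_le _ _).trans (Finset.sum_le_sum fun i _ => ?_)
  rw [norm_mul, norm_pow, mul_comm]
  gcongr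
  exact norm_le_pi_norm x i

theorem continuous_phaseL {n : ℕ} (A : Fin n → ℕ) : Continuous (phaseL A) := by
  unfold phaseL
  fun_prop

theorem phase_snoc {n : ℕ} (A : Fin (n + 1) → ℕ) (x : Fin n → ℂ) (z t : ℂ) :
    phase A (Fin.snoc x z : Fin (n + 1) → ℂ) t =
      phase (trunc A) x t + z * t ^ A (Fin.last n) := by
  rw [phase, Fin.sum_univ_castSucc]
  simp [phase, trunc]

theorem continuous_phase {n : ℕ} (A : Fin n → ℕ) (x : Fin n → ℂ) : Continuous (phase A x) := by
  unfold phase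
  fun_prop

section
variable {n : ℕ} {A : Fin (n + 2) → ℕ} {θ₁ θ₂ : ℝ} {W T : ℝ → ℂ}

/-- The uniform decay of `exp (∑ x_i T^(a_i))`, with some room. -/
theorem CycleData.exp_phase_le (h : CycleData A θ₁ θ₂ W T) (hA : IsRow A)
    {p : Fin (n + 1) → ℂ} {ρ : ℝ} (hρ : 0 < ρ)
    (hp : p (Fin.last n) = ρ * Complex.exp (θ₁ * Complex.I)) :
    ∃ r > 0, ∃ c > 0, ∃ K > 0, ∀ x ∈ Metric.ball p r, ∀ u,
      ‖Complex.exp (phase (trunc A) x (T u))‖ * Real.exp (r * ∑ i, ‖T u‖ ^ trunc A i) ≤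
        K * Real.exp (-c * ‖T u‖ ^ pen A) := by
  obtain ⟨η, hη, B, hB, hd⟩ := h.decay
  -- Budget for the coefficient of τ^(a_{n-1}): the main term gives -ρη; moving the last coordinate
  -- of x and the factor exp(r ∑ ‖T‖^(a_i)) cost r each, together ρη/4; the n lower monomials cost
  -- at most e each, together at most ρη/4. The rate ρη/2 remains.
  set r : ℝ := ρ * η / 8 with hr
  have hr0 : 0 < r := by positivity
  set e : ℝ := ρ * η / (4 * (n + 1)) with he
  have he0 : 0 < e := by positivity
  have hlow : ∀ i : Fin n, ∃ K : ℝ, 0 ≤ K ∧ ∀ τ : ℝ, 0 ≤ τ →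
      ((‖p‖ + r) + r) * τ ^ A i.castSucc.castSucc ≤ e * τ ^ pen A + K :=
    fun i => exists_lower_le (hA.lt i) _ he0
  choose K hK0 hK using hlow
  refine ⟨r, hr0, ρ * η / 2, by positivity, Real.exp (∑ i, K i + ρ * B), Real.exp_pos _,
    fun x hx u => ?_⟩
  rw [Complex.norm_exp, ← Real.exp_add, ← Real.exp_add]
  refine Real.exp_le_exp.2 ?_
  set τ := ‖T u‖ with hτ
  have hτ0 : 0 ≤ τ := norm_nonneg _
  have hx' : ‖x - p‖ < r := by rwa [← dist_eq_norm]
  have hxn : ‖x‖ ≤ ‖p‖ + r := by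
    have := norm_add_le p (x - p)
    rw [add_sub_cancel] at this
    linarith
  have e1 : (phase (trunc A) x (T u)).re ≤ ∑ i : Fin n, (‖p‖ + r) * τ ^ A i.castSucc.castSucc +
      (ρ * (-η * τ ^ pen A + B) + r * τ ^ pen A) := by
    rw [phase, Fin.sum_univ_castSucc, Complex.add_re, Complex.re_sum]
    refine add_le_add (Finset.sum_le_sum fun i _ => ?_) ?_
    · refine (Complex.re_le_norm _).trans ?_
      rw [norm_mul, norm_pow]
      exact mul_le_mul_of_nonneg_right ((norm_le_pi_norm x _).trans hxn) (by positivity)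
    · have e2 : x (Fin.last n) * T u ^ trunc A (Fin.last n) =
          ρ * (T u ^ pen A * Complex.exp (θ₁ * Complex.I)) +
          (x - p) (Fin.last n) * T u ^ pen A := by
        rw [Pi.sub_apply, hp]
        simp only [trunc, pen]
        ring
      rw [e2, Complex.add_re, Complex.re_ofReal_mul]
      refine add_le_add (mul_le_mul_of_nonneg_left (hd u).1 hρ.le) ?_
      refine (Complex.re_le_norm _).trans ?_
      rw [norm_mul, norm_pow]
      gcongr
      exact (norm_le_pi_norm (x - p) _).trans hx'.le
  have e3 : ∑ i, τ ^ trunc A i = ∑ i : Fin n, τ ^ A i.castSucc.castSucc + τ ^ pen A := by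
    rw [Fin.sum_univ_castSucc]; rfl
  have e4 : ∑ i : Fin n, ((‖p‖ + r) * τ ^ A i.castSucc.castSucc + r * τ ^ A i.castSucc.castSucc) ≤
      ∑ i : Fin n, (e * τ ^ pen A + K i) := by
    refine Finset.sum_le_sum fun i _ => ?_
    have := hK i τ hτ0
    linarith
  rw [Finset.sum_add_distrib, Finset.sum_add_distrib, Finset.sum_const, Finset.card_univ,
    Fintype.card_fin, nsmul_eq_mul, ← Finset.mul_sum, ← Finset.mul_sum] at e4
  have e5 : (n : ℝ) * (e * τ ^ pen A) ≤ ρ * η / 4 * τ ^ pen A := by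
    rw [← mul_assoc]
    gcongr
    rw [he]
    rw [mul_div_assoc', div_le_div_iff₀ (by positivity) (by positivity)]
    have : 0 < ρ * η := by positivity
    nlinarith
  rw [e3, mul_add]
  have e6 : r * τ ^ pen A = ρ * η / 8 * τ ^ pen A := rfl
  have e7 : 0 ≤ ρ * η * τ ^ pen A := by positivity
  rw [← Finset.mul_sum] at e1
  nlinarith [e1, e4, e5, e6, e7]

/-- Turning z by an angle α changes z T^b by at most |α| ‖z T^b‖, so for |α| < η/2 half of the decay
survives. The bound is proportional to ‖z‖ and hence does not deteriorate as z → 0. -/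
theorem CycleData.exp_last_le (h : CycleData A θ₁ θ₂ W T) :
    ∃ η > 0, ∃ B ≥ 0, ∀ z : ℂ, z ≠ 0 → |(z * Complex.exp (-(θ₂ * Complex.I))).arg| < η → ∀ u,
      (z * T u ^ A (Fin.last (n + 1))).re ≤ ‖z‖ * (-η * ‖T u‖ ^ A (Fin.last (n + 1)) + B) := by
  obtain ⟨η, hη, B, hB, hd⟩ := h.decay
  refine ⟨η / 2, by positivity, B, hB, fun z hz hz' u => ?_⟩
  set α := (z * Complex.exp (-(θ₂ * Complex.I))).arg
  set b := A (Fin.last (n + 1))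
  have h1 : z * Complex.exp (-(θ₂ * Complex.I)) = ‖z‖ * Complex.exp (α * Complex.I) := by
    have h0 := Complex.norm_mul_exp_arg_mul_I (z * Complex.exp (-(θ₂ * Complex.I)))
    have hn : ‖z * Complex.exp (-(θ₂ * Complex.I))‖ = ‖z‖ := by
      rw [norm_mul, Complex.norm_exp]
      simp
    rw [hn] at h0
    exact h0.symm
  have h2 : z = ‖z‖ * Complex.exp (α * Complex.I) * Complex.exp (θ₂ * Complex.I) := by
    rw [← h1, mul_assoc, ← Complex.exp_add, neg_add_cancel, Complex.exp_zero, mul_one]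
  set S := T u ^ b * Complex.exp (θ₂ * Complex.I)
  have h3 : z * T u ^ b = ‖z‖ * (S + (Complex.exp (Complex.I * α) - 1) * S) := by
    rw [h2]
    simp only [S, norm_mul, Complex.norm_exp_ofReal_mul_I, mul_one, Complex.norm_real, norm_norm]
    rw [mul_comm Complex.I]
    ring
  rw [h3, Complex.re_ofReal_mul, Complex.add_re]
  refine mul_le_mul_of_nonneg_left ?_ (norm_nonneg z)
  have h4 : ((Complex.exp (Complex.I * α) - 1) * S).re ≤ η / 2 * ‖T u‖ ^ b := by
    refine (Complex.re_le_norm _).trans ?_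
    rw [norm_mul]
    have h5 : ‖S‖ = ‖T u‖ ^ b := by
      simp only [S, norm_mul, Complex.norm_exp_ofReal_mul_I, mul_one, norm_pow]
    rw [h5]
    gcongr
    exact Real.norm_exp_I_mul_ofReal_sub_one_le.trans hz'.le
  have h6 : S.re ≤ _ := (hd u).2
  linarith

theorem CycleData.integrable_mom (h : CycleData A θ₁ θ₂ W T) (hA : IsRow A)
    {p : Fin (n + 1) → ℂ} {ρ : ℝ} (hρ : 0 < ρ)
    (hp : p (Fin.last n) = ρ * Complex.exp (θ₁ * Complex.I)) :
    ∃ r > 0, ∃ c > 0, ∃ K > 0, ∀ x ∈ Metric.ball p r,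
      (∀ u, ‖Complex.exp (phase (trunc A) x (T u))‖ ≤ K * Real.exp (-c * ‖T u‖ ^ pen A)) ∧
      (∀ j, Integrable fun u => W u * T u ^ j * Complex.exp (phase (trunc A) x (T u))) ∧
      ∀ j, AnalyticAt ℂ (mom A W T j) x ∧ ∀ i : Fin (n + 1),
        fderiv ℂ (mom A W T j) x (Pi.single i 1) = mom A W T (j + A i.castSucc) x := by
  obtain ⟨r, hr, c, hc, K, hK, hb⟩ := h.exp_phase_le hA hρ hp
  refine ⟨r, hr, c, hc, K, hK, fun x hx => ⟨fun u => ?_, fun j => ?_, fun j => ?_⟩⟩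
  · refine le_trans (le_mul_of_one_le_right (norm_nonneg _) ?_) (hb x hx u)
    exact Real.one_le_exp (by positivity)
  · refine Integrable.mono' ((h.int j c hc).const_mul K) ((h.meas.mul
      (h.cont.pow j).aestronglyMeasurable).mul (Complex.continuous_exp.comp
      ((continuous_phase _ x).comp h.cont)).aestronglyMeasurable) (Eventually.of_forall fun u => ?_)
    rw [norm_mul, norm_mul, norm_pow]
    have h1 : ‖Complex.exp (phase (trunc A) x (T u))‖ ≤ K * Real.exp (-c * ‖T u‖ ^ pen A) := by
      refine le_trans (le_mul_of_one_le_right (norm_nonneg _) ?_) (hb x hx u)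
      exact Real.one_le_exp (by positivity)
    calc _ ≤ ‖W u‖ * ‖T u‖ ^ j * (K * Real.exp (-c * ‖T u‖ ^ pen A)) := by gcongr
      _ = _ := by ring
  · have hint : Integrable fun u => ‖W u * T u ^ j‖ *
        ‖Complex.exp (phaseL (trunc A) (T u) x)‖ * Real.exp (r * ‖phaseL (trunc A) (T u)‖) := by
      have hLc := (continuous_phaseL (trunc A)).comp h.cont
      refine Integrable.mono' ((h.int j c hc).const_mul K) ?_ (Eventually.of_forall fun u => ?_)
      · refine ((h.meas.mul (h.cont.pow j).aestronglyMeasurable).norm.mul ?_).mul ?_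
        · exact (Continuous.norm (by fun_prop)).aestronglyMeasurable
        · exact (Real.continuous_exp.comp (continuous_const.mul hLc.norm)).aestronglyMeasurable
      · rw [phaseL_apply, Real.norm_of_nonneg (by positivity), norm_mul, norm_pow]
        calc _ ≤ ‖W u‖ * ‖T u‖ ^ j * (‖Complex.exp (phase (trunc A) x (T u))‖ *
              Real.exp (r * ∑ i, ‖T u‖ ^ trunc A i)) := by
              rw [mul_assoc (‖W u‖ * ‖T u‖ ^ j)]
              gcongr
              exact norm_phaseL_le _ _
          _ ≤ ‖W u‖ * ‖T u‖ ^ j * (K * Real.exp (-c * ‖T u‖ ^ pen A)) := by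
              exact mul_le_mul_of_nonneg_left (hb x hx u) (by positivity)
          _ = _ := by ring
    have := analyticAt_integral_exp hr (h.meas.mul (h.cont.pow j).aestronglyMeasurable)
      ((continuous_phaseL (trunc A)).comp h.cont) hint
    have e : mom A W T j = fun x => ∫ u, (W u * T u ^ j) *
        Complex.exp (phaseL (trunc A) (T u) x) := by
      funext x
      simp only [mom, phaseL_apply]
    rw [e]
    refine ⟨this.1, fun i => (this.2 _).trans ?_⟩
    rw [mom]
    refine integral_congr_ae (Eventually.of_forall fun u => ?_)
    have h2 : phaseL (trunc A) (T u) (Pi.single i 1) = T u ^ A i.castSucc := by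
      rw [phaseL_apply, phase, Finset.sum_eq_single i]
      · simp [trunc]
      · intro j _ hj; simp [hj]
      · simp
    simp only [Function.comp_apply, Pi.mul_apply, Pi.pow_apply, h2, phaseL_apply, pow_add]
    ring

/-- Half of the exponential decay absorbs ‖T‖^j by `pow_mul_exp_le`; the other half keeps the
integral finite independently of j. -/
theorem CycleData.hasGrowth (h : CycleData A θ₁ θ₂ W T) (hA : IsRow A)
    {p : Fin (n + 1) → ℂ} {ρ : ℝ} (hρ : 0 < ρ)
    (hp : p (Fin.last n) = ρ * Complex.exp (θ₁ * Complex.I)) :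
    HasGrowth (pen A) Set.univ p (mom A W T) := by
  obtain ⟨r, hr, c, hc, K, hK, hb⟩ := h.integrable_mom hA hρ hp
  obtain ⟨D, hD, hD'⟩ := pow_mul_exp_le hA.pos (half_pos hc)
  have hi := h.int 0 (c / 2) (half_pos hc)
  simp only [pow_zero, mul_one] at hi
  refine ⟨K * ∫ u, ‖W u‖ * Real.exp (-(c / 2) * ‖T u‖ ^ pen A), D, ?_, hD, ?_⟩
  · have : 0 ≤ ∫ u, ‖W u‖ * Real.exp (-(c / 2) * ‖T u‖ ^ pen A) :=
      integral_nonneg fun u => by positivity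
    positivity
  · filter_upwards [Metric.ball_mem_nhds p hr] with x hx j _
    obtain ⟨h1, h2, -⟩ := hb x hx
    rw [mom, mul_assoc, mul_assoc, mul_comm (∫ _, _), ← integral_const_mul, ← integral_const_mul]
    refine norm_integral_le_of_norm_le ((hi.const_mul _).const_mul _)
      (Eventually.of_forall fun u => ?_)
    rw [norm_mul, norm_mul, norm_pow]
    have h3 : Real.exp (-c * ‖T u‖ ^ pen A) = Real.exp (-(c / 2) * ‖T u‖ ^ pen A) *
        Real.exp (-(c / 2) * ‖T u‖ ^ pen A) := by
      rw [← Real.exp_add]; ring_nf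
    calc _ ≤ ‖W u‖ * ‖T u‖ ^ j * (K * Real.exp (-c * ‖T u‖ ^ pen A)) := by gcongr; exact h1 u
      _ = K * (‖W u‖ * Real.exp (-(c / 2) * ‖T u‖ ^ pen A)) *
          (‖T u‖ ^ j * Real.exp (-(c / 2) * ‖T u‖ ^ pen A)) := by rw [h3]; ring
      _ ≤ K * (‖W u‖ * Real.exp (-(c / 2) * ‖T u‖ ^ pen A)) *
          (D ^ j * (j.factorial : ℝ) ^ (1 / (pen A : ℝ))) := by
          exact mul_le_mul_of_nonneg_left (hD' j ‖T u‖ (norm_nonneg (T u))) (by positivity)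
      _ = _ := by ring

/-- The integral over the cycle as a function on the product. -/
theorem CycleData.differentiableAt (h : CycleData A θ₁ θ₂ W T) (hA : IsRow A)
    {p : Fin (n + 1) → ℂ} {ρ : ℝ} (hρ : 0 < ρ)
    (hp : p (Fin.last n) = ρ * Complex.exp (θ₁ * Complex.I)) :
    ∃ r > 0, ∃ δ > 0, ∀ x ∈ Metric.ball p r, ∀ z : ℂ, z ≠ 0 →
      |(z * Complex.exp (-(θ₂ * Complex.I))).arg| < δ →
      DifferentiableAt ℂ (fun y : (Fin (n + 1) → ℂ) × ℂ =>
        ∫ u, W u * Complex.exp (phase A (Fin.snoc y.1 y.2 : Fin (n + 2) → ℂ) (T u))) (x, z) := by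
  obtain ⟨r, hr, c, hc, K, hK, hb⟩ := h.exp_phase_le hA hρ hp
  obtain ⟨η, hη, B, hB, hz⟩ := h.exp_last_le
  refine ⟨r, hr, η, hη, fun x hx z hz0 hza => ?_⟩
  set b := A (Fin.last (n + 1))
  set L : ℂ → ((Fin (n + 1) → ℂ) × ℂ) →L[ℂ] ℂ := fun t =>
    (phaseL (trunc A) t).comp (ContinuousLinearMap.fst ℂ _ _) +
      t ^ b • ContinuousLinearMap.snd ℂ _ _ with hL
  have hLa : ∀ (y : (Fin (n + 1) → ℂ) × ℂ) t, L t y =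
      phase A (Fin.snoc y.1 y.2 : Fin (n + 2) → ℂ) t := by
    intro y t
    rw [phase_snoc]
    simp [hL, phaseL_apply, mul_comm, b]
  have hLn : ∀ t, ‖L t‖ ≤ ∑ i, ‖t‖ ^ trunc A i + ‖t‖ ^ b := by
    intro t
    refine (norm_add_le _ _).trans (add_le_add ?_ ?_)
    · refine (ContinuousLinearMap.opNorm_comp_le _ _).trans ?_
      refine (mul_le_of_le_one_right (norm_nonneg _) (ContinuousLinearMap.norm_fst_le ℂ (Fin (n + 1) → ℂ) ℂ)).trans ?_
      exact norm_phaseL_le _ _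
    · rw [norm_smul, norm_pow]
      exact mul_le_of_le_one_right (by positivity) (ContinuousLinearMap.norm_snd_le ℂ (Fin (n + 1) → ℂ) ℂ)
  have hLc : Continuous L := by
    have := continuous_phaseL (trunc A)
    simp only [hL]
    fun_prop
  -- The growth exp(r' ‖T‖^b) allowed for the power series is compensated by the decay of exp(z
  -- T^b), whose rate is ‖z‖ η. The radius of analyticity in z therefore shrinks with z.
  set r' : ℝ := min r (‖z‖ * η)
  have hr' : 0 < r' := lt_min hr (mul_pos (norm_pos_iff.2 hz0) hη)
  have hint : Integrable fun u => ‖W u‖ * ‖Complex.exp (L (T u) (x, z))‖ *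
      Real.exp (r' * ‖L (T u)‖) := by
    refine Integrable.mono' ((h.int 0 c hc).const_mul (K * Real.exp (‖z‖ * B))) ?_
      (Eventually.of_forall fun u => ?_)
    · have hT := h.cont
      have hLT := hLc.comp h.cont
      refine (h.meas.norm.mul ?_).mul ?_
      · exact (Continuous.norm (by fun_prop)).aestronglyMeasurable
      · exact (Real.continuous_exp.comp (continuous_const.mul hLT.norm)).aestronglyMeasurable
    · rw [Real.norm_of_nonneg (by positivity), hLa, phase_snoc, Complex.exp_add, norm_mul,
        Complex.norm_exp (z * _)]
      dsimp only
      have h1 : Real.exp (r' * ‖L (T u)‖) ≤ Real.exp (r * ∑ i, ‖T u‖ ^ trunc A i) *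
          Real.exp (‖z‖ * η * ‖T u‖ ^ b) := by
        rw [← Real.exp_add]
        refine Real.exp_le_exp.2 ?_
        calc r' * ‖L (T u)‖ ≤ r' * (∑ i, ‖T u‖ ^ trunc A i + ‖T u‖ ^ b) := by
              gcongr; exact hLn _
          _ = r' * ∑ i, ‖T u‖ ^ trunc A i + r' * ‖T u‖ ^ b := mul_add _ _ _
          _ ≤ _ := by
              gcongr
              · exact min_le_left _ _
              · exact min_le_right _ _
      calc _ ≤ ‖W u‖ * (‖Complex.exp (phase (trunc A) x (T u))‖ *
            Real.exp (‖z‖ * (-η * ‖T u‖ ^ b + B))) *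
            (Real.exp (r * ∑ i, ‖T u‖ ^ trunc A i) * Real.exp (‖z‖ * η * ‖T u‖ ^ b)) := by
            gcongr
            exact hz z hz0 hza u
        _ = ‖W u‖ * (‖Complex.exp (phase (trunc A) x (T u))‖ *
            Real.exp (r * ∑ i, ‖T u‖ ^ trunc A i)) *
            (Real.exp (‖z‖ * (-η * ‖T u‖ ^ b + B)) * Real.exp (‖z‖ * η * ‖T u‖ ^ b)) := by ring
        _ = ‖W u‖ * (‖Complex.exp (phase (trunc A) x (T u))‖ *
            Real.exp (r * ∑ i, ‖T u‖ ^ trunc A i)) * Real.exp (‖z‖ * B) := by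
            rw [← Real.exp_add]; ring_nf
        _ ≤ ‖W u‖ * (K * Real.exp (-c * ‖T u‖ ^ pen A)) * Real.exp (‖z‖ * B) := by
            exact mul_le_mul_of_nonneg_right
              (mul_le_mul_of_nonneg_left (hb x hx u) (norm_nonneg _)) (Real.exp_pos _).le
        _ = _ := by ring
  have := (analyticAt_integral_exp hr' h.meas (hLc.comp h.cont) hint).1.differentiableAt
  simpa only [Function.comp_apply, hLa] using this

/-- Only the factor exp(z T^b) depends on z. On the sector Re(z T^b) is bounded above, so its Taylor
remainder of order N is at most a constant times |z|^N ‖T‖^(bN), and the decay of the x_{n-1}-term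
makes this integrable uniformly in z. The Taylor terms integrate to M_{bm} z^m / m!. -/
theorem CycleData.hasExpansion (h : CycleData A θ₁ θ₂ W T) (hA : IsRow A)
    {p : Fin (n + 1) → ℂ} {ρ : ℝ} (hρ : 0 < ρ)
    (hp : p (Fin.last n) = ρ * Complex.exp (θ₁ * Complex.I)) {β : ℂ} {γ : GeomCycle}
    (hγ : ∀ y u, γ.integrand A β y u = W u * Complex.exp (phase A y (T u)))
    {S : Set ℕ} (hS : IsStable A S) (hM : IsMom A β S p (mom A W T)) :
    HasExpansion A β θ₂ (Finsupp.single γ 1) (momGerm hM hS) := by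
  obtain ⟨r₁, hr₁, c, hc, K, hK, hb⟩ := h.integrable_mom hA hρ hp
  obtain ⟨η, hη, B, hB, hz⟩ := h.exp_last_le
  obtain ⟨r₂, hr₂, δ₂, hδ₂, hdiff⟩ := h.differentiableAt hA hρ hp
  set b := A (Fin.last (n + 1)) with hbdef
  set r : ℝ := min r₁ r₂
  have hr : 0 < r := lt_min hr₁ hr₂
  set δ : ℝ := min η δ₂
  have hδ : 0 < δ := lt_min hη hδ₂
  have hγ' : ∀ y, γ.integrand A β y = fun u => W u * Complex.exp (phase A y (T u)) :=
    fun y => funext (hγ y)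
  have hcyc : ∀ y, cycleIntegral A β (Finsupp.single γ 1) y =
      ∫ u, W u * Complex.exp (phase A y (T u)) := by
    intro y
    rw [cycleIntegral, Finsupp.sum_single_index (by simp), one_mul, hγ' y]
  have hre : ∀ z ∈ sector θ₂ δ r, ∀ u, (z * T u ^ b).re ≤ r * B := by
    intro z hz' u
    have h1 := hz z hz'.1 (hz'.2.2.trans_le (min_le_left _ _)) u
    refine h1.trans ?_
    have h2 : -η * ‖T u‖ ^ b + B ≤ B := by
      have : 0 ≤ η * ‖T u‖ ^ b := by positivity
      linarith
    exact (mul_le_mul_of_nonneg_left h2 (norm_nonneg _)).trans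
      (mul_le_mul_of_nonneg_right hz'.2.1.le hB)
  have hTc := h.cont
  have hfull : ∀ x ∈ Metric.ball p r, ∀ z ∈ sector θ₂ δ r,
      Integrable fun u => W u * Complex.exp (phase A (Fin.snoc x z : Fin (n + 2) → ℂ) (T u)) := by
    intro x hx z hz'
    obtain ⟨h1, -, -⟩ := hb x (Metric.ball_subset_ball (min_le_left _ _) hx)
    refine Integrable.mono' ((h.int 0 c hc).const_mul (K * Real.exp (r * B)))
      (h.meas.mul (Complex.continuous_exp.comp ((continuous_phase _ _).comp
      h.cont)).aestronglyMeasurable) (Eventually.of_forall fun u => ?_)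
    rw [phase_snoc, Complex.exp_add, norm_mul, norm_mul, Complex.norm_exp (z * _)]
    calc _ ≤ ‖W u‖ * (K * Real.exp (-c * ‖T u‖ ^ pen A) * Real.exp (r * B)) := by
          gcongr
          · exact h1 u
          · exact hre z hz' u
      _ = _ := by ring
  refine ⟨r, hr, δ, hδ, ?_, ?_, momSer b (mom A W T), rfl, fun N => ?_⟩
  · intro x hx z hz' c' hc'
    rw [Finsupp.support_single _ one_ne_zero] at hc'
    rw [Finset.mem_singleton.1 hc', hγ']
    exact hfull x hx z hz'
  · simp only [hcyc]
    rintro ⟨x, z⟩ ⟨hx, hz'⟩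
    exact (hdiff x (Metric.ball_subset_ball (min_le_right _ _) hx) z hz'.1
      (hz'.2.2.trans_le (min_le_right _ _))).differentiableWithinAt
  · refine ⟨∫ u, K * Real.exp (r * B) *
      (‖W u‖ * ‖T u‖ ^ (b * N) * Real.exp (-c * ‖T u‖ ^ pen A)), fun x hx z hz' => ?_⟩
    obtain ⟨h1, h2, -⟩ := hb x (Metric.ball_subset_ball (min_le_left _ _) hx)
    have hsum : ∑ m ∈ Finset.range N, momSer b (mom A W T) x m * z ^ m =
        ∫ u, ∑ m ∈ Finset.range N, W u * T u ^ (b * m) *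
          Complex.exp (phase (trunc A) x (T u)) * (z ^ m / (m.factorial : ℂ)) := by
      rw [integral_finsetSum _ fun m _ => (h2 (b * m)).mul_const _]
      refine Finset.sum_congr rfl fun m _ => ?_
      rw [integral_mul_const, momSer, mom]
      ring
    rw [hcyc, hsum, ← integral_sub (hfull x hx z hz')
      (integrable_finsetSum _ fun m _ => (h2 (b * m)).mul_const _), ← integral_mul_const]
    refine norm_integral_le_of_norm_le (((h.int (b * N) c hc).const_mul _).mul_const _)
      (Eventually.of_forall fun u => ?_)
    have e1 : W u * Complex.exp (phase A (Fin.snoc x z : Fin (n + 2) → ℂ) (T u)) -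
        ∑ m ∈ Finset.range N, W u * T u ^ (b * m) * Complex.exp (phase (trunc A) x (T u)) *
          (z ^ m / (m.factorial : ℂ)) = W u * Complex.exp (phase (trunc A) x (T u)) *
        (Complex.exp (z * T u ^ b) - ∑ m ∈ Finset.range N, (z * T u ^ b) ^ m / (m.factorial : ℂ)) := by
      rw [phase_snoc, Complex.exp_add, mul_sub, Finset.mul_sum, mul_assoc]
      congr 1
      refine Finset.sum_congr rfl fun m _ => ?_
      rw [mul_pow, ← pow_mul]
      ring
    rw [e1, norm_mul, norm_mul]
    have e2 : Real.exp (max 0 (z * T u ^ b).re) ≤ Real.exp (r * B) :=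
      Real.exp_le_exp.2 (max_le (by positivity) (hre z hz' u))
    calc _ ≤ ‖W u‖ * (K * Real.exp (-c * ‖T u‖ ^ pen A)) *
          (‖z * T u ^ b‖ ^ N * Real.exp (r * B)) := by
          gcongr
          · exact h1 u
          · exact (norm_exp_sub_sum_le N _).trans (by gcongr)
      _ = _ := by rw [norm_mul, norm_pow, mul_pow, ← pow_mul]; ring

end

end Hypergeo

namespace Hypergeo

/-! ### Paths and half lines -/

/-- The weight of a cycle: `t^(-β-1) dt/du`. -/
noncomputable def GeomCycle.weight (β : ℂ) : GeomCycle → ℝ → ℂ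
  | .path γ, u => Complex.exp (-β * γ.w u) * deriv γ.w u
  | .ray φ, u => Set.indicator (Set.Ioi (0 : ℝ)) (fun r : ℝ =>
      (Complex.exp (φ * Complex.I) * r) ^ (-β - 1) * Complex.exp (φ * Complex.I)) u

/-- The parametrisation of a cycle. -/
noncomputable def GeomCycle.param : GeomCycle → ℝ → ℂ
  | .path γ, u => Complex.exp (γ.w u)
  | .ray φ, u => Complex.exp (φ * Complex.I) * (max u 0 : ℝ)

/-- The moments of a cycle. -/
noncomputable def cmom {n : ℕ} (A : Fin (n + 1) → ℕ) (β : ℂ) (c : GeomCycle) (j : ℕ)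
    (x : Fin n → ℂ) : ℂ :=
  mom A (c.weight β) c.param j x

theorem bounded_above_of_eventually {F : ℝ → ℝ} (hF : Continuous F) (h1 : ∀ᶠ u in atTop, F u ≤ 0)
    (h2 : ∀ᶠ u in atBot, F u ≤ 0) : ∃ B ≥ 0, ∀ u, F u ≤ B := by
  obtain ⟨M, hM⟩ := eventually_atTop.1 h1
  obtain ⟨m, hm⟩ := eventually_atBot.1 h2
  obtain ⟨B, hB⟩ := (isCompact_Icc (a := m) (b := M)).bddAbove_image hF.continuousOn
  refine ⟨max B 0, le_max_right _ _, fun u => ?_⟩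
  rcases le_total M u with h | h
  · exact (hM u h).trans (le_max_right _ _)
  rcases le_total u m with h' | h'
  · exact (hm u h').trans (le_max_right _ _)
  · exact (hB ⟨u, ⟨h', h⟩, rfl⟩).trans (le_max_left _ _)

theorem re_exp_pow (w : ℂ) (a : ℕ) (θ : ℝ) :
    (Complex.exp w ^ a * Complex.exp (θ * Complex.I)).re =
      ‖Complex.exp w‖ ^ a * Real.cos (θ + a * w.im) := by
  rw [← Complex.exp_nat_mul, ← Complex.exp_add, Complex.exp_re, Complex.norm_exp,
    ← Real.exp_nat_mul]
  congr 2
  · simp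
  · simp; ring

namespace LogPath

theorem continuous_w (γ : LogPath) : Continuous γ.w := γ.contDiff.continuous

theorem hasDerivAt_w (γ : LogPath) (u : ℝ) : HasDerivAt γ.w (deriv γ.w u) u :=
  (γ.contDiff.differentiable one_ne_zero u).hasDerivAt

theorem continuous_deriv_w (γ : LogPath) : Continuous (deriv γ.w) :=
  γ.contDiff.continuous_deriv le_rfl

theorem norm_w_le (γ : LogPath) : ∃ L ≥ 0, ∀ u, ‖deriv γ.w u‖ ≤ L ∧ ‖γ.w u‖ ≤ ‖γ.w 0‖ + L * |u| := by
  obtain ⟨L, hL⟩ := γ.bounded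
  refine ⟨|L|, abs_nonneg L, fun u => ⟨(hL u).trans (le_abs_self L), ?_⟩⟩
  have h := Convex.norm_image_sub_le_of_norm_deriv_le (𝕜 := ℝ) (f := γ.w) (C := |L|)
    (s := Set.univ) (x := 0) (y := u) (fun u _ => (γ.hasDerivAt_w u).differentiableAt)
    (fun u _ => (hL u).trans (le_abs_self L)) convex_univ trivial trivial
  rw [sub_zero, Real.norm_eq_abs] at h
  have h2 := norm_add_le (γ.w 0) (γ.w u - γ.w 0)
  rw [add_sub_cancel] at h2
  linarith

theorem integrable_weight (γ : LogPath) {a : ℕ} (ha : 1 ≤ a) {Y : ℝ → ℂ} (hY : Continuous Y)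
    {C K : ℝ} (hb : ∀ u, ‖Y u‖ ≤ C * Real.exp (K * |u|)) (j : ℕ) {c : ℝ} (hc : 0 < c) :
    Integrable fun u => ‖Y u‖ * ‖Complex.exp (γ.w u)‖ ^ j *
      Real.exp (-c * ‖Complex.exp (γ.w u)‖ ^ a) := by
  obtain ⟨c₀, hc₀, C₀, hg⟩ := γ.growth
  have hw := γ.continuous_w
  obtain ⟨D, hD, hD'⟩ := pow_mul_exp_le ha hc
  -- Since the modulus τ of the path grows at least like e^(c₀|u|), N extra powers of τ beat
  -- e^(K|u|) and leave a factor e^(-|u|).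
  obtain ⟨N, hN⟩ := exists_nat_gt ((|K| + 1) / c₀)
  rw [div_lt_iff₀ hc₀] at hN
  set Q : ℝ := D ^ (j + N) * ((j + N).factorial : ℝ) ^ (1 / a : ℝ)
  have hQ : 0 ≤ Q := by positivity
  refine Integrable.mono' (integrable_inv_one_add_sq.const_mul (|C| * Q * Real.exp (N * C₀) * 2))
    (Continuous.aestronglyMeasurable (by fun_prop)) (Eventually.of_forall fun u => ?_)
  rw [Real.norm_of_nonneg (by positivity)]
  set τ := ‖Complex.exp (γ.w u)‖ with hτ
  have hτ0 : 0 < τ := norm_pos_iff.2 (Complex.exp_ne_zero _)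
  have h1 : τ ^ j * Real.exp (-c * τ ^ a) ≤ Q * Real.exp (-(N * (c₀ * |u| - C₀))) := by
    have h2 := hD' (j + N) τ hτ0.le
    have h3 : Real.exp (N * (c₀ * |u| - C₀)) ≤ τ ^ N := by
      rw [hτ, Complex.norm_exp, ← Real.exp_nat_mul]
      exact Real.exp_le_exp.2 (mul_le_mul_of_nonneg_left (hg u) (Nat.cast_nonneg N))
    rw [Real.exp_neg, ← div_eq_mul_inv, le_div_iff₀ (Real.exp_pos _)]
    calc _ ≤ τ ^ j * Real.exp (-c * τ ^ a) * τ ^ N := by gcongr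
      _ = τ ^ (j + N) * Real.exp (-c * τ ^ a) := by ring
      _ ≤ _ := h2
  have h4 : Real.exp (K * |u|) * Real.exp (-(N * (c₀ * |u| - C₀))) ≤
      Real.exp (N * C₀) * (2 * (1 + u ^ 2)⁻¹) := by
    have h5 : Real.exp (K * |u|) * Real.exp (-(N * (c₀ * |u| - C₀))) ≤
        Real.exp (N * C₀) * Real.exp (-|u|) := by
      rw [← Real.exp_add, ← Real.exp_add]
      refine Real.exp_le_exp.2 ?_
      have := mul_le_mul_of_nonneg_right (hN.le.trans' (add_le_add_left (le_abs_self K) 1))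
        (abs_nonneg u)
      nlinarith
    refine h5.trans ?_
    gcongr
    rw [Real.exp_neg, ← div_eq_mul_inv, inv_eq_one_div, div_le_div_iff₀ (Real.exp_pos _)
      (by positivity)]
    have h6 := Real.quadratic_le_exp_of_nonneg (abs_nonneg u)
    have h7 := abs_nonneg u
    have h8 := sq_abs u
    nlinarith
  calc ‖Y u‖ * τ ^ j * Real.exp (-c * τ ^ a)
      ≤ (|C| * Real.exp (K * |u|)) * (Q * Real.exp (-(N * (c₀ * |u| - C₀)))) := by
        rw [mul_assoc]
        gcongr
        refine (hb u).trans ?_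
        gcongr
        exact le_abs_self C
    _ = |C| * Q * (Real.exp (K * |u|) * Real.exp (-(N * (c₀ * |u| - C₀)))) := by ring
    _ ≤ |C| * Q * (Real.exp (N * C₀) * (2 * (1 + u ^ 2)⁻¹)) := by gcongr
    _ = _ := by ring

theorem norm_exp_le (γ : LogPath) (s : ℂ) : ∃ C K : ℝ, ∀ u,
    ‖Complex.exp (s * γ.w u)‖ ≤ C * Real.exp (K * |u|) ∧
    ‖Complex.exp (s * γ.w u) * deriv γ.w u‖ ≤ C * Real.exp (K * |u|) := by
  obtain ⟨L, hL, h⟩ := γ.norm_w_le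
  refine ⟨Real.exp (‖s‖ * ‖γ.w 0‖) * (1 + L), ‖s‖ * L, fun u => ?_⟩
  have h1 : ‖Complex.exp (s * γ.w u)‖ ≤
      Real.exp (‖s‖ * ‖γ.w 0‖) * Real.exp (‖s‖ * L * |u|) := by
    rw [Complex.norm_exp, ← Real.exp_add]
    refine Real.exp_le_exp.2 ((Complex.re_le_norm _).trans ?_)
    rw [norm_mul]
    calc _ ≤ ‖s‖ * (‖γ.w 0‖ + L * |u|) := by gcongr; exact (h u).2
      _ = _ := by ring
  have h2 : 0 ≤ Real.exp (‖s‖ * ‖γ.w 0‖) * Real.exp (‖s‖ * L * |u|) := by positivity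
  constructor
  · nlinarith
  · rw [norm_mul]
    calc _ ≤ Real.exp (‖s‖ * ‖γ.w 0‖) * Real.exp (‖s‖ * L * |u|) * L := by
          gcongr; exact (h u).1
      _ ≤ _ := by nlinarith

end LogPath

theorem tendsto_cos_neg {l : Filter ℝ} {f : ℝ → ℝ} {φ θ : ℝ} {a : ℕ} (hf : Tendsto f l (𝓝 φ))
    {η : ℝ} (hη : η < -Real.cos (θ + a * φ)) :
    ∀ᶠ u in l, Real.cos (θ + a * f u) ≤ -η := by
  have h1 : Tendsto (fun u => Real.cos (θ + a * f u)) l (𝓝 (Real.cos (θ + a * φ))) :=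
    (Real.continuous_cos.tendsto _).comp ((hf.const_mul (a : ℝ)).const_add θ)
  filter_upwards [h1.eventually (gt_mem_nhds (show Real.cos (θ + a * φ) < -η by linarith))]
    with u hu using hu.le

theorem exists_pos_lt_four {a b c d : ℝ} (ha : a < 0) (hb : b < 0) (hc : c < 0) (hd : d < 0) :
    ∃ η > 0, η < -a ∧ η < -b ∧ η < -c ∧ η < -d := by
  refine ⟨min (min (-a) (-b)) (min (-c) (-d)) / 2, ?_, ?_⟩
  · have : 0 < min (min (-a) (-b)) (min (-c) (-d)) := by
      simp only [lt_min_iff, neg_pos]; exact ⟨⟨ha, hb⟩, hc, hd⟩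
    linarith
  · have h1 := min_le_left (min (-a) (-b)) (min (-c) (-d))
    have h2 := min_le_right (min (-a) (-b)) (min (-c) (-d))
    have h3 := min_le_left (-a) (-b)
    have h4 := min_le_right (-a) (-b)
    have h5 := min_le_left (-c) (-d)
    have h6 := min_le_right (-c) (-d)
    have h7 : 0 < min (min (-a) (-b)) (min (-c) (-d)) := by
      simp only [lt_min_iff, neg_pos]; exact ⟨⟨ha, hb⟩, hc, hd⟩
    refine ⟨?_, ?_, ?_, ?_⟩ <;> linarith

/-! ### Admissible cycles satisfy the moment relations -/

section
variable {n : ℕ} {A : Fin (n + 2) → ℕ} {β : ℂ} {θ₁ θ₂ : ℝ}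

/-- Near both ends the cosines stay below a negative constant by continuity; the compact middle part
of the path is absorbed in the additive constant B. -/
theorem cycleData_path (hA : IsRow A) {γ : LogPath} {φ₁ φ₂ : ℝ}
    (h₁ : Tendsto (fun u => (γ.w u).im) atBot (𝓝 φ₁))
    (h₂ : Tendsto (fun u => (γ.w u).im) atTop (𝓝 φ₂))
    (hd₁ : Decays A θ₁ θ₂ φ₁) (hd₂ : Decays A θ₁ θ₂ φ₂) :
    CycleData A θ₁ θ₂ ((GeomCycle.path γ).weight β) (GeomCycle.path γ).param := by
  have hw := γ.continuous_w
  have hw' := γ.continuous_deriv_w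
  have hT : Continuous (GeomCycle.path γ).param := by
    show Continuous fun u => Complex.exp (γ.w u)
    fun_prop
  have hW : Continuous ((GeomCycle.path γ).weight β) := by
    show Continuous fun u => Complex.exp (-β * γ.w u) * deriv γ.w u
    fun_prop
  refine ⟨hT, hW.aestronglyMeasurable, ?_, ?_⟩
  · obtain ⟨η, hη, e1, e2, e3, e4⟩ := exists_pos_lt_four hd₁.1 hd₁.2 hd₂.1 hd₂.2
    have key : ∀ (a : ℕ) (θ : ℝ), η < -Real.cos (θ + a * φ₁) → η < -Real.cos (θ + a * φ₂) → ∃ B ≥ 0, ∀ u,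
        (Complex.exp (γ.w u) ^ a * Complex.exp (θ * Complex.I)).re +
          η * ‖Complex.exp (γ.w u)‖ ^ a ≤ B := by
      intro a θ g3 g4
      refine bounded_above_of_eventually (by fun_prop) ?_ ?_
      · filter_upwards [tendsto_cos_neg h₂ g4] with u hu
        rw [re_exp_pow]
        have : 0 ≤ ‖Complex.exp (γ.w u)‖ ^ a := by positivity
        nlinarith
      · filter_upwards [tendsto_cos_neg h₁ g3] with u hu
        rw [re_exp_pow]
        have : 0 ≤ ‖Complex.exp (γ.w u)‖ ^ a := by positivity
        nlinarith
    obtain ⟨B₁, hB₁, k1⟩ := key _ θ₁ e1 e3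
    obtain ⟨B₂, hB₂, k2⟩ := key _ θ₂ e2 e4
    refine ⟨η, hη, max B₁ B₂, le_max_of_le_left hB₁, fun u => ⟨?_, ?_⟩⟩
    · have := (k1 u).trans (le_max_left B₁ B₂)
      simp only [GeomCycle.param, pen]
      linarith
    · have := (k2 u).trans (le_max_right B₁ B₂)
      simp only [GeomCycle.param]
      linarith
  · intro j c hc
    obtain ⟨C, K, hCK⟩ := γ.norm_exp_le (-β)
    exact γ.integrable_weight hA.pos hW (fun u => (hCK u).2) j hc

theorem hasDerivAt_phase {m : ℕ} (B : Fin m → ℕ) (x : Fin m → ℂ) {T : ℝ → ℂ} {D : ℂ} {u : ℝ}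
    (hT : HasDerivAt T D u) : ∃ P, HasDerivAt (fun u => phase B x (T u)) P u ∧
      T u * P = D * ∑ i, (B i : ℂ) * x i * T u ^ B i := by
  have h1 : HasDerivAt (fun u => phase B x (T u))
      (∑ i, x i * ((B i : ℂ) * T u ^ (B i - 1) * D)) u := by
    unfold phase
    exact HasDerivAt.fun_sum fun i _ => (hT.pow (B i)).const_mul (x i)
  refine ⟨_, h1, ?_⟩
  rw [Finset.mul_sum, Finset.mul_sum]
  refine Finset.sum_congr rfl fun i _ => ?_
  rcases Nat.eq_zero_or_pos (B i) with h | h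
  · simp [h]
  · obtain ⟨e, he⟩ : ∃ e, B i = e + 1 := ⟨B i - 1, by omega⟩
    rw [he, Nat.add_sub_cancel, pow_succ]
    ring

/-- Analyticity and the derivatives in x are already known from `CycleData.integrable_mom`. What
depends on the kind of cycle is only that a certain total derivative integrates to zero. -/
theorem isMom_of_rel {W T : ℝ → ℂ} (h : CycleData A θ₁ θ₂ W T) (hA : IsRow A)
    {p : Fin (n + 1) → ℂ} {ρ : ℝ} (hρ : 0 < ρ)
    (hp : p (Fin.last n) = ρ * Complex.exp (θ₁ * Complex.I))
    (hrel : ∀ x : Fin (n + 1) → ℂ, (∃ c > 0, ∃ K > 0, ∀ u, ‖Complex.exp (phase (trunc A) x (T u))‖ ≤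
      K * Real.exp (-c * ‖T u‖ ^ pen A)) →
      (∀ j, Integrable fun u => W u * T u ^ j * Complex.exp (phase (trunc A) x (T u))) →
      ∀ j : ℕ, ∫ u, ((j - β) * (W u * T u ^ j * Complex.exp (phase (trunc A) x (T u))) +
        ∑ i : Fin (n + 1), (A i.castSucc : ℂ) * x i *
          (W u * T u ^ (j + A i.castSucc) * Complex.exp (phase (trunc A) x (T u)))) = 0) :
    IsMom A β Set.univ p (mom A W T) := by
  obtain ⟨r, hr, c, hc, K, hK, hb⟩ := h.integrable_mom hA hρ hp
  filter_upwards [Metric.ball_mem_nhds p hr] with x hx j _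
  obtain ⟨h1, h2, h3⟩ := hb x hx
  refine ⟨(h3 j).1, (h3 j).2, ?_⟩
  have := hrel x ⟨c, hc, K, hK, h1⟩ h2 j
  rw [integral_add ((h2 j).const_mul _) (integrable_finsetSum _ fun i _ => (h2 _).const_mul _),
    integral_const_mul, integral_finsetSum _ fun i _ => (h2 _).const_mul _] at this
  simp only [integral_const_mul] at this
  rw [add_comm]
  exact this

/-- The integrand is the derivative of t^(j-β) exp(∑ x_i t^(a_i)) along the path, and this function
is itself integrable, so there are no boundary terms. -/
theorem isMom_path (hA : IsRow A) {γ : LogPath}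
    (h : CycleData A θ₁ θ₂ ((GeomCycle.path γ).weight β) (GeomCycle.path γ).param)
    {p : Fin (n + 1) → ℂ} {ρ : ℝ} (hρ : 0 < ρ)
    (hp : p (Fin.last n) = ρ * Complex.exp (θ₁ * Complex.I)) :
    IsMom A β Set.univ p (cmom A β (GeomCycle.path γ)) := by
  refine isMom_of_rel h hA hρ hp fun x ⟨c, hc, K, hK, hb⟩ hi j => ?_
  have hw := γ.continuous_w
  refine integral_eq_zero_of_hasDerivAt_of_integrable
    (f := fun u => Complex.exp (-β * γ.w u) * Complex.exp (γ.w u) ^ j *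
      Complex.exp (phase (trunc A) x (Complex.exp (γ.w u)))) (fun u => ?_)
    (((hi j).const_mul _).add (integrable_finsetSum _ fun i _ => (hi _).const_mul _)) ?_
  · have hwd := γ.hasDerivAt_w u
    have hT : HasDerivAt (fun u => Complex.exp (γ.w u))
      (Complex.exp (γ.w u) * deriv γ.w u) u := hwd.cexp
    obtain ⟨P, hP, hPe⟩ := hasDerivAt_phase (trunc A) x hT
    have hP' : P = deriv γ.w u * ∑ i, (trunc A i : ℂ) * x i * Complex.exp (γ.w u) ^ trunc A i := by
      rw [mul_assoc] at hPe
      exact mul_left_cancel₀ (Complex.exp_ne_zero _) hPe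
    have hE : HasDerivAt (fun u => Complex.exp (-β * γ.w u) * Complex.exp (γ.w u) ^ j)
        ((j - β) * deriv γ.w u * (Complex.exp (-β * γ.w u) * Complex.exp (γ.w u) ^ j)) u := by
      have e : (fun u => Complex.exp (-β * γ.w u) * Complex.exp (γ.w u) ^ j) =
          fun u => Complex.exp ((j - β) * γ.w u) := by
        funext u
        rw [← Complex.exp_nat_mul, ← Complex.exp_add]
        ring_nf
      rw [e, congrFun e u]
      have := (hwd.const_mul ((j : ℂ) - β)).cexp
      convert! this using 1
      ring
    refine (hE.mul hP.cexp).congr_deriv ?_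
    rw [hP']
    simp only [GeomCycle.weight, GeomCycle.param, pow_add, trunc, Finset.mul_sum]
    congr 1
    · ring
    · exact Finset.sum_congr rfl fun i _ => by ring
  · obtain ⟨C, K', hCK⟩ := γ.norm_exp_le (-β)
    have hY : Continuous fun u => Complex.exp (-β * γ.w u) := by fun_prop
    refine Integrable.mono' ((γ.integrable_weight hA.pos hY (fun u => (hCK u).1) j hc).const_mul K)
      (Continuous.aestronglyMeasurable ?_) (Eventually.of_forall fun u => ?_)
    · have := (continuous_phase (trunc A) x).comp (Complex.continuous_exp.comp hw)
      exact (hY.mul ((Complex.continuous_exp.comp hw).pow j)).mul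
        (Complex.continuous_exp.comp this)
    · rw [norm_mul, norm_mul, norm_pow]
      calc _ ≤ ‖Complex.exp (-β * γ.w u)‖ * ‖Complex.exp (γ.w u)‖ ^ j *
            (K * Real.exp (-c * ‖Complex.exp (γ.w u)‖ ^ pen A)) := by gcongr; exact hb u
        _ = _ := by ring

/-- For a negative integer parameter the complex power is a natural power of t and the integral
converges at 0 without regularisation, so the half line fits into `CycleData`. -/
theorem weight_ray (N : ℕ) (φ : ℝ) : (GeomCycle.ray φ).weight (-(N + 1 : ℂ)) =
    Set.indicator (Set.Ioi (0 : ℝ)) fun u =>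
      ((Complex.exp (φ * Complex.I) * u) ^ N * Complex.exp (φ * Complex.I)) := by
  funext u
  simp only [GeomCycle.weight]
  congr 1
  funext r
  have : -(-(N + 1 : ℂ)) - 1 = (N : ℕ) := by ring
  rw [this, Complex.cpow_natCast]

theorem param_ray_of_pos (φ : ℝ) {u : ℝ} (hu : 0 < u) :
    (GeomCycle.ray φ).param u = Complex.exp (φ * Complex.I) * u := by
  simp [GeomCycle.param, max_eq_left hu.le]

theorem cycleData_ray (hA : IsRow A) (N : ℕ) {φ : ℝ} (hd : Decays A θ₁ θ₂ φ) :
    CycleData A θ₁ θ₂ ((GeomCycle.ray φ).weight (-(N + 1 : ℂ))) (GeomCycle.ray φ).param := by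
  have hT : Continuous (GeomCycle.ray φ).param := by
    show Continuous fun u => Complex.exp (φ * Complex.I) * (max u 0 : ℝ)
    fun_prop
  have hn : ∀ u, ‖(GeomCycle.ray φ).param u‖ = max u 0 := by
    intro u
    simp only [GeomCycle.param]
    rw [norm_mul, Complex.norm_exp_ofReal_mul_I, one_mul, Complex.norm_real,
      Real.norm_of_nonneg (le_max_right _ _)]
  refine ⟨hT, ?_, ?_, ?_⟩
  · rw [weight_ray]
    exact (Continuous.aestronglyMeasurable (by fun_prop)).indicator measurableSet_Ioi
  · obtain ⟨η, hη, e1, e2, -, -⟩ := exists_pos_lt_four hd.1 hd.2 hd.1 hd.2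
    have key : ∀ (a : ℕ) (θ : ℝ), η < -Real.cos (θ + a * φ) → ∀ u,
        ((GeomCycle.ray φ).param u ^ a * Complex.exp (θ * Complex.I)).re ≤
          -η * ‖(GeomCycle.ray φ).param u‖ ^ a + 0 := by
      intro a θ h u
      have h1 : (GeomCycle.ray φ).param u ^ a * Complex.exp (θ * Complex.I) =
          ((max u 0 ^ a : ℝ) : ℂ) * (Complex.exp (φ * Complex.I) ^ a *
            Complex.exp (θ * Complex.I)) := by
        simp only [GeomCycle.param]
        push_cast
        ring
      rw [h1, Complex.re_ofReal_mul, re_exp_pow, hn, Complex.norm_exp_ofReal_mul_I, one_pow,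
        one_mul]
      have h2 : ((φ : ℂ) * Complex.I).im = φ := by simp
      rw [h2]
      have : 0 ≤ max u 0 ^ a := by positivity
      nlinarith
    exact ⟨η, hη, 0, le_rfl, fun u => ⟨key _ _ e1 u, key _ _ e2 u⟩⟩
  · intro j c hc
    have h1 : (fun u => ‖(GeomCycle.ray φ).weight (-(N + 1 : ℂ)) u‖ *
        ‖(GeomCycle.ray φ).param u‖ ^ j * Real.exp (-c * ‖(GeomCycle.ray φ).param u‖ ^ pen A)) =
        Set.indicator (Set.Ioi 0) fun u : ℝ => u ^ ((N + j : ℕ) : ℝ) *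
          Real.exp (-c * u ^ ((pen A : ℕ) : ℝ)) := by
      funext u
      rw [weight_ray]
      by_cases hu : u ∈ Set.Ioi (0 : ℝ)
      · rw [Set.indicator_of_mem hu, Set.indicator_of_mem hu, hn, max_eq_left (le_of_lt hu),
          norm_mul, norm_pow, norm_mul, Complex.norm_exp_ofReal_mul_I, one_mul, mul_one,
          Complex.norm_real, Real.norm_of_nonneg (le_of_lt hu), Real.rpow_natCast,
          Real.rpow_natCast, pow_add]
      · rw [Set.indicator_of_notMem hu, Set.indicator_of_notMem hu]
        simp
    rw [h1, integrable_indicator_iff measurableSet_Ioi]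
    exact integrableOn_rpow_mul_exp_neg_mul_rpow (by
      have : (0 : ℝ) ≤ ((N + j : ℕ) : ℝ) := Nat.cast_nonneg _
      linarith) (by exact_mod_cast hA.pos) hc

/-- As for paths, a total derivative is integrated; the boundary value at 0 vanishes because the
primitive carries the factor t^(N+1+j). -/
theorem isMom_ray (hA : IsRow A) (N : ℕ) {φ : ℝ} (hd : Decays A θ₁ θ₂ φ)
    {p : Fin (n + 1) → ℂ} {ρ : ℝ} (hρ : 0 < ρ)
    (hp : p (Fin.last n) = ρ * Complex.exp (θ₁ * Complex.I)) :
    IsMom A (-(N + 1 : ℂ)) Set.univ p (cmom A (-(N + 1 : ℂ)) (GeomCycle.ray φ)) := by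
  have h := cycleData_ray hA N hd
  refine isMom_of_rel h hA hρ hp fun x ⟨c, hc, K, hK, hb⟩ hi j => ?_
  set e := Complex.exp (φ * Complex.I) with he
  set f : ℝ → ℂ := fun u => (e * u) ^ (N + 1 + j) * Complex.exp (phase (trunc A) x (e * u)) with hf
  set g : ℝ → ℂ := fun u => (j - -(N + 1 : ℂ)) * ((e * u) ^ N * e * (e * u) ^ j *
      Complex.exp (phase (trunc A) x (e * u))) + ∑ i : Fin (n + 1), (A i.castSucc : ℂ) * x i *
      ((e * u) ^ N * e * (e * u) ^ (j + A i.castSucc) *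
        Complex.exp (phase (trunc A) x (e * u))) with hg
  have hgi : (fun u => (j - -(N + 1 : ℂ)) * ((GeomCycle.ray φ).weight (-(N + 1 : ℂ)) u *
      (GeomCycle.ray φ).param u ^ j *
      Complex.exp (phase (trunc A) x ((GeomCycle.ray φ).param u))) +
      ∑ i : Fin (n + 1), (A i.castSucc : ℂ) * x i *
        ((GeomCycle.ray φ).weight (-(N + 1 : ℂ)) u *
        (GeomCycle.ray φ).param u ^ (j + A i.castSucc) *
        Complex.exp (phase (trunc A) x ((GeomCycle.ray φ).param u)))) =
      Set.indicator (Set.Ioi 0) g := by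
    funext u
    by_cases hu : u ∈ Set.Ioi (0 : ℝ)
    · rw [Set.indicator_of_mem hu, weight_ray, Set.indicator_of_mem hu, param_ray_of_pos φ hu]
    · rw [Set.indicator_of_notMem hu, weight_ray, Set.indicator_of_notMem hu]
      simp
  have hgint : Integrable (Set.indicator (Set.Ioi 0) g) := by
    rw [← hgi]
    exact ((hi j).const_mul _).add (integrable_finsetSum _ fun i _ => (hi _).const_mul _)
  rw [hgi, integral_indicator measurableSet_Ioi]
  rw [integrable_indicator_iff measurableSet_Ioi] at hgint
  have hder : ∀ u ∈ Set.Ici (0 : ℝ), HasDerivAt f (g u) u := by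
    intro u _
    have hT : HasDerivAt (fun u : ℝ => e * (u : ℂ)) e u := by
      simpa using (Complex.ofRealCLM.hasDerivAt (x := u)).const_mul e
    obtain ⟨P, hP, hPe⟩ := hasDerivAt_phase (trunc A) x hT
    refine ((hT.pow (N + 1 + j)).mul hP.cexp).congr_deriv ?_
    have h1 : (e * (u : ℂ)) ^ (N + 1 + j) * (Complex.exp (phase (trunc A) x (e * u)) * P) =
        (e * u) ^ (N + j) * Complex.exp (phase (trunc A) x (e * u)) * (e * u * P) := by ring
    have h2 : N + 1 + j - 1 = N + j := by omega
    simp only [Pi.pow_apply]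
    rw [h1, hPe, h2, hg]
    simp only [pow_add, trunc, Finset.mul_sum]
    push_cast
    congr 1
    · ring
    · exact Finset.sum_congr rfl fun i _ => by ring
  have hfint : IntegrableOn f (Set.Ioi 0) := by
    have h1 : Integrable (fun u => (GeomCycle.ray φ).weight (-(N + 1 : ℂ)) u *
        (GeomCycle.ray φ).param u ^ (j + 1) *
        Complex.exp (phase (trunc A) x ((GeomCycle.ray φ).param u)) * e⁻¹) := (hi (j + 1)).mul_const _
    have h2 := h1.integrableOn (s := Set.Ioi 0)
    refine h2.congr_fun (fun u hu => ?_) measurableSet_Ioi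
    dsimp only
    rw [weight_ray, Set.indicator_of_mem hu, param_ray_of_pos φ hu, hf, ← he]
    have : e ≠ 0 := Complex.exp_ne_zero _
    field_simp
    ring
  rw [integral_Ioi_of_hasDerivAt_of_tendsto' hder hgint
    (tendsto_zero_of_hasDerivAt_of_integrableOn_Ioi (fun u hu => hder u (Set.Ioi_subset_Ici_self hu)) hgint hfint)]
  simp [hf]

theorem integrand_path (γ : LogPath) (y : Fin (n + 2) → ℂ) (u : ℝ) :
    (GeomCycle.path γ).integrand A β y u = (GeomCycle.path γ).weight β u *
      Complex.exp (phase A y ((GeomCycle.path γ).param u)) := by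
  simp only [GeomCycle.integrand, GeomCycle.weight, GeomCycle.param]
  ring

theorem integrand_ray (N : ℕ) (φ : ℝ) (y : Fin (n + 2) → ℂ) (u : ℝ) :
    (GeomCycle.ray φ).integrand A (-(N + 1 : ℂ)) y u =
      (GeomCycle.ray φ).weight (-(N + 1 : ℂ)) u *
      Complex.exp (phase A y ((GeomCycle.ray φ).param u)) := by
  by_cases hu : u ∈ Set.Ioi (0 : ℝ)
  · simp only [GeomCycle.integrand, GeomCycle.weight, Set.indicator_of_mem hu,
      param_ray_of_pos φ hu]
    have h1 : taylorPoly A (-(N + 1 : ℂ)).re y (Complex.exp (φ * Complex.I) * u) = 0 := by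
      rw [taylorPoly, Finset.filter_false_of_mem, Finset.sum_empty]
      intro l _ hl
      have h2 : (0 : ℝ) ≤ ((∑ j, A j * l j : ℕ) : ℝ) := Nat.cast_nonneg _
      have h3 : (-(N + 1 : ℂ)).re = -(N + 1 : ℝ) := by simp
      rw [h3] at hl
      have h4 : (0 : ℝ) ≤ N := Nat.cast_nonneg _
      linarith
    rw [h1]
    ring
  · simp [GeomCycle.integrand, GeomCycle.weight, Set.indicator_of_notMem hu]

/-- The expansions of the integrals along admissible cycles; half lines are allowed for negative
integers `β`. -/
theorem hasExpansion_cmom (hA : IsRow A) {c : GeomCycle} (hc : Admissible A β θ₁ θ₂ c)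
    (hneg : ∀ φ, c = GeomCycle.ray φ → ∃ N : ℕ, β = -(N + 1 : ℂ))
    {p : Fin (n + 1) → ℂ} {ρ : ℝ} (hρ : 0 < ρ)
    (hp : p (Fin.last n) = ρ * Complex.exp (θ₁ * Complex.I)) :
    ∃ hM : IsMom A β Set.univ p (cmom A β c), HasGrowth (pen A) Set.univ p (cmom A β c) ∧
      HasExpansion A β θ₂ (Finsupp.single c 1) (momGerm hM (isStable_univ A)) := by
  cases c with
  | path γ =>
    obtain ⟨φ₁, φ₂, h1, h2, h3, h4⟩ := hc
    have h := cycleData_path (β := β) hA h1 h2 h3 h4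
    exact ⟨isMom_path hA h hρ hp, h.hasGrowth hA hρ hp,
      h.hasExpansion hA hρ hp (integrand_path γ) _ _⟩
  | ray φ =>
    obtain ⟨N, rfl⟩ := hneg φ rfl
    have h := cycleData_ray hA N hc.2
    exact ⟨isMom_ray hA N hc.2 hρ hp, h.hasGrowth hA hρ hp,
      h.hasExpansion hA hρ hp (integrand_ray N φ) _ _⟩

end

end Hypergeo

namespace Hypergeo

/-! ### Linearity and uniqueness of expansions -/

section
variable {n : ℕ} {A : Fin (n + 1) → ℕ} {β : ℂ} {θ : ℝ} {p : Fin n → ℂ}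

theorem cycleIntegral_add (C C' : GeomCycle →₀ ℂ) (x : Fin (n + 1) → ℂ) :
    cycleIntegral A β (C + C') x = cycleIntegral A β C x + cycleIntegral A β C' x := by
  classical
  exact Finsupp.sum_add_index' (fun _ => zero_mul _) fun _ _ _ => add_mul _ _ _

theorem cycleIntegral_smul (a : ℂ) (C : GeomCycle →₀ ℂ) (x : Fin (n + 1) → ℂ) :
    cycleIntegral A β (a • C) x = a * cycleIntegral A β C x := by
  rw [cycleIntegral, Finsupp.sum_smul_index' fun _ => zero_mul _, cycleIntegral, Finsupp.mul_sum]
  simp only [smul_eq_mul, mul_assoc]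

theorem sector_mono {δ δ' ρ ρ' : ℝ} (hδ : δ ≤ δ') (hρ : ρ ≤ ρ') :
    sector θ δ ρ ⊆ sector θ δ' ρ' :=
  fun _ h => ⟨h.1, h.2.1.trans_le hρ, h.2.2.trans_le hδ⟩

theorem HasExpansion.add {C C' : GeomCycle →₀ ℂ} {Φ Φ' : HolGerm p}
    (h : HasExpansion A β θ C Φ) (h' : HasExpansion A β θ C' Φ') :
    HasExpansion A β θ (C + C') (Φ + Φ') := by
  classical
  obtain ⟨ρ, hρ, δ, hδ, h1, h2, f, hf, h3⟩ := h
  obtain ⟨ρ', hρ', δ', hδ', h1', h2', f', hf', h3'⟩ := h'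
  have b1 := Metric.ball_subset_ball (x := p) (min_le_left ρ ρ')
  have b2 := Metric.ball_subset_ball (x := p) (min_le_right ρ ρ')
  have s1 := sector_mono (θ := θ) (min_le_left δ δ') (min_le_left ρ ρ')
  have s2 := sector_mono (θ := θ) (min_le_right δ δ') (min_le_right ρ ρ')
  refine ⟨min ρ ρ', lt_min hρ hρ', min δ δ', lt_min hδ hδ', ?_, ?_, f + f', ?_, fun N => ?_⟩
  · intro x hx z hz c hc
    rcases Finset.mem_union.1 (Finsupp.support_add hc) with hc | hc
    · exact h1 x (b1 hx) z (s1 hz) c hc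
    · exact h1' x (b2 hx) z (s2 hz) c hc
  · simp only [cycleIntegral_add]
    exact (h2.mono (Set.prod_mono b1 s1)).add (h2'.mono (Set.prod_mono b2 s2))
  · rw [Submodule.coe_add, ← hf, ← hf']; rfl
  · obtain ⟨K, hK⟩ := h3 N
    obtain ⟨K', hK'⟩ := h3' N
    refine ⟨K + K', fun x hx z hz => ?_⟩
    have e : cycleIntegral A β (C + C') (Fin.snoc x z : Fin (n + 1) → ℂ) -
        ∑ m ∈ Finset.range N, (f + f') x m * z ^ m =
        (cycleIntegral A β C (Fin.snoc x z : Fin (n + 1) → ℂ) -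
          ∑ m ∈ Finset.range N, f x m * z ^ m) +
        (cycleIntegral A β C' (Fin.snoc x z : Fin (n + 1) → ℂ) -
          ∑ m ∈ Finset.range N, f' x m * z ^ m) := by
      rw [cycleIntegral_add]
      simp only [Pi.add_apply, add_mul, Finset.sum_add_distrib]
      ring
    rw [e, add_mul]
    exact (norm_add_le _ _).trans (add_le_add (hK x (b1 hx) z (s1 hz)) (hK' x (b2 hx) z (s2 hz)))

theorem HasExpansion.smul {C : GeomCycle →₀ ℂ} {Φ : HolGerm p} (a : ℂ)
    (h : HasExpansion A β θ C Φ) : HasExpansion A β θ (a • C) (a • Φ) := by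
  obtain ⟨ρ, hρ, δ, hδ, h1, h2, f, hf, h3⟩ := h
  refine ⟨ρ, hρ, δ, hδ, fun x hx z hz c hc => h1 x hx z hz c (Finsupp.support_smul hc), ?_,
    a • f, by rw [Submodule.coe_smul, ← hf]; rfl, fun N => ?_⟩
  · simp only [cycleIntegral_smul]
    exact h2.const_mul a
  · obtain ⟨K, hK⟩ := h3 N
    refine ⟨‖a‖ * K, fun x hx z hz => ?_⟩
    have e : cycleIntegral A β (a • C) (Fin.snoc x z : Fin (n + 1) → ℂ) -
        ∑ m ∈ Finset.range N, (a • f) x m * z ^ m =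
        a * (cycleIntegral A β C (Fin.snoc x z : Fin (n + 1) → ℂ) -
          ∑ m ∈ Finset.range N, f x m * z ^ m) := by
      rw [cycleIntegral_smul, mul_sub, Finset.mul_sum]
      congr 1
      exact Finset.sum_congr rfl fun m _ => by simp [mul_assoc]
    rw [e, norm_mul, mul_assoc]
    exact mul_le_mul_of_nonneg_left (hK x hx z hz) (norm_nonneg _)

theorem HasExpansion.zero : HasExpansion A β θ 0 (0 : HolGerm p) := by
  have e : ∀ x, cycleIntegral A β (0 : GeomCycle →₀ ℂ) x = 0 := fun x => Finsupp.sum_zero_index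
  refine ⟨1, one_pos, 1, one_pos, by simp, ?_, 0, rfl, fun N => ⟨0, by simp [e]⟩⟩
  simp only [e]
  exact differentiableOn_const 0

theorem HasExpansion.sum {ι : Type*} (s : Finset ι) {a : ι → ℂ} {C : ι → GeomCycle →₀ ℂ}
    {Φ : ι → HolGerm p} (h : ∀ i ∈ s, HasExpansion A β θ (C i) (Φ i)) :
    HasExpansion A β θ (∑ i ∈ s, a i • C i) (∑ i ∈ s, a i • Φ i) := by
  induction s using Finset.cons_induction with
  | empty => exact HasExpansion.zero
  | cons i s hi ih =>
    rw [Finset.sum_cons, Finset.sum_cons]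
    exact ((h i (Finset.mem_cons_self i s)).smul _).add
      (ih fun j hj => h j (Finset.mem_cons.2 (Or.inr hj)))

theorem mem_sector_ray {δ ρ t : ℝ} (hδ : 0 < δ) (ht : 0 < t) (htρ : t < ρ) :
    (t * Complex.exp (θ * Complex.I) : ℂ) ∈ sector θ δ ρ := by
  refine ⟨mul_ne_zero (by exact_mod_cast ht.ne') (Complex.exp_ne_zero _), ?_, ?_⟩
  · rw [norm_mul, Complex.norm_exp_ofReal_mul_I, mul_one, Complex.norm_real,
      Real.norm_of_nonneg ht.le]
    exact htρ
  · rw [mul_assoc, ← Complex.exp_add, add_neg_cancel, Complex.exp_zero, mul_one,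
      Complex.arg_ofReal_of_nonneg ht.le, abs_zero]
    exact hδ

/-- Induction on m: if the earlier coefficients agree, the expansions to order m + 1 bound |f_m -
f'_m| by (K + K')|z|; let z → 0 on the central ray of the sector. -/
theorem HasExpansion.unique {C : GeomCycle →₀ ℂ} {Φ Φ' : HolGerm p}
    (h : HasExpansion A β θ C Φ) (h' : HasExpansion A β θ C Φ') : Φ = Φ' := by
  obtain ⟨ρ, hρ, δ, hδ, -, -, f, hf, h3⟩ := h
  obtain ⟨ρ', hρ', δ', hδ', -, -, f', hf', h3'⟩ := h'
  refine Subtype.ext ?_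
  rw [← hf, ← hf']
  refine Germ.coe_eq.2 ?_
  filter_upwards [Metric.ball_mem_nhds p (lt_min hρ hρ')] with x hx
  funext m
  induction m using Nat.strong_induction_on with
  | _ m ih =>
    obtain ⟨K, hK⟩ := h3 (m + 1)
    obtain ⟨K', hK'⟩ := h3' (m + 1)
    have key : ∀ t : ℝ, 0 < t → t < min ρ ρ' → ‖f x m - f' x m‖ ≤ (K + K') * t := by
      intro t ht htρ
      set z : ℂ := t * Complex.exp (θ * Complex.I) with hz
      have hzn : ‖z‖ = t := by
        rw [hz, norm_mul, Complex.norm_exp_ofReal_mul_I, mul_one, Complex.norm_real,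
          Real.norm_of_nonneg ht.le]
      have h1 := hK x (Metric.ball_subset_ball (min_le_left _ _) hx) z
        (mem_sector_ray hδ ht (htρ.trans_le (min_le_left _ _)))
      have h2 := hK' x (Metric.ball_subset_ball (min_le_right _ _) hx) z
        (mem_sector_ray hδ' ht (htρ.trans_le (min_le_right _ _)))
      have e1 : ∑ i ∈ Finset.range m, f x i * z ^ i = ∑ i ∈ Finset.range m, f' x i * z ^ i :=
        Finset.sum_congr rfl fun i hi => by rw [ih i (Finset.mem_range.1 hi)]
      have e2 := norm_sub_le_of_le h2 h1
      rw [Finset.sum_range_succ, Finset.sum_range_succ, e1, hzn] at e2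
      have e3 : ∀ a b c d : ℂ, a - (b + c * z ^ m) - (a - (b + d * z ^ m)) = (d - c) * z ^ m :=
        fun a b c d => by ring
      rw [e3, norm_mul, norm_pow, hzn, ← add_mul, pow_succ, ← mul_assoc, mul_right_comm] at e2
      rw [add_comm K K']
      exact le_of_mul_le_mul_right e2 (by positivity)
    have hlim : Tendsto (fun t : ℝ => (K + K') * t) (𝓝[>] 0) (𝓝 0) := by
      have : Tendsto (fun t : ℝ => (K + K') * t) (𝓝 0) (𝓝 ((K + K') * 0)) :=
        (continuous_const.mul continuous_id).tendsto 0
      rw [mul_zero] at this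
      exact this.mono_left nhdsWithin_le_nhds
    have h0 : ‖f x m - f' x m‖ ≤ 0 := by
      refine ge_of_tendsto hlim ?_
      filter_upwards [Ioo_mem_nhdsGT (lt_min hρ hρ')] with t ht using key t ht.1 ht.2
    exact sub_eq_zero.1 (norm_le_zero_iff.1 h0)

end

end Hypergeo

namespace Hypergeo

/-! ### Combinations of cycles and their moments -/

/-- `M` is the sequence of moments of `C`, at all points over the half line of argument `θ₁`. -/
def HasMoments {n : ℕ} (A : Fin (n + 2) → ℕ) (β : ℂ) (θ₁ θ₂ : ℝ) (C : GeomCycle →₀ ℂ)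
    (M : ℕ → (Fin (n + 1) → ℂ) → ℂ) : Prop :=
  ∀ (p : Fin (n + 1) → ℂ) (ρ : ℝ), 0 < ρ → p (Fin.last n) = ρ * Complex.exp (θ₁ * Complex.I) →
    ∃ hM : IsMom A β Set.univ p M, HasGrowth (pen A) Set.univ p M ∧
      HasExpansion A β θ₂ C (momGerm hM (isStable_univ A))

theorem HasGrowth.sum {n a : ℕ} {S : Set ℕ} {p : Fin n → ℂ} {ι : Type*} (s : Finset ι) (c : ι → ℂ)
    {M : ι → ℕ → (Fin n → ℂ) → ℂ} (h : ∀ i ∈ s, HasGrowth a S p (M i)) :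
    HasGrowth a S p fun j x => ∑ i ∈ s, c i * M i j x := by
  induction s using Finset.cons_induction with
  | empty => exact ⟨0, 1, le_rfl, le_rfl, Eventually.of_forall fun x j _ => by simp⟩
  | cons i s hi ih =>
    obtain ⟨C, K, hC, hK, h1⟩ := h i (Finset.mem_cons_self i s)
    obtain ⟨C', K', hC', hK', h2⟩ := ih fun j hj => h j (Finset.mem_cons.2 (Or.inr hj))
    refine ⟨‖c i‖ * C + C', max K K', by positivity, hK.trans (le_max_left _ _), ?_⟩
    filter_upwards [h1, h2] with x h1 h2 j hj
    rw [Finset.sum_cons]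
    refine (norm_add_le _ _).trans ?_
    rw [norm_mul, add_mul, add_mul]
    refine add_le_add ?_ ((h2 j hj).trans ?_)
    · rw [mul_assoc, mul_assoc]
      refine mul_le_mul_of_nonneg_left ((h1 j hj).trans ?_) (norm_nonneg _)
      rw [mul_assoc]
      gcongr
      exact le_max_left _ _
    · gcongr
      exact le_max_right _ _

theorem momGerm_sum {n : ℕ} {A : Fin (n + 1) → ℕ} {β : ℂ} {p : Fin n → ℂ} {ι : Type*}
    (s : Finset ι) (c : ι → ℂ) {M : ι → ℕ → (Fin n → ℂ) → ℂ} {S : Set ℕ} (hS : IsStable A S)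
    (h : ∀ i, IsMom A β S p (M i)) :
    momGerm (IsMom.sum s c fun i _ => h i) hS = ∑ i ∈ s, c i • momGerm (h i) hS := by
  have e : ∀ s : Finset ι, (((∑ i ∈ s, c i • momGerm (h i) hS : HolGerm p)) :
      Germ (𝓝 p) (ℕ → ℂ)) =
      ((∑ i ∈ s, c i • momSer (A (Fin.last n)) (M i) : (Fin n → ℂ) → ℕ → ℂ) :
        Germ (𝓝 p) (ℕ → ℂ)) := by
    intro s
    induction s using Finset.cons_induction with
    | empty => rfl
    | cons i s hi ih =>
      rw [Finset.sum_cons, Submodule.coe_add, ih, Finset.sum_cons]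
      rfl
  refine Subtype.ext ?_
  rw [e]
  refine Germ.coe_eq.2 (Eventually.of_forall fun x => funext fun m => ?_)
  simp only [momSer, Finset.sum_apply, Pi.smul_apply, smul_eq_mul, Finset.sum_div, mul_div_assoc]

section
variable {n : ℕ} {A : Fin (n + 2) → ℕ} {β : ℂ} {θ₁ θ₂ : ℝ}

theorem HasMoments.sum {ι : Type*} (s : Finset ι) (c : ι → ℂ) {C : ι → GeomCycle →₀ ℂ}
    {M : ι → ℕ → (Fin (n + 1) → ℂ) → ℂ} (h : ∀ i, HasMoments A β θ₁ θ₂ (C i) (M i)) :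
    HasMoments A β θ₁ θ₂ (∑ i ∈ s, c i • C i) (fun j x => ∑ i ∈ s, c i * M i j x) := by
  intro p ρ hρ hp
  choose hM hg hE using fun i => h i p ρ hρ hp
  refine ⟨IsMom.sum s c fun i _ => hM i, HasGrowth.sum s c fun i _ => hg i, ?_⟩
  rw [momGerm_sum s c _ hM]
  exact HasExpansion.sum s fun i _ => hE i

theorem hasMoments_cmom (hA : IsRow A) {c : GeomCycle} (hc : Admissible A β θ₁ θ₂ c)
    (hneg : ∀ φ, c = GeomCycle.ray φ → ∃ N : ℕ, β = -(N + 1 : ℂ)) :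
    HasMoments A β θ₁ θ₂ (Finsupp.single c 1) (cmom A β c) :=
  fun _ _ hρ hp => hasExpansion_cmom hA hc hneg hρ hp

end

theorem isRow_two {a b : ℕ} (ha : 1 ≤ a) (hab : a < b) : IsRow ![a, b] :=
  ⟨ha, fun i => i.elim0, hab⟩

theorem isRow_three {a b k : ℕ} (hab : a < b) (hk : 1 ≤ k) (hka : 1 < k * a) :
    IsRow ![1, k * a, k * b] :=
  ⟨hka.le, fun i => by fin_cases i; exact hka, Nat.mul_lt_mul_of_pos_left hab hk⟩

end Hypergeo

namespace Hypergeo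

/-! ### Lifted families -/

/-- The cycles `γt` for `(1, ka, kb)` lift the cycles `γ` for `(a, b)`, outside of a set `B` with at
most one element, where their expansions are in the kernel of `varpi`. -/
structure IsLift (a b k : ℕ) (β : ℂ) (θ₁ θ₂ : ℝ) (γ : Fin a → Fin k → GeomCycle)
    (γt : Fin a → Fin k → (GeomCycle →₀ ℂ)) (B : Fin a × Fin k → Prop) : Prop where
  moments : ∀ τ r, ∃ M, HasMoments ![1, k * a, k * b] β θ₁ θ₂ (γt τ r) M
  good : ∀ ρ : ℝ, 0 < ρ → ∀ (τ : Fin a) (r : Fin k), ¬ B (τ, r) → ∀ (Φ : HolGerm (pt θ₁ ρ))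
    (Φt : HolGerm (Fin.cons 0 (pt θ₁ ρ) : Fin 2 → ℂ)),
    HasExpansion ![a, b] ((β - (r : ℕ)) / k) θ₂ (Finsupp.single (γ τ r) 1) Φ →
    HasExpansion ![1, k * a, k * b] β θ₂ (γt τ r) Φt →
    varpi k (pt θ₁ ρ) Φt = Pi.single r ((1 / (k : ℂ)) • Φ)
  bad : ∀ ρ : ℝ, 0 < ρ → ∀ (τ : Fin a) (r : Fin k), B (τ, r) →
    ∀ Φt : HolGerm (Fin.cons 0 (pt θ₁ ρ) : Fin 2 → ℂ),
    HasExpansion ![1, k * a, k * b] β θ₂ (γt τ r) Φt → varpi k (pt θ₁ ρ) Φt = 0 ∧ Φt ≠ 0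
  subsingleton : ∀ i j, B i → B j → i = j

theorem pt_ne_zero {θ ρ : ℝ} (hρ : 0 < ρ) (i : Fin 1) : pt θ ρ i ≠ 0 :=
  mul_ne_zero (by exact_mod_cast hρ.ne') (Complex.exp_ne_zero _)

theorem linearIndependent_single_family {R ι κ V : Type*} [Ring R] [AddCommGroup V] [Module R V]
    [Fintype ι] [Fintype κ] [DecidableEq κ] {Φ : ι → κ → V}
    (h : ∀ r, LinearIndependent R fun τ => Φ τ r) :
    LinearIndependent R fun i : ι × κ => (Pi.single i.2 (Φ i.1 i.2) : κ → V) := by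
  rw [Fintype.linearIndependent_iff]
  intro g hg ⟨τ, r⟩
  have h1 := Fintype.linearIndependent_iff.1 (h r) (fun τ => g (τ, r)) ?_ τ
  · exact h1
  have h2 := congrFun hg r
  rw [Fintype.sum_prod_type, Finset.sum_apply] at h2
  refine Eq.trans (Finset.sum_congr rfl fun τ _ => ?_) h2
  rw [Finset.sum_apply, Finset.sum_eq_single r]
  · simp
  · intro r' _ hr'
    simp [Pi.single_eq_of_ne hr'.symm]
  · simp

/-! ### Consequences of a lift: bases of solutions and the image of ϖ_β -/

section
variable {a b k : ℕ} {β : ℂ} {θ₁ θ₂ : ℝ} {γ : Fin a → Fin k → GeomCycle}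
  {γt : Fin a → Fin k → (GeomCycle →₀ ℂ)} {B : Fin a × Fin k → Prop}

theorem IsBasicFamily.exists_expansions (hγ : IsBasicFamily a b k β θ₁ θ₂ γ) {ρ : ℝ} (hρ : 0 < ρ) :
    ∃ Φ : Fin a → Fin k → HolGerm (pt θ₁ ρ), (∀ (τ : Fin a) (r : Fin k),
      HasExpansion ![a, b] ((β - (r : ℕ)) / k) θ₂ (Finsupp.single (γ τ r) 1) (Φ τ r)) ∧
      (∀ r, LinearIndependent ℂ fun τ => Φ τ r) ∧
      ∀ r : Fin k, Submodule.span ℂ (Set.range fun τ => Φ τ r) =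
        Sol ![a, b] ((β - (r : ℕ)) / k) (b / a) (pt θ₁ ρ) := by
  choose Φ h1 h2 h3 using hγ.2.2 ρ hρ
  exact ⟨fun τ r => Φ r τ, fun τ r => h1 r τ, h2, h3⟩

/-- Apply ϖ to a relation: the exceptional term disappears, and the others become multiples by 1/k
of independent vectors, so their coefficients vanish. The exceptional expansion alone is left, and
it is not zero. -/
theorem IsLift.linearIndependent_zero (h : IsLift a b k β θ₁ θ₂ γ γt B)
    (hγ : IsBasicFamily a b k β θ₁ θ₂ γ) (hk : 1 ≤ k) {ρ : ℝ} (hρ : 0 < ρ)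
    {Φt : Fin a × Fin k → HolGerm (Fin.cons 0 (pt θ₁ ρ) : Fin 2 → ℂ)}
    (hΦt : ∀ i, HasExpansion ![1, k * a, k * b] β θ₂ (γt i.1 i.2) (Φt i)) :
    LinearIndependent ℂ Φt := by
  obtain ⟨Φ, hΦ, hli, -⟩ := hγ.exists_expansions hρ
  have hk0 : (1 / (k : ℂ)) ≠ 0 := one_div_ne_zero (by exact_mod_cast (by omega : k ≠ 0))
  have hs := linearIndependent_single_family hli
  rw [Fintype.linearIndependent_iff] at hs ⊢
  intro g hg
  have hgood : ∀ i, ¬ B i → g i = 0 := by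
    classical
    have h1 := hs (fun i => if B i then 0 else g i * (1 / (k : ℂ))) ?_
    · intro i hi
      have := h1 i
      rw [if_neg hi] at this
      exact (mul_eq_zero.1 this).resolve_right hk0
    · have h2 := congrArg (varpi k (pt θ₁ ρ)) hg
      rw [map_sum, map_zero] at h2
      rw [← h2]
      refine Finset.sum_congr rfl fun i _ => ?_
      rw [map_smul]
      by_cases hi : B i
      · rw [if_pos hi, (h.bad ρ hρ i.1 i.2 hi _ (hΦt i)).1, zero_smul, smul_zero]
      · rw [if_neg hi, h.good ρ hρ i.1 i.2 hi _ _ (hΦ i.1 i.2) (hΦt i), mul_smul,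
          ← Pi.single_smul]
  intro i
  by_cases hi : B i
  · rw [Finset.sum_eq_single i (fun j _ hj => by
      rw [hgood j fun hB => hj (h.subsingleton _ _ hB hi), zero_smul]) (by simp)] at hg
    exact (smul_eq_zero.1 hg).resolve_right (h.bad ρ hρ i.1 i.2 hi _ (hΦt i)).2
  · exact hgood i hi

/-- The moments of a combination are the same functions at all base points. If the germ of the
combination vanishes at one x_0, its moments vanish there, hence, transported along the segment,
also at x_0 = 0, where independence is known. -/
theorem IsLift.linearIndependent (h : IsLift a b k β θ₁ θ₂ γ γt B)
    (hγ : IsBasicFamily a b k β θ₁ θ₂ γ) (hk : 1 ≤ k) (hka : 1 < k * a) {ρ : ℝ} (hρ : 0 < ρ)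
    {x₀ : ℂ} {Φt : Fin a × Fin k → HolGerm (Fin.cons x₀ (pt θ₁ ρ) : Fin 2 → ℂ)}
    (hΦt : ∀ i, HasExpansion ![1, k * a, k * b] β θ₂ (γt i.1 i.2) (Φt i)) :
    LinearIndependent ℂ Φt := by
  choose M hM using fun i : Fin a × Fin k => h.moments i.1 i.2
  choose hX _ hE using fun (x : ℂ) (i : Fin a × Fin k) =>
    hM i (Fin.cons x (pt θ₁ ρ) : Fin 2 → ℂ) ρ hρ rfl
  rw [Fintype.linearIndependent_iff]
  intro g hg
  have hli := h.linearIndependent_zero hγ hk hρ (hE 0)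
  rw [Fintype.linearIndependent_iff] at hli
  refine hli g ?_
  rw [← momGerm_sum Finset.univ g (isStable_univ _) (hX 0)]
  have hsum : ∀ x, IsMom ![1, k * a, k * b] β Set.univ (Fin.cons x (pt θ₁ ρ) : Fin 2 → ℂ)
      (fun j y => ∑ i, g i * M i j y) := fun x => IsMom.sum Finset.univ g fun i _ => hX x i
  have hzero : momGerm (hsum x₀) (isStable_univ _) = 0 := by
    rw [momGerm_sum Finset.univ g (isStable_univ _) (hX x₀), ← hg]
    exact Finset.sum_congr rfl fun i _ => by rw [(hE x₀ i).unique (hΦt i)]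
  refine momGerm_eq_zero_of_lt hka _ (pt_ne_zero hρ 0) fun j _ => ?_
  have hseg : ∀ t : ℝ, (Fin.cons x₀ (pt θ₁ ρ) : Fin 2 → ℂ) + (t : ℂ) •
      ((Fin.cons 0 (pt θ₁ ρ) : Fin 2 → ℂ) - Fin.cons x₀ (pt θ₁ ρ)) =
      Fin.cons (x₀ + t * (0 - x₀)) (pt θ₁ ρ) := by
    intro t
    funext i
    refine Fin.cases ?_ (fun i => ?_) i <;> simp
  refine mom_eq_zero_of_segment hka (β := β) (M := fun j y => ∑ i, g i * M i j y)
    (p := Fin.cons x₀ (pt θ₁ ρ)) (fun t _ => ?_)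
    (fun t _ j => ?_) (fun j _ => ?_) j
  · rw [hseg]
    exact pt_ne_zero hρ 0
  · rw [hseg]
    exact (hsum _).rel_three.self_of_nhds j
  · rw [← evalCoeff_pd_momGerm (hsum x₀), hzero, map_zero, map_zero]

/-- The expansions are ka independent members of a space of dimension at most ka. The argument works
for every s ≥ b/a, so all these spaces coincide. -/
theorem IsLift.exists_expansions (h : IsLift a b k β θ₁ θ₂ γ γt B)
    (hγ : IsBasicFamily a b k β θ₁ θ₂ γ) (hk : 1 ≤ k) (hka : 1 < k * a) {ρ : ℝ} (hρ : 0 < ρ)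
    (x₀ : ℂ) : ∃ Φt : Fin a × Fin k → HolGerm (Fin.cons x₀ (pt θ₁ ρ) : Fin 2 → ℂ),
      (∀ i, HasExpansion ![1, k * a, k * b] β θ₂ (γt i.1 i.2) (Φt i)) ∧
      LinearIndependent ℂ Φt ∧ ∀ s : ℝ, (b : ℝ) / a ≤ s → 
        Submodule.span ℂ (Set.range Φt) = Sol ![1, k * a, k * b] β s (Fin.cons x₀ (pt θ₁ ρ)) := by
  choose M hM using fun i : Fin a × Fin k => h.moments i.1 i.2
  choose hX hg hE using fun i : Fin a × Fin k =>
    hM i (Fin.cons x₀ (pt θ₁ ρ) : Fin 2 → ℂ) ρ hρ rfl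
  have hli := h.linearIndependent hγ hk hka hρ hE
  refine ⟨_, hE, hli, fun s hs => ?_⟩
  obtain ⟨hfd, hrank⟩ := finiteDimensional_Sol_three (d := k * b) (β := β) (s := s)
    (p := Fin.cons x₀ (pt θ₁ ρ)) hka (pt_ne_zero hρ 0)
  refine Submodule.eq_of_le_of_finrank_le ?_ ?_
  · rw [Submodule.span_le]
    rintro _ ⟨i, rfl⟩
    refine momGerm_mem_Sol (hX i) _ (hg i) hka.le ?_
    show ((k * b : ℕ) : ℝ) / ((k * a : ℕ) : ℝ) ≤ s
    push_cast
    rwa [mul_div_mul_left _ _ (by exact_mod_cast (by omega : k ≠ 0))]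
  · rw [finrank_span_eq_card hli]
    simpa [mul_comm] using hrank

/-- By linearity and uniqueness of expansions, a relation between formal cycles is a relation
between their expansions. -/
theorem IsLift.linearIndependent_cycles (h : IsLift a b k β θ₁ θ₂ γ γt B)
    (hγ : IsBasicFamily a b k β θ₁ θ₂ γ) (hk : 1 ≤ k) (hka : 1 < k * a) :
    LinearIndependent ℂ fun i : Fin a × Fin k => γt i.1 i.2 := by
  obtain ⟨Φt, hE, hli, -⟩ := h.exists_expansions hγ hk hka one_pos 0
  rw [Fintype.linearIndependent_iff] at hli ⊢
  intro g hg
  refine hli g ?_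
  have h1 := HasExpansion.sum Finset.univ (a := g) fun i _ => hE i
  rw [hg] at h1
  exact h1.unique HasExpansion.zero

theorem IsLift.finrank_span (h : IsLift a b k β θ₁ θ₂ γ γt B)
    (hγ : IsBasicFamily a b k β θ₁ θ₂ γ) (hk : 1 ≤ k) (hka : 1 < k * a) :
    Module.finrank ℂ (Submodule.span ℂ (Set.range fun i : Fin a × Fin k => γt i.1 i.2)) =
      k * a := by
  rw [finrank_span_eq_card (h.linearIndependent_cycles hγ hk hka)]
  simp [mul_comm]

theorem IsLift.exists_equiv (h : IsLift a b k β θ₁ θ₂ γ γt B)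
    (hγ : IsBasicFamily a b k β θ₁ θ₂ γ) (hk : 1 ≤ k) (hka : 1 < k * a) {ρ : ℝ} (hρ : 0 < ρ)
    (x₀ : ℂ) {s : ℝ} (hs : (b : ℝ) / a ≤ s) :
    ∃ G : Submodule.span ℂ (Set.range fun i : Fin a × Fin k => γt i.1 i.2) ≃ₗ[ℂ]
      Sol ![1, k * a, k * b] β s (Fin.cons x₀ (pt θ₁ ρ)),
      ∀ C, HasExpansion ![1, k * a, k * b] β θ₂ C.1 (G C).1 := by
  obtain ⟨Φt, hE, hli, hspan⟩ := h.exists_expansions hγ hk hka hρ x₀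
  have hc := h.linearIndependent_cycles hγ hk hka
  set e := LinearEquiv.ofEq _ _ (hspan s hs)
  set b₁ := Module.Basis.span hc
  set b₂ := (Module.Basis.span hli).map e
  refine ⟨b₁.equiv b₂ (Equiv.refl _), fun C => ?_⟩
  have h1 : (C : GeomCycle →₀ ℂ) = ∑ i, b₁.repr C i • γt i.1 i.2 := by
    conv_lhs => rw [← b₁.sum_repr C]
    rw [Submodule.coe_sum]
    exact Finset.sum_congr rfl fun i _ => by
      rw [Submodule.coe_smul, Module.Basis.span_apply]
  have h2 : ((b₁.equiv b₂ (Equiv.refl _) C : Sol ![1, k * a, k * b] β s _) :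
      HolGerm (Fin.cons x₀ (pt θ₁ ρ) : Fin 2 → ℂ)) = ∑ i, b₁.repr C i • Φt i := by
    conv_lhs => rw [← b₁.sum_repr C]
    rw [map_sum, Submodule.coe_sum]
    refine Finset.sum_congr rfl fun i _ => ?_
    rw [map_smul, Submodule.coe_smul, Module.Basis.equiv_apply, Equiv.refl_apply,
      Module.Basis.map_apply, LinearEquiv.coe_ofEq_apply, Module.Basis.span_apply]
  rw [h1, h2]
  exact HasExpansion.sum _ fun i _ => hE i

theorem IsLift.mapsTo (h : IsLift a b k β θ₁ θ₂ γ γt B) (hγ : IsBasicFamily a b k β θ₁ θ₂ γ)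
    (hk : 1 ≤ k) (hka : 1 < k * a) {ρ : ℝ} (hρ : 0 < ρ) :
    Set.MapsTo (varpi k (pt θ₁ ρ))
      (Sol ![1, k * a, k * b] β (b / a) (Fin.cons 0 (pt θ₁ ρ)))
      {v | ∀ ℓ : Fin k, v ℓ ∈ Sol ![a, b] ((β - (ℓ : ℕ)) / k) (b / a) (pt θ₁ ρ)} := by
  obtain ⟨Φt, hE, -, hspan⟩ := h.exists_expansions hγ hk hka hρ 0
  have ha : 1 ≤ a := Nat.pos_of_ne_zero (by rintro rfl; simp at hka)
  intro φ hφ l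
  have hle : Sol ![1, k * a, k * b] β (b / a) (Fin.cons 0 (pt θ₁ ρ) : Fin 2 → ℂ) ≤
      (Sol ![a, b] ((β - (l : ℕ)) / k) (b / a) (pt θ₁ ρ)).comap
        (LinearMap.proj l ∘ₗ varpi k (pt θ₁ ρ)) := by
    rw [← hspan _ le_rfl, Submodule.span_le]
    rintro _ ⟨i, rfl⟩
    obtain ⟨M, hM⟩ := h.moments i.1 i.2
    obtain ⟨hX, hg, hE'⟩ := hM (Fin.cons 0 (pt θ₁ ρ) : Fin 2 → ℂ) ρ hρ rfl
    rw [(hE i).unique hE']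
    show varpi k (pt θ₁ ρ) (momGerm hX (isStable_univ _)) l ∈
      Sol ![a, b] ((β - (l : ℕ)) / k) (b / a) (pt θ₁ ρ)
    rw [varpi_momGerm hk]
    exact momGerm_mem_Sol _ _ (HasGrowth.restrict ha hk hg l) ha le_rfl
  exact hle hφ

/-- Without an exceptional pair, ϖ sends a basis of the source to 1/k times a basis of the direct
sum. -/
theorem IsLift.bijOn (h : IsLift a b k β θ₁ θ₂ γ γt B) (hγ : IsBasicFamily a b k β θ₁ θ₂ γ)
    (hk : 1 ≤ k) (hka : 1 < k * a) {ρ : ℝ} (hρ : 0 < ρ) (hB : ∀ i, ¬ B i) :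
    VarpiIso a b k β (pt θ₁ ρ) := by
  obtain ⟨Φt, hE, hli', hspan⟩ := h.exists_expansions hγ hk hka hρ 0
  obtain ⟨Φ, hΦ, hli, hsp⟩ := hγ.exists_expansions hρ
  have hk0 : (1 / (k : ℂ)) ≠ 0 := one_div_ne_zero (by exact_mod_cast (by omega : k ≠ 0))
  have hval : ∀ i, varpi k (pt θ₁ ρ) (Φt i) = (1 / (k : ℂ)) • Pi.single i.2 (Φ i.1 i.2) := by
    intro i
    rw [h.good ρ hρ i.1 i.2 (hB i) _ _ (hΦ i.1 i.2) (hE i), Pi.single_smul]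
  have hs := linearIndependent_single_family hli
  refine ⟨h.mapsTo hγ hk hka hρ, ?_, ?_⟩
  · intro φ hφ ψ hψ hφψ
    rw [← sub_eq_zero]
    have hmem : φ - ψ ∈ Submodule.span ℂ (Set.range Φt) := by
      rw [hspan _ le_rfl]
      exact Submodule.sub_mem _ hφ hψ
    obtain ⟨c, hc⟩ := (Submodule.mem_span_range_iff_exists_fun ℂ).1 hmem
    have h0 : varpi k (pt θ₁ ρ) (φ - ψ) = 0 := by rw [map_sub, hφψ, sub_self]
    rw [← hc, map_sum] at h0
    simp only [map_smul, hval, smul_smul] at h0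
    have h1 := Fintype.linearIndependent_iff.1 hs _ h0
    rw [← hc]
    exact Finset.sum_eq_zero fun i _ => by
      rw [(mul_eq_zero.1 (h1 i)).resolve_right hk0, zero_smul]
  · intro v hv
    have hle : v ∈ (Sol ![1, k * a, k * b] β (b / a) (Fin.cons 0 (pt θ₁ ρ) : Fin 2 → ℂ)).map
        (varpi k (pt θ₁ ρ)) := by
      rw [← Finset.univ_sum_single v]
      refine Submodule.sum_mem _ fun l _ => ?_
      have hvl := hv l
      rw [← hsp l] at hvl
      obtain ⟨c, hc⟩ := (Submodule.mem_span_range_iff_exists_fun ℂ).1 hvl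
      refine ⟨∑ τ, ((k : ℂ) * c τ) • Φt (τ, l), ?_, ?_⟩
      · rw [← hspan _ le_rfl]
        exact Submodule.sum_mem _ fun τ _ => Submodule.smul_mem _ _ (Submodule.subset_span ⟨_, rfl⟩)
      · rw [map_sum, ← hc]
        simp only [map_smul, hval, smul_smul]
        have hk1 : (k : ℂ) ≠ 0 := by exact_mod_cast (by omega : k ≠ 0)
        have e : ∀ τ, (k : ℂ) * c τ * (1 / (k : ℂ)) = c τ := fun τ => by field_simp
        simp only [e, ← Pi.single_smul]
        exact (map_sum (AddMonoidHom.single (fun _ : Fin k => HolGerm (pt θ₁ ρ)) l) _ _).symm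
    exact hle

/-- The expansion of the exceptional cycle is a non-zero solution in the kernel. -/
theorem IsLift.not_varpiIso (h : IsLift a b k β θ₁ θ₂ γ γt B) (hγ : IsBasicFamily a b k β θ₁ θ₂ γ)
    (hk : 1 ≤ k) (hka : 1 < k * a) {ρ : ℝ} (hρ : 0 < ρ) {i : Fin a × Fin k} (hB : B i) :
    ¬ VarpiIso a b k β (pt θ₁ ρ) := by
  obtain ⟨Φt, hE, -, hspan⟩ := h.exists_expansions hγ hk hka hρ 0
  intro hV
  obtain ⟨h1, h2⟩ := h.bad ρ hρ i.1 i.2 hB _ (hE i)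
  refine h2 (hV.2.1 ?_ (Submodule.zero_mem _) (by rw [h1, map_zero]))
  rw [SetLike.mem_coe, ← hspan _ le_rfl]
  exact Submodule.subset_span ⟨i, rfl⟩

/-- The image is spanned by the non-exceptional basis vectors of the direct sum, so it misses
exactly the exceptional one, which is independent of them. -/
theorem IsLift.mem_map_iff (h : IsLift a b k β θ₁ θ₂ γ γt B) (hγ : IsBasicFamily a b k β θ₁ θ₂ γ)
    (hk : 1 ≤ k) (hka : 1 < k * a) {ρ : ℝ} (hρ : 0 < ρ) {Φ : Fin a → Fin k → HolGerm (pt θ₁ ρ)}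
    (hΦ : ∀ (τ : Fin a) (r : Fin k), HasExpansion ![a, b] ((β - (r : ℕ)) / k) θ₂
      (Finsupp.single (γ τ r) 1) (Φ τ r)) (τ : Fin a) (r : Fin k) :
    Pi.single r (Φ τ r) ∈ Submodule.map (varpi k (pt θ₁ ρ))
      (Sol ![1, k * a, k * b] β (b / a) (Fin.cons 0 (pt θ₁ ρ))) ↔ ¬ B (τ, r) := by
  obtain ⟨Φt, hE, -, hspan⟩ := h.exists_expansions hγ hk hka hρ 0
  obtain ⟨Φ', hΦ', hli, -⟩ := hγ.exists_expansions hρ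
  obtain rfl : Φ' = Φ := funext fun τ => funext fun r => (hΦ' τ r).unique (hΦ τ r)
  have hk1 : (k : ℂ) ≠ 0 := by exact_mod_cast (by omega : k ≠ 0)
  have hs := linearIndependent_single_family hli
  constructor
  · intro hmem hB
    refine hs.notMem_span_image (s := {i | ¬ B i}) (x := (τ, r)) (by simpa using hB) ?_
    have hle : Submodule.map (varpi k (pt θ₁ ρ))
        (Sol ![1, k * a, k * b] β (b / a) (Fin.cons 0 (pt θ₁ ρ) : Fin 2 → ℂ)) ≤
        Submodule.span ℂ ((fun i : Fin a × Fin k =>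
          (Pi.single i.2 (Φ' i.1 i.2) : Fin k → HolGerm (pt θ₁ ρ))) '' {i | ¬ B i}) := by
      rw [← hspan _ le_rfl, Submodule.map_span, Submodule.span_le]
      rintro _ ⟨_, ⟨i, rfl⟩, rfl⟩
      by_cases hi : B i
      · rw [(h.bad ρ hρ i.1 i.2 hi _ (hE i)).1]
        exact Submodule.zero_mem _
      · rw [h.good ρ hρ i.1 i.2 hi _ _ (hΦ i.1 i.2) (hE i), Pi.single_smul]
        exact Submodule.smul_mem _ _ (Submodule.subset_span ⟨i, hi, rfl⟩)
    exact hle hmem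
  · intro hB
    refine ⟨(k : ℂ) • Φt (τ, r), ?_, ?_⟩
    · rw [SetLike.mem_coe, ← hspan _ le_rfl]
      exact Submodule.smul_mem _ _ (Submodule.subset_span ⟨_, rfl⟩)
    · rw [map_smul, h.good ρ hρ τ r hB _ _ (hΦ τ r) (hE (τ, r)), ← Pi.single_smul, smul_smul,
        mul_one_div_cancel hk1, one_smul]

end

end Hypergeo

namespace Hypergeo

/-! ### Roots of cycles -/

/-- The `k`-th root of a path, multiplied by `e^{-2πiν/k}`. -/
noncomputable def LogPath.root (γ : LogPath) {k : ℕ} (hk : 1 ≤ k) (ν : ℕ) : LogPath where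
  w u := (γ.w u - 2 * Real.pi * Complex.I * ν) / k
  contDiff := (γ.contDiff.sub contDiff_const).div_const _
  bounded := by
    obtain ⟨L, hL⟩ := γ.bounded
    refine ⟨L / k, fun u => ?_⟩
    rw [((γ.hasDerivAt_w u).sub_const _ |>.div_const _).deriv, norm_div, Complex.norm_natCast]
    gcongr
    exact hL u
  growth := by
    obtain ⟨c, hc, C, h⟩ := γ.growth
    have hk0 : (0 : ℝ) < k := by exact_mod_cast hk
    refine ⟨c / k, by positivity, C / k, fun u => ?_⟩
    rw [Complex.div_natCast_re]
    have e : (γ.w u - 2 * Real.pi * Complex.I * ν).re = (γ.w u).re := by simp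
    rw [e, div_mul_eq_mul_div, ← sub_div]
    gcongr
    exact h u
  argBot := by
    obtain ⟨φ, h⟩ := γ.argBot
    refine ⟨(φ - 2 * Real.pi * ν) / k, ((h.sub_const _).div_const _).congr fun u => ?_⟩
    rw [Complex.div_natCast_im]
    simp
  argTop := by
    obtain ⟨φ, h⟩ := γ.argTop
    refine ⟨(φ - 2 * Real.pi * ν) / k, ((h.sub_const _).div_const _).congr fun u => ?_⟩
    rw [Complex.div_natCast_im]
    simp

theorem LogPath.root_w (γ : LogPath) {k : ℕ} (hk : 1 ≤ k) (ν : ℕ) (u : ℝ) :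
    (γ.root hk ν).w u = (γ.w u - 2 * Real.pi * Complex.I * ν) / k := rfl

theorem LogPath.isRoot_root (γ : LogPath) {k : ℕ} (hk : 1 ≤ k) (ν : Fin k) :
    IsRoot k γ (γ.root hk ν) := by
  refine ⟨ν, fun u => ?_⟩
  rw [root_w, mul_div_cancel₀]
  exact_mod_cast (by omega : k ≠ 0)

/-- The factor k in the entries ka and kb undoes the division by k, and what is left of the rotation
is an integral multiple of 2π. -/
theorem decays_div {a b k : ℕ} (hk : 1 ≤ k) {θ₁ θ₂ φ : ℝ} (h : Decays ![a, b] θ₁ θ₂ φ) (ν : ℤ) :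
    Decays ![1, k * a, k * b] θ₁ θ₂ ((φ - 2 * Real.pi * ν) / k) := by
  have hk0 : (k : ℝ) ≠ 0 := by exact_mod_cast (by omega : k ≠ 0)
  have key : ∀ (c : ℕ) (θ : ℝ), Real.cos (θ + ((k * c : ℕ) : ℝ) * ((φ - 2 * Real.pi * ν) / k)) =
      Real.cos (θ + c * φ) := by
    intro c θ
    have e : θ + ((k * c : ℕ) : ℝ) * ((φ - 2 * Real.pi * ν) / k) =
        θ + c * φ - ((c * ν : ℤ) : ℝ) * (2 * Real.pi) := by
      push_cast
      field_simp
      ring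
    rw [e, Real.cos_sub_int_mul_two_pi]
  refine ⟨?_, ?_⟩
  · exact (key a θ₁).trans_lt h.1
  · exact (key b θ₂).trans_lt h.2

theorem admissible_root {a b k : ℕ} (hk : 1 ≤ k) {β β' : ℂ} {θ₁ θ₂ : ℝ} {γ : LogPath}
    (h : Admissible ![a, b] β θ₁ θ₂ (GeomCycle.path γ)) (ν : ℕ) :
    Admissible ![1, k * a, k * b] β' θ₁ θ₂ (GeomCycle.path (γ.root hk ν)) := by
  obtain ⟨φ₁, φ₂, h1, h2, h3, h4⟩ := h
  refine ⟨_, _, ?_, ?_, decays_div hk h3 ν, decays_div hk h4 ν⟩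
  · refine ((h1.sub_const _).div_const _).congr fun u => ?_
    rw [LogPath.root_w, Complex.div_natCast_im]
    simp
  · refine ((h2.sub_const _).div_const _).congr fun u => ?_
    rw [LogPath.root_w, Complex.div_natCast_im]
    simp

theorem phase_trunc_two {a b : ℕ} (y : Fin 1 → ℂ) (t : ℂ) :
    phase (trunc ![a, b]) y t = y 0 * t ^ a := by
  simp [phase, trunc]

theorem phase_trunc_three {c d : ℕ} (x : Fin 2 → ℂ) (t : ℂ) :
    phase (trunc ![1, c, d]) x t = x 0 * t + x 1 * t ^ c := by
  simp [phase, trunc, Fin.sum_univ_two]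

/-- If t is a root of T, so that t^k = T and dt/t = (1/k) dT/T, then at x_0 = 0 the exponent is x_1
T^a and t^(kj) = T^j. The leftover t^(ℓ-β) is T^(-(β-ℓ)/k) times a phase depending on ν and ℓ, which
is what separates the residue classes. -/
theorem cmom_root {a b k : ℕ} (hk : 1 ≤ k) {β : ℂ} (γ : LogPath) (ν j ℓ : ℕ) (y : Fin 1 → ℂ) :
    cmom ![1, k * a, k * b] β (GeomCycle.path (γ.root hk ν)) (k * j + ℓ) (Fin.cons 0 y) =
      1 / k * Complex.exp (2 * Real.pi * Complex.I * ν * ((β - ℓ) / k)) *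
        cmom ![a, b] ((β - ℓ) / k) (GeomCycle.path γ) j y := by
  have hk0 : (k : ℂ) ≠ 0 := by exact_mod_cast (by omega : k ≠ 0)
  rw [cmom, cmom, mom, mom, ← integral_const_mul]
  congr 1
  funext u
  rw [phase_trunc_two, phase_trunc_three, Fin.cons_zero, zero_mul, zero_add]
  have e0 : (Fin.cons 0 y : Fin 2 → ℂ) 1 = y 0 := rfl
  rw [e0]
  simp only [GeomCycle.weight, GeomCycle.param]
  have hd : deriv (γ.root hk ν).w u = deriv γ.w u / k :=
    ((γ.hasDerivAt_w u).sub_const _ |>.div_const _).deriv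
  have h1 : Complex.exp ((γ.root hk ν).w u) ^ k = Complex.exp (γ.w u) := by
    rw [← Complex.exp_nat_mul, LogPath.root_w, mul_div_cancel₀ _ hk0, Complex.exp_sub]
    have : Complex.exp (2 * Real.pi * Complex.I * ν) = 1 := by
      rw [mul_comm, Complex.exp_nat_mul, Complex.exp_two_pi_mul_I, one_pow]
    rw [this, div_one]
  rw [pow_add, pow_mul, pow_mul, h1, hd]
  have h2 : Complex.exp (-β * (γ.root hk ν).w u) * Complex.exp ((γ.root hk ν).w u) ^ ℓ =
      Complex.exp (2 * Real.pi * Complex.I * ν * ((β - ℓ) / k)) *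
        Complex.exp (-((β - ℓ) / k) * γ.w u) := by
    rw [← Complex.exp_nat_mul, ← Complex.exp_add, ← Complex.exp_add, LogPath.root_w]
    congr 1
    field_simp
    ring
  calc _ = (Complex.exp (-β * (γ.root hk ν).w u) * Complex.exp ((γ.root hk ν).w u) ^ ℓ) *
        (deriv γ.w u / k) * Complex.exp (γ.w u) ^ j *
        Complex.exp (y 0 * Complex.exp (γ.w u) ^ a) := by ring
    _ = _ := by rw [h2]; ring

/-- The sum of the powers of a root of unity. -/
theorem sum_exp_div {k : ℕ} (r l : Fin k) :
    ∑ ν : Fin k, Complex.exp (2 * Real.pi * Complex.I * (ν : ℕ) * (((r : ℕ) - (l : ℕ) : ℂ) / k)) =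
      if l = r then (k : ℂ) else 0 := by
  have hk : 1 ≤ k := by have := r.2; omega
  have hk0 : (k : ℂ) ≠ 0 := by exact_mod_cast (by omega : k ≠ 0)
  split_ifs with h
  · subst h
    simp
  set z := Complex.exp (2 * Real.pi * Complex.I * (((r : ℕ) - (l : ℕ) : ℂ) / k)) with hz
  have h1 : ∀ ν : Fin k, Complex.exp (2 * Real.pi * Complex.I * (ν : ℕ) *
      (((r : ℕ) - (l : ℕ) : ℂ) / k)) = z ^ (ν : ℕ) := by
    intro ν
    rw [hz, ← Complex.exp_nat_mul]
    ring_nf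
  simp only [h1]
  rw [Fin.sum_univ_eq_sum_range (fun i => z ^ i)]
  have hz1 : z ≠ 1 := by
    intro hz1
    rw [hz, Complex.exp_eq_one_iff] at hz1
    obtain ⟨n, hn⟩ := hz1
    have hpi := Complex.two_pi_I_ne_zero
    have h2 : (((r : ℕ) - (l : ℕ) : ℂ) / k) = n := by
      rw [mul_comm] at hn
      exact mul_right_cancel₀ hpi hn
    rw [div_eq_iff hk0] at h2
    have h3 : ((r : ℕ) : ℤ) - (l : ℕ) = n * k := by exact_mod_cast h2
    have h4 := r.2
    have h5 := l.2
    rcases lt_trichotomy n 0 with hn | hn | hn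
    · nlinarith
    · subst hn
      exact h (Fin.ext (by omega))
    · nlinarith
  have h2 : z ^ k = 1 := by
    rw [hz, ← Complex.exp_nat_mul, Complex.exp_eq_one_iff]
    exact ⟨(r : ℕ) - (l : ℕ), by push_cast; field_simp⟩
  rw [geom_sum_eq hz1, h2, sub_self, zero_div]

/-- Discrete Fourier inversion. The coefficient of the ν-th root cancels its phase in the component
l = r; for l ≠ r the phases run through all powers of a non-trivial k-th root of unity and sum to
zero. One factor 1/k normalises this sum, the other comes from dt/t and survives in the formula for
ϖ. -/
theorem exists_root_combination {a b k : ℕ} (hab : a < b) (hk : 1 ≤ k) (hka : 1 < k * a) {β : ℂ}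
    {θ₁ θ₂ : ℝ} {γ : LogPath} {r : Fin k}
    (h : Admissible ![a, b] ((β - (r : ℕ)) / k) θ₁ θ₂ (GeomCycle.path γ)) :
    ∃ (C : GeomCycle →₀ ℂ) (M : ℕ → (Fin 2 → ℂ) → ℂ), HasMoments ![1, k * a, k * b] β θ₁ θ₂ C M ∧
      (∀ c ∈ C.support, Admissible ![1, k * a, k * b] β θ₁ θ₂ c) ∧
      C ∈ Submodule.span ℂ
        {C | ∃ w' : LogPath, IsRoot k γ w' ∧ C = Finsupp.single (GeomCycle.path w') 1} ∧
      ∀ (j : ℕ) (l : Fin k) (y : Fin 1 → ℂ), M (k * j + l) (Fin.cons 0 y) = if l = r then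
        1 / k * cmom ![a, b] ((β - (r : ℕ)) / k) (GeomCycle.path γ) j y else 0 := by
  classical
  have hk0 : (k : ℂ) ≠ 0 := by exact_mod_cast (by omega : k ≠ 0)
  set c : Fin k → ℂ := fun ν =>
    1 / k * Complex.exp (-(2 * Real.pi * Complex.I * (ν : ℕ) * ((β - (r : ℕ)) / k))) with hc
  refine ⟨_, _, HasMoments.sum Finset.univ c fun ν : Fin k => hasMoments_cmom
    (isRow_three hab hk hka) (admissible_root (β' := β) hk h ν) (by simp), ?_, ?_, ?_⟩
  · intro g hg
    obtain ⟨ν, -, hν⟩ := Finset.mem_biUnion.1 (Finsupp.support_finsetSum hg)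
    have := Finsupp.support_single_subset (Finsupp.support_smul hν)
    rw [Finset.mem_singleton] at this
    subst this
    exact admissible_root hk h ν
  · refine Submodule.sum_mem _ fun ν _ => Submodule.smul_mem _ _ (Submodule.subset_span ?_)
    exact ⟨_, γ.isRoot_root hk ν, rfl⟩
  · intro j l y
    simp only [cmom_root]
    have e : ∀ ν : Fin k, c ν * (1 / k * Complex.exp (2 * Real.pi * Complex.I * (ν : ℕ) *
        ((β - (l : ℕ)) / k)) * cmom ![a, b] ((β - (l : ℕ)) / k) (GeomCycle.path γ) j y) =
        Complex.exp (2 * Real.pi * Complex.I * (ν : ℕ) * (((r : ℕ) - (l : ℕ) : ℂ) / k)) *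
        (1 / k * (1 / k) * cmom ![a, b] ((β - (l : ℕ)) / k) (GeomCycle.path γ) j y) := by
      intro ν
      have e1 : (2 * Real.pi * Complex.I * (ν : ℕ) * (((r : ℕ) - (l : ℕ) : ℂ) / k)) =
          -(2 * Real.pi * Complex.I * (ν : ℕ) * ((β - (r : ℕ)) / k)) +
          2 * Real.pi * Complex.I * (ν : ℕ) * ((β - (l : ℕ)) / k) := by
        ring
      rw [e1, Complex.exp_add, hc]
      ring
    simp only [e]
    rw [← Finset.sum_mul, sum_exp_div]
    split_ifs with hl
    · subst hl
      field_simp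
    · rw [zero_mul]

theorem varpi_eq_single {a b k : ℕ} (hk : 1 ≤ k) {β : ℂ} {q : Fin 1 → ℂ}
    {M : ℕ → (Fin 2 → ℂ) → ℂ} {N : ℕ → (Fin 1 → ℂ) → ℂ} {r : Fin k} {c : ℂ}
    (h : IsMom ![1, k * a, k * b] β Set.univ (Fin.cons 0 q : Fin 2 → ℂ) M)
    (hN : IsMom ![a, b] ((β - (r : ℕ)) / k) Set.univ q N)
    (hr : ∀ᶠ y in 𝓝 q, ∀ j, M (k * (b * j) + r) (Fin.cons 0 y) = c * N (b * j) y)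
    (h0 : ∀ l, l ≠ r → ∀ᶠ y in 𝓝 q, ∀ j, M (k * (b * j) + (l : ℕ)) (Fin.cons 0 y) = 0) :
    varpi k q (momGerm h (isStable_univ _)) =
      Pi.single r (c • momGerm hN (isStable_univ _)) := by
  funext l
  rw [varpi_momGerm hk]
  by_cases hl : l = r
  · subst hl
    rw [Pi.single_eq_same]
    refine Subtype.ext (Germ.coe_eq.2 ?_)
    filter_upwards [hr] with y hy
    funext m
    show M (k * (b * m) + l) (Fin.cons 0 y) / _ = c * (N (b * m) y / _)
    rw [hy, mul_div_assoc]
  · rw [Pi.single_eq_of_ne hl]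
    refine Subtype.ext (Germ.coe_eq.2 ?_)
    filter_upwards [h0 l hl] with y hy
    funext m
    show M (k * (b * m) + l) (Fin.cons 0 y) / _ = 0
    rw [hy, zero_div]

end Hypergeo

namespace Hypergeo

/-! ### Paths between two directions -/

theorem exists_bound_deriv_smoothTransition : ∃ L : ℝ, ∀ u, |deriv Real.smoothTransition u| ≤ L := by
  have hc : Continuous (deriv Real.smoothTransition) :=
    (Real.smoothTransition.contDiff (n := 1)).continuous_deriv le_rfl
  obtain ⟨L, hL⟩ := (isCompact_Icc (a := (0 : ℝ)) (b := 1)).bddAbove_image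
    (f := fun u => |deriv Real.smoothTransition u|) hc.abs.continuousOn
  refine ⟨max L 0, fun u => ?_⟩
  rcases lt_or_ge u 0 with h | h
  · have : Real.smoothTransition =ᶠ[𝓝 u] fun _ => 0 := by
      filter_upwards [Iio_mem_nhds h] with v hv
      exact Real.smoothTransition.zero_of_nonpos (le_of_lt hv)
    simp [this.deriv_eq]
  rcases lt_or_ge 1 u with h' | h'
  · have : Real.smoothTransition =ᶠ[𝓝 u] fun _ => 1 := by
      filter_upwards [Ioi_mem_nhds h'] with v hv
      exact Real.smoothTransition.one_of_one_le (le_of_lt hv)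
    simp [this.deriv_eq]
  · exact (hL ⟨u, ⟨h, h'⟩, rfl⟩).trans (le_max_left _ _)

theorem hasDerivAt_sqrt_one_add_sq (u : ℝ) :
    HasDerivAt (fun u : ℝ => √(1 + u ^ 2)) (u / √(1 + u ^ 2)) u := by
  have h := ((hasDerivAt_pow 2 u).const_add 1).sqrt (by positivity)
  refine h.congr_deriv ?_
  have : √(1 + u ^ 2) ≠ 0 := by positivity
  field_simp
  ring

/-- A path that comes from infinity in the direction `φ₁` and goes to infinity in the direction
`φ₂`. -/
noncomputable def arcPath (φ₁ φ₂ : ℝ) : LogPath where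
  w u := (√(1 + u ^ 2) : ℝ) + (φ₁ + (φ₂ - φ₁) * Real.smoothTransition u : ℝ) * Complex.I
  contDiff := by
    have h1 : ContDiff ℝ 1 fun u : ℝ => √(1 + u ^ 2) :=
      ContDiff.sqrt (by fun_prop) fun u => by positivity
    have h2 : ContDiff ℝ 1 fun u : ℝ => φ₁ + (φ₂ - φ₁) * Real.smoothTransition u :=
      contDiff_const.add (contDiff_const.mul Real.smoothTransition.contDiff)
    exact (Complex.ofRealCLM.contDiff.comp h1).add
      ((Complex.ofRealCLM.contDiff.comp h2).mul contDiff_const)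
  bounded := by
    obtain ⟨L, hL⟩ := exists_bound_deriv_smoothTransition
    refine ⟨1 + |φ₂ - φ₁| * L, fun u => ?_⟩
    have hs : HasDerivAt Real.smoothTransition (deriv Real.smoothTransition u) u :=
      ((Real.smoothTransition.contDiff (n := 1)).differentiable one_ne_zero u).hasDerivAt
    have h := (hasDerivAt_sqrt_one_add_sq u).ofReal_comp.add
      (((hs.const_mul (φ₂ - φ₁)).const_add φ₁).ofReal_comp.mul_const Complex.I)
    rw [show deriv (fun u : ℝ => ((√(1 + u ^ 2) : ℝ) : ℂ) +
      (φ₁ + (φ₂ - φ₁) * Real.smoothTransition u : ℝ) * Complex.I) u = _ from h.deriv]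
    refine (norm_add_le _ _).trans (add_le_add ?_ ?_)
    · rw [Complex.norm_real, Real.norm_eq_abs, abs_div, abs_of_nonneg (Real.sqrt_nonneg _)]
      refine div_le_one_of_le₀ (Real.abs_le_sqrt ?_) (Real.sqrt_nonneg _)
      linarith
    · rw [norm_mul, Complex.norm_I, mul_one, Complex.norm_real, Real.norm_eq_abs, abs_mul]
      gcongr
      exact hL u
  growth := by
    refine ⟨1, one_pos, 0, fun u => ?_⟩
    have h : |u| ≤ √(1 + u ^ 2) := Real.abs_le_sqrt (by linarith)
    simpa using h
  argBot := by
    refine ⟨φ₁, tendsto_const_nhds.congr' ?_⟩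
    filter_upwards [eventually_le_atBot 0] with u hu
    simp [Real.smoothTransition.zero_of_nonpos hu]
  argTop := by
    refine ⟨φ₂, tendsto_const_nhds.congr' ?_⟩
    filter_upwards [eventually_ge_atTop 1] with u hu
    simp [Real.smoothTransition.one_of_one_le hu]

theorem arcPath_w_of_one_le (φ₁ φ₂ : ℝ) {u : ℝ} (hu : 1 ≤ u) :
    (arcPath φ₁ φ₂).w u = (√(1 + u ^ 2) : ℝ) + φ₂ * Complex.I := by
  simp [arcPath, Real.smoothTransition.one_of_one_le hu]

theorem arcPath_w_of_nonpos (φ₁ φ₂ : ℝ) {u : ℝ} (hu : u ≤ 0) :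
    (arcPath φ₁ φ₂).w u = (√(1 + u ^ 2) : ℝ) + φ₁ * Complex.I := by
  simp [arcPath, Real.smoothTransition.zero_of_nonpos hu]

theorem admissible_arcPath {n : ℕ} {A : Fin (n + 2) → ℕ} {β : ℂ} {θ₁ θ₂ φ₁ φ₂ : ℝ}
    (h₁ : Decays A θ₁ θ₂ φ₁) (h₂ : Decays A θ₁ θ₂ φ₂) :
    Admissible A β θ₁ θ₂ (GeomCycle.path (arcPath φ₁ φ₂)) := by
  refine ⟨φ₁, φ₂, tendsto_const_nhds.congr' ?_, tendsto_const_nhds.congr' ?_, h₁, h₂⟩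
  · filter_upwards [eventually_le_atBot 0] with u hu
    simp [arcPath_w_of_nonpos _ _ hu]
  · filter_upwards [eventually_ge_atTop 1] with u hu
    simp [arcPath_w_of_one_le _ _ hu]

/-- In the logarithmic variable the integrands are entire and have global primitives, so an integral
is the limit of differences of a primitive at the two ends. Contour deformation is used in this form
only. -/
theorem LogPath.tendsto_sub (γ : LogPath) {F G : ℂ → ℂ} (hG : ∀ w, HasDerivAt G (F w) w)
    (hF : Continuous F) (hi : Integrable fun u => F (γ.w u) * deriv γ.w u) :
    Tendsto (fun r : ℝ => G (γ.w r) - G (γ.w (-r))) atTop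
      (𝓝 (∫ u, F (γ.w u) * deriv γ.w u)) := by
  refine (intervalIntegral_tendsto_integral hi tendsto_neg_atTop_atBot tendsto_id).congr fun r => ?_
  refine intervalIntegral.integral_eq_sub_of_hasDerivAt (f := fun u => G (γ.w u)) (fun u _ => ?_)
    (Continuous.intervalIntegrable
      ((hF.comp γ.continuous_w).mul γ.continuous_deriv_w) _ _)
  exact (hG (γ.w u)).comp_of_eq u (γ.hasDerivAt_w u) rfl

/-- Near the points over the half line of argument `θ₁`, the integrals of all moments of a path
converge. -/
theorem integrable_cmom_path {n : ℕ} {A : Fin (n + 2) → ℕ} (hA : IsRow A) {β : ℂ} {θ₁ θ₂ : ℝ}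
    {γ : LogPath} (h : Admissible A β θ₁ θ₂ (GeomCycle.path γ)) {p : Fin (n + 1) → ℂ} {ρ : ℝ}
    (hρ : 0 < ρ) (hp : p (Fin.last n) = ρ * Complex.exp (θ₁ * Complex.I)) :
    ∀ᶠ x in 𝓝 p, ∀ j : ℕ, Integrable fun u => Complex.exp ((j - β) * γ.w u) *
      Complex.exp (phase (trunc A) x (Complex.exp (γ.w u))) * deriv γ.w u := by
  obtain ⟨φ₁, φ₂, h1, h2, h3, h4⟩ := h
  obtain ⟨r, hr, c, hc, K, hK, hb⟩ := (cycleData_path (β := β) hA h1 h2 h3 h4).integrable_mom hA hρ hp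
  filter_upwards [Metric.ball_mem_nhds p hr] with x hx j
  refine ((hb x hx).2.1 j).congr (Eventually.of_forall fun u => ?_)
  simp only [GeomCycle.weight, GeomCycle.param]
  rw [sub_mul, sub_eq_add_neg, ← neg_mul, Complex.exp_add, Complex.exp_nat_mul]
  ring

theorem cmom_path {n : ℕ} (A : Fin (n + 1) → ℕ) (β : ℂ) (γ : LogPath) (j : ℕ) (x : Fin n → ℂ) :
    cmom A β (GeomCycle.path γ) j x = ∫ u, Complex.exp ((j - β) * γ.w u) *
      Complex.exp (phase (trunc A) x (Complex.exp (γ.w u))) * deriv γ.w u := by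
  rw [cmom, mom]
  congr 1
  funext u
  simp only [GeomCycle.weight, GeomCycle.param]
  rw [sub_mul, sub_eq_add_neg, ← neg_mul, Complex.exp_add, Complex.exp_nat_mul]
  ring

/-! ### Loops -/

theorem differentiable_phase {m : ℕ} (B : Fin m → ℕ) (x : Fin m → ℂ) :
    Differentiable ℂ (phase B x) := by
  unfold phase
  fun_prop

theorem arcPath_two_pi (φ : ℝ) {r : ℝ} (hr : 1 ≤ r) :
    (arcPath φ (φ + 2 * Real.pi)).w r = (arcPath φ (φ + 2 * Real.pi)).w (-r) +
      2 * Real.pi * Complex.I := by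
  rw [arcPath_w_of_one_le _ _ hr, arcPath_w_of_nonpos _ _ (by linarith)]
  push_cast
  rw [neg_sq]
  ring

/-- The moments of a loop, for `β ∈ ℕ`, are residues. -/
theorem cmom_loop {m : ℕ} {A : Fin (m + 1) → ℕ} (hpos : ∀ i : Fin m, A i.castSucc ≠ 0) (n : ℕ)
    (φ : ℝ) {x : Fin m → ℂ}
    (hi : ∀ j : ℕ, Integrable fun u => Complex.exp ((j - n : ℂ) * (arcPath φ (φ + 2 * Real.pi)).w u) *
      Complex.exp (phase (trunc A) x (Complex.exp ((arcPath φ (φ + 2 * Real.pi)).w u))) *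
      deriv (arcPath φ (φ + 2 * Real.pi)).w u) :
    (∀ j, n < j → cmom A n (GeomCycle.path (arcPath φ (φ + 2 * Real.pi))) j x = 0) ∧
    cmom A n (GeomCycle.path (arcPath φ (φ + 2 * Real.pi))) n x = 2 * Real.pi * Complex.I := by
  set γ := arcPath φ (φ + 2 * Real.pi) with hγ
  set E : ℂ → ℂ := fun t => Complex.exp (phase (trunc A) x t) with hE
  have hEd : Differentiable ℂ E := (differentiable_phase _ _).cexp
  have hE0 : E 0 = 1 := by
    simp only [hE, phase]
    rw [Finset.sum_eq_zero, Complex.exp_zero]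
    intro i _
    rw [trunc, zero_pow (hpos i), mul_zero]
  have key : ∀ (j : ℕ) (G : ℂ → ℂ) (c : ℂ),
      (∀ w, HasDerivAt G (Complex.exp ((j - n : ℂ) * w) * E (Complex.exp w)) w) →
      (∀ w, G (w + 2 * Real.pi * Complex.I) = G w + c) → cmom A n (GeomCycle.path γ) j x = c := by
    intro j G c hG hc
    rw [cmom_path]
    have hcont : Continuous fun w => Complex.exp ((j - n : ℂ) * w) * E (Complex.exp w) := by
      have := hEd.continuous
      fun_prop
    refine tendsto_nhds_unique (γ.tendsto_sub hG hcont (hi j)) (tendsto_const_nhds.congr' ?_)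
    filter_upwards [eventually_ge_atTop 1] with r hr
    rw [hγ, arcPath_two_pi φ hr, hc, add_sub_cancel_left]
  constructor
  · intro j hj
    obtain ⟨i, rfl⟩ : ∃ i, j = n + 1 + i := ⟨j - (n + 1), by omega⟩
    -- For j = n + 1 + i the form is t^i E(t) dt, with an entire primitive H(t). In w = log t it is
    -- 2πi-periodic, so the two ends cancel.
    obtain ⟨H, hH⟩ := ((differentiable_pow i).mul hEd).isExactOn_univ
    refine key _ (fun w => H (Complex.exp w)) 0 (fun w => ?_) fun w => by
      rw [Complex.exp_periodic w, add_zero]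
    refine ((hH _ trivial).comp w (Complex.hasDerivAt_exp w)).congr_deriv ?_
    have : ((n + 1 + i : ℕ) - n : ℂ) * w = w + i * w := by push_cast; ring
    rw [this, Complex.exp_add, Complex.exp_nat_mul]
    simp only [Pi.mul_apply]
    ring
  · have hd : Differentiable ℂ (dslope E 0) := by
      rw [← differentiableOn_univ, Complex.differentiableOn_dslope univ_mem]
      exact hEd.differentiableOn
    -- For j = n the form E(t) dt/t equals dw + ((E(t) - 1)/t) dt. The second part has the entire
    -- primitive H(t); w itself increases by 2πi.
    obtain ⟨H, hH⟩ := hd.isExactOn_univ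
    refine key n (fun w => w + H (Complex.exp w)) _ (fun w => ?_) fun w => by
      rw [Complex.exp_periodic w]; ring
    refine ((hasDerivAt_id w).add ((hH _ trivial).comp w (Complex.hasDerivAt_exp w))).congr_deriv ?_
    have h := sub_smul_dslope E 0 (Complex.exp w)
    rw [sub_zero, smul_eq_mul, hE0] at h
    rw [sub_self, zero_mul, Complex.exp_zero, one_mul, mul_comm, h]
    ring

end Hypergeo

namespace Hypergeo

/-! ### The exceptional cycles -/

/-- The recursion (n - j) M_j = x_0 M_{j+1} + c x_1 M_{j+c} determines the moments downwards from
the constant M_n and the zeros beyond it, so all of them are polynomials. Since d ≥ 1, only finitely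
many M_{dm} are non-zero. -/
theorem isPolySeries_of_mom {c d n : ℕ} (hc : 1 ≤ c) (hd : 1 ≤ d) {p : Fin 2 → ℂ} {ω : ℂ}
    {M : ℕ → (Fin 2 → ℂ) → ℂ} (h : IsMom ![1, c, d] n Set.univ p M)
    (h0 : ∀ᶠ x in 𝓝 p, (∀ j, n < j → M j x = 0) ∧ M n x = ω) :
    IsPolySeries (momGerm h (isStable_univ _)) := by
  classical
  obtain ⟨S, hS, hrel⟩ := (h.rel_three.and h0).exists_mem
  have key : ∀ m j : ℕ, n - j = m → ∃ Q : MvPolynomial (Fin 2) ℂ,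
      (n < j → Q = 0) ∧ ∀ x ∈ S, M j x = MvPolynomial.eval x Q := by
    intro m
    induction m using Nat.strong_induction_on with
    | _ m ih =>
      intro j hj
      rcases lt_trichotomy j n with hjn | hjn | hjn
      · obtain ⟨Q₁, -, h₁⟩ := ih (n - (j + 1)) (by omega) (j + 1) rfl
        obtain ⟨Q₂, -, h₂⟩ := ih (n - (j + c)) (by omega) (j + c) rfl
        refine ⟨MvPolynomial.C ((n - j : ℂ)⁻¹) * (MvPolynomial.X 0 * Q₁ +
          MvPolynomial.C (c : ℂ) * MvPolynomial.X 1 * Q₂), fun h => by omega, fun x hx => ?_⟩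
        have h3 := ((hrel x hx).1 j).2.2.2
        have h4 : (n - j : ℂ) ≠ 0 := by
          rw [sub_ne_zero]
          exact_mod_cast hjn.ne'
        simp only [map_mul, map_add, MvPolynomial.eval_C, MvPolynomial.eval_X]
        rw [← h₁ x hx, ← h₂ x hx]
        field_simp
        linear_combination -h3
      · subst hjn
        exact ⟨MvPolynomial.C ω, fun h => by omega, fun x hx => by
          rw [MvPolynomial.eval_C]; exact (hrel x hx).2.2⟩
      · exact ⟨0, fun _ => rfl, fun x hx => by rw [map_zero]; exact (hrel x hx).2.1 j hjn⟩
  choose Q hQ0 hQ using fun j => key (n - j) j rfl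
  refine ⟨∑ m ∈ Finset.range (n + 1),
    Polynomial.monomial m (MvPolynomial.C ((m.factorial : ℂ)⁻¹) * Q (d * m)),
    Germ.coe_eq.2 ?_⟩
  filter_upwards [hS] with x hx
  funext m
  rw [Polynomial.finsetSum_coeff]
  simp only [Polynomial.coeff_monomial]
  rw [Finset.sum_ite_eq']
  show M (d * m) x / (m.factorial : ℂ) = _
  split_ifs with hm
  · rw [map_mul, MvPolynomial.eval_C, ← hQ _ x hx]
    ring
  · rw [map_zero, (hrel x hx).2.1, zero_div]
    rw [Finset.mem_range] at hm
    nlinarith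

/-- At x_0 = 0 the recursion links j only to j + c, so the value at n can reach only those j from
which n is obtained by steps of length c. -/
theorem mom_eq_zero_of_ne {c n : ℕ} (hc : 1 ≤ c) {x : Fin 2 → ℂ} {M : ℕ → (Fin 2 → ℂ) → ℂ}
    (hx : x 0 = 0)
    (hrel : ∀ j : ℕ, x 0 * M (j + 1) x + c * x 1 * M (j + c) x + (j - n) * M j x = 0)
    (h0 : ∀ j, n < j → M j x = 0) (j : ℕ) (hj : ∀ m, n ≠ j + c * m) : M j x = 0 := by
  induction hm : n - j using Nat.strong_induction_on generalizing j with
  | _ m ih =>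
    rcases lt_trichotomy j n with hjn | hjn | hjn
    · have h1 := ih (n - (j + c)) (by omega) (j + c)
        (fun m h => hj (m + 1) (by rw [h]; ring)) rfl
      have h2 := hrel j
      have h3 : (j - n : ℂ) ≠ 0 := by
        rw [sub_ne_zero]
        exact_mod_cast hjn.ne
      rw [hx, h1, zero_mul, mul_zero, zero_add, zero_add] at h2
      exact (mul_eq_zero.1 h2).resolve_left h3
    · exact absurd hjn.symm (by simpa using hj 0)
    · exact h0 j hjn

theorem decays_add_two_pi {n : ℕ} {A : Fin (n + 2) → ℕ} {θ₁ θ₂ φ : ℝ} (h : Decays A θ₁ θ₂ φ) :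
    Decays A θ₁ θ₂ (φ + 2 * Real.pi) := by
  have key : ∀ (c : ℕ) (θ : ℝ), Real.cos (θ + c * (φ + 2 * Real.pi)) = Real.cos (θ + c * φ) := by
    intro c θ
    have e : θ + c * (φ + 2 * Real.pi) = θ + c * φ + c * (2 * Real.pi) := by ring
    rw [e, Real.cos_add_nat_mul_two_pi]
  exact ⟨by rw [key]; exact h.1, by rw [key]; exact h.2⟩

/-- A loop around 0 has residues as moments, hence a polynomial expansion. Write n = r + kq. The
component l of ϖ involves the indices kbm + l; one of these moments could be non-zero only if n =
kbm + l + kam', which forces l = r and q = bm + am', contrary to the gap condition. The germ is not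
zero because its n-th x_0-derivative has the value M_n = 2πi. -/
theorem exists_loop {a b k : ℕ} (hab : a < b) (hk : 1 ≤ k) (hka : 1 < k * a) {θ₁ θ₂ φ : ℝ}
    (h : Decays ![1, k * a, k * b] θ₁ θ₂ φ) {β : ℂ} {r : Fin k} {q : ℕ}
    (hβ : β = (r : ℕ) + k * q) (hq : ¬ ∃ l m : ℕ, q = a * l + b * m) :
    ∃ γ : LogPath, Admissible ![1, k * a, k * b] β θ₁ θ₂ (GeomCycle.path γ) ∧
      (∀ ρ : ℝ, 0 < ρ → ∀ Φ : HolGerm (Fin.cons 0 (pt θ₁ ρ) : Fin 2 → ℂ),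
        HasExpansion ![1, k * a, k * b] β θ₂ (Finsupp.single (GeomCycle.path γ) 1) Φ →
        varpi k (pt θ₁ ρ) Φ = 0 ∧ Φ ≠ 0) ∧
      ∀ ρ : ℝ, 0 < ρ → ∀ (x₀ : ℂ) (Φ : HolGerm (Fin.cons x₀ (pt θ₁ ρ) : Fin 2 → ℂ)),
        HasExpansion ![1, k * a, k * b] β θ₂ (Finsupp.single (GeomCycle.path γ) 1) Φ →
        IsPolySeries Φ := by
  have hA := isRow_three hab hk hka
  obtain ⟨n, hn, rfl⟩ : ∃ n : ℕ, n = r + k * q ∧ β = n := ⟨_, rfl, by rw [hβ]; push_cast; rfl⟩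
  set γ := arcPath φ (φ + 2 * Real.pi) with hγ
  have hadm : Admissible ![1, k * a, k * b] (n : ℂ) θ₁ θ₂ (GeomCycle.path γ) :=
    admissible_arcPath h (decays_add_two_pi h)
  have hmom := hasMoments_cmom hA hadm (by simp)
  have hres : ∀ (x₀ : ℂ) (ρ : ℝ), 0 < ρ → ∀ᶠ x in 𝓝 (Fin.cons x₀ (pt θ₁ ρ) : Fin 2 → ℂ),
      (∀ j, n < j → cmom ![1, k * a, k * b] n (GeomCycle.path γ) j x = 0) ∧
      cmom ![1, k * a, k * b] n (GeomCycle.path γ) n x = 2 * Real.pi * Complex.I := by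
    intro x₀ ρ hρ
    filter_upwards [integrable_cmom_path hA hadm (p := (Fin.cons x₀ (pt θ₁ ρ) : Fin 2 → ℂ)) hρ rfl]
      with x hx
    refine cmom_loop (fun i => ?_) n φ hx
    fin_cases i
    · exact one_ne_zero
    · exact (by omega : k * a ≠ 0)
  refine ⟨γ, hadm, fun ρ hρ Φ hΦ => ?_, fun ρ hρ x₀ Φ hΦ => ?_⟩
  · obtain ⟨hX, -, hE⟩ := hmom (Fin.cons 0 (pt θ₁ ρ)) ρ hρ rfl
    rw [hΦ.unique hE]
    constructor
    · funext l
      rw [varpi_momGerm hk]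
      refine Subtype.ext (Germ.coe_eq.2 ?_)
      filter_upwards [(tendsto_cons_zero _).eventually hX.rel_three,
        (tendsto_cons_zero _).eventually (hres 0 ρ hρ)] with y hy hy'
      funext m
      show cmom ![1, k * a, k * b] n (GeomCycle.path γ) (k * (b * m) + l) (Fin.cons 0 y) / _ = 0
      rw [mom_eq_zero_of_ne hka.le rfl (fun j => (hy j).2.2.2) hy'.1, zero_div]
      intro m' hm'
      rw [hn] at hm'
      have hmod := congrArg (· % k) hm'
      have e1 : k * (b * m) + l + k * a * m' = l + k * (b * m + a * m') := by ring
      simp only [e1, Nat.add_mul_mod_self_left, Nat.mod_eq_of_lt r.2, Nat.mod_eq_of_lt l.2] at hmod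
      rw [e1, hmod] at hm'
      refine hq ⟨m', m, ?_⟩
      have := Nat.eq_of_mul_eq_mul_left hk (Nat.add_left_cancel hm')
      rw [this]
      ring
    · intro h0
      have h1 := evalCoeff_pd_momGerm hX n
      rw [h0, map_zero, map_zero, (hres 0 ρ hρ).self_of_nhds.2] at h1
      exact Complex.two_pi_I_ne_zero h1.symm
  · obtain ⟨hX, -, hE⟩ := hmom (Fin.cons x₀ (pt θ₁ ρ)) ρ hρ rfl
    rw [hΦ.unique hE]
    exact isPolySeries_of_mom hka.le (Nat.mul_pos hk (by omega)) hX (hres x₀ ρ hρ)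

/-- Substitute u^k for u in the radial integral. The hypothesis on N and N' says that β = -(N'+1)
and (β - r)/k = -(N+1) correspond to each other. -/
theorem cmom_ray_root {a b k : ℕ} (hk : 1 ≤ k) (N N' j : ℕ) (r : Fin k)
    (hN : N' + 1 + r = k * (N + 1)) (φ : ℝ) (y : Fin 1 → ℂ) :
    cmom ![1, k * a, k * b] (-(N' + 1 : ℂ)) (GeomCycle.ray (φ / k)) (k * j + r) (Fin.cons 0 y) =
      1 / k * cmom ![a, b] (-(N + 1 : ℂ)) (GeomCycle.ray φ) j y := by
  have hk0 : (k : ℂ) ≠ 0 := by exact_mod_cast (by omega : k ≠ 0)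
  have hkr : (0 : ℝ) < k := by exact_mod_cast hk
  set e := Complex.exp (φ * Complex.I) with he
  set e' := Complex.exp ((φ / k : ℝ) * Complex.I) with he'
  have hee : e' ^ k = e := by
    rw [he', he, ← Complex.exp_nat_mul]
    congr 1
    push_cast
    field_simp
  rw [cmom, cmom, mom, mom, weight_ray, weight_ray, ← he, ← he']
  have h1 : ∀ u : ℝ, Set.indicator (Set.Ioi (0 : ℝ)) (fun u : ℝ => (e' * u) ^ N' * e') u *
      (GeomCycle.ray (φ / k)).param u ^ (k * j + r) *
      Complex.exp (phase (trunc ![1, k * a, k * b]) (Fin.cons 0 y)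
        ((GeomCycle.ray (φ / k)).param u)) =
      Set.indicator (Set.Ioi (0 : ℝ)) (fun u : ℝ => (e' * u) ^ N' * e' * (e' * u) ^ (k * j + r) *
        Complex.exp (y 0 * (e' * u) ^ (k * a))) u := by
    intro u
    by_cases hu : u ∈ Set.Ioi (0 : ℝ)
    · rw [Set.indicator_of_mem hu, Set.indicator_of_mem hu, param_ray_of_pos _ hu,
        phase_trunc_three, Fin.cons_zero, zero_mul, zero_add]
      rfl
    · rw [Set.indicator_of_notMem hu, Set.indicator_of_notMem hu, zero_mul, zero_mul]
  have h2 : ∀ u : ℝ, Set.indicator (Set.Ioi (0 : ℝ)) (fun u : ℝ => (e * u) ^ N * e) u *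
      (GeomCycle.ray φ).param u ^ j *
      Complex.exp (phase (trunc ![a, b]) y ((GeomCycle.ray φ).param u)) =
      Set.indicator (Set.Ioi (0 : ℝ)) (fun u : ℝ => (e * u) ^ N * e * (e * u) ^ j *
        Complex.exp (y 0 * (e * u) ^ a)) u := by
    intro u
    by_cases hu : u ∈ Set.Ioi (0 : ℝ)
    · rw [Set.indicator_of_mem hu, Set.indicator_of_mem hu, param_ray_of_pos _ hu,
        phase_trunc_two]
    · rw [Set.indicator_of_notMem hu, Set.indicator_of_notMem hu, zero_mul, zero_mul]
  simp only [h1, h2]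
  rw [integral_indicator measurableSet_Ioi, integral_indicator measurableSet_Ioi,
    ← integral_comp_rpow_Ioi_of_pos (g := fun u : ℝ => (e * u) ^ N * e * (e * u) ^ j *
      Complex.exp (y 0 * (e * u) ^ a)) hkr, ← integral_const_mul]
  refine setIntegral_congr_fun measurableSet_Ioi fun u hu => ?_
  have hu0 : (0 : ℝ) < u := hu
  have h3 : ((u ^ (k : ℝ) : ℝ) : ℂ) = (u : ℂ) ^ k := by rw [Real.rpow_natCast]; push_cast; rfl
  have h4 : ((u ^ ((k : ℝ) - 1) : ℝ) : ℂ) * u = (u : ℂ) ^ k := by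
    rw [← h3, ← Complex.ofReal_mul, ← Real.rpow_add_one hu0.ne', sub_add_cancel]
  have hu1 : (u : ℂ) ≠ 0 := by exact_mod_cast hu0.ne'
  simp only [h3, Complex.real_smul]
  rw [← hee, ← mul_pow, pow_mul]
  have h5 : (e' * (u : ℂ)) ^ N' * e' * (e' * u) ^ (k * j + (r : ℕ)) * u =
      (e' * u) ^ (k * (N + 1) + k * j) := by
    rw [← hN]
    ring
  have h6 : 1 / (k : ℂ) * (((k : ℝ) * u ^ ((k : ℝ) - 1) : ℝ) : ℂ) * u * (e' ^ k) = (e' * u) ^ k := by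
    push_cast
    rw [mul_pow, ← h4]
    field_simp
  refine mul_right_cancel₀ hu1 ?_
  calc _ = ((e' * (u : ℂ)) ^ N' * e' * (e' * u) ^ (k * j + (r : ℕ)) * u) *
        Complex.exp (y 0 * ((e' * u) ^ k) ^ a) := by ring
    _ = ((e' * u) ^ k) ^ N * (e' * u) ^ k * ((e' * u) ^ k) ^ j *
        Complex.exp (y 0 * ((e' * u) ^ k) ^ a) := by rw [h5]; ring
    _ = _ := by rw [← h6]; ring

/-- A Gevrey solution given by moments vanishes everywhere over a half line if it vanishes at one
point. -/
theorem momGerm_eq_zero_of_pt {a b : ℕ} {β : ℂ} {θ ρ₁ ρ₂ : ℝ} {N : ℕ → (Fin 1 → ℂ) → ℂ}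
    (ha : 1 ≤ a) (hN : ∀ ρ : ℝ, 0 < ρ → IsMom ![a, b] β Set.univ (pt θ ρ) N) (h₁ : 0 < ρ₁)
    (h₂ : 0 < ρ₂) (h0 : momGerm (hN ρ₁ h₁) (isStable_univ _) = 0) :
    ∀ᶠ y in 𝓝 (pt θ ρ₂), ∀ m, N (b * m) y = 0 := by
  have ha0 : (a : ℂ) ≠ 0 := by exact_mod_cast (by omega : a ≠ 0)
  have hzero : ∀ m, N (b * m) (pt θ ρ₁) = 0 := by
    intro m
    have h1 := Germ.coe_eq.1 (Subtype.ext_iff.1 h0)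
    have h2 : N (b * m) (pt θ ρ₁) / (m.factorial : ℂ) = 0 := congrFun h1.self_of_nhds m
    exact (div_eq_zero_iff.1 h2).resolve_right (by exact_mod_cast m.factorial_ne_zero)
  have heuler : ∀ p : Fin 1 → ℂ, IsMom ![a, b] β Set.univ p N → ∀ᶠ y in 𝓝 p, ∀ j,
      DifferentiableAt ℂ (N j) y ∧
      y 0 * fderiv ℂ (N j) y (Pi.single 0 1) = (-(j - β) / a) * N j y := by
    intro p hp
    filter_upwards [hp] with y hy j
    obtain ⟨h1, h2, h3⟩ := hy j trivial
    refine ⟨h1.differentiableAt, ?_⟩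
    rw [h2]
    simp only [Fin.sum_univ_one] at h3
    have e : (![a, b] : Fin 2 → ℕ) (Fin.castSucc 0) = a := rfl
    simp only [e] at h3 ⊢
    field_simp
    linear_combination h3
  have hline : ∀ m, N (b * m) (pt θ ρ₂) = 0 := by
    intro m
    have hseg : ∀ t : ℝ, pt θ ρ₁ + (t : ℂ) • (pt θ ρ₂ - pt θ ρ₁) = pt θ (ρ₁ + t * (ρ₂ - ρ₁)) := by
      intro t
      funext i
      simp only [pt, Pi.add_apply, Pi.smul_apply, Pi.sub_apply, smul_eq_mul]
      push_cast
      ring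
    have hpos : ∀ t ∈ Set.Icc (0 : ℝ) 1, 0 < ρ₁ + t * (ρ₂ - ρ₁) := by
      rintro t ⟨ht0, ht1⟩
      rcases ht0.eq_or_lt with rfl | ht
      · simpa using h₁
      · nlinarith [mul_pos ht h₂, mul_nonneg (sub_nonneg.2 ht1) h₁.le]
    refine eq_zero_of_euler_segment (p := pt θ ρ₁) (κ := -((b * m : ℕ) - β) / a) ?_ ?_ ?_ (hzero m)
    · intro t ht
      rw [hseg]
      exact pt_ne_zero (hpos t ht) 0
    · intro t ht
      rw [hseg]
      exact ((heuler _ (hN _ (hpos t ht))).self_of_nhds _).1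
    · intro t ht
      rw [hseg]
      exact ((heuler _ (hN _ (hpos t ht))).self_of_nhds _).2
  have hne : ∀ᶠ y : Fin 1 → ℂ in 𝓝 (pt θ ρ₂), y 0 ≠ 0 :=
    (continuous_apply 0).continuousAt.eventually_ne (pt_ne_zero h₂ 0)
  obtain ⟨r, hr, hball⟩ := Metric.eventually_nhds_iff_ball.1 (hne.and (heuler _ (hN ρ₂ h₂)))
  filter_upwards [Metric.ball_mem_nhds _ hr] with y hy m
  have hb := fun t (ht : t ∈ Set.Icc (0 : ℝ) 1) =>
    hball _ (segment_mem_ball (Metric.mem_ball_self hr) hy ht)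
  exact eq_zero_of_euler_segment (fun t ht => (hb t ht).1)
    (fun t ht => ((hb t ht).2 (b * m)).1) (fun t ht => ((hb t ht).2 (b * m)).2) (hline m)

end Hypergeo

namespace Hypergeo

/-! ### Existence of lifted families -/

theorem HasMoments.zero {n : ℕ} (A : Fin (n + 2) → ℕ) (β : ℂ) (θ₁ θ₂ : ℝ) :
    HasMoments A β θ₁ θ₂ 0 fun _ _ => 0 := by
  have h := HasMoments.sum (A := A) (β := β) (θ₁ := θ₁) (θ₂ := θ₂) (ι := Empty) Finset.univ
    (fun _ => 0) (C := fun _ => 0) (M := fun _ _ _ => 0) fun i => i.elim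
  simpa using h

section
variable {a b k : ℕ} {β : ℂ} {θ₁ θ₂ : ℝ} {γ : Fin a → Fin k → GeomCycle}

theorem varpi_eq_single_of_hasMoments (hk : 1 ≤ k) {r : Fin k} {c : GeomCycle} {z : ℂ}
    {C : GeomCycle →₀ ℂ} {M : ℕ → (Fin 2 → ℂ) → ℂ} {N : ℕ → (Fin 1 → ℂ) → ℂ}
    (hM : HasMoments ![1, k * a, k * b] β θ₁ θ₂ C M)
    (hN : HasMoments ![a, b] ((β - (r : ℕ)) / k) θ₁ θ₂ (Finsupp.single c 1) N)
    {ρ : ℝ} (hρ : 0 < ρ)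
    (hr : ∀ᶠ y in 𝓝 (pt θ₁ ρ), ∀ j, M (k * (b * j) + r) (Fin.cons 0 y) = z * N (b * j) y)
    (h0 : ∀ l, l ≠ r → ∀ᶠ y in 𝓝 (pt θ₁ ρ), ∀ j, M (k * (b * j) + (l : ℕ)) (Fin.cons 0 y) = 0)
    {Φ : HolGerm (pt θ₁ ρ)} {Φt : HolGerm (Fin.cons 0 (pt θ₁ ρ) : Fin 2 → ℂ)}
    (hΦ : HasExpansion ![a, b] ((β - (r : ℕ)) / k) θ₂ (Finsupp.single c 1) Φ)
    (hΦt : HasExpansion ![1, k * a, k * b] β θ₂ C Φt) :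
    varpi k (pt θ₁ ρ) Φt = Pi.single r (z • Φ) := by
  obtain ⟨hX, -, hE⟩ := hM (Fin.cons 0 (pt θ₁ ρ)) ρ hρ rfl
  obtain ⟨hY, -, hF⟩ := hN (pt θ₁ ρ) ρ hρ rfl
  rw [hΦt.unique hE, hΦ.unique hF]
  exact varpi_eq_single hk hX hY hr h0

/-- The data of a lift of one path. -/
def IsPathLift (a b k : ℕ) (β : ℂ) (θ₁ θ₂ : ℝ) (w : LogPath) (r : Fin k) (C : GeomCycle →₀ ℂ)
    (M : ℕ → (Fin 2 → ℂ) → ℂ) : Prop :=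
  (∀ c ∈ C.support, Admissible ![1, k * a, k * b] β θ₁ θ₂ c) ∧
  C ∈ Submodule.span ℂ
    {C | ∃ w' : LogPath, IsRoot k w w' ∧ C = Finsupp.single (GeomCycle.path w') 1} ∧
  ∀ (j : ℕ) (l : Fin k) (y : Fin 1 → ℂ), M (k * j + l) (Fin.cons 0 y) = if l = r then
    1 / k * cmom ![a, b] ((β - (r : ℕ)) / k) (GeomCycle.path w) j y else 0

/-- Stated for all pairs so that the choices can be made at once. The value 0 at a half line is a
placeholder: later it is replaced or occurs with coefficient zero. -/
theorem exists_pathLift (hab : a < b) (hk : 1 ≤ k) (hka : 1 < k * a)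
    (hγ : IsBasicFamily a b k β θ₁ θ₂ γ) (τ : Fin a) (r : Fin k) :
    ∃ (C : GeomCycle →₀ ℂ) (M : ℕ → (Fin 2 → ℂ) → ℂ),
      HasMoments ![1, k * a, k * b] β θ₁ θ₂ C M ∧
      ∀ w, γ τ r = GeomCycle.path w → IsPathLift a b k β θ₁ θ₂ w r C M := by
  have hadm := hγ.1 τ r
  cases hc : γ τ r with
  | path w =>
    rw [hc] at hadm
    obtain ⟨C, M, h1, h2, h3, h4⟩ := exists_root_combination hab hk hka hadm
    refine ⟨C, M, h1, fun w' hw' => ?_⟩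
    obtain rfl : w = w' := by injection hw'
    exact ⟨h2, h3, h4⟩
  | ray φ => exact ⟨0, _, HasMoments.zero _ _ _ _, fun w hw => by cases hw⟩

theorem IsPathLift.varpi_eq (hab : a < b) (hk : 1 ≤ k) (hka : 1 < k * a) {w : LogPath} {r : Fin k}
    {C : GeomCycle →₀ ℂ} {M : ℕ → (Fin 2 → ℂ) → ℂ} (h : IsPathLift a b k β θ₁ θ₂ w r C M)
    (hM : HasMoments ![1, k * a, k * b] β θ₁ θ₂ C M)
    (hw : Admissible ![a, b] ((β - (r : ℕ)) / k) θ₁ θ₂ (GeomCycle.path w)) {ρ : ℝ} (hρ : 0 < ρ)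
    {Φ : HolGerm (pt θ₁ ρ)} {Φt : HolGerm (Fin.cons 0 (pt θ₁ ρ) : Fin 2 → ℂ)}
    (hΦ : HasExpansion ![a, b] ((β - (r : ℕ)) / k) θ₂ (Finsupp.single (GeomCycle.path w) 1) Φ)
    (hΦt : HasExpansion ![1, k * a, k * b] β θ₂ C Φt) :
    varpi k (pt θ₁ ρ) Φt = Pi.single r ((1 / (k : ℂ)) • Φ) := by
  have ha : 1 ≤ a := Nat.pos_of_ne_zero (by rintro rfl; simp at hka)
  refine varpi_eq_single_of_hasMoments hk hM
    (hasMoments_cmom (isRow_two ha hab) hw (by simp)) hρ ?_ ?_ hΦ hΦt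
  · exact Eventually.of_forall fun y j => by rw [h.2.2, if_pos rfl]
  · exact fun l hl => Eventually.of_forall fun y j => by rw [h.2.2, if_neg hl]

/-- There is at most one half line in a basic family. -/
theorem IsBasicFamily.ray_unique (hγ : IsBasicFamily a b k β θ₁ θ₂ γ) {τ₀ τ : Fin a} {r₀ r : Fin k}
    {φ₀ φ : ℝ} (h₀ : γ τ₀ r₀ = GeomCycle.ray φ₀) (h : γ τ r = GeomCycle.ray φ) :
    (τ, r) = (τ₀, r₀) := by
  have e₀ := hγ.1 τ₀ r₀
  have e := hγ.1 τ r
  rw [h₀] at e₀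
  rw [h] at e
  have hk : 1 ≤ k := by have := r.2; omega
  have hk0 : (k : ℂ) ≠ 0 := by exact_mod_cast (by omega : k ≠ 0)
  obtain ⟨N₀, hN₀, -⟩ := e₀.1
  obtain ⟨N, hN, -⟩ := e.1
  -- Both (β - r)/k and (β - r₀)/k are integers, so k divides r - r₀, and both are less than k.
  have hr : r = r₀ := by
    rw [div_eq_iff hk0] at hN hN₀
    have h1 : ((r : ℕ) : ℂ) - (r₀ : ℕ) = (N₀ - N) * k := by linear_combination hN₀ - hN
    have h2 : ((r : ℕ) : ℤ) - (r₀ : ℕ) = (N₀ - N) * k := by exact_mod_cast h1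
    have h3 := r.2
    have h4 := r₀.2
    refine Fin.ext ?_
    rcases lt_trichotomy (N₀ - N) 0 with hn | hn | hn
    · nlinarith
    · rw [hn] at h2
      omega
    · nlinarith
  subst hr
  rw [(hγ.2.1 r e.1).unique ⟨φ, h⟩ ⟨φ₀, h₀⟩]

theorem IsBasicFamily.exists_path (hγ : IsBasicFamily a b k β θ₁ θ₂ γ) {τ₀ : Fin a} {r₀ : Fin k}
    {φ₀ : ℝ} (h₀ : γ τ₀ r₀ = GeomCycle.ray φ₀) {τ : Fin a} {r : Fin k} (h : (τ, r) ≠ (τ₀, r₀)) :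
    ∃ w, γ τ r = GeomCycle.path w := by
  cases hc : γ τ r with
  | path w => exact ⟨w, rfl⟩
  | ray φ => exact absurd (hγ.ray_unique h₀ hc) h

end

/-! ### The lift of a half line for negative parameters -/

section
variable {a b k : ℕ} {β : ℂ} {θ₁ θ₂ : ℝ} {γ : Fin a → Fin k → GeomCycle}

/-- The lift of a half line, for negative `β`. -/
theorem exists_rayLift (hab : a < b) (hk : 1 ≤ k) (hka : 1 < k * a)
    (hγ : IsBasicFamily a b k β θ₁ θ₂ γ) {τ₀ : Fin a} {r₀ : Fin k} {φ : ℝ}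
    (h₀ : γ τ₀ r₀ = GeomCycle.ray φ) {N : ℕ} (hN : (β - (r₀ : ℕ)) / k = -(N + 1 : ℂ))
    {C : Fin a → Fin k → (GeomCycle →₀ ℂ)} {M : Fin a → Fin k → ℕ → (Fin 2 → ℂ) → ℂ}
    (hM : ∀ τ r, HasMoments ![1, k * a, k * b] β θ₁ θ₂ (C τ r) (M τ r))
    (hC : ∀ τ r w, γ τ r = GeomCycle.path w → IsPathLift a b k β θ₁ θ₂ w r (C τ r) (M τ r)) :
    ∃ (d : Fin a × Fin k → ℂ) (M' : ℕ → (Fin 2 → ℂ) → ℂ), (∀ i, i.2 = r₀ → d i = 0) ∧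
      Admissible ![1, k * a, k * b] β θ₁ θ₂ (GeomCycle.ray (φ / k)) ∧
      HasMoments ![1, k * a, k * b] β θ₁ θ₂
        (Finsupp.single (GeomCycle.ray (φ / k)) 1 + ∑ i, d i • C i.1 i.2) M' ∧
      ∀ ρ : ℝ, 0 < ρ → ∀ (Φ : HolGerm (pt θ₁ ρ))
        (Φt : HolGerm (Fin.cons 0 (pt θ₁ ρ) : Fin 2 → ℂ)),
        HasExpansion ![a, b] ((β - (r₀ : ℕ)) / k) θ₂ (Finsupp.single (γ τ₀ r₀) 1) Φ →
        HasExpansion ![1, k * a, k * b] β θ₂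
          (Finsupp.single (GeomCycle.ray (φ / k)) 1 + ∑ i, d i • C i.1 i.2) Φt →
        varpi k (pt θ₁ ρ) Φt = Pi.single r₀ ((1 / (k : ℂ)) • Φ) := by
  classical
  have ha : 1 ≤ a := Nat.pos_of_ne_zero (by rintro rfl; simp at hka)
  have hk0 : (k : ℂ) ≠ 0 := by exact_mod_cast (by omega : k ≠ 0)
  have hadm₀ := hγ.1 τ₀ r₀
  rw [h₀] at hadm₀
  -- Since r₀ < k, the parameter β = r₀ - k(N+1) is again a negative integer, so the root of the
  -- half line is admissible for (1, ka, kb) and needs no Taylor polynomial.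
  obtain ⟨N', hN'⟩ : ∃ N' : ℕ, N' + 1 + r₀ = k * (N + 1) := by
    refine ⟨k * (N + 1) - r₀ - 1, ?_⟩
    have := r₀.2
    have : k * 1 ≤ k * (N + 1) := Nat.mul_le_mul_left k (by omega)
    omega
  have hβ : β = -(N' + 1 : ℂ) := by
    have h1 : ((N' : ℂ) + 1 + (r₀ : ℕ)) = k * (N + 1) := by exact_mod_cast hN'
    rw [div_eq_iff hk0] at hN
    linear_combination hN + h1
  have hray : Admissible ![1, k * a, k * b] β θ₁ θ₂ (GeomCycle.ray (φ / k)) := by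
    refine ⟨⟨-(N' + 1), by rw [hβ]; push_cast; rfl, ?_⟩, ?_⟩
    · rintro ⟨l, hl⟩
      have h1 := Finset.sum_nonneg (s := Finset.univ)
        (f := fun j => ((![1, k * a, k * b] j : ℕ) : ℤ) * l j) fun j _ => by positivity
      rw [← hl] at h1
      omega
    · have := decays_div hk hadm₀.2 0
      simpa using this
  have hMray := hasMoments_cmom (isRow_three hab hk hka) hray fun _ _ => ⟨N', hβ⟩
  obtain ⟨Φ, hΦ, -, hspan⟩ := hγ.exists_expansions one_pos
  obtain ⟨hX, hg, hE⟩ := hMray (Fin.cons 0 (pt θ₁ 1)) 1 one_pos rfl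
  -- The root of the half line may have non-zero components in the other residue classes. Each of
  -- them is a solution for (a, b), hence a combination of the basic expansions; the coefficients
  -- are determined at the point with ρ = 1.
  have hcoef : ∀ l : Fin k, ∃ e : Fin a → ℂ, ∑ τ, e τ • Φ τ l =
      varpi k (pt θ₁ 1) (momGerm hX (isStable_univ _)) l := by
    intro l
    rw [← Submodule.mem_span_range_iff_exists_fun, hspan, varpi_momGerm hk]
    exact momGerm_mem_Sol _ _ (HasGrowth.restrict ha hk hg l) ha le_rfl
  choose e he using hcoef
  -- The factor k offsets the 1/k in the value of ϖ on lifted paths. The class r₀ needs no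
  -- correction, since there the half line already has the required moments.
  set d : Fin a × Fin k → ℂ := fun i => if i.2 = r₀ then 0 else -(k * e i.2 i.1) with hd
  have hd0 : ∀ i, i.2 = r₀ → d i = 0 := fun i hi => if_pos hi
  have hpath : ∀ i : Fin a × Fin k, i.2 ≠ r₀ → ∃ w, γ i.1 i.2 = GeomCycle.path w := fun i hi =>
    hγ.exists_path h₀ (fun h => hi (congrArg Prod.snd h))
  set M₁ : Option (Fin a × Fin k) → ℕ → (Fin 2 → ℂ) → ℂ := fun o =>
    o.elim (cmom ![1, k * a, k * b] β (GeomCycle.ray (φ / k))) fun i => M i.1 i.2 with hM₁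
  have hsum := HasMoments.sum Finset.univ (fun o : Option (Fin a × Fin k) => o.elim 1 d)
    (C := fun o => o.elim (Finsupp.single (GeomCycle.ray (φ / k)) 1) fun i => C i.1 i.2)
    (M := M₁) (A := ![1, k * a, k * b]) (β := β) (θ₁ := θ₁) (θ₂ := θ₂) (by
      rintro (_ | i)
      · exact hMray
      · exact hM i.1 i.2)
  simp only [Fintype.sum_option, Option.elim_none, Option.elim_some, one_smul, one_mul, hM₁] at hsum
  refine ⟨d, _, hd0, hray, hsum, fun ρ hρ Φ' Φt hΦ' hΦt => ?_⟩
  rw [h₀] at hΦ'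
  have hN2 := hasMoments_cmom (isRow_two ha hab) hadm₀ fun _ _ => ⟨N, hN⟩
  choose hXs _ hEs using fun (ρ : ℝ) (hρ : 0 < ρ) =>
    hsum (Fin.cons 0 (pt θ₁ ρ) : Fin 2 → ℂ) ρ hρ rfl
  refine varpi_eq_single_of_hasMoments hk hsum hN2 hρ ?_ ?_ hΦ' hΦt
  · refine Eventually.of_forall fun y j => ?_
    rw [Finset.sum_eq_zero, add_zero]
    · have := cmom_ray_root (a := a) (b := b) hk N N' (b * j) r₀ hN' φ y
      rw [← hβ, ← hN] at this
      exact this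
    · intro i _
      by_cases hi : i.2 = r₀
      · rw [hd0 i hi, zero_mul]
      · obtain ⟨w, hw⟩ := hpath i hi
        rw [(hC i.1 i.2 w hw).2.2 (b * j) r₀ y, if_neg (Ne.symm hi), mul_zero]
  · intro l hl
    have hN3 : ∀ ρ : ℝ, 0 < ρ → IsMom ![a, b] ((β - (l : ℕ)) / k) Set.univ (pt θ₁ ρ) _ :=
      fun ρ hρ => IsMom.restrict hk (hXs ρ hρ) l
    -- The correction was found at ρ = 1; the Euler equation carries the vanishing to all ρ, so one
    -- combination of cycles serves everywhere.
    refine momGerm_eq_zero_of_pt ha hN3 one_pos hρ ?_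
    rw [← varpi_momGerm hk (hXs 1 one_pos) l]
    have hgerm : momGerm (hXs 1 one_pos) (isStable_univ _) =
        momGerm hX (isStable_univ _) + ∑ i : Fin a × Fin k, d i •
          momGerm ((hM i.1 i.2) (Fin.cons 0 (pt θ₁ 1)) 1 one_pos rfl).1 (isStable_univ _) := by
      refine (hEs 1 one_pos).unique (hE.add (HasExpansion.sum _ fun i _ => ?_))
      exact ((hM i.1 i.2) (Fin.cons 0 (pt θ₁ 1)) 1 one_pos rfl).2.2
    rw [hgerm, map_add, map_sum, Pi.add_apply, ← he, Finset.sum_apply, Fintype.sum_prod_type,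
      ← Finset.sum_add_distrib]
    refine Finset.sum_eq_zero fun τ _ => ?_
    rw [Finset.sum_eq_single l]
    · obtain ⟨w, hw⟩ := hpath (τ, l) hl
      have hadm := hγ.1 τ l
      have hΦl := hΦ τ l
      rw [hw] at hadm hΦl
      rw [map_smul, (hC τ l w hw).varpi_eq hab hk hka (hM τ l) hadm one_pos hΦl
        ((hM τ l) (Fin.cons 0 (pt θ₁ 1)) 1 one_pos rfl).2.2, Pi.smul_apply, Pi.single_eq_same, hd]
      simp only
      rw [if_neg hl, smul_smul, neg_mul, mul_right_comm, mul_one_div_cancel hk0, one_mul, neg_smul,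
        add_neg_cancel]
    · intro l' _ hl'
      by_cases hr : l' = r₀
      · rw [hd0 (τ, l') hr, zero_smul, map_zero, Pi.zero_apply]
      · obtain ⟨w, hw⟩ := hpath (τ, l') hr
        have hadm := hγ.1 τ l'
        have hΦl := hΦ τ l'
        rw [hw] at hadm hΦl
        rw [map_smul, (hC τ l' w hw).varpi_eq hab hk hka (hM τ l') hadm one_pos hΦl
          ((hM τ l') (Fin.cons 0 (pt θ₁ 1)) 1 one_pos rfl).2.2, Pi.smul_apply,
          Pi.single_eq_of_ne hl'.symm, smul_zero]
    · simp

end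

end Hypergeo

namespace Hypergeo

/-! ### Assembly of the lifted families -/

section
variable {a b k : ℕ} {β : ℂ} {θ₁ θ₂ : ℝ} {γ : Fin a → Fin k → GeomCycle}

/-- A lift with the properties of its cycles. -/
structure IsGoodLift (a b k : ℕ) (β : ℂ) (θ₁ θ₂ : ℝ) (γ : Fin a → Fin k → GeomCycle)
    (γt : Fin a → Fin k → (GeomCycle →₀ ℂ)) (B : Fin a × Fin k → Prop) : Prop where
  isLift : IsLift a b k β θ₁ θ₂ γ γt B
  admissible : ∀ τ r, ∀ c ∈ (γt τ r).support, Admissible ![1, k * a, k * b] β θ₁ θ₂ c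
  mem_span : ∀ τ r w, γ τ r = GeomCycle.path w → γt τ r ∈ Submodule.span ℂ
    {C | ∃ w' : LogPath, IsRoot k w w' ∧ C = Finsupp.single (GeomCycle.path w') 1}
  ray : (∀ i, ¬ B i) → ∀ τ r φ, γ τ r = GeomCycle.ray φ →
    γt τ r - Finsupp.single (GeomCycle.ray (φ / k)) 1 ∈
      Submodule.span ℂ {C | ∃ τ' r', (τ', r') ≠ (τ, r) ∧ C = γt τ' r'}
  bad : ∀ τ r, B (τ, r) → (∃ q : ℕ, β = (r : ℕ) + k * q) ∧ ∀ ρ : ℝ, 0 < ρ → ∀ (x₀ : ℂ)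
    (Ψ : HolGerm (Fin.cons x₀ (pt θ₁ ρ) : Fin 2 → ℂ)),
    HasExpansion ![1, k * a, k * b] β θ₂ (γt τ r) Ψ → IsPolySeries Ψ

/-- All paths are lifted through their roots, and only the possible half line needs a choice. Its
parameter is a gap N with β = r₀ + kN. For N < 0 the corrected root of the half line works and there
is no exceptional pair. For N ≥ 0 the number β lies in the semigroup of (1, ka, kb), so half lines
are not admitted there; the loop replaces it, and the pair is exceptional. -/
theorem exists_isGoodLift (hab : a < b) (hk : 1 ≤ k) (hka : 1 < k * a)
    (hγ : IsBasicFamily a b k β θ₁ θ₂ γ) : ∃ γt B, IsGoodLift a b k β θ₁ θ₂ γ γt B := by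
  classical
  have hk0 : (k : ℂ) ≠ 0 := by exact_mod_cast (by omega : k ≠ 0)
  choose C M hM hC using exists_pathLift hab hk hka hγ
  have hgood : ∀ ρ : ℝ, 0 < ρ → ∀ (τ : Fin a) (r : Fin k) (w : LogPath),
      γ τ r = GeomCycle.path w → ∀ (Φ : HolGerm (pt θ₁ ρ))
      (Φt : HolGerm (Fin.cons 0 (pt θ₁ ρ) : Fin 2 → ℂ)),
      HasExpansion ![a, b] ((β - (r : ℕ)) / k) θ₂ (Finsupp.single (γ τ r) 1) Φ →
      HasExpansion ![1, k * a, k * b] β θ₂ (C τ r) Φt →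
      varpi k (pt θ₁ ρ) Φt = Pi.single r ((1 / (k : ℂ)) • Φ) := by
    intro ρ hρ τ r w hw Φ Φt hΦ hΦt
    have hadm := hγ.1 τ r
    rw [hw] at hadm hΦ
    exact (hC τ r w hw).varpi_eq hab hk hka (hM τ r) hadm hρ hΦ hΦt
  by_cases hray : ∃ τ₀ r₀ φ, γ τ₀ r₀ = GeomCycle.ray φ
  swap
  · have hpath : ∀ τ r, ∃ w, γ τ r = GeomCycle.path w := by
      intro τ r
      cases hc : γ τ r with
      | path w => exact ⟨w, rfl⟩
      | ray φ => exact absurd ⟨τ, r, φ, hc⟩ hray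
    refine ⟨C, fun _ => False, ⟨fun τ r => ⟨_, hM τ r⟩, fun ρ hρ τ r _ Φ Φt h1 h2 => ?_,
      fun _ _ _ _ h => h.elim, fun _ _ h => h.elim⟩, fun τ r => ?_,
      fun τ r w hw => (hC τ r w hw).2.1, fun _ τ r φ h => (hray ⟨τ, r, φ, h⟩).elim,
      fun _ _ h => h.elim⟩
    · obtain ⟨w, hw⟩ := hpath τ r
      exact hgood ρ hρ τ r w hw Φ Φt h1 h2
    · obtain ⟨w, hw⟩ := hpath τ r
      exact (hC τ r w hw).1
  obtain ⟨τ₀, r₀, φ, h₀⟩ := hray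
  have hadm₀ := hγ.1 τ₀ r₀
  rw [h₀] at hadm₀
  obtain ⟨N, hN, hNot⟩ := hadm₀.1
  have hpath : ∀ τ r, (τ, r) ≠ (τ₀, r₀) → ∃ w, γ τ r = GeomCycle.path w := fun τ r h =>
    hγ.exists_path h₀ h
  set γt : (GeomCycle →₀ ℂ) → Fin a → Fin k → (GeomCycle →₀ ℂ) := fun C₀ τ r =>
    if (τ, r) = (τ₀, r₀) then C₀ else C τ r with hγt
  have hself : ∀ C₀, γt C₀ τ₀ r₀ = C₀ := fun C₀ => if_pos rfl
  have hne : ∀ C₀ τ r, (τ, r) ≠ (τ₀, r₀) → γt C₀ τ r = C τ r := fun C₀ τ r h => if_neg h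
  have hadm : ∀ C₀ : GeomCycle →₀ ℂ,
      (∀ c ∈ C₀.support, Admissible ![1, k * a, k * b] β θ₁ θ₂ c) → ∀ τ r,
      ∀ c ∈ (γt C₀ τ r).support, Admissible ![1, k * a, k * b] β θ₁ θ₂ c := by
    intro C₀ h τ r
    by_cases hi : (τ, r) = (τ₀, r₀)
    · obtain ⟨rfl, rfl⟩ := Prod.mk.inj hi
      rwa [hself]
    · obtain ⟨w, hw⟩ := hpath τ r hi
      rw [hne _ _ _ hi]
      exact (hC τ r w hw).1
  have hspan : ∀ C₀ τ r w, γ τ r = GeomCycle.path w → γt C₀ τ r ∈ Submodule.span ℂ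
      {C | ∃ w' : LogPath, IsRoot k w w' ∧ C = Finsupp.single (GeomCycle.path w') 1} := by
    intro C₀ τ r w hw
    have hi : (τ, r) ≠ (τ₀, r₀) := by
      intro hi
      obtain ⟨rfl, rfl⟩ := Prod.mk.inj hi
      rw [h₀] at hw
      cases hw
    rw [hne _ _ _ hi]
    exact (hC τ r w hw).2.1
  have hmom : ∀ C₀ M₀, HasMoments ![1, k * a, k * b] β θ₁ θ₂ C₀ M₀ → ∀ τ r, ∃ M,
      HasMoments ![1, k * a, k * b] β θ₁ θ₂ (γt C₀ τ r) M := by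
    intro C₀ M₀ h τ r
    by_cases hi : (τ, r) = (τ₀, r₀)
    · obtain ⟨rfl, rfl⟩ := Prod.mk.inj hi
      exact ⟨M₀, by rwa [hself]⟩
    · exact ⟨M τ r, by rw [hne _ _ _ hi]; exact hM τ r⟩
  rcases lt_or_ge N 0 with hneg | hpos
  · obtain ⟨n, rfl⟩ : ∃ n : ℕ, N = -(n + 1) := ⟨(-N - 1).toNat, by omega⟩
    push_cast at hN
    obtain ⟨d, M', hd, hadm', hM', hval⟩ := exists_rayLift hab hk hka hγ h₀ hN hM hC
    set C₀ : GeomCycle →₀ ℂ := Finsupp.single (GeomCycle.ray (φ / k)) 1 +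
      ∑ i : Fin a × Fin k, d i • C i.1 i.2 with hC₀
    have hdi : ∀ i : Fin a × Fin k, d i ≠ 0 → i ≠ (τ₀, r₀) := by
      rintro i hi rfl
      exact hi (hd _ rfl)
    refine ⟨γt C₀, fun _ => False, ⟨hmom _ _ hM', fun ρ hρ τ r _ Φ Φt h1 h2 => ?_,
      fun _ _ _ _ h => h.elim, fun _ _ h => h.elim⟩, hadm _ ?_, hspan _, ?_, fun _ _ h => h.elim⟩
    · by_cases hi : (τ, r) = (τ₀, r₀)
      · obtain ⟨rfl, rfl⟩ := Prod.mk.inj hi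
        rw [hself] at h2
        exact hval ρ hρ Φ Φt h1 h2
      · obtain ⟨w, hw⟩ := hpath τ r hi
        rw [hne _ _ _ hi] at h2
        exact hgood ρ hρ τ r w hw Φ Φt h1 h2
    · intro c hc
      rcases Finset.mem_union.1 (Finsupp.support_add hc) with hc | hc
      · have := Finsupp.support_single_subset hc
        rw [Finset.mem_singleton] at this
        rw [this]
        exact hadm'
      · obtain ⟨i, -, hi⟩ := Finset.mem_biUnion.1 (Finsupp.support_finsetSum hc)
        have hdi0 : d i ≠ 0 := by
          intro h
          rw [h, zero_smul] at hi
          simp at hi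
        obtain ⟨w, hw⟩ := hpath i.1 i.2 (hdi i hdi0)
        exact (hC _ _ w hw).1 c (Finsupp.support_smul hi)
    · intro _ τ r φ' h
      have hi := hγ.ray_unique h₀ h
      obtain ⟨rfl, rfl⟩ := Prod.mk.inj hi
      rw [h₀] at h
      obtain rfl : φ = φ' := by injection h
      rw [hself, hC₀, add_sub_cancel_left]
      refine Submodule.sum_mem _ fun i _ => ?_
      by_cases hi : d i = 0
      · rw [hi, zero_smul]
        exact Submodule.zero_mem _
      · refine Submodule.smul_mem _ _ (Submodule.subset_span ⟨i.1, i.2, hdi i hi, ?_⟩)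
        rw [hne _ _ _ (hdi i hi)]
  · obtain ⟨q, rfl⟩ : ∃ q : ℕ, N = q := ⟨N.toNat, by omega⟩
    have hβ : β = (r₀ : ℕ) + k * q := by
      rw [div_eq_iff hk0] at hN
      push_cast at hN
      linear_combination hN
    have hq : ¬ ∃ l m : ℕ, q = a * l + b * m := by
      rintro ⟨l, m, h⟩
      refine hNot ⟨![l, m], Eq.trans ?_ (Fin.sum_univ_two _).symm⟩
      show (q : ℤ) = a * l + b * m
      exact_mod_cast h
    have hdec := decays_div hk hadm₀.2 0
    obtain ⟨w, hadm', hker, hpoly⟩ := exists_loop hab hk hka hdec hβ hq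
    have hM' := hasMoments_cmom (isRow_three hab hk hka) hadm' (by simp)
    refine ⟨γt (Finsupp.single (GeomCycle.path w) 1), fun i => i = (τ₀, r₀), ⟨hmom _ _ hM',
      fun ρ hρ τ r hi Φ Φt h1 h2 => ?_, fun ρ hρ τ r hi Φt h => ?_,
      fun _ _ h h' => h.trans h'.symm⟩, hadm _ ?_, hspan _, fun h => (h _ rfl).elim, ?_⟩
    · obtain ⟨w, hw⟩ := hpath τ r hi
      rw [hne _ _ _ hi] at h2
      exact hgood ρ hρ τ r w hw Φ Φt h1 h2
    · obtain ⟨rfl, rfl⟩ := Prod.mk.inj hi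
      rw [hself] at h
      exact hker ρ hρ Φt h
    · intro c hc
      have := Finsupp.support_single_subset hc
      rw [Finset.mem_singleton] at this
      rw [this]
      exact hadm'
    · intro τ r hi
      obtain ⟨rfl, rfl⟩ := Prod.mk.inj hi
      exact ⟨⟨q, hβ⟩, fun ρ hρ x₀ Ψ h => hpoly ρ hρ x₀ Ψ (by rwa [hself] at h)⟩

end

end Hypergeo

namespace Hypergeo

/-! ### Directions of decay -/

/-- The centre of the `j`-th sector on which `x t^a` has negative real part, for `x` of argument
`θ`. -/
noncomputable def sectorCentre (θ : ℝ) (a : ℕ) (j : ℕ) : ℝ := (Real.pi * (2 * j + 1) - θ) / a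

theorem add_mul_sectorCentre (θ : ℝ) {a : ℕ} (ha : 1 ≤ a) (j : ℕ) :
    θ + a * sectorCentre θ a j = Real.pi * (2 * j + 1) := by
  have ha0 : (a : ℝ) ≠ 0 := by exact_mod_cast (by omega : a ≠ 0)
  rw [sectorCentre]
  field_simp
  ring

theorem sectorCentre_eq (θ : ℝ) {a : ℕ} (ha : 1 ≤ a) (j : ℕ) :
    sectorCentre θ a j = sectorCentre θ a 0 + j * (2 * Real.pi / a) := by
  have ha0 : (a : ℝ) ≠ 0 := by exact_mod_cast (by omega : a ≠ 0)
  simp only [sectorCentre]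
  push_cast
  field_simp
  ring

theorem cos_sector (θ : ℝ) {a : ℕ} (ha : 1 ≤ a) (j : ℕ) (y : ℝ) :
    Real.cos (θ + a * y) = -Real.cos (a * (y - sectorCentre θ a j)) := by
  have h := add_mul_sectorCentre θ ha j
  have e : θ + a * y = a * (y - sectorCentre θ a j) + Real.pi + j * (2 * Real.pi) := by
    linear_combination h
  rw [e, Real.cos_add_nat_mul_two_pi, Real.cos_add_pi]

/-- At the centre of a sector the phase of the a-term is ideal and that of the b-term is off by some
δ with |δ| ≤ π. Moving by κδ/b with κ = b/(a+b) shares the defect equally: both phases are then off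
by a|δ|/(a+b), which is less than π/2 because a < b. -/
theorem exists_direction {a b : ℕ} (ha : 1 ≤ a) (hab : a < b) (θ₁ θ₂ : ℝ) (j : ℕ) :
    ∃ φ, a * |φ - sectorCentre θ₁ a j| < Real.pi / 2 ∧ Decays ![a, b] θ₁ θ₂ φ := by
  have ha0 : (0 : ℝ) < a := by exact_mod_cast ha
  have hab' : (a : ℝ) < b := by exact_mod_cast hab
  have hb0 : (0 : ℝ) < b := ha0.trans hab'
  have hpi := Real.pi_pos
  set ψ := sectorCentre θ₁ a j with hψ
  set X := θ₂ + b * ψ with hX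
  set m := round ((X - Real.pi) / (2 * Real.pi)) with hm
  set δ : ℝ := (2 * m + 1) * Real.pi - X with hδ
  have hδ' : |δ| ≤ Real.pi := by
    have h := abs_sub_round ((X - Real.pi) / (2 * Real.pi))
    rw [← hm] at h
    have e : δ = -(2 * Real.pi) * ((X - Real.pi) / (2 * Real.pi) - m) := by
      rw [hδ]
      field_simp
      ring
    rw [e, abs_mul, abs_neg, abs_of_pos (by positivity : 0 < 2 * Real.pi)]
    nlinarith
  set κ : ℝ := b / (a + b) with hκ
  have hκ0 : 0 < κ := by positivity
  have hκ1 : 1 - κ = a / (a + b) := by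
    rw [hκ]
    field_simp
    ring
  have hκa : a * κ / b < 1 / 2 := by
    rw [hκ]
    have : a * (b / (a + b)) / b = (a : ℝ) / (a + b) := by field_simp
    rw [this, div_lt_div_iff₀ (by positivity) (by norm_num)]
    linarith
  have hκ2 : 0 < 1 - κ ∧ 1 - κ < 1 / 2 := by
    rw [hκ1, div_lt_div_iff₀ (by positivity) (by norm_num)]
    exact ⟨by positivity, by linarith⟩
  have h1 : a * |κ * δ / b| < Real.pi / 2 := by
    rw [abs_div, abs_mul, abs_of_pos hκ0, abs_of_pos hb0]
    calc a * (κ * |δ| / b) = a * κ / b * |δ| := by ring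
      _ ≤ a * κ / b * Real.pi := by gcongr
      _ < 1 / 2 * Real.pi := by gcongr
      _ = _ := by ring
  refine ⟨ψ + κ * δ / b, by rwa [add_sub_cancel_left], ?_, ?_⟩
  · show Real.cos (θ₁ + a * (ψ + κ * δ / b)) < 0
    rw [cos_sector θ₁ ha j, ← hψ, add_sub_cancel_left, neg_lt_zero, ← Real.cos_abs, abs_mul,
      abs_of_pos ha0]
    exact Real.cos_pos_of_mem_Ioo ⟨by linarith [mul_nonneg ha0.le (abs_nonneg (κ * δ / b))], h1⟩
  · show Real.cos (θ₂ + b * (ψ + κ * δ / b)) < 0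
    have e : θ₂ + b * (ψ + κ * δ / b) = -((1 - κ) * δ) + Real.pi + m * (2 * Real.pi) := by
      have : b * (ψ + κ * δ / b) = b * ψ + κ * δ := by field_simp
      rw [this]
      linear_combination hδ + hX
    rw [e, Real.cos_add_int_mul_two_pi, Real.cos_add_pi, Real.cos_neg, neg_lt_zero,
      ← Real.cos_abs, abs_mul, abs_of_pos hκ2.1]
    refine Real.cos_pos_of_mem_Ioo ⟨by nlinarith [abs_nonneg δ], ?_⟩
    nlinarith [abs_nonneg δ]

/-! ### The integrals between two sectors -/

/-- The integrand `e^(sw) exp (x e^(aw))`. -/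
noncomputable def expIntegrand (a : ℕ) (s x w : ℂ) : ℂ :=
  Complex.exp (s * w) * Complex.exp (x * Complex.exp w ^ a)

theorem differentiable_expIntegrand (a : ℕ) (s x : ℂ) : Differentiable ℂ (expIntegrand a s x) := by
  unfold expIntegrand
  fun_prop

theorem norm_expIntegrand (a : ℕ) (s : ℂ) (ρ θ : ℝ) (w : ℂ) :
    ‖expIntegrand a s (ρ * Complex.exp (θ * Complex.I)) w‖ = Real.exp (s * w).re *
      Real.exp (ρ * (Real.exp w.re ^ a * Real.cos (θ + a * w.im))) := by
  rw [expIntegrand, norm_mul, Complex.norm_exp, Complex.norm_exp]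
  congr 2
  have e : (ρ * Complex.exp (θ * Complex.I)) * Complex.exp w ^ a =
      (ρ : ℂ) * (Complex.exp w ^ a * Complex.exp (θ * Complex.I)) := by ring
  rw [e, Complex.re_ofReal_mul, re_exp_pow, Complex.norm_exp]

theorem exists_bound_expIntegrand {a : ℕ} (ha : 1 ≤ a) (s : ℂ) {ρ θ η : ℝ} (hρ : 0 < ρ) (hη : 0 < η)
    (B : ℝ) : ∃ C, ∀ w : ℂ, 0 ≤ w.re → |w.im| ≤ B → Real.cos (θ + a * w.im) ≤ -η →
      ‖expIntegrand a s (ρ * Complex.exp (θ * Complex.I)) w‖ ≤ C * Real.exp (-w.re) := by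
  obtain ⟨K, hK, h⟩ := pow_mul_exp_le ha (mul_pos hρ hη)
  -- With j > ‖s‖ + 1 the factor e^(j Re w) dominates |e^(sw)| and leaves a spare e^(-Re w).
  obtain ⟨j, hj⟩ := exists_nat_gt (‖s‖ + 1)
  refine ⟨Real.exp (‖s‖ * B) * (K ^ j * (j.factorial : ℝ) ^ (1 / a : ℝ)), fun w hw hB hc => ?_⟩
  rw [norm_expIntegrand]
  have h1 : (s * w).re ≤ ‖s‖ * B + (j * w.re - w.re) := by
    calc (s * w).re ≤ ‖s * w‖ := Complex.re_le_norm _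
      _ = ‖s‖ * ‖w‖ := norm_mul _ _
      _ ≤ ‖s‖ * (w.re + B) := by
        gcongr
        refine (Complex.norm_le_abs_re_add_abs_im w).trans ?_
        rw [abs_of_nonneg hw]
        gcongr
      _ ≤ _ := by nlinarith
  have h2 := h j (Real.exp w.re) (Real.exp_pos _).le
  calc Real.exp (s * w).re * Real.exp (ρ * (Real.exp w.re ^ a * Real.cos (θ + a * w.im)))
      ≤ Real.exp (‖s‖ * B + (j * w.re - w.re)) * Real.exp (-(ρ * η) * Real.exp w.re ^ a) := by
        refine mul_le_mul (Real.exp_le_exp.2 h1) (Real.exp_le_exp.2 ?_) (by positivity)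
          (by positivity)
        have : 0 < ρ * Real.exp w.re ^ a := by positivity
        nlinarith
    _ = Real.exp (‖s‖ * B) * (Real.exp w.re ^ j * Real.exp (-(ρ * η) * Real.exp w.re ^ a)) *
        Real.exp (-w.re) := by
        rw [Real.exp_add, sub_eq_add_neg, Real.exp_add, Real.exp_nat_mul]
        ring
    _ ≤ _ := by gcongr

theorem norm_sub_le_of_vertical {F G : ℂ → ℂ} (hG : ∀ w, HasDerivAt G (F w) w) {R φ ψ D : ℝ}
    (hD : ∀ y ∈ Set.uIcc φ ψ, ‖F (R + y * Complex.I)‖ ≤ D) :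
    ‖G (R + φ * Complex.I) - G (R + ψ * Complex.I)‖ ≤ D * |φ - ψ| := by
  refine Convex.norm_image_sub_le_of_norm_hasDerivWithin_le (s := Set.uIcc φ ψ)
    (f := fun y : ℝ => G (R + y * Complex.I)) (f' := fun y : ℝ => F (R + y * Complex.I) * Complex.I)
    (fun y _ => HasDerivAt.hasDerivWithinAt ?_) (fun y hy => ?_) (convex_uIcc _ _)
    Set.right_mem_uIcc Set.left_mem_uIcc
  · have h : HasDerivAt (fun y : ℝ => (R : ℂ) + y * Complex.I) Complex.I y := by
      simpa using ((Complex.ofRealCLM.hasDerivAt (x := y)).mul_const Complex.I).const_add (R : ℂ)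
    exact (hG _).comp_of_eq y h rfl
  · rw [norm_mul, Complex.norm_I, mul_one]
    exact hD y hy

theorem abs_le_of_mem_uIcc {φ ψ y : ℝ} (hy : y ∈ Set.uIcc φ ψ) : |y| ≤ |φ| + |ψ| := by
  have h1 := neg_abs_le φ
  have h2 := neg_abs_le ψ
  have h3 := le_abs_self φ
  have h4 := le_abs_self ψ
  have h5 := abs_nonneg φ
  have h6 := abs_nonneg ψ
  rcases Set.mem_uIcc.1 hy with ⟨h, h'⟩ | ⟨h, h'⟩ <;> rw [abs_le] <;> constructor <;> linarith

/-- On a vertical segment of real part R inside one sector the integrand is O(e^(-R)), so the end of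
a path can be moved within its sector without changing the integral. -/
theorem tendsto_vertical_atTop {a : ℕ} (ha : 1 ≤ a) (s : ℂ) {ρ θ η φ ψ : ℝ} (hρ : 0 < ρ)
    (hη : 0 < η) (hc : ∀ y ∈ Set.uIcc φ ψ, Real.cos (θ + a * y) ≤ -η) {G : ℂ → ℂ}
    (hG : ∀ w, HasDerivAt G (expIntegrand a s (ρ * Complex.exp (θ * Complex.I)) w) w) :
    Tendsto (fun R : ℝ => G (R + φ * Complex.I) - G (R + ψ * Complex.I)) atTop (𝓝 0) := by
  obtain ⟨C, hC⟩ := exists_bound_expIntegrand (θ := θ) ha s hρ hη (|φ| + |ψ|)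
  have hlim : Tendsto (fun R : ℝ => C * Real.exp (-R) * |φ - ψ|) atTop (𝓝 0) := by
    have := ((Real.tendsto_exp_neg_atTop_nhds_zero).const_mul C).mul_const |φ - ψ|
    simpa using this
  refine squeeze_zero_norm' ?_ hlim
  filter_upwards [eventually_ge_atTop 0] with R hR
  refine norm_sub_le_of_vertical hG fun y hy => ?_
  have := hC (R + y * Complex.I) (by simpa using hR) (by simpa using abs_le_of_mem_uIcc hy)
    (by simpa using hc y hy)
  simpa using this

theorem exists_cos_le_of_near (θ : ℝ) {a : ℕ} (ha : 1 ≤ a) (j : ℕ) {φ : ℝ}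
    (h : a * |φ - sectorCentre θ a j| < Real.pi / 2) :
    ∃ η > 0, ∀ y ∈ Set.uIcc φ (sectorCentre θ a j), Real.cos (θ + a * y) ≤ -η := by
  have ha0 : (0 : ℝ) < a := by exact_mod_cast ha
  have h0 : 0 ≤ a * |φ - sectorCentre θ a j| := by positivity
  refine ⟨Real.cos (a * |φ - sectorCentre θ a j|),
    Real.cos_pos_of_mem_Ioo ⟨by linarith [Real.pi_pos], h⟩, fun y hy => ?_⟩
  rw [cos_sector θ ha j, neg_le_neg_iff, ← Real.cos_abs (a * (y - _)), abs_mul, abs_of_pos ha0]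
  refine Real.cos_le_cos_of_nonneg_of_le_pi (by positivity) (by linarith [Real.pi_pos]) ?_
  refine mul_le_mul_of_nonneg_left ?_ ha0.le
  rcases Set.mem_uIcc.1 hy with ⟨h1, h2⟩ | ⟨h1, h2⟩
  · rw [abs_of_nonpos (by linarith), abs_of_nonpos (by linarith)]
    linarith
  · rw [abs_of_nonneg (by linarith), abs_of_nonneg (by linarith)]
    linarith

end Hypergeo

namespace Hypergeo

/-! ### The integrals between two adjacent sectors -/

/-- The integral of `e^(sw) exp (x e^(aw))` between the directions `φ_j` and `φ_{j+1}`. -/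
noncomputable def arcMom (a : ℕ) (φ : ℕ → ℝ) (x s : ℂ) (j : ℕ) : ℂ :=
  ∫ u, expIntegrand a s x ((arcPath (φ j) (φ (j + 1))).w u) *
    deriv (arcPath (φ j) (φ (j + 1))).w u

theorem cmom_arcPath {a b : ℕ} (φ : ℕ → ℝ) (β : ℂ) (j i : ℕ) (y : Fin 1 → ℂ) :
    cmom ![a, b] β (GeomCycle.path (arcPath (φ j) (φ (j + 1)))) i y =
      arcMom a φ (y 0) (i - β) j := by
  rw [cmom_path, arcMom]
  simp only [phase_trunc_two, expIntegrand]

/-- Directions of decay, one for each sector. -/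
def IsDirections (a b : ℕ) (θ₁ θ₂ : ℝ) (φ : ℕ → ℝ) : Prop :=
  ∀ j, a * |φ j - sectorCentre θ₁ a j| < Real.pi / 2 ∧ Decays ![a, b] θ₁ θ₂ (φ j)

theorem exists_isDirections {a b : ℕ} (ha : 1 ≤ a) (hab : a < b) (θ₁ θ₂ : ℝ) :
    ∃ φ, IsDirections a b θ₁ θ₂ φ := by
  choose φ hφ using exists_direction ha hab θ₁ θ₂
  exact ⟨φ, hφ⟩

section
variable {a b : ℕ} {θ₁ θ₂ ρ : ℝ} {φ : ℕ → ℝ}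

theorem IsDirections.admissible (h : IsDirections a b θ₁ θ₂ φ) (β : ℂ) (j : ℕ) :
    Admissible ![a, b] β θ₁ θ₂ (GeomCycle.path (arcPath (φ j) (φ (j + 1)))) :=
  admissible_arcPath (h j).2 (h (j + 1)).2

theorem integrable_arcMom (ha : 1 ≤ a) (hab : a < b) (h : IsDirections a b θ₁ θ₂ φ) (hρ : 0 < ρ)
    (s : ℂ) (j : ℕ) : Integrable fun u =>
      expIntegrand a s (ρ * Complex.exp (θ₁ * Complex.I)) ((arcPath (φ j) (φ (j + 1))).w u) *
        deriv (arcPath (φ j) (φ (j + 1))).w u := by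
  have := (integrable_cmom_path (isRow_two ha hab) (h.admissible (-s) j) (p := pt θ₁ ρ) hρ
    rfl).self_of_nhds 0
  simp only [phase_trunc_two, Nat.cast_zero, zero_sub, neg_neg] at this
  exact this

theorem arcMom_recursion (ha : 1 ≤ a) (hab : a < b) (h : IsDirections a b θ₁ θ₂ φ) (hρ : 0 < ρ)
    (s : ℂ) (j : ℕ) : a * (ρ * Complex.exp (θ₁ * Complex.I)) *
      arcMom a φ (ρ * Complex.exp (θ₁ * Complex.I)) (s + a) j +
      s * arcMom a φ (ρ * Complex.exp (θ₁ * Complex.I)) s j = 0 := by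
  obtain ⟨hM, -, -⟩ := hasMoments_cmom (isRow_two ha hab) (h.admissible (-s) j) (by simp)
    (pt θ₁ ρ) ρ hρ rfl
  replace hM : IsMom ![a, b] (-s) Set.univ (pt θ₁ ρ) _ := hM
  have h1 := (hM.self_of_nhds 0 trivial).2.2
  simp only [Fin.sum_univ_one] at h1
  have e : (![a, b] : Fin 2 → ℕ) (Fin.castSucc 0) = a := rfl
  rw [e, cmom_arcPath, cmom_arcPath] at h1
  have e1 : ((0 + a : ℕ) : ℂ) - -s = s + a := by push_cast; ring
  have e2 : ((0 : ℕ) : ℂ) - -s = s := by push_cast; ring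
  rw [e1, e2] at h1
  exact h1

/-- The directions φ_j also have to respect x_n and are not evenly spaced. Replacing them by the
centres, which are exactly 2π/a apart, makes the rotational symmetry of t^a available. -/
theorem tendsto_arcMom (ha : 1 ≤ a) (hab : a < b) (h : IsDirections a b θ₁ θ₂ φ) (hρ : 0 < ρ)
    {s : ℂ} {G : ℂ → ℂ}
    (hG : ∀ w, HasDerivAt G (expIntegrand a s (ρ * Complex.exp (θ₁ * Complex.I)) w) w) (j : ℕ) :
    Tendsto (fun R : ℝ => G (R + sectorCentre θ₁ a (j + 1) * Complex.I) -
      G (R + sectorCentre θ₁ a j * Complex.I)) atTop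
      (𝓝 (arcMom a φ (ρ * Complex.exp (θ₁ * Complex.I)) s j)) := by
  have h1 := (arcPath (φ j) (φ (j + 1))).tendsto_sub hG
    (differentiable_expIntegrand _ _ _).continuous (integrable_arcMom ha hab h hρ s j)
  -- This inverts R = √(1 + r²), the real part of the logarithm of the arc at the parameters r and
  -- -r.
  have h2 : Tendsto (fun R : ℝ => √(R ^ 2 - 1)) atTop atTop := by
    refine Real.tendsto_sqrt_atTop.comp (tendsto_atTop_add_const_right _ (-1 : ℝ) ?_)
    exact tendsto_pow_atTop two_ne_zero
  have hv : ∀ i, Tendsto (fun R : ℝ => G (R + φ i * Complex.I) -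
      G (R + sectorCentre θ₁ a i * Complex.I)) atTop (𝓝 0) := by
    intro i
    obtain ⟨η, hη, hc⟩ := exists_cos_le_of_near θ₁ ha i (h i).1
    exact tendsto_vertical_atTop ha s hρ hη hc hG
  have h3 := ((h1.comp h2).sub (hv (j + 1))).add (hv j)
  rw [sub_zero, add_zero] at h3
  refine h3.congr' ?_
  filter_upwards [eventually_ge_atTop 2] with R hR
  have hr : 1 ≤ √(R ^ 2 - 1) := by
    rw [Real.one_le_sqrt]
    nlinarith
  have hs : √(1 + √(R ^ 2 - 1) ^ 2) = R := by
    rw [Real.sq_sqrt (by nlinarith), add_sub_cancel, Real.sqrt_sq (by linarith)]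
  simp only [Function.comp]
  rw [arcPath_w_of_one_le _ _ hr, arcPath_w_of_nonpos _ _ (by linarith), neg_sq, hs]
  ring

theorem exp_add_two_pi_div_pow (ha : 1 ≤ a) (w : ℂ) :
    Complex.exp (w + 2 * Real.pi * Complex.I / a) ^ a = Complex.exp w ^ a := by
  have ha0 : (a : ℂ) ≠ 0 := by exact_mod_cast (by omega : a ≠ 0)
  rw [Complex.exp_add, mul_pow, ← Complex.exp_nat_mul (2 * Real.pi * Complex.I / a),
    mul_div_cancel₀ _ ha0, Complex.exp_two_pi_mul_I, mul_one]

theorem sectorCentre_succ (ha : 1 ≤ a) (R : ℝ) (j : ℕ) :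
    (R : ℂ) + sectorCentre θ₁ a (j + 1) * Complex.I =
      R + sectorCentre θ₁ a j * Complex.I + 2 * Real.pi * Complex.I / a := by
  rw [sectorCentre_eq θ₁ ha (j + 1), sectorCentre_eq θ₁ ha j]
  push_cast
  ring

/-- The translation w ↦ w + 2πi/a fixes e^(aw) and multiplies e^(sw) by ω = e^(2πis/a). For a
primitive G, therefore, G(w + 2πi/a) - ω G(w) is constant, and the increments between successive
centres form a geometric progression. -/
theorem arcMom_eq_pow (ha : 1 ≤ a) (hab : a < b) (h : IsDirections a b θ₁ θ₂ φ) (hρ : 0 < ρ)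
    (s : ℂ) (j : ℕ) : arcMom a φ (ρ * Complex.exp (θ₁ * Complex.I)) s j =
      Complex.exp (2 * Real.pi * Complex.I * (s / a)) ^ j *
        arcMom a φ (ρ * Complex.exp (θ₁ * Complex.I)) s 0 := by
  set X : ℂ := ρ * Complex.exp (θ₁ * Complex.I)
  set ω : ℂ := Complex.exp (2 * Real.pi * Complex.I * (s / a)) with hω
  set T : ℂ := 2 * Real.pi * Complex.I / a with hT
  obtain ⟨G, hG⟩ := (differentiable_expIntegrand a s X).isExactOn_univ
  replace hG := fun w => hG w trivial
  have hper : ∀ w, expIntegrand a s X (w + T) = ω * expIntegrand a s X w := by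
    intro w
    rw [expIntegrand, expIntegrand, exp_add_two_pi_div_pow ha, mul_add, Complex.exp_add, hω]
    have : s * T = 2 * Real.pi * Complex.I * (s / a) := by rw [hT]; ring
    rw [this]
    ring
  have hder : ∀ w, HasDerivAt (fun w => G (w + T) - ω * G w) 0 w := by
    intro w
    have h1 := (hG (w + T)).comp_add_const w T
    refine (h1.sub ((hG w).const_mul ω)).congr_deriv ?_
    rw [hper, sub_self]
  have hconst := is_const_of_deriv_eq_zero (fun w => (hder w).differentiableAt)
    fun w => (hder w).deriv
  have hstep : ∀ (R : ℝ) (j : ℕ), G (R + sectorCentre θ₁ a (j + 1) * Complex.I) -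
      G (R + sectorCentre θ₁ a j * Complex.I) =
      ω ^ j * (G (R + sectorCentre θ₁ a (0 + 1) * Complex.I) -
        G (R + sectorCentre θ₁ a 0 * Complex.I)) := by
    intro R j
    induction j with
    | zero => simp
    | succ j ih =>
      rw [pow_succ', mul_assoc, ← ih, sectorCentre_succ ha R (j + 1), sectorCentre_succ ha R j]
      have := hconst (R + sectorCentre θ₁ a j * Complex.I + T) (R + sectorCentre θ₁ a j * Complex.I)
      linear_combination this
  refine tendsto_nhds_unique (tendsto_arcMom ha hab h hρ hG j) ?_
  simp only [hstep _ j]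
  exact (tendsto_arcMom ha hab h hρ hG 0).const_mul _

theorem arcMom_of_primitive (ha : 1 ≤ a) (hab : a < b) (h : IsDirections a b θ₁ θ₂ φ) (hρ : 0 < ρ)
    {s c : ℂ} {G : ℂ → ℂ}
    (hG : ∀ w, HasDerivAt G (expIntegrand a s (ρ * Complex.exp (θ₁ * Complex.I)) w) w)
    (hc : ∀ w, G (w + 2 * Real.pi * Complex.I / a) = G w + c) :
    arcMom a φ (ρ * Complex.exp (θ₁ * Complex.I)) s 0 = c := by
  refine tendsto_nhds_unique (tendsto_arcMom ha hab h hρ hG 0)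
    (tendsto_const_nhds.congr fun R => ?_)
  rw [sectorCentre_succ ha R 0, hc, add_sub_cancel_left]

theorem hasDerivAt_exp_pow (w : ℂ) : HasDerivAt (fun w => Complex.exp w ^ a)
    (a * Complex.exp w ^ a) w := by
  have h : (fun w => Complex.exp w ^ a) = fun w => Complex.exp (a * w) := by
    funext w
    rw [Complex.exp_nat_mul]
  rw [h, ← Complex.exp_nat_mul]
  have := ((hasDerivAt_id w).const_mul (a : ℂ)).cexp
  simpa [mul_comm] using this

/-- In v = e^(aw) the form is v^N e^(Xv) dv / a. It has a primitive that is entire in v, hence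
invariant under w ↦ w + 2πi/a. -/
theorem arcMom_mul_eq_zero (ha : 1 ≤ a) (hab : a < b) (h : IsDirections a b θ₁ θ₂ φ) (hρ : 0 < ρ)
    (N : ℕ) : arcMom a φ (ρ * Complex.exp (θ₁ * Complex.I)) (a * (N + 1 : ℕ)) 0 = 0 := by
  have ha0 : (a : ℂ) ≠ 0 := by exact_mod_cast (by omega : a ≠ 0)
  set X : ℂ := ρ * Complex.exp (θ₁ * Complex.I) with hX
  have hd : Differentiable ℂ fun v : ℂ => v ^ N * Complex.exp (X * v) := by fun_prop
  obtain ⟨H, hH⟩ := hd.isExactOn_univ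
  refine arcMom_of_primitive ha hab h hρ (G := fun w => H (Complex.exp w ^ a) / a) (fun w => ?_)
    fun w => by rw [exp_add_two_pi_div_pow ha, add_zero]
  refine (((hH _ trivial).comp w (hasDerivAt_exp_pow w)).div_const _).congr_deriv ?_
  have e : Complex.exp (a * (N + 1 : ℕ) * w) = (Complex.exp w ^ a) ^ N * Complex.exp w ^ a := by
    rw [← pow_succ, ← Complex.exp_nat_mul, ← Complex.exp_nat_mul]
    congr 1
    ring
  rw [expIntegrand, e, ← hX]
  clear_value X
  field_simp

/-- In v = e^(aw) the arc winds once around 0, and the form e^(Xv) dv / (av) has residue 1/a there.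
-/
theorem arcMom_zero (ha : 1 ≤ a) (hab : a < b) (h : IsDirections a b θ₁ θ₂ φ) (hρ : 0 < ρ) :
    arcMom a φ (ρ * Complex.exp (θ₁ * Complex.I)) 0 0 = 2 * Real.pi * Complex.I / a := by
  have ha0 : (a : ℂ) ≠ 0 := by exact_mod_cast (by omega : a ≠ 0)
  set X : ℂ := ρ * Complex.exp (θ₁ * Complex.I) with hX
  set E : ℂ → ℂ := fun v => Complex.exp (X * v) with hE
  have hEd : Differentiable ℂ E := by fun_prop
  have hd : Differentiable ℂ (dslope E 0) := by
    rw [← differentiableOn_univ, Complex.differentiableOn_dslope univ_mem]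
    exact hEd.differentiableOn
  obtain ⟨H, hH⟩ := hd.isExactOn_univ
  refine arcMom_of_primitive ha hab h hρ (G := fun w => w + H (Complex.exp w ^ a) / a) (fun w => ?_)
    fun w => by rw [exp_add_two_pi_div_pow ha]; ring
  refine ((hasDerivAt_id w).add
    (((hH _ trivial).comp w (hasDerivAt_exp_pow w)).div_const _)).congr_deriv ?_
  have h1 := sub_smul_dslope E 0 (Complex.exp w ^ a)
  have h2 : E 0 = 1 := by simp [hE]
  rw [sub_zero, smul_eq_mul, h2] at h1
  rw [expIntegrand, zero_mul, Complex.exp_zero, one_mul]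
  have h3 : Complex.exp (X * Complex.exp w ^ a) = E (Complex.exp w ^ a) := rfl
  rw [h3]
  field_simp
  linear_combination h1

/-- The substitution v = e^(au) turns it into a non-zero multiple of Γ(s/a). -/
theorem integral_exp_mul_exp_ne_zero (ha : 1 ≤ a) (hρ : 0 < ρ) {s : ℂ} (hs : 0 < s.re) :
    ∫ u : ℝ, Complex.exp (s * u) * Complex.exp (-(ρ * Complex.exp u ^ a)) ≠ 0 := by
  have ha0 : (0 : ℝ) < a := by exact_mod_cast ha
  have ha1 : (a : ℂ) ≠ 0 := by exact_mod_cast (by omega : a ≠ 0)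
  have hsa : 0 < (s / a).re := by
    rw [Complex.div_natCast_re]
    positivity
  have h1 := Complex.integral_cpow_mul_exp_neg_mul_Ioi hsa (r := ρ) hρ
  have himg : (fun u : ℝ => Real.exp (a * u)) '' Set.univ = Set.Ioi 0 := by
    ext v
    constructor
    · rintro ⟨u, -, rfl⟩
      exact Real.exp_pos _
    · intro hv
      refine ⟨Real.log v / a, trivial, ?_⟩
      simp only
      rw [mul_div_cancel₀ _ ha0.ne', Real.exp_log hv]
  have hder : ∀ u ∈ Set.univ, HasDerivWithinAt (fun u : ℝ => Real.exp (a * u))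
      (Real.exp (a * u) * a) Set.univ u := by
    intro u _
    have := ((hasDerivAt_id u).const_mul (a : ℝ)).exp
    simp only [id, mul_one] at this
    exact this.hasDerivWithinAt
  have hinj : Set.InjOn (fun u : ℝ => Real.exp (a * u)) Set.univ := by
    intro u _ v _ huv
    exact mul_left_cancel₀ ha0.ne' (Real.exp_injective huv)
  have h2 := integral_image_eq_integral_abs_deriv_smul MeasurableSet.univ hder hinj
    fun t : ℝ => (t : ℂ) ^ (s / a - 1) * Complex.exp (-(ρ * t))
  rw [himg, h1, setIntegral_univ] at h2
  have h3 : ∀ u : ℝ, |Real.exp (a * u) * a| • (((Real.exp (a * u) : ℝ) : ℂ) ^ (s / a - 1) *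
      Complex.exp (-(ρ * (Real.exp (a * u) : ℝ)))) =
      a * (Complex.exp (s * u) * Complex.exp (-(ρ * Complex.exp u ^ a))) := by
    intro u
    rw [abs_of_pos (by positivity), Complex.real_smul]
    have e1 : ((Real.exp (a * u) : ℝ) : ℂ) = Complex.exp u ^ a := by
      rw [← Complex.exp_nat_mul]
      push_cast
      rfl
    have e2 : ((Real.exp (a * u) : ℝ) : ℂ) ^ (s / a - 1) =
        Complex.exp (s * u) / Complex.exp u ^ a := by
      have e0 : ((Real.exp (a * u) : ℝ) : ℂ) = Complex.exp ((a * u : ℝ) : ℂ) := by push_cast; rfl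
      rw [Complex.cpow_def_of_ne_zero (by exact_mod_cast (Real.exp_pos _).ne'),
        ← Complex.ofReal_log (Real.exp_pos _).le, Real.log_exp, ← Complex.exp_nat_mul,
        ← Complex.exp_sub]
      congr 1
      push_cast
      field_simp
    have e3 : Complex.exp u ^ a ≠ 0 := pow_ne_zero _ (Complex.exp_ne_zero _)
    rw [Complex.ofReal_mul, e2, e1, Complex.ofReal_natCast]
    field_simp
  simp only [h3] at h2
  rw [integral_const_mul] at h2
  intro h0
  rw [h0, mul_zero] at h2
  refine mul_ne_zero ?_ (Complex.Gamma_ne_zero_of_re_pos hsa) h2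
  refine (Complex.cpow_ne_zero_iff_of_exponent_ne_zero ?_).2 ?_
  · rintro h
    rw [h] at hsa
    simp at hsa
  · exact one_div_ne_zero (by exact_mod_cast hρ.ne')

theorem tendsto_vertical_atBot {s : ℂ} (hs : 0 < s.re) (hρ : 0 < ρ) {G : ℂ → ℂ}
    (hG : ∀ w, HasDerivAt G (expIntegrand a s (ρ * Complex.exp (θ₁ * Complex.I)) w) w) (x y : ℝ) :
    Tendsto (fun R : ℝ => G ((-R : ℝ) + x * Complex.I) - G ((-R : ℝ) + y * Complex.I)) atTop
      (𝓝 0) := by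
  have hlim : Tendsto (fun R : ℝ => Real.exp (|s.im| * (|x| + |y|) + ρ) * Real.exp (-(s.re * R)) *
      |x - y|) atTop (𝓝 0) := by
    have h1 : Tendsto (fun R : ℝ => Real.exp (-(s.re * R))) atTop (𝓝 0) :=
      Real.tendsto_exp_neg_atTop_nhds_zero.comp (tendsto_id.const_mul_atTop hs)
    simpa using (h1.const_mul _).mul_const |x - y|
  refine squeeze_zero_norm' ?_ hlim
  filter_upwards [eventually_ge_atTop 0] with R hR
  refine norm_sub_le_of_vertical hG fun t ht => ?_
  rw [norm_expIntegrand, ← Real.exp_add, ← Real.exp_add]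
  refine Real.exp_le_exp.2 ?_
  have h1 : (s * ((-R : ℝ) + t * Complex.I)).re = -(s.re * R) - s.im * t := by simp
  have h2 : ((-R : ℝ) + t * Complex.I : ℂ).re = -R := by simp
  rw [h1, h2]
  have h3 : -(s.im * t) ≤ |s.im| * (|x| + |y|) := by
    refine (neg_le_abs _).trans ?_
    rw [abs_mul]
    exact mul_le_mul_of_nonneg_left (abs_le_of_mem_uIcc ht) (abs_nonneg _)
  have h4 : Real.exp (-R) ^ a * Real.cos (θ₁ + a * ((-R : ℝ) + t * Complex.I : ℂ).im) ≤ 1 := by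
    have h5 : Real.exp (-R) ^ a ≤ 1 :=
      pow_le_one₀ (Real.exp_pos _).le (Real.exp_le_one_iff.2 (by linarith))
    have h6 := Real.cos_le_one (θ₁ + a * ((-R : ℝ) + t * Complex.I : ℂ).im)
    have h7 : 0 ≤ Real.exp (-R) ^ a := by positivity
    nlinarith
  nlinarith

/-- For Re s > 0 the integrand is small as Re w → -∞, so the arc can be pulled apart into the two
horizontal lines through the centres. On each the integral is a phase times the same Gamma integral;
the phases differ by the factor e^(2πis/a), which is 1 only if s ∈ aℤ. -/
theorem arcMom_ne_zero_of_re_pos (ha : 1 ≤ a) (hab : a < b) (h : IsDirections a b θ₁ θ₂ φ)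
    (hρ : 0 < ρ) {s : ℂ} (hs : 0 < s.re) (hsa : ∀ N : ℤ, s ≠ a * N) :
    arcMom a φ (ρ * Complex.exp (θ₁ * Complex.I)) s 0 ≠ 0 := by
  have ha0 : (a : ℂ) ≠ 0 := by exact_mod_cast (by omega : a ≠ 0)
  obtain ⟨G, hG⟩ := (differentiable_expIntegrand a s
    (ρ * Complex.exp (θ₁ * Complex.I))).isExactOn_univ
  replace hG := fun w => hG w trivial
  have hI := integral_exp_mul_exp_ne_zero ha hρ hs
  set κ : ℝ → ℂ := fun u => Complex.exp (s * u) * Complex.exp (-(ρ * Complex.exp u ^ a)) with hκ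
  -- The integral of a non-integrable function is 0 by convention, so non-vanishing already gives
  -- integrability.
  have hint : Integrable κ := not_imp_comm.1 integral_undef hI
  have hcentre : ∀ (j : ℕ) (u : ℝ), expIntegrand a s (ρ * Complex.exp (θ₁ * Complex.I))
      (u + sectorCentre θ₁ a j * Complex.I) =
      Complex.exp (s * (sectorCentre θ₁ a j * Complex.I)) * κ u := by
    intro j u
    have e1 : Complex.exp (θ₁ * Complex.I) * Complex.exp (sectorCentre θ₁ a j * Complex.I) ^ a =
        -1 := by
      rw [← Complex.exp_nat_mul, ← Complex.exp_add]
      have h1 : (θ₁ * Complex.I + a * (sectorCentre θ₁ a j * Complex.I) : ℂ) =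
          Real.pi * Complex.I + j * (2 * Real.pi * Complex.I) := by
        have h2 := congrArg (fun r : ℝ => (r : ℂ) * Complex.I) (add_mul_sectorCentre θ₁ ha j)
        push_cast at h2
        linear_combination h2
      rw [h1, Complex.exp_add, Complex.exp_pi_mul_I, Complex.exp_nat_mul,
        Complex.exp_two_pi_mul_I, one_pow, mul_one]
    rw [expIntegrand, mul_add, Complex.exp_add, Complex.exp_add, mul_pow, hκ]
    have e2 : ρ * Complex.exp (θ₁ * Complex.I) *
        (Complex.exp u ^ a * Complex.exp (sectorCentre θ₁ a j * Complex.I) ^ a) =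
        -(ρ * Complex.exp u ^ a) := by
      linear_combination (ρ * Complex.exp u ^ a) * e1
    rw [e2]
    ring
  have hline : ∀ j : ℕ, Tendsto (fun R : ℝ => G (R + sectorCentre θ₁ a j * Complex.I) -
      G ((-R : ℝ) + sectorCentre θ₁ a j * Complex.I)) atTop
      (𝓝 (Complex.exp (s * (sectorCentre θ₁ a j * Complex.I)) * ∫ u, κ u)) := by
    intro j
    have h1 := (intervalIntegral_tendsto_integral (hint.const_mul
      (Complex.exp (s * (sectorCentre θ₁ a j * Complex.I)))) tendsto_neg_atTop_atBot tendsto_id)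
    rw [integral_const_mul] at h1
    refine h1.congr fun R => ?_
    have hcont : Continuous fun u => Complex.exp (s * (sectorCentre θ₁ a j * Complex.I)) * κ u := by
      rw [hκ]
      fun_prop
    refine intervalIntegral.integral_eq_sub_of_hasDerivAt
      (f := fun u : ℝ => G (u + sectorCentre θ₁ a j * Complex.I)) (fun u _ => ?_)
      (hcont.intervalIntegrable _ _)
    rw [← hcentre]
    exact ((hG _).comp_add_const (u : ℂ) _).comp_ofReal
  have h1 := ((hline 1).sub (hline 0)).add (tendsto_vertical_atBot hs hρ hG
    (sectorCentre θ₁ a 1) (sectorCentre θ₁ a 0))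
  have h2 := tendsto_nhds_unique (tendsto_arcMom ha hab h hρ hG 0)
    (h1.congr fun R => by ring)
  rw [h2, add_zero, ← sub_mul]
  refine mul_ne_zero ?_ hI
  have h3 := sectorCentre_succ (θ₁ := θ₁) ha 0 0
  simp only [Complex.ofReal_zero, zero_add] at h3
  rw [h3, mul_add, Complex.exp_add, ← mul_sub_one]
  refine mul_ne_zero (Complex.exp_ne_zero _) (sub_ne_zero.2 fun h4 => ?_)
  obtain ⟨N, hN⟩ := Complex.exp_eq_one_iff.1 h4
  refine hsa N ?_
  have h5 := Complex.two_pi_I_ne_zero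
  field_simp at hN
  linear_combination hN

/-- By the recursion a zero at s would propagate to s + a, s + 2a, and so on. For s = -an this
reaches 0, where the value is 2πi/a; for s outside aℤ it reaches Re s > 0, where there are no zeros.
-/
theorem arcMom_ne_zero (ha : 1 ≤ a) (hab : a < b) (h : IsDirections a b θ₁ θ₂ φ)
    (hρ : 0 < ρ) {s : ℂ} (hsa : ∀ N : ℕ, s ≠ a * (N + 1 : ℕ)) :
    arcMom a φ (ρ * Complex.exp (θ₁ * Complex.I)) s 0 ≠ 0 := by
  have ha0 : (a : ℂ) ≠ 0 := by exact_mod_cast (by omega : a ≠ 0)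
  have hX : (ρ * Complex.exp (θ₁ * Complex.I) : ℂ) ≠ 0 :=
    mul_ne_zero (by exact_mod_cast hρ.ne') (Complex.exp_ne_zero _)
  have hstep : ∀ s, arcMom a φ (ρ * Complex.exp (θ₁ * Complex.I)) s 0 = 0 →
      arcMom a φ (ρ * Complex.exp (θ₁ * Complex.I)) (s + a) 0 = 0 := by
    intro s hs
    have h1 := arcMom_recursion ha hab h hρ s 0
    rw [hs, mul_zero, add_zero] at h1
    exact (mul_eq_zero.1 h1).resolve_left (mul_ne_zero ha0 hX)
  have hiter : ∀ (n : ℕ) (s), arcMom a φ (ρ * Complex.exp (θ₁ * Complex.I)) s 0 = 0 →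
      arcMom a φ (ρ * Complex.exp (θ₁ * Complex.I)) (s + a * n) 0 = 0 := by
    intro n s hs
    induction n with
    | zero => simpa using hs
    | succ n ih =>
      have e : s + a * ((n + 1 : ℕ) : ℂ) = s + a * n + a := by push_cast; ring
      rw [e]
      exact hstep _ ih
  intro h0
  by_cases hint : ∃ N : ℤ, s = a * N
  · obtain ⟨N, rfl⟩ := hint
    rcases lt_or_ge 0 N with hN | hN
    · obtain ⟨n, rfl⟩ : ∃ n : ℕ, N = (n + 1 : ℕ) := ⟨(N - 1).toNat, by omega⟩
      exact hsa n (by push_cast; ring)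
    · obtain ⟨n, rfl⟩ : ∃ n : ℕ, N = -(n : ℤ) := ⟨(-N).toNat, by omega⟩
      have h1 := hiter n _ h0
      have e : (a : ℂ) * ((-(n : ℤ) : ℤ) : ℂ) + a * n = 0 := by push_cast; ring
      rw [e, arcMom_zero ha hab h hρ] at h1
      exact div_ne_zero Complex.two_pi_I_ne_zero ha0 h1
  · push Not at hint
    obtain ⟨n, hn⟩ := exists_nat_gt (-s.re)
    refine arcMom_ne_zero_of_re_pos ha hab h hρ (s := s + a * n) ?_ ?_ (hiter n s h0)
    · have ha1 : (1 : ℝ) ≤ a := by exact_mod_cast ha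
      have hn0 : (0 : ℝ) ≤ n := Nat.cast_nonneg n
      have : (s + a * n).re = s.re + a * n := by simp
      rw [this]
      nlinarith
    · intro N hN
      refine hint (N - n) ?_
      push_cast
      linear_combination hN

end

end Hypergeo

namespace Hypergeo

/-! ### Taylor polynomials of the exponential -/

/-- The terms of degree at most `N` in `t` of `exp (x t^a + y t^b)`, as a sum over a box. -/
noncomputable def boxTaylor (a b K : ℕ) (N : ℤ) (x y t : ℂ) : ℂ :=
  ∑ l ∈ Finset.range K, ∑ m ∈ Finset.range K, if ((a * l + b * m : ℕ) : ℤ) ≤ N then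
    x ^ l / (l.factorial : ℂ) * (y ^ m / (m.factorial : ℂ)) * t ^ (a * l + b * m) else 0

section
variable {a b : ℕ}

theorem boxTaylor_of_neg (K : ℕ) {N : ℤ} (hN : N < 0) (x y t : ℂ) :
    boxTaylor a b K N x y t = 0 := by
  refine Finset.sum_eq_zero fun l _ => Finset.sum_eq_zero fun m _ => if_neg ?_
  omega

/-- As a and b are positive, both exponents are at most al + bm ≤ N < K, so every box of size
exceeding N contains all the terms. -/
theorem boxTaylor_le (ha : 1 ≤ a) (hb : 1 ≤ b) {K K' : ℕ} (hK : K ≤ K') {N : ℤ} (hN : N < K)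
    (x y t : ℂ) : boxTaylor a b K N x y t = boxTaylor a b K' N x y t := by
  have h : ∀ l m : ℕ, l ≤ a * l + b * m ∧ m ≤ a * l + b * m := fun l m =>
    ⟨by nlinarith [Nat.zero_le (b * m)], by nlinarith [Nat.zero_le (a * l)]⟩
  have hs : Finset.range K ⊆ Finset.range K' := Finset.range_subset_range.2 hK
  rw [boxTaylor, boxTaylor]
  rw [Finset.sum_subset hs fun l _ hl => Finset.sum_eq_zero fun m _ => if_neg ?_]
  · refine Finset.sum_congr rfl fun l _ => Finset.sum_subset hs fun m _ hm => if_neg ?_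
    have := (h l m).2
    rw [Finset.mem_range] at hm
    omega
  · have := (h l m).1
    rw [Finset.mem_range] at hl
    omega

theorem boxTaylor_eq (ha : 1 ≤ a) (hb : 1 ≤ b) {K K' : ℕ} {N : ℤ} (hN : N < K) (hN' : N < K')
    (x y t : ℂ) : boxTaylor a b K N x y t = boxTaylor a b K' N x y t := by
  rcases le_total K K' with h | h
  · exact boxTaylor_le ha hb h hN x y t
  · exact (boxTaylor_le ha hb h hN' x y t).symm

theorem taylorPoly_two (ha : 1 ≤ a) (hb : 1 ≤ b) {K : ℕ} {N : ℤ} (hN : N < K)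
    (y : Fin 2 → ℂ) (t : ℂ) :
    taylorPoly ![a, b] (N : ℝ) y t = boxTaylor a b K N (y 0) (y 1) t := by
  have hf : N < ((⌊(N : ℝ)⌋₊ + 1 : ℕ) : ℤ) := by
    have := Nat.lt_floor_add_one (N : ℝ)
    exact_mod_cast this
  rw [boxTaylor_eq ha hb hN hf, taylorPoly, boxTaylor, ← Finset.sum_product', Finset.sum_filter]
  refine Finset.sum_nbij' (fun l => (l 0, l 1)) (fun q => ![q.1, q.2]) ?_ ?_ ?_ ?_ ?_
  · intro l hl
    rw [Fintype.mem_piFinset] at hl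
    exact Finset.mem_product.2 ⟨hl 0, hl 1⟩
  · intro q hq
    rw [Finset.mem_product] at hq
    rw [Fintype.mem_piFinset]
    intro i
    fin_cases i
    · exact hq.1
    · exact hq.2
  · intro l _
    funext i
    fin_cases i <;> rfl
  · intro q _
    rfl
  · intro l _
    have e : ∑ j, ![a, b] j * l j = a * l 0 + b * l 1 := Fin.sum_univ_two _
    rw [e, Fin.prod_univ_two]
    have : (((a * l 0 + b * l 1 : ℕ) : ℝ) ≤ (N : ℝ)) ↔ ((a * l 0 + b * l 1 : ℕ) : ℤ) ≤ N := by
      rw [← Int.cast_natCast (R := ℝ), Int.cast_le]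
    simp only [this]

theorem boxTaylor_zero (ha : 1 ≤ a) (hb : 1 ≤ b) {K : ℕ} {N : ℤ} (hK : 1 ≤ K) (hN : 0 ≤ N)
    (x y : ℂ) : boxTaylor a b K N x y 0 = 1 := by
  rw [boxTaylor, Finset.sum_eq_single 0, Finset.sum_eq_single 0]
  · simp [hN]
  · intro m _ hm
    have : b * m ≠ 0 := Nat.mul_ne_zero (by omega) hm
    rw [mul_zero, zero_add, zero_pow this, mul_zero, ite_self]
  · intro h
    exact absurd (Finset.mem_range.2 hK) h
  · intro l _ hl
    refine Finset.sum_eq_zero fun m _ => ?_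
    have : a * l ≠ 0 := Nat.mul_ne_zero (by omega) hl
    rw [zero_pow (by omega), mul_zero, ite_self]
  · intro h
    exact absurd (Finset.mem_range.2 hK) h

theorem sum_range_shift (x : ℂ) (K : ℕ) (g : ℕ → ℂ) :
    ∑ l ∈ Finset.range (K + 1), (l : ℂ) * (x ^ l / (l.factorial : ℂ)) * g l =
      x * ∑ l ∈ Finset.range K, x ^ l / (l.factorial : ℂ) * g (l + 1) := by
  rw [Finset.sum_range_succ', Finset.mul_sum]
  simp only [Nat.cast_zero, zero_mul, add_zero]
  refine Finset.sum_congr rfl fun l _ => ?_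
  have h1 : ((l.factorial : ℕ) : ℂ) ≠ 0 := by exact_mod_cast l.factorial_ne_zero
  have h2 : (l : ℂ) + 1 ≠ 0 := by exact_mod_cast l.succ_ne_zero
  rw [Nat.factorial_succ]
  push_cast
  field_simp
  ring

/-- The exponential satisfies E' = (a x t^(a-1) + b y t^(b-1)) E. Comparing degrees in t, the
truncation at N corresponds to truncations at N - a and N - b on the right. -/
theorem hasDerivAt_boxTaylor (ha : 1 ≤ a) (hb : 1 ≤ b) {K : ℕ} {N : ℤ} (hN : N < K) (x y t : ℂ) :
    HasDerivAt (boxTaylor a b K N x y)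
      (a * x * t ^ (a - 1) * boxTaylor a b K (N - a) x y t +
        b * y * t ^ (b - 1) * boxTaylor a b K (N - b) x y t) t := by
  -- The enlarged box leaves room for the index shifts l ↦ l + 1 and m ↦ m + 1; the terms lost at
  -- the border have degree greater than N.
  have h0 : HasDerivAt (boxTaylor a b (K + 1) N x y)
      (∑ l ∈ Finset.range (K + 1), ∑ m ∈ Finset.range (K + 1),
        if ((a * l + b * m : ℕ) : ℤ) ≤ N then
        x ^ l / (l.factorial : ℂ) * (y ^ m / (m.factorial : ℂ)) *
          (((a * l + b * m : ℕ) : ℂ) * t ^ (a * l + b * m - 1)) else 0) t := by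
    unfold boxTaylor
    refine HasDerivAt.fun_sum fun l _ => HasDerivAt.fun_sum fun m _ => ?_
    split_ifs
    · exact (hasDerivAt_pow _ t).const_mul _
    · exact hasDerivAt_const _ _
  have e0 : boxTaylor a b K N x y = boxTaylor a b (K + 1) N x y :=
    funext fun t => boxTaylor_le ha hb (Nat.le_succ K) hN x y t
  rw [e0]
  refine h0.congr_deriv ?_
  set G : ℕ → ℕ → ℂ := fun l m => if ((a * l + b * m : ℕ) : ℤ) ≤ N then
    t ^ (a * l + b * m - 1) else 0 with hG
  have e1 : ∀ l m : ℕ, (if ((a * l + b * m : ℕ) : ℤ) ≤ N then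
        x ^ l / (l.factorial : ℂ) * (y ^ m / (m.factorial : ℂ)) *
          (((a * l + b * m : ℕ) : ℂ) * t ^ (a * l + b * m - 1)) else 0) =
      a * ((l : ℂ) * (x ^ l / (l.factorial : ℂ)) * (y ^ m / (m.factorial : ℂ) * G l m)) +
      b * (x ^ l / (l.factorial : ℂ) * ((m : ℂ) * (y ^ m / (m.factorial : ℂ)) * G l m)) := by
    intro l m
    rw [hG]
    dsimp only
    split_ifs
    · push_cast; ring
    · ring
  simp only [e1, Finset.sum_add_distrib, ← Finset.mul_sum]
  have hG0 : ∀ l m, (N < (a * l + b * m : ℕ)) → G l m = 0 := fun l m h => if_neg (by omega)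
  have hab : ∀ l m : ℕ, l ≤ a * l + b * m ∧ m ≤ a * l + b * m := fun l m =>
    ⟨by nlinarith [Nat.zero_le (b * m)], by nlinarith [Nat.zero_le (a * l)]⟩
  rw [boxTaylor_eq (K' := K + 1) (N := N - a) ha hb (by omega) (by push_cast; omega),
    boxTaylor_eq (K' := K + 1) (N := N - b) ha hb (by omega) (by push_cast; omega), boxTaylor,
    boxTaylor]
  have e2 : ∑ l ∈ Finset.range (K + 1), (l : ℂ) * (x ^ l / (l.factorial : ℂ)) *
      ∑ m ∈ Finset.range (K + 1), y ^ m / (m.factorial : ℂ) * G l m =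
      x * ∑ l ∈ Finset.range (K + 1), x ^ l / (l.factorial : ℂ) *
      ∑ m ∈ Finset.range (K + 1), y ^ m / (m.factorial : ℂ) * G (l + 1) m := by
    rw [sum_range_shift x K fun l => ∑ m ∈ Finset.range (K + 1), y ^ m / (m.factorial : ℂ) * G l m,
      Finset.sum_range_succ _ K, Finset.sum_eq_zero (s := Finset.range (K + 1)), mul_zero, add_zero]
    intro m _
    rw [hG0 _ _ (by have := (hab (K + 1) m).1; omega), mul_zero]
  have e3 : ∀ l, ∑ m ∈ Finset.range (K + 1), (m : ℂ) * (y ^ m / (m.factorial : ℂ)) * G l m =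
      y * ∑ m ∈ Finset.range (K + 1), y ^ m / (m.factorial : ℂ) * G l (m + 1) := by
    intro l
    rw [sum_range_shift y K, Finset.sum_range_succ _ K,
      hG0 l _ (by have := (hab l (K + 1)).2; omega), mul_zero, add_zero]
  rw [e2]
  simp only [e3, Finset.mul_sum]
  congr 1
  · refine Finset.sum_congr rfl fun l _ => Finset.sum_congr rfl fun m _ => ?_
    have h1 : a * (l + 1) + b * m = a * l + b * m + a := by ring
    rw [hG]
    dsimp only
    rw [h1]
    by_cases h : ((a * l + b * m : ℕ) : ℤ) ≤ N - a
    · rw [if_pos h, if_pos (by push_cast at h ⊢; omega), Nat.add_sub_assoc ha, pow_add]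
      ring
    · rw [if_neg h, if_neg (by push_cast at h ⊢; omega)]
      ring
  · refine Finset.sum_congr rfl fun l _ => Finset.sum_congr rfl fun m _ => ?_
    have h1 : a * l + b * (m + 1) = a * l + b * m + b := by ring
    rw [hG]
    dsimp only
    rw [h1]
    by_cases h : ((a * l + b * m : ℕ) : ℤ) ≤ N - b
    · rw [if_pos h, if_pos (by push_cast at h ⊢; omega), Nat.add_sub_assoc hb, pow_add]
      ring
    · rw [if_neg h, if_neg (by push_cast at h ⊢; omega)]
      ring

/-! ### The remainder -/

/-- The Taylor remainder of the exponential. -/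
noncomputable def boxRemainder (a b K : ℕ) (N : ℤ) (x y t : ℂ) : ℂ :=
  Complex.exp (x * t ^ a + y * t ^ b) - boxTaylor a b K N x y t

theorem hasDerivAt_exp_two (x y t : ℂ) :
    HasDerivAt (fun t => Complex.exp (x * t ^ a + y * t ^ b))
      (a * x * t ^ (a - 1) * Complex.exp (x * t ^ a + y * t ^ b) +
        b * y * t ^ (b - 1) * Complex.exp (x * t ^ a + y * t ^ b)) t := by
  have h := (((hasDerivAt_pow a t).const_mul x).add ((hasDerivAt_pow b t).const_mul y)).cexp
  refine h.congr_deriv ?_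
  simp only [Pi.add_apply]
  ring

theorem hasDerivAt_boxRemainder (ha : 1 ≤ a) (hb : 1 ≤ b) {K : ℕ} {N : ℤ} (hN : N < K)
    (x y t : ℂ) : HasDerivAt (boxRemainder a b K N x y)
      (a * x * t ^ (a - 1) * boxRemainder a b K (N - a) x y t +
        b * y * t ^ (b - 1) * boxRemainder a b K (N - b) x y t) t := by
  refine ((hasDerivAt_exp_two x y t).sub (hasDerivAt_boxTaylor ha hb hN x y t)).congr_deriv ?_
  simp only [boxRemainder]
  ring

/-- Induction on the degree: the derivative of the remainder is expressed by the remainders for N -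
a and N - b, so it is O(|t|^N), and the remainder vanishes at 0 when N ≥ 0. The truncation to
natural exponents makes the claim plain boundedness for N < 0. -/
theorem norm_boxRemainder_le (ha : 1 ≤ a) (hb : 1 ≤ b) {K : ℕ} (hK : 1 ≤ K) (x y : ℂ) (n : ℕ) :
    ∀ N : ℤ, N < n → N < K → ∃ C ≥ 0, ∀ t : ℂ, ‖t‖ ≤ 1 →
      ‖boxRemainder a b K N x y t‖ ≤ C * ‖t‖ ^ (N + 1).toNat := by
  induction n with
  | zero =>
    intro N hN _
    refine ⟨Real.exp (‖x‖ + ‖y‖), by positivity, fun t ht => ?_⟩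
    have h1 : (N + 1).toNat = 0 := by push_cast at hN; omega
    rw [boxRemainder, boxTaylor_of_neg K (by exact_mod_cast hN), sub_zero, h1, pow_zero, mul_one]
    refine (Complex.norm_exp_le_exp_norm _).trans (Real.exp_le_exp.2 ((norm_add_le _ _).trans ?_))
    rw [norm_mul, norm_mul, norm_pow, norm_pow]
    exact add_le_add (mul_le_of_le_one_right (norm_nonneg _) (pow_le_one₀ (norm_nonneg _) ht))
      (mul_le_of_le_one_right (norm_nonneg _) (pow_le_one₀ (norm_nonneg _) ht))
  | succ n ih =>
    intro N hN hNK
    rcases lt_or_ge N 0 with h0 | h0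
    · exact ih N (by omega) hNK
    obtain ⟨C₁, hC₁, h1⟩ := ih (N - a) (by push_cast at hN; omega) (by omega)
    obtain ⟨C₂, hC₂, h2⟩ := ih (N - b) (by push_cast at hN; omega) (by omega)
    refine ⟨a * ‖x‖ * C₁ + b * ‖y‖ * C₂, by positivity, fun t ht => ?_⟩
    have key : ∀ (e : ℕ) (z : ℂ) (C : ℝ), 1 ≤ e → 0 ≤ C → (∀ t : ℂ, ‖t‖ ≤ 1 →
        ‖boxRemainder a b K (N - e) x y t‖ ≤ C * ‖t‖ ^ (N - e + 1).toNat) → ∀ w : ℂ, ‖w‖ ≤ ‖t‖ →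
        ‖e * z * w ^ (e - 1) * boxRemainder a b K (N - e) x y w‖ ≤
          e * ‖z‖ * C * ‖t‖ ^ N.toNat := by
      intro e z C he hC h w hw
      rw [norm_mul, norm_mul, norm_mul, Complex.norm_natCast, norm_pow]
      calc _ ≤ e * ‖z‖ * ‖w‖ ^ (e - 1) * (C * ‖w‖ ^ (N - e + 1).toNat) := by
            gcongr; exact h w (hw.trans ht)
        _ = e * ‖z‖ * C * ‖w‖ ^ (e - 1 + (N - e + 1).toNat) := by rw [pow_add]; ring
        _ ≤ e * ‖z‖ * C * ‖t‖ ^ (e - 1 + (N - e + 1).toNat) := by gcongr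
        _ ≤ _ := by
          refine mul_le_mul_of_nonneg_left
            (pow_le_pow_of_le_one (norm_nonneg _) ht ?_) (by positivity)
          omega
    have h3 := (convex_closedBall (0 : ℂ) ‖t‖).norm_image_sub_le_of_norm_hasDerivWithin_le
      (f := boxRemainder a b K N x y) (C := (a * ‖x‖ * C₁ + b * ‖y‖ * C₂) * ‖t‖ ^ N.toNat)
      (x := 0) (y := t)
      (fun w _ => (hasDerivAt_boxRemainder ha hb hNK x y w).hasDerivWithinAt)
      (fun w hw => ?_) (by simp) (by simp)
    · have h4 : boxRemainder a b K N x y 0 = 0 := by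
        rw [boxRemainder, boxTaylor_zero ha hb hK h0, zero_pow (by omega), zero_pow (by omega)]
        simp
      have h5 : (N + 1).toNat = N.toNat + 1 := by omega
      rw [h4, sub_zero, sub_zero] at h3
      rw [h5, pow_succ, ← mul_assoc]
      exact h3
    · rw [mem_closedBall_zero_iff] at hw
      refine (norm_add_le _ _).trans ?_
      rw [add_mul]
      exact add_le_add (key a x C₁ ha hC₁ h1 w hw) (key b y C₂ hb hC₂ h2 w hw)

end

end Hypergeo

namespace Hypergeo

/-! ### Integration by parts along a half line -/

/-- `N` is not in the semigroup generated by `a` and `b`. -/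
def IsGap (a b : ℕ) (N : ℤ) : Prop := ∀ l m : ℕ, N ≠ (a * l + b * m : ℕ)

/-- The regularised integrand `t^(-N-1) (exp (x t^a + y t^b) - P_N) dt / du` on a half line. -/
noncomputable def rayIntegrand (a b K : ℕ) (φ : ℝ) (N : ℤ) (x y : ℂ) (u : ℝ) : ℂ :=
  (Complex.exp (φ * Complex.I) * u) ^ (-N - 1) *
    boxRemainder a b K N x y (Complex.exp (φ * Complex.I) * u) * Complex.exp (φ * Complex.I)

theorem IsGap.sub_left {a b : ℕ} {N : ℤ} (h : IsGap a b N) : IsGap a b (N - a) := by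
  intro l m e
  refine h (l + 1) m ?_
  push_cast at e ⊢
  linarith

theorem IsGap.sub_right {a b : ℕ} {N : ℤ} (h : IsGap a b N) : IsGap a b (N - b) := by
  intro l m e
  refine h l (m + 1) ?_
  push_cast at e ⊢
  linarith

theorem IsGap.ne_zero {a b : ℕ} {N : ℤ} (h : IsGap a b N) : N ≠ 0 := by
  simpa using h 0 0

theorem isGap_of_isExceptional {a b : ℕ} {N : ℤ} (h : IsExceptional ![a, b] (N : ℂ)) :
    IsGap a b N := by
  obtain ⟨N', e, hN⟩ := h
  obtain rfl : N = N' := by exact_mod_cast e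
  intro l m e
  refine hN ⟨![l, m], ?_⟩
  rw [e]
  push_cast
  exact (Fin.sum_univ_two fun j => (![a, b] j : ℤ) * (![l, m] j : ℕ)).symm

section
variable {a b : ℕ}

/-- A gap N is not the degree of any monomial, so the Taylor polynomial has degree at most N - 1.
This gain of one power makes t^(-N-1) P_N integrable at infinity. -/
theorem norm_boxTaylor_le (K n : ℕ) (h : IsGap a b (n + 1 : ℕ)) (x y : ℂ) :
    ∃ B ≥ 0, ∀ t : ℂ, 1 ≤ ‖t‖ → ‖boxTaylor a b K (n + 1 : ℕ) x y t‖ ≤ B * ‖t‖ ^ n := by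
  refine ⟨∑ l ∈ Finset.range K, ∑ m ∈ Finset.range K,
    ‖x ^ l / (l.factorial : ℂ) * (y ^ m / (m.factorial : ℂ))‖, by positivity, fun t ht => ?_⟩
  rw [boxTaylor, Finset.sum_mul]
  refine (norm_sum_le _ _).trans (Finset.sum_le_sum fun l _ => ?_)
  rw [Finset.sum_mul]
  refine (norm_sum_le _ _).trans (Finset.sum_le_sum fun m _ => ?_)
  split_ifs with h1
  · rw [norm_mul, norm_pow]
    refine mul_le_mul_of_nonneg_left (pow_le_pow_right₀ ht ?_) (norm_nonneg _)
    have := h l m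
    omega
  · rw [norm_zero]
    positivity

section
variable {K : ℕ} {φ : ℝ} {x y : ℂ}

theorem ray_ne_zero (φ : ℝ) {u : ℝ} (hu : 0 < u) : Complex.exp (φ * Complex.I) * (u : ℂ) ≠ 0 :=
  mul_ne_zero (Complex.exp_ne_zero _) (by exact_mod_cast hu.ne')

theorem norm_ray (φ : ℝ) {u : ℝ} (hu : 0 ≤ u) : ‖Complex.exp (φ * Complex.I) * (u : ℂ)‖ = u := by
  rw [norm_mul, Complex.norm_exp_ofReal_mul_I, one_mul, Complex.norm_real, Real.norm_of_nonneg hu]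

theorem hasDerivAt_ray (φ u : ℝ) :
    HasDerivAt (fun u : ℝ => Complex.exp (φ * Complex.I) * (u : ℂ)) (Complex.exp (φ * Complex.I)) u := by
  simpa using (Complex.ofRealCLM.hasDerivAt (x := u)).const_mul (Complex.exp (φ * Complex.I))

theorem continuousOn_rayIntegrand (ha : 1 ≤ a) (hb : 1 ≤ b) {N : ℤ} (hN : N < K) :
    ContinuousOn (rayIntegrand a b K φ N x y) (Set.Ioi 0) := by
  intro u hu
  have h1 := (hasDerivAt_ray φ u).continuousAt
  have h2 := (hasDerivAt_boxRemainder ha hb hN x y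
    (Complex.exp (φ * Complex.I) * u)).continuousAt
  have h3 : ContinuousAt (fun u : ℝ => boxRemainder a b K N x y
      (Complex.exp (φ * Complex.I) * u)) u := ContinuousAt.comp (f := fun u : ℝ => Complex.exp (φ * Complex.I) * (u : ℂ)) h2 h1
  exact (((h1.zpow₀ (-N - 1) (Or.inl (ray_ne_zero φ hu))).mul h3).mul
    continuousAt_const).continuousWithinAt

theorem norm_ray_zpow (φ : ℝ) {u : ℝ} (hu : 0 < u) (n : ℕ) :
    ‖(Complex.exp (φ * Complex.I) * (u : ℂ)) ^ (-(n : ℤ))‖ = (u ^ n)⁻¹ := by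
  rw [zpow_neg, zpow_natCast, norm_inv, norm_pow, norm_ray φ hu.le]

/-- Near 0 the remainder is O(u^(n+2)) and cancels the pole. At infinity the exponential part is
controlled by the integrand for parameter -1, and the polynomial part is O(u^(-2)) because n + 1 is
a gap. -/
theorem integrableOn_rayIntegrand (ha : 1 ≤ a) (hb : 1 ≤ b) {n : ℕ} (hn : IsGap a b (n + 1 : ℕ))
    (hK : n + 1 < K) (h1 : IntegrableOn (rayIntegrand a b K φ (-1) x y) (Set.Ioi 0)) :
    IntegrableOn (rayIntegrand a b K φ (n + 1 : ℕ) x y) (Set.Ioi 0) := by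
  have hK' : ((n + 1 : ℕ) : ℤ) < K := by exact_mod_cast hK
  have hc := continuousOn_rayIntegrand (φ := φ) (x := x) (y := y) ha hb hK'
  have hm : AEStronglyMeasurable (rayIntegrand a b K φ (n + 1 : ℕ) x y)
      (volume.restrict (Set.Ioi 0)) := hc.aestronglyMeasurable measurableSet_Ioi
  have he : (-((n + 1 : ℕ) : ℤ) - 1) = -((n + 2 : ℕ) : ℤ) := by push_cast; ring
  rw [← Set.Ioc_union_Ioi_eq_Ioi (zero_le_one (α := ℝ))]
  refine IntegrableOn.union ?_ ?_
  · obtain ⟨C, hC, hb'⟩ := norm_boxRemainder_le ha hb (by omega : 1 ≤ K) x y (n + 2) (n + 1 : ℕ)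
      (by push_cast; omega) hK'
    refine IntegrableOn.of_bound (C := C) (by simp)
      (hm.mono_measure (Measure.restrict_mono Set.Ioc_subset_Ioi_self le_rfl)) ?_
    refine (ae_restrict_iff' measurableSet_Ioc).2 (Eventually.of_forall fun u hu => ?_)
    have h2 := hb' (Complex.exp (φ * Complex.I) * u) (by rw [norm_ray φ hu.1.le]; exact hu.2)
    rw [norm_ray φ hu.1.le, show (((n + 1 : ℕ) : ℤ) + 1).toNat = n + 2 by omega] at h2
    rw [rayIntegrand, norm_mul, norm_mul, Complex.norm_exp_ofReal_mul_I, mul_one, he,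
      norm_ray_zpow φ hu.1, inv_mul_le_iff₀ (pow_pos hu.1 _), mul_comm _ C]
    exact h2
  · obtain ⟨B, hB, hB'⟩ := norm_boxTaylor_le K n hn x y
    have h2 := (h1.mono_set (Set.Ioi_subset_Ioi (zero_le_one (α := ℝ)))).norm
    have h3 := (integrableOn_Ioi_rpow_of_lt (by norm_num : (-2 : ℝ) < -1) zero_lt_one).const_mul B
    refine Integrable.mono' (h2.add h3)
      (hm.mono_measure (Measure.restrict_mono (Set.Ioi_subset_Ioi zero_le_one) le_rfl)) ?_
    refine (ae_restrict_iff' measurableSet_Ioi).2 (Eventually.of_forall fun u hu => ?_)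
    have hu1 : (1 : ℝ) < u := hu
    have hu0 : (0 : ℝ) < u := by linarith
    have h4 := hB' (Complex.exp (φ * Complex.I) * u) (by rw [norm_ray φ hu0.le]; exact hu1.le)
    rw [norm_ray φ hu0.le] at h4
    simp only [Pi.add_apply]
    have e1 : ‖rayIntegrand a b K φ (-1) x y u‖ =
        ‖Complex.exp (x * (Complex.exp (φ * Complex.I) * u) ^ a +
          y * (Complex.exp (φ * Complex.I) * u) ^ b)‖ := by
      rw [rayIntegrand, boxRemainder, boxTaylor_of_neg K (by norm_num), norm_mul, norm_mul,
        Complex.norm_exp_ofReal_mul_I]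
      simp
    rw [e1, rayIntegrand, norm_mul, norm_mul, Complex.norm_exp_ofReal_mul_I, mul_one, he,
      norm_ray_zpow φ hu0, inv_mul_le_iff₀ (pow_pos hu0 _), boxRemainder]
    refine (norm_sub_le _ _).trans ?_
    rw [mul_add]
    refine add_le_add (le_mul_of_one_le_left (norm_nonneg _) (one_le_pow₀ hu1.le)) (h4.trans ?_)
    rw [Real.rpow_neg hu0.le, Real.rpow_two, pow_add]
    field_simp
    exact le_rfl

/-- Integrate the derivative of t^(-N) (exp - P_N) with N = n + 1. The boundary term at 0 is O(u);
at infinity the exponential tends to 0 and t^(-N) P_N is O(1/u), again because N is a gap. -/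
theorem ray_parts (ha : 1 ≤ a) (hb : 1 ≤ b) {n : ℕ} (hn : IsGap a b (n + 1 : ℕ))
    (hK : n + 1 < K) (h1 : IntegrableOn (rayIntegrand a b K φ (-1) x y) (Set.Ioi 0))
    (h2 : IntegrableOn (rayIntegrand a b K φ (-a) x y) (Set.Ioi 0))
    (h3 : IntegrableOn (rayIntegrand a b K φ (-b) x y) (Set.Ioi 0))
    (h4 : IntegrableOn (rayIntegrand a b K φ ((n + 1 : ℕ) - a) x y) (Set.Ioi 0))
    (h5 : IntegrableOn (rayIntegrand a b K φ ((n + 1 : ℕ) - b) x y) (Set.Ioi 0)) :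
    ((n : ℂ) + 1) * ∫ u in Set.Ioi (0 : ℝ), rayIntegrand a b K φ (n + 1 : ℕ) x y u =
      a * x * (∫ u in Set.Ioi (0 : ℝ), rayIntegrand a b K φ ((n + 1 : ℕ) - a) x y u) +
      b * y * ∫ u in Set.Ioi (0 : ℝ), rayIntegrand a b K φ ((n + 1 : ℕ) - b) x y u := by
  have hK' : ((n + 1 : ℕ) : ℤ) < K := by exact_mod_cast hK
  have h0 := integrableOn_rayIntegrand ha hb hn hK h1
  set e := Complex.exp (φ * Complex.I) with he
  have hpow : ∀ (t : ℂ), t ≠ 0 → ∀ (c : ℕ), 1 ≤ c → ∀ N : ℤ,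
      t ^ (-(N - c) - 1) = t ^ (-N) * t ^ (c - 1) := by
    intro t ht c hc N
    rw [← zpow_natCast, ← zpow_add₀ ht]
    congr 1
    push_cast [hc]
    ring
  set f : ℝ → ℂ := fun u => (e * u) ^ (-((n + 1 : ℕ) : ℤ)) *
    boxRemainder a b K (n + 1 : ℕ) x y (e * u) with hf
  set g : ℝ → ℂ := fun u => -((n : ℂ) + 1) * rayIntegrand a b K φ (n + 1 : ℕ) x y u +
    (a * x * rayIntegrand a b K φ ((n + 1 : ℕ) - a) x y u +
      b * y * rayIntegrand a b K φ ((n + 1 : ℕ) - b) x y u) with hg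
  have hder : ∀ u ∈ Set.Ioi (0 : ℝ), HasDerivAt f (g u) u := by
    intro u hu
    have ht := ray_ne_zero φ hu
    rw [← he] at ht
    have d1 := (hasDerivAt_zpow (-((n + 1 : ℕ) : ℤ)) (e * (u : ℂ)) (Or.inl ht)).comp u
      (hasDerivAt_ray φ u)
    have d2 := (hasDerivAt_boxRemainder ha hb hK' x y (e * (u : ℂ))).comp u (hasDerivAt_ray φ u)
    refine (d1.mul d2).congr_deriv ?_
    rw [hg]
    simp only [rayIntegrand, ← he, hpow _ ht a ha, hpow _ ht b hb, Function.comp]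
    push_cast
    ring
  have hgi : IntegrableOn g (Set.Ioi 0) :=
    (h0.const_mul _).add ((h4.const_mul _).add (h5.const_mul _))
  have hcont : ContinuousWithinAt f (Set.Ici 0) 0 := by
    obtain ⟨C, hC, hb'⟩ := norm_boxRemainder_le ha hb (by omega : 1 ≤ K) x y (n + 2) (n + 1 : ℕ)
      (by push_cast; omega) hK'
    -- The negative power of 0 is 0 by convention, which here is also the limit of f at 0.
    have hf0 : f 0 = 0 := by
      rw [hf]
      dsimp only
      rw [Complex.ofReal_zero, mul_zero, zero_zpow _ (by push_cast; omega), zero_mul]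
    rw [ContinuousWithinAt, hf0]
    refine squeeze_zero_norm' (a := fun u => C * u) ?_ ?_
    · have : Set.Iio (1 : ℝ) ∈ 𝓝[Set.Ici 0] (0 : ℝ) :=
        mem_nhdsWithin_of_mem_nhds (Iio_mem_nhds zero_lt_one)
      filter_upwards [self_mem_nhdsWithin, this] with u hu hu1
      rcases eq_or_lt_of_le (show (0 : ℝ) ≤ u from hu) with h | h
      · rw [← h, hf0]; simp
      have h6 := hb' (e * u) (by rw [norm_ray φ hu]; exact le_of_lt hu1)
      rw [norm_ray φ hu, show (((n + 1 : ℕ) : ℤ) + 1).toNat = n + 1 + 1 by omega] at h6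
      rw [hf]
      dsimp only
      rw [norm_mul, norm_ray_zpow φ h, inv_mul_le_iff₀ (pow_pos h _)]
      refine h6.trans_eq ?_
      ring
    · have : Tendsto (fun u : ℝ => C * u) (𝓝 0) (𝓝 (C * 0)) := tendsto_id.const_mul C
      rw [mul_zero] at this
      exact this.mono_left nhdsWithin_le_nhds
  have hneg : ∀ c : ℕ, 1 ≤ c → ∀ u : ℝ, rayIntegrand a b K φ (-c) x y u =
      (e * u) ^ (c - 1) * Complex.exp (x * (e * u) ^ a + y * (e * u) ^ b) * e := by
    intro c hc u
    rw [rayIntegrand, boxRemainder, boxTaylor_of_neg K (by omega), sub_zero, ← he,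
      ← zpow_natCast _ (c - 1), Nat.cast_sub hc, neg_neg, Nat.cast_one]
  -- A function that is integrable together with its derivative tends to 0; this uses the integrands
  -- for the parameters -1, -a and -b.
  have hexp : Tendsto (fun u : ℝ => Complex.exp (x * (e * u) ^ a + y * (e * u) ^ b)) atTop (𝓝 0) := by
    refine tendsto_zero_of_hasDerivAt_of_integrableOn_Ioi (a := 0)
      (f' := fun u => a * x * rayIntegrand a b K φ (-a) x y u +
        b * y * rayIntegrand a b K φ (-b) x y u) (fun u _ => ?_)
      ((h2.const_mul _).add (h3.const_mul _)) ?_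
    · refine ((hasDerivAt_exp_two x y (e * u)).comp u (hasDerivAt_ray φ u)).congr_deriv ?_
      rw [hneg a ha, hneg b hb]
      ring
    · have h6 := h1.mul_const e⁻¹
      refine IntegrableOn.congr_fun h6 (fun u _ => ?_) measurableSet_Ioi
      have h7 := hneg 1 le_rfl u
      rw [Nat.cast_one] at h7
      rw [h7, Nat.sub_self, pow_zero, one_mul, mul_assoc,
        mul_inv_cancel₀ (Complex.exp_ne_zero _), mul_one]
  have hlim : Tendsto f atTop (𝓝 0) := by
    obtain ⟨B, hB, hB'⟩ := norm_boxTaylor_le K n hn x y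
    have h6 := hexp.norm.add ((tendsto_inv_atTop_zero (𝕜 := ℝ)).const_mul B)
    rw [norm_zero, mul_zero, add_zero] at h6
    refine squeeze_zero_norm' ?_ h6
    filter_upwards [eventually_ge_atTop 1] with u hu
    have hu0 : (0 : ℝ) < u := by linarith
    have h7 := hB' (e * u) (by rw [norm_ray φ hu0.le]; exact hu)
    rw [norm_ray φ hu0.le] at h7
    rw [hf]
    dsimp only
    rw [norm_mul, norm_ray_zpow φ hu0, inv_mul_le_iff₀ (pow_pos hu0 _), boxRemainder]
    refine (norm_sub_le _ _).trans ?_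
    rw [mul_add]
    refine add_le_add (le_mul_of_one_le_left (norm_nonneg _) (one_le_pow₀ hu)) (h7.trans ?_)
    rw [pow_succ]
    field_simp
    exact le_rfl
  have h8 := integral_Ioi_of_hasDerivAt_of_tendsto hcont hder hgi hlim
  have hf0 : f 0 = 0 := by
    rw [hf]
    dsimp only
    rw [Complex.ofReal_zero, mul_zero, zero_zpow _ (by push_cast; omega), zero_mul]
  have h9 : Integrable (fun u => a * x * rayIntegrand a b K φ ((n + 1 : ℕ) - a) x y u +
      b * y * rayIntegrand a b K φ ((n + 1 : ℕ) - b) x y u) (volume.restrict (Set.Ioi 0)) :=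
    (h4.const_mul _).add (h5.const_mul _)
  rw [hf0, sub_zero, hg, integral_add (h0.const_mul _) h9,
    integral_add (h4.const_mul _) (h5.const_mul _), integral_const_mul, integral_const_mul,
    integral_const_mul] at h8
  linear_combination -h8

theorem integrand_ray_int (ha : 1 ≤ a) (hb : 1 ≤ b) {N : ℤ} (hN : N < K) (φ : ℝ)
    (y : Fin 2 → ℂ) : (GeomCycle.ray φ).integrand ![a, b] (N : ℂ) y =
      Set.indicator (Set.Ioi 0) (rayIntegrand a b K φ N (y 0) (y 1)) := by
  funext u
  rw [GeomCycle.integrand]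
  congr 1
  funext r
  rw [rayIntegrand, boxRemainder, Complex.intCast_re, taylorPoly_two ha hb hN, phase]
  have e1 : (-(N : ℂ) - 1) = ((-N - 1 : ℤ) : ℂ) := by push_cast; ring
  have e2 : ∑ j, y j * (Complex.exp (φ * Complex.I) * (r : ℂ)) ^ ![a, b] j =
      y 0 * (Complex.exp (φ * Complex.I) * (r : ℂ)) ^ a +
      y 1 * (Complex.exp (φ * Complex.I) * (r : ℂ)) ^ b := Fin.sum_univ_two _
  rw [e1, Complex.cpow_intCast, e2]

end

end

end Hypergeo

namespace Hypergeo

/-! ### Expansions and integration by parts -/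

/-- The integral along `C` has the asymptotic expansion `∑ f_m z^m` on the ball and the sector of
size `r`. -/
def ExpandsOn {n : ℕ} (A : Fin (n + 1) → ℕ) (β : ℂ) (θ : ℝ) (p : Fin n → ℂ)
    (C : GeomCycle →₀ ℂ) (f : (Fin n → ℂ) → ℕ → ℂ) (r : ℝ) : Prop :=
  (∀ x ∈ Metric.ball p r, ∀ z ∈ sector θ r r, ∀ c ∈ C.support,
      Integrable (c.integrand A β (Fin.snoc x z : Fin (n + 1) → ℂ))) ∧
    DifferentiableOn ℂ
      (fun y : (Fin n → ℂ) × ℂ => cycleIntegral A β C (Fin.snoc y.1 y.2 : Fin (n + 1) → ℂ))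
      (Metric.ball p r ×ˢ sector θ r r) ∧
    ∀ N : ℕ, ∃ K : ℝ, ∀ x ∈ Metric.ball p r, ∀ z ∈ sector θ r r,
      ‖cycleIntegral A β C (Fin.snoc x z : Fin (n + 1) → ℂ) - ∑ m ∈ Finset.range N, f x m * z ^ m‖
        ≤ K * ‖z‖ ^ N

/-- With a single small r as radius of the ball and as radius and opening of the sector, a common
domain for several expansions is found by intersecting filters. The representative f does not depend
on r. -/
theorem HasExpansion.eventually {n : ℕ} {A : Fin (n + 1) → ℕ} {β : ℂ} {θ : ℝ} {p : Fin n → ℂ}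
    {C : GeomCycle →₀ ℂ} {Φ : HolGerm p} (h : HasExpansion A β θ C Φ) :
    ∃ f : (Fin n → ℂ) → ℕ → ℂ, (f : Germ (𝓝 p) (ℕ → ℂ)) = Φ.1 ∧
      ∀ᶠ r in 𝓝[>] (0 : ℝ), ExpandsOn A β θ p C f r := by
  obtain ⟨ρ, hρ, δ, hδ, h1, h2, f, hf, h3⟩ := h
  refine ⟨f, hf, ?_⟩
  filter_upwards [Ioc_mem_nhdsGT (lt_min hρ hδ)] with r hr
  have hb := Metric.ball_subset_ball (x := p) (hr.2.trans (min_le_left ρ δ))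
  have hs := sector_mono (θ := θ) (hr.2.trans (min_le_right ρ δ)) (hr.2.trans (min_le_left ρ δ))
  refine ⟨fun x hx z hz => h1 x (hb hx) z (hs hz), h2.mono (Set.prod_mono hb hs), fun N => ?_⟩
  obtain ⟨K, hK⟩ := h3 N
  exact ⟨K, fun x hx z hz => hK x (hb hx) z (hs hz)⟩

theorem ExpandsOn.hasExpansion {n : ℕ} {A : Fin (n + 1) → ℕ} {β : ℂ} {θ : ℝ} {p : Fin n → ℂ}
    {C : GeomCycle →₀ ℂ} {Φ : HolGerm p} {f : (Fin n → ℂ) → ℕ → ℂ} {r : ℝ} (hr : 0 < r)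
    (h : ExpandsOn A β θ p C f r) (hf : (f : Germ (𝓝 p) (ℕ → ℂ)) = Φ.1) :
    HasExpansion A β θ C Φ :=
  ⟨r, hr, r, hr, h.1, h.2.1, f, hf, h.2.2⟩

theorem cycleIntegral_single {n : ℕ} {A : Fin n → ℕ} {β : ℂ} (c : GeomCycle) (x : Fin n → ℂ) :
    cycleIntegral A β (Finsupp.single c 1) x = ∫ u, c.integrand A β x u := by
  rw [cycleIntegral, Finsupp.sum_single_index (zero_mul _), one_mul]

section
variable {a b : ℕ} {θ φ : ℝ} {p : Fin 1 → ℂ}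

theorem ExpandsOn.integrable {A : Fin 2 → ℕ} {β : ℂ} {c : GeomCycle}
    {f : (Fin 1 → ℂ) → ℕ → ℂ} {r : ℝ} (h : ExpandsOn A β θ p (Finsupp.single c 1) f r)
    {x : Fin 1 → ℂ} (hx : x ∈ Metric.ball p r) {z : ℂ} (hz : z ∈ sector θ r r) :
    Integrable (c.integrand A β (Fin.snoc x z : Fin 2 → ℂ)) :=
  h.1 x hx z hz c (by rw [Finsupp.support_single _ one_ne_zero]; simp)

theorem integrable_ray_int (ha : 1 ≤ a) (hb : 1 ≤ b) {K : ℕ} {N : ℤ} (hN : N < K)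
    {y : Fin 2 → ℂ} : Integrable ((GeomCycle.ray φ).integrand ![a, b] (N : ℂ) y) ↔
      IntegrableOn (rayIntegrand a b K φ N (y 0) (y 1)) (Set.Ioi 0) := by
  rw [integrand_ray_int ha hb hN, integrable_indicator_iff measurableSet_Ioi]

theorem cycleIntegral_ray_int (ha : 1 ≤ a) (hb : 1 ≤ b) {K : ℕ} {N : ℤ} (hN : N < K)
    (y : Fin 2 → ℂ) : cycleIntegral ![a, b] (N : ℂ) (Finsupp.single (GeomCycle.ray φ) 1) y =
      ∫ u in Set.Ioi (0 : ℝ), rayIntegrand a b K φ N (y 0) (y 1) u := by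
  rw [cycleIntegral_single, integrand_ray_int ha hb hN, integral_indicator measurableSet_Ioi]

/-- Expansions are compatible with integration by parts along a half line. -/
theorem hasExpansion_parts (ha : 1 ≤ a) (hb : 1 ≤ b) {n : ℕ} (hn : IsGap a b (n + 1 : ℕ))
    {Φ₁ Φ₂ Φ₃ Φ₄ Φ₅ : HolGerm p}
    (h₁ : HasExpansion ![a, b] ((-1 : ℤ) : ℂ) θ (Finsupp.single (.ray φ) 1) Φ₁)
    (h₂ : HasExpansion ![a, b] ((-a : ℤ) : ℂ) θ (Finsupp.single (.ray φ) 1) Φ₂)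
    (h₃ : HasExpansion ![a, b] ((-b : ℤ) : ℂ) θ (Finsupp.single (.ray φ) 1) Φ₃)
    (h₄ : HasExpansion ![a, b] (((n + 1 : ℕ) - a : ℤ) : ℂ) θ (Finsupp.single (.ray φ) 1) Φ₄)
    (h₅ : HasExpansion ![a, b] (((n + 1 : ℕ) - b : ℤ) : ℂ) θ (Finsupp.single (.ray φ) 1) Φ₅) :
    HasExpansion ![a, b] (((n + 1 : ℕ) : ℤ) : ℂ) θ (Finsupp.single (.ray φ) 1)
      (((n : ℂ) + 1)⁻¹ • ((a : ℂ) • mulX 0 Φ₄ + (b : ℂ) • mulZ Φ₅)) := by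
  have hn0 : (n : ℂ) + 1 ≠ 0 := by exact_mod_cast n.succ_ne_zero
  obtain ⟨f₁, -, e₁⟩ := h₁.eventually
  obtain ⟨f₂, -, e₂⟩ := h₂.eventually
  obtain ⟨f₃, -, e₃⟩ := h₃.eventually
  obtain ⟨f₄, hf₄, e₄⟩ := h₄.eventually
  obtain ⟨f₅, hf₅, e₅⟩ := h₅.eventually
  obtain ⟨r, ⟨⟨⟨⟨g₁, g₂⟩, g₃⟩, g₄⟩, g₅⟩, hr⟩ :=
    (((((e₁.and e₂).and e₃).and e₄).and e₅).and self_mem_nhdsWithin).exists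
  set K := n + 2 with hK
  have hy0 : ∀ (x : Fin 1 → ℂ) (z : ℂ), (Fin.snoc x z : Fin 2 → ℂ) 0 = x 0 := fun x z =>
    Fin.snoc_castSucc (α := fun _ => ℂ) z x 0
  have hy1 : ∀ (x : Fin 1 → ℂ) (z : ℂ), (Fin.snoc x z : Fin 2 → ℂ) 1 = z := fun x z =>
    Fin.snoc_last (α := fun _ => ℂ) z x
  have key : ∀ x ∈ Metric.ball p r, ∀ z ∈ sector θ r r,
      Integrable ((GeomCycle.ray φ).integrand ![a, b] (((n + 1 : ℕ) : ℤ) : ℂ)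
        (Fin.snoc x z : Fin 2 → ℂ)) ∧
      cycleIntegral ![a, b] (((n + 1 : ℕ) : ℤ) : ℂ) (Finsupp.single (.ray φ) 1)
        (Fin.snoc x z : Fin 2 → ℂ) = ((n : ℂ) + 1)⁻¹ * (a * x 0 *
        cycleIntegral ![a, b] (((n + 1 : ℕ) - a : ℤ) : ℂ) (Finsupp.single (.ray φ) 1)
          (Fin.snoc x z : Fin 2 → ℂ) + b * z *
        cycleIntegral ![a, b] (((n + 1 : ℕ) - b : ℤ) : ℂ) (Finsupp.single (.ray φ) 1)
          (Fin.snoc x z : Fin 2 → ℂ)) := by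
    intro x hx z hz
    have i₁ := (integrable_ray_int (K := K) ha hb (by omega)).1 (g₁.integrable hx hz)
    have i₂ := (integrable_ray_int (K := K) ha hb (by omega)).1 (g₂.integrable hx hz)
    have i₃ := (integrable_ray_int (K := K) ha hb (by omega)).1 (g₃.integrable hx hz)
    have i₄ := (integrable_ray_int (K := K) ha hb (by omega)).1 (g₄.integrable hx hz)
    have i₅ := (integrable_ray_int (K := K) ha hb (by omega)).1 (g₅.integrable hx hz)
    refine ⟨(integrable_ray_int (K := K) ha hb (by omega)).2
      (integrableOn_rayIntegrand ha hb hn (by omega) i₁), ?_⟩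
    have hp := ray_parts ha hb hn (by omega) i₁ i₂ i₃ i₄ i₅
    rw [cycleIntegral_ray_int (K := K) ha hb (by omega),
      cycleIntegral_ray_int (K := K) ha hb (by omega),
      cycleIntegral_ray_int (K := K) ha hb (by omega)]
    rw [hy0, hy1] at hp ⊢
    rw [eq_inv_mul_iff_mul_eq₀ hn0]
    exact hp
  refine ExpandsOn.hasExpansion (r := r) hr (f := fun x m => ((n : ℂ) + 1)⁻¹ *
    (a * (x 0 * f₄ x m) + b * (if m = 0 then 0 else f₅ x (m - 1)))) ⟨?_, ?_, ?_⟩ ?_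
  · intro x hx z hz c hc
    rw [Finsupp.support_single _ one_ne_zero, Finset.mem_singleton] at hc
    rw [hc]
    exact (key x hx z hz).1
  · have hd : DifferentiableOn ℂ (fun y : (Fin 1 → ℂ) × ℂ => ((n : ℂ) + 1)⁻¹ * (a * y.1 0 *
        cycleIntegral ![a, b] (((n + 1 : ℕ) - a : ℤ) : ℂ) (Finsupp.single (.ray φ) 1)
          (Fin.snoc y.1 y.2 : Fin 2 → ℂ) + b * y.2 *
        cycleIntegral ![a, b] (((n + 1 : ℕ) - b : ℤ) : ℂ) (Finsupp.single (.ray φ) 1)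
          (Fin.snoc y.1 y.2 : Fin 2 → ℂ))) (Metric.ball p r ×ˢ sector θ r r) := by
      have d1 : DifferentiableOn ℂ (fun y : (Fin 1 → ℂ) × ℂ => (a : ℂ) * y.1 0)
        (Metric.ball p r ×ˢ sector θ r r) := by fun_prop
      have d2 : DifferentiableOn ℂ (fun y : (Fin 1 → ℂ) × ℂ => (b : ℂ) * y.2)
        (Metric.ball p r ×ˢ sector θ r r) := by fun_prop
      exact ((d1.mul g₄.2.1).add (d2.mul g₅.2.1)).const_mul _
    exact hd.congr fun y hy => (key y.1 hy.1 y.2 hy.2).2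
  · intro N
    obtain ⟨K₄, hK₄⟩ := g₄.2.2 N
    -- Multiplication by z raises the order by one, so the expansion to order N - 1 suffices; order
    -- 0 is separate and uses |z| < r.
    obtain ⟨K₅, hK₅⟩ : ∃ K₅ : ℝ, ∀ x ∈ Metric.ball p r, ∀ z ∈ sector θ r r,
        ‖z * (cycleIntegral ![a, b] (((n + 1 : ℕ) - b : ℤ) : ℂ) (Finsupp.single (.ray φ) 1)
          (Fin.snoc x z : Fin 2 → ℂ)) - ∑ m ∈ Finset.range N,
            (if m = 0 then 0 else f₅ x (m - 1)) * z ^ m‖ ≤ K₅ * ‖z‖ ^ N := by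
      rcases N with _ | N
      · obtain ⟨K₅, hK₅⟩ := g₅.2.2 0
        refine ⟨r * K₅, fun x hx z hz => ?_⟩
        have := hK₅ x hx z hz
        simp only [Finset.range_zero, Finset.sum_empty, sub_zero, pow_zero, mul_one] at this ⊢
        rw [norm_mul]
        exact mul_le_mul hz.2.1.le this (norm_nonneg _) (le_of_lt hr)
      · obtain ⟨K₅, hK₅⟩ := g₅.2.2 N
        refine ⟨K₅, fun x hx z hz => ?_⟩
        have e : ∑ m ∈ Finset.range (N + 1), (if m = 0 then 0 else f₅ x (m - 1)) * z ^ m =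
            z * ∑ m ∈ Finset.range N, f₅ x m * z ^ m := by
          rw [Finset.sum_range_succ', Finset.mul_sum]
          simp only [if_true, zero_mul, add_zero, Nat.succ_ne_zero, if_false, Nat.add_sub_cancel]
          exact Finset.sum_congr rfl fun m _ => by ring
        rw [e, ← mul_sub, norm_mul, pow_succ, mul_comm, ← mul_assoc]
        exact mul_le_mul_of_nonneg_right (hK₅ x hx z hz) (norm_nonneg _)
    refine ⟨‖((n : ℂ) + 1)⁻¹‖ * (a * (‖p‖ + r) * K₄ + b * K₅), fun x hx z hz => ?_⟩
    rw [(key x hx z hz).2]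
    have e : ((n : ℂ) + 1)⁻¹ * (a * x 0 *
        cycleIntegral ![a, b] (((n + 1 : ℕ) - a : ℤ) : ℂ) (Finsupp.single (.ray φ) 1)
          (Fin.snoc x z : Fin 2 → ℂ) + b * z *
        cycleIntegral ![a, b] (((n + 1 : ℕ) - b : ℤ) : ℂ) (Finsupp.single (.ray φ) 1)
          (Fin.snoc x z : Fin 2 → ℂ)) - ∑ m ∈ Finset.range N, ((n : ℂ) + 1)⁻¹ *
        (a * (x 0 * f₄ x m) + b * (if m = 0 then 0 else f₅ x (m - 1))) * z ^ m =
        ((n : ℂ) + 1)⁻¹ * (a * x 0 *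
        (cycleIntegral ![a, b] (((n + 1 : ℕ) - a : ℤ) : ℂ) (Finsupp.single (.ray φ) 1)
          (Fin.snoc x z : Fin 2 → ℂ) - ∑ m ∈ Finset.range N, f₄ x m * z ^ m) + b * (z *
        cycleIntegral ![a, b] (((n + 1 : ℕ) - b : ℤ) : ℂ) (Finsupp.single (.ray φ) 1)
          (Fin.snoc x z : Fin 2 → ℂ) - ∑ m ∈ Finset.range N,
            (if m = 0 then 0 else f₅ x (m - 1)) * z ^ m)) := by
      have e1 : ∑ m ∈ Finset.range N, ((n : ℂ) + 1)⁻¹ *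
          (a * (x 0 * f₄ x m) + b * (if m = 0 then 0 else f₅ x (m - 1))) * z ^ m =
          ((n : ℂ) + 1)⁻¹ * (a * x 0 * ∑ m ∈ Finset.range N, f₄ x m * z ^ m +
            b * ∑ m ∈ Finset.range N, (if m = 0 then 0 else f₅ x (m - 1)) * z ^ m) := by
        rw [Finset.mul_sum, Finset.mul_sum, ← Finset.sum_add_distrib, Finset.mul_sum]
        exact Finset.sum_congr rfl fun m _ => by ring
      rw [e1]
      ring
    rw [e, norm_mul, mul_assoc ‖((n : ℂ) + 1)⁻¹‖]
    refine mul_le_mul_of_nonneg_left ((norm_add_le _ _).trans ?_) (norm_nonneg _)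
    rw [add_mul]
    have hx0 : ‖x 0‖ ≤ ‖p‖ + r := by
      have h1 := norm_le_pi_norm x 0
      have h2 : ‖x - p‖ < r := by rwa [← dist_eq_norm]
      have h3 := norm_add_le p (x - p)
      rw [add_sub_cancel] at h3
      linarith
    refine add_le_add ?_ ?_
    · rw [norm_mul, norm_mul, Complex.norm_natCast, mul_assoc _ K₄]
      have := hK₄ x hx z hz
      gcongr
    · rw [norm_mul, Complex.norm_natCast, mul_assoc]
      exact mul_le_mul_of_nonneg_left (hK₅ x hx z hz) (Nat.cast_nonneg b)
  · rw [Submodule.coe_smul, Submodule.coe_add, Submodule.coe_smul, Submodule.coe_smul]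
    obtain ⟨_, k₄, rfl, _⟩ := Φ₄
    obtain ⟨_, k₅, rfl, _⟩ := Φ₅
    refine Germ.coe_eq.2 ?_
    filter_upwards [Germ.coe_eq.1 hf₄, Germ.coe_eq.1 hf₅] with x h4 h5
    funext m
    rw [h4, h5]
    rfl

end

end Hypergeo

namespace Hypergeo

/-! ### The Weyl algebra acts on germs -/

section
variable {p : Fin 1 → ℂ}

theorem pd_mulX (φ : HolGerm p) : pd 0 (mulX 0 φ) = φ + mulX 0 (pd 0 φ) := by
  obtain ⟨f, hf, rfl⟩ := exists_eq_mkGerm φ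
  refine Subtype.ext (Germ.coe_eq.2 ?_)
  filter_upwards [hf] with x hx
  funext m
  have h1 : HasFDerivAt (fun y : Fin 1 → ℂ => y 0) (ContinuousLinearMap.proj (R := ℂ) 0) x :=
    (ContinuousLinearMap.proj (R := ℂ) (φ := fun _ : Fin 1 => ℂ) 0).hasFDerivAt
  have h2 := h1.mul (hx m).differentiableAt.hasFDerivAt
  show fderiv ℂ (fun y => y 0 * f y m) x (Pi.single 0 1) =
    f x m + x 0 * fderiv ℂ (fun y => f y m) x (Pi.single 0 1)
  rw [show fderiv ℂ (fun y => y 0 * f y m) x = _ from h2.fderiv]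
  simp
  ring

theorem pd_mulZ (φ : HolGerm p) : pd 0 (mulZ φ) = mulZ (pd 0 φ) := by
  obtain ⟨f, hf, rfl⟩ := exists_eq_mkGerm φ
  refine Subtype.ext (Germ.coe_eq.2 (Eventually.of_forall fun x => funext fun m => ?_))
  show fderiv ℂ (fun y => if m = 0 then 0 else f y (m - 1)) x (Pi.single 0 1) =
    if m = 0 then 0 else fderiv ℂ (fun y => f y (m - 1)) x (Pi.single 0 1)
  split_ifs <;> simp

theorem dz_mulX (φ : HolGerm p) : dz (mulX 0 φ) = mulX 0 (dz φ) := by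
  obtain ⟨f, hf, rfl⟩ := exists_eq_mkGerm φ
  refine Subtype.ext (Germ.coe_eq.2 (Eventually.of_forall fun x => funext fun m => ?_))
  exact mul_left_comm _ _ _

theorem dz_mulZ (φ : HolGerm p) : dz (mulZ φ) = φ + mulZ (dz φ) := by
  obtain ⟨f, hf, rfl⟩ := exists_eq_mkGerm φ
  refine Subtype.ext (Germ.coe_eq.2 (Eventually.of_forall fun x => funext fun m => ?_))
  show ((m : ℂ) + 1) * (if m + 1 = 0 then 0 else f x (m + 1 - 1)) =
    f x m + if m = 0 then 0 else (((m - 1 : ℕ) : ℂ) + 1) * f x (m - 1 + 1)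
  rcases m with _ | m
  · simp
  · simp only [Nat.succ_ne_zero, if_false, Nat.add_sub_cancel]
    push_cast
    ring

theorem mulX_mem_gevrey {s : ℝ} {φ : HolGerm p} (h : φ ∈ gevrey p s) : mulX 0 φ ∈ gevrey p s := by
  obtain ⟨f, hf, C, K, hb⟩ := h
  obtain ⟨_, g, rfl, hg⟩ := φ
  refine ⟨fun x m => x 0 * f x m, Germ.coe_eq.2 ?_, (‖p‖ + 1) * |C|, |K|, ?_⟩
  · filter_upwards [Germ.coe_eq.1 hf] with x hx
    rw [hx]
  · filter_upwards [hb, Metric.ball_mem_nhds p one_pos] with x hx hxp m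
    have h1 := norm_le_pi_norm x 0
    have h2 : ‖x - p‖ < 1 := by rwa [← dist_eq_norm]
    have h3 := norm_add_le p (x - p)
    rw [add_sub_cancel] at h3
    rw [norm_mul, mul_assoc, mul_assoc]
    refine mul_le_mul (by linarith) ((hx m).trans ?_) (norm_nonneg _) (by positivity)
    rw [← mul_assoc]
    refine mul_le_mul_of_nonneg_right ((le_abs_self _).trans_eq ?_) (by positivity)
    rw [abs_mul, abs_pow]

theorem mulZ_mem_gevrey {s : ℝ} (hs : 1 ≤ s) {φ : HolGerm p} (h : φ ∈ gevrey p s) :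
    mulZ φ ∈ gevrey p s := by
  obtain ⟨f, hf, C, K, hb⟩ := h
  obtain ⟨_, g, rfl, hg⟩ := φ
  refine ⟨fun x m => if m = 0 then 0 else f x (m - 1), Germ.coe_eq.2 ?_, |C|, max 1 |K|, ?_⟩
  · filter_upwards [Germ.coe_eq.1 hf] with x hx
    rw [hx]
  · filter_upwards [hb] with x hx m
    rcases m with _ | m
    · simp
    · rw [if_neg m.succ_ne_zero, Nat.add_sub_cancel]
      have h1 : C * K ^ m ≤ |C| * max 1 |K| ^ (m + 1) := by
        calc C * K ^ m ≤ |C| * |K| ^ m := by rw [← abs_pow, ← abs_mul]; exact le_abs_self _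
          _ ≤ |C| * max 1 |K| ^ m := by gcongr; exact le_max_right _ _
          _ ≤ _ := by gcongr; exacts [le_max_left _ _, m.le_succ]
      have h2 : (m.factorial : ℝ) ≤ ((m + 1).factorial : ℝ) := by
        exact_mod_cast Nat.factorial_le m.le_succ
      refine (hx m).trans (mul_le_mul h1 ?_ (by positivity) (by positivity))
      exact Real.rpow_le_rpow (by positivity) h2 (by linarith)

/-! ### The expansions along a half line -/

/-- The solutions of the recursion `N Φ_N = a x Φ_(N-a) + b z Φ_(N-b)` with given values for
`N ≤ 0`. -/
noncomputable def extendGerm (a b : ℕ) (G : ℤ → HolGerm p) (N : ℤ) : HolGerm p :=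
  -- The cases a = 0 and b = 0 are included only to make the recursion decrease.
  if _h : N ≤ 0 ∨ a = 0 ∨ b = 0 then G N else
    (N : ℂ)⁻¹ • ((a : ℂ) • mulX 0 (extendGerm a b G (N - a)) +
      (b : ℂ) • mulZ (extendGerm a b G (N - b)))
termination_by N.toNat
decreasing_by all_goals omega

/-- Germs indexed by integers that behave like the expansions of the integrals along one cycle. -/
structure IsRayFamily (a b : ℕ) (s : ℝ) (G : ℤ → HolGerm p) (N : ℤ) : Prop where
  pd_eq : pd 0 (G N) = G (N - a)
  dz_eq : dz (G N) = G (N - b)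
  euler_eq : (a : ℂ) • mulX 0 (G (N - a)) + (b : ℂ) • mulZ (G (N - b)) = (N : ℂ) • G N
  mem_gevrey : G N ∈ gevrey p s

variable {a b : ℕ} {s : ℝ} {G : ℤ → HolGerm p}

theorem extendGerm_of_nonpos {N : ℤ} (hN : N ≤ 0) : extendGerm a b G N = G N := by
  rw [extendGerm, dif_pos (Or.inl hN)]

/-- Gaps are stable under subtracting a and b and never equal 0, so the recursion can be divided by
N. Its compatibility with ∂_x is the commutation relation: applied to the right-hand side, ∂_x gives
a Φ_{N-a} + (N - a) Φ_{N-a} = N Φ_{N-a}; likewise for ∂_z. -/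
theorem isRayFamily_extendGerm (ha : 1 ≤ a) (hb : 1 ≤ b) (hs : 1 ≤ s)
    (h : ∀ N < 0, IsRayFamily a b s G N) (n : ℕ) : ∀ N < (n : ℤ), IsGap a b N →
      IsRayFamily a b s (extendGerm a b G) N := by
  induction n with
  | zero =>
    intro N hN _
    have hN' : N < 0 := by exact_mod_cast hN
    have h1 := h N hN'
    have e0 : extendGerm a b G N = G N := extendGerm_of_nonpos hN'.le
    have e1 : extendGerm a b G (N - a) = G (N - a) := extendGerm_of_nonpos (by omega)
    have e2 : extendGerm a b G (N - b) = G (N - b) := extendGerm_of_nonpos (by omega)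
    exact ⟨by rw [e0, e1, h1.pd_eq], by rw [e0, e2, h1.dz_eq], by rw [e0, e1, e2, h1.euler_eq],
      by rw [e0]; exact h1.mem_gevrey⟩
  | succ n ih =>
    intro N hN hg
    by_cases hlt : N < n
    · exact ih N hlt hg
    have hN0 := hg.ne_zero
    have hpos : 0 < N := by omega
    have hNc : (N : ℂ) ≠ 0 := by exact_mod_cast hN0
    have i1 := ih (N - a) (by push_cast at hN; omega) hg.sub_left
    have i2 := ih (N - b) (by push_cast at hN; omega) hg.sub_right
    have e : extendGerm a b G N = (N : ℂ)⁻¹ • ((a : ℂ) • mulX 0 (extendGerm a b G (N - a)) +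
      (b : ℂ) • mulZ (extendGerm a b G (N - b))) := by
      rw [extendGerm, dif_neg (by omega)]
    refine ⟨?_, ?_, ?_, ?_⟩
    · rw [e, map_smul, map_add, map_smul, map_smul, pd_mulX, pd_mulZ, i1.pd_eq, i2.pd_eq, smul_add (a : ℂ),
        add_assoc, sub_right_comm N (b : ℤ), i1.euler_eq, ← add_smul, smul_smul]
      have : (N : ℂ)⁻¹ * ((a : ℂ) + ((N - a : ℤ) : ℂ)) = 1 := by
        push_cast
        rw [add_sub_cancel, inv_mul_cancel₀ hNc]
      rw [this, one_smul]
    · rw [e, map_smul, map_add, map_smul, map_smul, dz_mulX, dz_mulZ, i1.dz_eq, i2.dz_eq, smul_add (b : ℂ),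
        add_left_comm, sub_right_comm N (a : ℤ), i2.euler_eq, ← add_smul, smul_smul]
      have : (N : ℂ)⁻¹ * ((b : ℂ) + ((N - b : ℤ) : ℂ)) = 1 := by
        push_cast
        rw [add_sub_cancel, inv_mul_cancel₀ hNc]
      rw [this, one_smul]
    · rw [e, smul_smul, mul_inv_cancel₀ hNc, one_smul]
    · rw [e]
      exact Submodule.smul_mem _ _ (Submodule.add_mem _
        (Submodule.smul_mem _ _ (mulX_mem_gevrey i1.mem_gevrey))
        (Submodule.smul_mem _ _ (mulZ_mem_gevrey hs i2.mem_gevrey)))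

/-- Here ∂^u sends the germ of index N to that of index N - Au, which stays among the gaps; so only
Au matters, as for moments. -/
theorem IsRayFamily.mem_Sol (h : ∀ N, IsGap a b N → IsRayFamily a b s G N) {N : ℤ}
    (hN : IsGap a b N) : G N ∈ Sol ![a, b] (N : ℂ) s p := by
  have p0 : (partialD 0 : Module.End ℂ (HolGerm p)) = pd 0 := partialD_castSucc 0
  have p1 : (partialD 1 : Module.End ℂ (HolGerm p)) = dz := partialD_last
  have m0 : (mulCoord 0 : Module.End ℂ (HolGerm p)) = mulX 0 := mulCoord_castSucc 0
  have m1 : (mulCoord 1 : Module.End ℂ (HolGerm p)) = mulZ := mulCoord_last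
  have h1 : ∀ (u : ℕ) (N : ℤ), IsGap a b N → IsGap a b (N - (a * u : ℕ)) ∧
      (pd 0 ^ u : Module.End ℂ (HolGerm p)) (G N) = G (N - (a * u : ℕ)) := by
    intro u
    induction u with
    | zero => intro N hN; simpa using hN
    | succ u ih =>
      intro N hN
      have e : N - ((a * (u + 1) : ℕ) : ℤ) = N - (a * u : ℕ) - a := by push_cast; ring
      rw [e, pow_succ', Module.End.mul_apply, (ih N hN).2]
      exact ⟨(ih N hN).1.sub_left, (h _ (ih N hN).1).pd_eq⟩
  have h2 : ∀ (u : ℕ) (N : ℤ), IsGap a b N → IsGap a b (N - (b * u : ℕ)) ∧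
      (dz ^ u : Module.End ℂ (HolGerm p)) (G N) = G (N - (b * u : ℕ)) := by
    intro u
    induction u with
    | zero => intro N hN; simpa using hN
    | succ u ih =>
      intro N hN
      have e : N - ((b * (u + 1) : ℕ) : ℤ) = N - (b * u : ℕ) - b := by push_cast; ring
      rw [e, pow_succ', Module.End.mul_apply, (ih N hN).2]
      exact ⟨(ih N hN).1.sub_right, (h _ (ih N hN).1).dz_eq⟩
  have h3 : ∀ u : Fin 2 → ℕ, Dmon u (G N) = G (N - (∑ j, ![a, b] j * u j : ℕ)) := by
    intro u
    have e : ∑ j, ![a, b] j * u j = a * u 0 + b * u 1 := Fin.sum_univ_two _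
    have e' : (Dmon u : Module.End ℂ (HolGerm p)) = pd 0 ^ u 0 * dz ^ u 1 := by
      rw [Dmon, ← p0, ← p1]
      simp [List.ofFn_succ]
    rw [e, e', Module.End.mul_apply, (h2 _ N hN).2, (h1 _ _ (h2 _ N hN).1).2]
    congr 1
    push_cast
    ring
  refine ⟨⟨(h N hN).mem_gevrey, ?_⟩, ?_⟩
  · simp only [SetLike.mem_coe, Submodule.mem_iInf]
    intro u v huv
    rw [LinearMap.mem_ker, LinearMap.sub_apply, h3, h3, huv, sub_self]
  · rw [SetLike.mem_coe, LinearMap.mem_ker, LinearMap.sub_apply, sub_eq_zero]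
    have e : (euler ![a, b] : Module.End ℂ (HolGerm p)) =
        (a : ℂ) • (mulX 0 * pd 0) + (b : ℂ) • (mulZ * dz) := by
      rw [← p0, ← p1, ← m0, ← m1]
      exact Fin.sum_univ_two _
    rw [e]
    simp only [LinearMap.add_apply, LinearMap.smul_apply, Module.End.mul_apply, (h N hN).pd_eq,
      (h N hN).dz_eq, (h N hN).euler_eq, Module.End.one_apply]

/-- This is the coefficient of z^m in the Euler relation, z ∂_z acting as m. It allows non-vanishing
to be passed from N - a to N. -/
theorem IsRayFamily.evalCoeff_eq {N : ℤ} (h : IsRayFamily a b s G N) (m : ℕ) :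
    ((N : ℂ) - b * m) * evalCoeff m (G N) = a * p 0 * evalCoeff m (G (N - a)) := by
  have h1 := congrArg (evalCoeff m) h.euler_eq
  rw [← h.dz_eq] at h1
  have e1 : ∀ ψ : HolGerm p, evalCoeff m (mulX 0 ψ) = p 0 * evalCoeff m ψ := by
    intro ψ
    obtain ⟨f, hf, rfl⟩ := exists_eq_mkGerm ψ
    rfl
  have e2 : ∀ ψ : HolGerm p, evalCoeff m (mulZ (dz ψ)) = m * evalCoeff m ψ := by
    intro ψ
    obtain ⟨f, hf, rfl⟩ := exists_eq_mkGerm ψ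
    show (if m = 0 then 0 else (((m - 1 : ℕ) : ℂ) + 1) * f p (m - 1 + 1)) = m * f p m
    rcases m with _ | m
    · simp
    · simp
  rw [map_add, map_smul, map_smul, map_smul, e1, e2] at h1
  simp only [smul_eq_mul] at h1
  linear_combination -h1

end

end Hypergeo

namespace Hypergeo

/-! ### Regularised integrals along a half line -/

section
variable {a b : ℕ} {θ₁ θ₂ ρ φ : ℝ}

theorem cmom_ray_add (n k j : ℕ) (x : Fin 1 → ℂ) :
    cmom ![a, b] (-((n + k : ℕ) + 1 : ℂ)) (GeomCycle.ray φ) j x =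
      cmom ![a, b] (-(n + 1 : ℂ)) (GeomCycle.ray φ) (j + k) x := by
  rw [cmom, cmom, mom, mom]
  congr 1
  funext u
  rw [weight_ray, weight_ray]
  by_cases hu : u ∈ Set.Ioi (0 : ℝ)
  · rw [Set.indicator_of_mem hu, Set.indicator_of_mem hu, param_ray_of_pos φ hu]
    ring
  · rw [Set.indicator_of_notMem hu, Set.indicator_of_notMem hu]
    simp

theorem admissible_ray_neg (hd : Decays ![a, b] θ₁ θ₂ φ) (n : ℕ) :
    Admissible ![a, b] (-(n + 1 : ℂ)) θ₁ θ₂ (GeomCycle.ray φ) := by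
  refine ⟨⟨-(n + 1 : ℤ), by push_cast; ring, ?_⟩, hd⟩
  rintro ⟨l, hl⟩
  exact absurd hl (ne_of_lt (lt_of_lt_of_le (by omega)
    (Finset.sum_nonneg fun j _ => by positivity)))

/-- The integral of a X t^(a-1) exp(X t^a) over the half line is -1; the moment recursion then
multiplies by non-zero factors in steps of a. -/
theorem cmom_ray_ne_zero (ha : 1 ≤ a) (hab : a < b) (hd : Decays ![a, b] θ₁ θ₂ φ) (hρ : 0 < ρ)
    (n K j : ℕ) (h : j + n + 1 = a * (K + 1)) :
    cmom ![a, b] (-(n + 1 : ℂ)) (GeomCycle.ray φ) j (pt θ₁ ρ) ≠ 0 := by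
  have hA := isRow_two ha hab
  have hX := pt_ne_zero (θ := θ₁) hρ 0
  have ha0 : (a : ℂ) ≠ 0 := by exact_mod_cast (by omega : a ≠ 0)
  have e : cmom ![a, b] (-(n + 1 : ℂ)) (GeomCycle.ray φ) j (pt θ₁ ρ) =
      cmom ![a, b] (-((0 : ℕ) + 1 : ℂ)) (GeomCycle.ray φ) (j + n) (pt θ₁ ρ) := by
    have := cmom_ray_add (a := a) (b := b) (φ := φ) 0 n j (pt θ₁ ρ)
    rwa [Nat.zero_add] at this
  rw [e, show j + n = a * (K + 1) - 1 by omega]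
  clear e h
  induction K with
  | zero =>
    obtain ⟨r, hr, c, hc, K, hK, hb⟩ := (cycleData_ray hA 0 hd).integrable_mom hA (p := pt θ₁ ρ) hρ rfl
    obtain ⟨-, hi, -⟩ := hb _ (Metric.mem_ball_self hr)
    have hval : ∀ i u, (GeomCycle.ray φ).weight (-((0 : ℕ) + 1 : ℂ)) u *
        (GeomCycle.ray φ).param u ^ i *
        Complex.exp (phase (trunc ![a, b]) (pt θ₁ ρ) ((GeomCycle.ray φ).param u)) =
        Set.indicator (Set.Ioi 0) (fun u : ℝ => Complex.exp (φ * Complex.I) *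
          (Complex.exp (φ * Complex.I) * u) ^ i *
          Complex.exp (pt θ₁ ρ 0 * (Complex.exp (φ * Complex.I) * u) ^ a)) u := by
      intro i u
      rw [weight_ray]
      by_cases hu : u ∈ Set.Ioi (0 : ℝ)
      · rw [Set.indicator_of_mem hu, Set.indicator_of_mem hu, param_ray_of_pos φ hu,
          phase_trunc_two, pow_zero, one_mul]
      · rw [Set.indicator_of_notMem hu, Set.indicator_of_notMem hu]
        simp
    simp only [hval, integrable_indicator_iff measurableSet_Ioi] at hi
    rw [cmom, mom]
    simp only [hval]
    rw [integral_indicator measurableSet_Ioi, zero_add, mul_one]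
    set ε := Complex.exp (φ * Complex.I) with hε
    set X := pt θ₁ ρ 0
    have hder : ∀ u ∈ Set.Ici (0 : ℝ), HasDerivAt (fun u : ℝ => Complex.exp (X * (ε * u) ^ a))
        (a * X * (ε * (ε * u) ^ (a - 1) * Complex.exp (X * (ε * u) ^ a))) u := by
      intro u _
      have h1 := ((hasDerivAt_pow a (ε * (u : ℂ))).comp u (hasDerivAt_ray φ u)).const_mul X
      refine h1.cexp.congr_deriv ?_
      simp only [Function.comp]
      ring
    have hf : IntegrableOn (fun u : ℝ => Complex.exp (X * (ε * u) ^ a)) (Set.Ioi 0) := by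
      refine IntegrableOn.congr_fun ((hi 0).const_mul ε⁻¹) (fun u _ => ?_) measurableSet_Ioi
      rw [pow_zero, mul_one, ← mul_assoc, inv_mul_cancel₀ (Complex.exp_ne_zero _), one_mul]
    have h2 := integral_Ioi_of_hasDerivAt_of_tendsto' hder ((hi (a - 1)).const_mul _)
      (tendsto_zero_of_hasDerivAt_of_integrableOn_Ioi
        (fun u hu => hder u (Set.Ioi_subset_Ici_self hu)) ((hi (a - 1)).const_mul _) hf)
    rw [integral_const_mul, Complex.ofReal_zero, mul_zero, zero_pow (by omega), mul_zero,
      Complex.exp_zero, zero_sub] at h2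
    intro h3
    rw [h3, mul_zero] at h2
    norm_num at h2
  | succ K ih =>
    have hM : IsMom ![a, b] (-((0 : ℕ) + 1 : ℂ)) Set.univ (pt θ₁ ρ) _ := isMom_ray hA 0 hd hρ rfl
    have h1 := (hM.self_of_nhds (a * (K + 1) - 1) trivial).2.2
    simp only [Fin.sum_univ_one] at h1
    have e : (![a, b] : Fin 2 → ℕ) (Fin.castSucc 0) = a := rfl
    have hpos : 1 ≤ a * (K + 1) := Nat.mul_pos ha K.succ_pos
    have e2 : a * (K + 1) - 1 + a = a * (K + 1 + 1) - 1 := by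
      rw [Nat.mul_succ a (K + 1)]
      omega
    rw [e, e2] at h1
    intro h0
    rw [h0, mul_zero, zero_add, mul_eq_zero] at h1
    refine h1.elim (fun h => ?_) ih
    rw [Nat.cast_sub hpos] at h
    push_cast at h
    have h5 : (a : ℂ) * (K + 1) = 0 := by linear_combination h
    have h4 : (K : ℂ) + 1 ≠ 0 := by exact_mod_cast K.succ_ne_zero
    exact mul_ne_zero ha0 h4 h5

/-- The regularised integrals along a half line have asymptotic expansions, which are solutions. -/
theorem exists_hasExpansion_ray (ha : 1 ≤ a) (hab : a < b) (hd : Decays ![a, b] θ₁ θ₂ φ)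
    (hρ : 0 < ρ) {N : ℤ} (hN : IsGap a b N) : ∃ Φ : HolGerm (pt θ₁ ρ),
      HasExpansion ![a, b] (N : ℂ) θ₂ (Finsupp.single (.ray φ) 1) Φ ∧
      Φ ∈ Sol ![a, b] (N : ℂ) (b / a) (pt θ₁ ρ) ∧
      ∀ m K : ℕ, (b * m : ℕ) - N = (a * (K + 1) : ℕ) → evalCoeff m Φ ≠ 0 := by
  have hb : 1 ≤ b := by omega
  have hA := isRow_two ha hab
  have hX := pt_ne_zero (θ := θ₁) hρ 0
  have ha0 : (a : ℂ) ≠ 0 := by exact_mod_cast (by omega : a ≠ 0)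
  have hs : (1 : ℝ) ≤ b / a := by
    rw [le_div_iff₀ (by exact_mod_cast ha), one_mul]
    exact_mod_cast hab.le
  have hex : ∀ n : ℕ, _ := fun n => hasExpansion_cmom hA (admissible_ray_neg hd n)
    (fun _ _ => ⟨n, rfl⟩) (p := pt θ₁ ρ) hρ rfl
  choose hM hgr hE using hex
  replace hM : ∀ n : ℕ, IsMom ![a, b] (-(n + 1 : ℂ)) Set.univ (pt θ₁ ρ)
    (cmom ![a, b] (-(n + 1 : ℂ)) (GeomCycle.ray φ)) := hM
  -- For N < 0 these are the honest expansions. The values for N ≥ 0 are placeholders: positive N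
  -- are handled by the recursion, and 0 is not a gap.
  set G : ℤ → HolGerm (pt θ₁ ρ) := fun N => momGerm (hM (-N - 1).toNat) (isStable_univ _) with hG
  have hGn : ∀ (N : ℤ) (n : ℕ), N = -(n + 1 : ℤ) → G N = momGerm (hM n) (isStable_univ _) := by
    intro N n h
    obtain rfl : n = (-N - 1).toNat := by omega
    rfl
  have hshift : ∀ n k : ℕ, momSer b (cmom ![a, b] (-((n + k : ℕ) + 1 : ℂ)) (GeomCycle.ray φ)) =
      momSer b fun j => cmom ![a, b] (-(n + 1 : ℂ)) (GeomCycle.ray φ) (j + (0 + k)) := by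
    intro n k
    funext x m
    rw [momSer, momSer, cmom_ray_add, zero_add]
  have hrep : ∀ n k : ℕ, RepShift b (cmom ![a, b] (-(n + 1 : ℂ)) (GeomCycle.ray φ))
      (momGerm (hM (n + k)) (isStable_univ _)) (0 + k) := fun n k =>
    congrArg (fun f : (Fin 1 → ℂ) → ℕ → ℂ => (f : Germ (𝓝 (pt θ₁ ρ)) (ℕ → ℂ))) (hshift n k)
  have hfam : ∀ N : ℤ, N < 0 → IsRayFamily a b (b / a) G N := by
    intro N hN
    obtain ⟨n, rfl⟩ : ∃ n : ℕ, N = -(n + 1 : ℤ) := ⟨(-N - 1).toNat, by omega⟩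
    have hda : pd 0 (G (-(n + 1 : ℤ))) = G (-(n + 1 : ℤ) - a) := by
      rw [hGn _ n rfl, hGn _ (n + a) (by push_cast; ring), ← partialD_castSucc]
      exact (repShift_partialD (hM n) (isStable_univ _) _ trivial
        (repShift_momGerm (hM n) (isStable_univ _)) (Fin.castSucc 0)).unique (hrep n a)
    have hdb : dz (G (-(n + 1 : ℤ))) = G (-(n + 1 : ℤ) - b) := by
      rw [hGn _ n rfl, hGn _ (n + b) (by push_cast; ring), ← partialD_last]
      exact (repShift_partialD (hM n) (isStable_univ _) _ trivial
        (repShift_momGerm (hM n) (isStable_univ _)) (Fin.last 1)).unique (hrep n b)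
    refine ⟨hda, hdb, ?_, ?_⟩
    · have h1 := momGerm_mem_euler (hM n) (isStable_univ _)
      rw [LinearMap.mem_ker, LinearMap.sub_apply, sub_eq_zero, ← hGn _ n rfl] at h1
      have p0 : (partialD 0 : Module.End ℂ (HolGerm (pt θ₁ ρ))) = pd 0 := partialD_castSucc 0
      have p1 : (partialD 1 : Module.End ℂ (HolGerm (pt θ₁ ρ))) = dz := partialD_last
      have m0 : (mulCoord 0 : Module.End ℂ (HolGerm (pt θ₁ ρ))) = mulX 0 := mulCoord_castSucc 0
      have m1 : (mulCoord 1 : Module.End ℂ (HolGerm (pt θ₁ ρ))) = mulZ := mulCoord_last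
      have e : (euler ![a, b] : Module.End ℂ (HolGerm (pt θ₁ ρ))) =
          (a : ℂ) • (mulX 0 * pd 0) + (b : ℂ) • (mulZ * dz) := by
        rw [← p0, ← p1, ← m0, ← m1]
        exact Fin.sum_univ_two _
      rw [e] at h1
      simp only [LinearMap.add_apply, LinearMap.smul_apply, Module.End.mul_apply, hda, hdb,
        Module.End.one_apply] at h1
      rw [h1]
      push_cast
      rfl
    · rw [hGn _ n rfl]
      exact momGerm_mem_gevrey (hM n) (isStable_univ _) (hgr n) ha le_rfl
  have hF : ∀ N, IsGap a b N → IsRayFamily a b (b / a) (extendGerm a b G) N := fun N hN =>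
    isRayFamily_extendGerm ha hb hs hfam (N + 1).toNat N (by omega) hN
  have hEneg : ∀ N : ℤ, N < 0 → HasExpansion ![a, b] (N : ℂ) θ₂ (Finsupp.single (.ray φ) 1)
      (extendGerm a b G N) := by
    intro N hN
    obtain ⟨n, rfl⟩ : ∃ n : ℕ, N = -(n + 1 : ℤ) := ⟨(-N - 1).toNat, by omega⟩
    rw [extendGerm_of_nonpos hN.le, hGn _ n rfl]
    have := hE n
    push_cast
    exact this
  refine ⟨extendGerm a b G N, ?_, IsRayFamily.mem_Sol hF hN, ?_⟩
  · have key : ∀ n : ℕ, ∀ N : ℤ, N < n → IsGap a b N → HasExpansion ![a, b] (N : ℂ) θ₂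
        (Finsupp.single (.ray φ) 1) (extendGerm a b G N) := by
      intro n
      induction n with
      | zero => exact fun N hN _ => hEneg N (by exact_mod_cast hN)
      | succ n ih =>
        intro N hN hg
        by_cases h0 : N < 0
        · exact hEneg N h0
        have hN0 := hg.ne_zero
        obtain ⟨l, rfl⟩ : ∃ l : ℕ, N = (l + 1 : ℕ) := ⟨(N - 1).toNat, by omega⟩
        have h := hasExpansion_parts ha hb hg (hEneg (-1) (by norm_num)) (hEneg (-a) (by omega))
          (hEneg (-b) (by omega)) (ih _ (by push_cast at hN ⊢; omega) hg.sub_left)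
          (ih _ (by push_cast at hN ⊢; omega) hg.sub_right)
        rw [extendGerm, dif_neg (by omega)]
        have e : ((((l + 1 : ℕ) : ℤ) : ℂ)) = (l : ℂ) + 1 := by push_cast; ring
        rw [e] at h ⊢
        exact h
    exact key (N + 1).toNat N (by omega) hN
  -- With m fixed, replacing N by N - a and K by K + 1 preserves the hypothesis; once N is negative
  -- the coefficient is a non-zero moment divided by m!.
  · have key : ∀ n : ℕ, ∀ N : ℤ, N < n → IsGap a b N → ∀ m K : ℕ,
        (b * m : ℕ) - N = (a * (K + 1) : ℕ) → evalCoeff m (extendGerm a b G N) ≠ 0 := by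
      intro n
      induction n with
      | zero =>
        intro N hN _ m K h
        have hN' : N < 0 := by exact_mod_cast hN
        obtain ⟨n, rfl⟩ : ∃ n : ℕ, N = -(n + 1 : ℤ) := ⟨(-N - 1).toNat, by omega⟩
        rw [extendGerm_of_nonpos hN'.le, hGn _ n rfl]
        have h1 := cmom_ray_ne_zero ha hab hd hρ n K (b * m) (by omega)
        exact div_ne_zero h1 (by exact_mod_cast m.factorial_ne_zero)
      | succ n ih =>
        intro N hN hg m K h
        by_cases hlt : N < n
        · exact ih N hlt hg m K h
        have h1 := ih (N - a) (by push_cast at hN; omega) hg.sub_left m (K + 1)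
          (by push_cast at h ⊢; linarith)
        intro h0
        have h2 := (hF N hg).evalCoeff_eq m
        rw [h0, mul_zero, eq_comm] at h2
        exact mul_ne_zero (mul_ne_zero ha0 hX) h1 h2
    exact key (N + 1).toNat N (by omega) hN

end

end Hypergeo

namespace Hypergeo

/-! ### Bases of solutions for two-term rows -/

section
variable {a b : ℕ} {θ₁ θ₂ ρ : ℝ} {φ : ℕ → ℝ}

/-- The multiplier of the `m`-th coefficient from one sector to the next. -/
noncomputable def multiplier (a b : ℕ) (β : ℂ) (m : ℕ) : ℂ :=
  Complex.exp (2 * Real.pi * Complex.I * ((b * m - β) / a))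

/-- Equal multipliers mean that a divides b(m - m'), hence m - m' by coprimality, which is
impossible for distinct residues. -/
theorem multiplier_injective (ha : 1 ≤ a) (hcop : Nat.Coprime a b) (β : ℂ) {m m' : ℕ} (hm : m < a)
    (hm' : m' < a) (h : multiplier a b β m = multiplier a b β m') : m = m' := by
  have ha0 : (a : ℂ) ≠ 0 := by exact_mod_cast (by omega : a ≠ 0)
  obtain ⟨n, hn⟩ := Complex.exp_eq_exp_iff_exists_int.1 h
  have h1 : ((b * m : ℤ) : ℂ) = ((b * m' + n * a : ℤ) : ℂ) := by
    push_cast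
    have h2 := mul_left_cancel₀ Complex.two_pi_I_ne_zero (hn.trans (by ring :
      _ = 2 * Real.pi * Complex.I * ((b * m' - β) / a + n)))
    field_simp at h2
    linear_combination h2
  have h2 : (b : ℤ) * m = b * m' + n * a := by exact_mod_cast h1
  have h3 : (a : ℤ) ∣ (b : ℤ) * ((m : ℤ) - m') := ⟨n, by linarith⟩
  have h4 : (a : ℤ) ∣ (m : ℤ) - m' := (Nat.isCoprime_iff_coprime.2 hcop).dvd_of_dvd_mul_left h3
  have h5 := Int.eq_zero_of_abs_lt_dvd h4 (by rw [abs_lt]; constructor <;> omega)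
  omega

/-- The coefficients of the j-th arc are those of the 0-th arc times j-th powers of the multipliers:
the Vandermonde shape used for independence. -/
theorem exists_hasExpansion_arc (ha : 1 ≤ a) (hab : a < b) (h : IsDirections a b θ₁ θ₂ φ)
    (hρ : 0 < ρ) (β : ℂ) (j : ℕ) : ∃ Φ : HolGerm (pt θ₁ ρ),
      HasExpansion ![a, b] β θ₂ (Finsupp.single (.path (arcPath (φ j) (φ (j + 1)))) 1) Φ ∧
      Φ ∈ Sol ![a, b] β (b / a) (pt θ₁ ρ) ∧
      ∀ m, evalCoeff m Φ = multiplier a b β m ^ j *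
        (arcMom a φ (ρ * Complex.exp (θ₁ * Complex.I)) (b * m - β) 0 / m.factorial) := by
  obtain ⟨hM, hg, hE⟩ := hasExpansion_cmom (isRow_two ha hab) (h.admissible β j) (by simp)
    (p := pt θ₁ ρ) hρ rfl
  refine ⟨_, hE, momGerm_mem_Sol hM (isStable_univ _) hg ha le_rfl, fun m => ?_⟩
  rw [momGerm, evalCoeff_mkGerm, momSer, cmom_arcPath, ← mul_div_assoc, multiplier]
  have e : (![a, b] : Fin 2 → ℕ) (Fin.last 1) = b := rfl
  have e' := arcMom_eq_pow ha hab h hρ (b * m - β) j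
  rw [← e']
  congr 2
  rw [e]
  push_cast
  rfl

theorem arcMom_zero_ne_zero (ha : 1 ≤ a) (hab : a < b) (h : IsDirections a b θ₁ θ₂ φ)
    (hρ : 0 < ρ) {β : ℂ} {m : ℕ} (hm : ∀ K : ℕ, (b * m : ℂ) - β ≠ a * (K + 1 : ℕ)) :
    arcMom a φ (ρ * Complex.exp (θ₁ * Complex.I)) (b * m - β) 0 / m.factorial ≠ 0 :=
  div_ne_zero (arcMom_ne_zero ha hab h hρ hm) (by exact_mod_cast m.factorial_ne_zero)

/-- Otherwise β would be the integer bm - a(K+1) with m < a. A representation β = al + bl' would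
make m - l' a positive multiple of a, too large for m < a; so β would be exceptional. -/
theorem sub_ne_mul_of_not_isExceptional (hcop : Nat.Coprime a b) {β : ℂ}
    (hβ : ¬ IsExceptional ![a, b] β) {m : ℕ} (hm : m < a) (K : ℕ) :
    (b * m : ℂ) - β ≠ a * (K + 1 : ℕ) := by
  intro h
  refine hβ ⟨b * m - a * (K + 1), by push_cast at h ⊢; linear_combination -h, ?_⟩
  rintro ⟨l, hl⟩
  have e : ∑ j, ((![a, b] j : ℕ) : ℤ) * (l j : ℕ) = a * l 0 + b * l 1 := Fin.sum_univ_two _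
  rw [e] at hl
  have h3 : (a : ℤ) ∣ (b : ℤ) * ((m : ℤ) - l 1) := ⟨K + 1 + l 0, by linarith⟩
  have h4 : (a : ℤ) ∣ (m : ℤ) - l 1 := (Nat.isCoprime_iff_coprime.2 hcop).dvd_of_dvd_mul_left h3
  have h5 : 0 < (a : ℤ) * (K + 1 + l 0) := by
    have : 0 < (a : ℤ) := by omega
    positivity
  have h6 : (b : ℤ) * (m - l 1) = a * (K + 1 + l 0) := by linarith
  have h7 : 0 < (m : ℤ) - l 1 := by
    rw [← h6] at h5
    exact pos_of_mul_pos_right h5 (by positivity)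
  have := Int.le_of_dvd h7 h4
  omega

/-- Bézout gives m < a with bm ≡ N modulo a. The quotient (bm - N)/a is positive, since otherwise N
would lie in the semigroup. -/
theorem exists_mul_sub_eq (ha : 1 ≤ a) (hcop : Nat.Coprime a b) {N : ℤ} (hN : IsGap a b N) :
    ∃ m < a, ∃ K : ℕ, ((b * m : ℕ) : ℤ) - N = (a * (K + 1) : ℕ) := by
  obtain ⟨u, v, huv⟩ := Nat.isCoprime_iff_coprime.2 hcop
  have ha0 : (0 : ℤ) < a := by omega
  refine ⟨((v * N) % a).toNat, ?_, ?_⟩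
  · have := Int.emod_lt_of_pos (v * N) ha0
    omega
  have h0 := Int.emod_nonneg (v * N) ha0.ne'
  have h1 := Int.emod_add_mul_ediv (v * N) a
  set q := (v * N) / (a : ℤ)
  set m := ((v * N) % (a : ℤ)).toNat with hm
  have h2 : (m : ℤ) = v * N - a * q := by omega
  have h3 : ((b * m : ℕ) : ℤ) - N = a * (-(u * N) - b * q) := by
    push_cast
    rw [h2]
    linear_combination N * huv
  have h4 : 0 < -(u * N) - b * q := by
    by_contra hneg
    refine hN (u * N + b * q).toNat m ?_
    push_cast at h3 ⊢
    rw [Int.toNat_of_nonneg (by linarith)]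
    linarith
  refine ⟨(-(u * N) - b * q - 1).toNat, ?_⟩
  rw [h3]
  push_cast
  rw [Int.toNat_of_nonneg (by linarith)]
  ring

/-- Arcs between adjacent sectors; the last one is replaced by a half line for exceptional
parameters. -/
noncomputable def basicCycle (a b : ℕ) (β : ℂ) (φ : ℕ → ℝ) (j : ℕ) : GeomCycle :=
  open Classical in if IsExceptional ![a, b] β ∧ j + 1 = a then .ray (φ 0)
    else .path (arcPath (φ j) (φ (j + 1)))

/-- For non-exceptional β the first a coefficients of the a arcs form a Vandermonde matrix with rows
scaled by non-zero numbers. For exceptional β one row m₀ vanishes on all arcs; the half line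
replacing the last arc is non-zero in that row, and the other rows give a Vandermonde system for the
remaining a - 1 arcs. -/
theorem exists_basis (ha : 1 ≤ a) (hab : a < b) (hcop : Nat.Coprime a b)
    (h : IsDirections a b θ₁ θ₂ φ) (hρ : 0 < ρ) (β : ℂ) : ∃ Φ : Fin a → HolGerm (pt θ₁ ρ),
      (∀ τ : Fin a, HasExpansion ![a, b] β θ₂ (Finsupp.single (basicCycle a b β φ τ) 1) (Φ τ)) ∧
      (∀ τ, Φ τ ∈ Sol ![a, b] β (b / a) (pt θ₁ ρ)) ∧ LinearIndependent ℂ Φ := by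
  choose Ψ hΨ hS hev using exists_hasExpansion_arc ha hab h hρ β
  by_cases hβ : IsExceptional ![a, b] β
  · obtain ⟨N, rfl, -⟩ := id hβ
    have hN := isGap_of_isExceptional hβ
    obtain ⟨Ω, hΩ, hΩS, hΩev⟩ := exists_hasExpansion_ray ha hab (h 0).2 hρ hN
    obtain ⟨m₀, hm₀, K, hK⟩ := exists_mul_sub_eq ha hcop hN
    obtain ⟨d, rfl⟩ : ∃ d, a = d + 1 := ⟨a - 1, by omega⟩
    refine ⟨fun τ => if (τ : ℕ) + 1 = d + 1 then Ω else Ψ τ, fun τ => ?_, fun τ => ?_, ?_⟩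
    · show HasExpansion _ _ _ _ (if (τ : ℕ) + 1 = d + 1 then Ω else Ψ τ)
      by_cases hτ : (τ : ℕ) + 1 = d + 1
      · rw [basicCycle, if_pos ⟨hβ, hτ⟩, if_pos hτ]; exact hΩ
      · rw [basicCycle, if_neg fun h => hτ h.2, if_neg hτ]; exact hΨ τ
    · dsimp only
      split_ifs
      exacts [hΩS, hS τ]
    · have hm₀' : (b * m₀ : ℂ) - N = (d + 1 : ℕ) * (K + 1 : ℕ) := by exact_mod_cast hK
      have hvan : ∀ j, evalCoeff m₀ (Ψ j) = 0 := by
        intro j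
        rw [hev, hm₀', arcMom_mul_eq_zero ha hab h hρ K, zero_div, mul_zero]
      rw [Fintype.linearIndependent_iff]
      intro g hg
      rw [Fin.sum_univ_castSucc] at hg
      simp only [Fin.val_castSucc, Fin.val_last, if_true, add_left_inj] at hg
      have hlt : ∀ i : Fin d, ((i : ℕ) = d) = False := fun i => eq_false (by omega)
      simp only [hlt, if_false] at hg
      have hlast : g (Fin.last d) = 0 := by
        have h1 := congrArg (evalCoeff m₀) hg
        rw [map_add, map_sum, map_zero] at h1
        simp only [map_smul, hvan, smul_eq_mul, mul_zero, Finset.sum_const_zero, zero_add] at h1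
        exact (mul_eq_zero.1 h1).resolve_right (hΩev m₀ K hK)
      rw [hlast, zero_smul, add_zero] at hg
      have hv : (fun i : Fin d => g i.castSucc) = 0 := by
        refine Matrix.eq_zero_of_forall_index_sum_pow_mul_eq_zero
          (f := fun i : Fin d => multiplier (d + 1) b N ((⟨m₀, hm₀⟩ : Fin (d + 1)).succAbove i)) ?_ ?_
        · intro i i' hi
          have := multiplier_injective ha hcop (N : ℂ) (Fin.is_lt _) (Fin.is_lt _) hi
          exact Fin.succAbove_right_injective (Fin.ext this)
        · intro i
          set m := (⟨m₀, hm₀⟩ : Fin (d + 1)).succAbove i with hm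
          have hne : (m : ℕ) ≠ m₀ := fun e => Fin.succAbove_ne (⟨m₀, hm₀⟩ : Fin (d + 1)) i (Fin.ext e)
          have hc : arcMom (d + 1) φ (ρ * Complex.exp (θ₁ * Complex.I)) (b * (m : ℕ) - N) 0 /
              (m : ℕ).factorial ≠ 0 := by
            -- A second vanishing row would have multiplier 1, like m₀, against the injectivity of
            -- the multipliers.
            refine arcMom_zero_ne_zero ha hab h hρ fun K' hK' => hne ?_
            refine multiplier_injective ha hcop (N : ℂ) m.is_lt hm₀ ?_
            have ha0 : ((d + 1 : ℕ) : ℂ) ≠ 0 := by exact_mod_cast d.succ_ne_zero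
            rw [multiplier, multiplier, hK', hm₀', mul_div_cancel_left₀ _ ha0,
              mul_div_cancel_left₀ _ ha0, mul_comm, mul_comm (2 * (Real.pi : ℂ) * Complex.I),
              Complex.exp_nat_mul_two_pi_mul_I, Complex.exp_nat_mul_two_pi_mul_I]
          have h1 := congrArg (evalCoeff (m : ℕ)) hg
          rw [map_sum, map_zero] at h1
          simp only [map_smul, hev, smul_eq_mul] at h1
          refine (mul_eq_zero.1 (Eq.trans ?_ h1)).resolve_left hc
          rw [Finset.mul_sum]
          exact Finset.sum_congr rfl fun τ _ => by ring
      intro τ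
      refine Fin.lastCases hlast (fun i => congrFun hv i) τ
  · refine ⟨fun τ => Ψ τ, fun τ => ?_, fun τ => hS τ, ?_⟩
    · rw [basicCycle, if_neg fun h => hβ h.1]
      exact hΨ τ
    · rw [Fintype.linearIndependent_iff]
      intro g hg
      have hv : g = 0 := by
        refine Matrix.eq_zero_of_forall_index_sum_pow_mul_eq_zero
          (f := fun i : Fin a => multiplier a b β i) ?_ ?_
        · intro i i' hi
          exact Fin.ext (multiplier_injective ha hcop β i.is_lt i'.is_lt hi)
        · intro m
          have hc := arcMom_zero_ne_zero ha hab h hρ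
            (sub_ne_mul_of_not_isExceptional hcop hβ m.is_lt)
          have h1 := congrArg (evalCoeff (m : ℕ)) hg
          rw [map_sum, map_zero] at h1
          simp only [map_smul, hev, smul_eq_mul] at h1
          refine (mul_eq_zero.1 (Eq.trans ?_ h1)).resolve_left hc
          rw [Finset.mul_sum]
          exact Finset.sum_congr rfl fun τ _ => by ring
      exact congrFun hv

/-- One choice of directions serves all r and all ρ. Independence becomes a basis because the space
of solutions has dimension at most a. -/
theorem exists_basicFamily (k : ℕ) (ha : 1 ≤ a) (hab : a < b) (hcop : Nat.Coprime a b)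
    (β : ℂ) (θ₁ θ₂ : ℝ) :
    ∃ γ : Fin a → Fin k → GeomCycle, IsBasicFamily a b k β θ₁ θ₂ γ := by
  obtain ⟨φ, h⟩ := exists_isDirections ha hab θ₁ θ₂
  refine ⟨fun τ r => basicCycle a b ((β - (r : ℕ)) / k) φ τ, fun τ r => ?_, fun r hr => ?_,
    fun ρ hρ r => ?_⟩
  · dsimp only [basicCycle]
    split_ifs with h1
    · exact ⟨h1.1, (h 0).2⟩
    · exact h.admissible _ _
  · refine ⟨⟨a - 1, by omega⟩, ⟨φ 0, if_pos ⟨hr, by simp; omega⟩⟩, ?_⟩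
    rintro τ ⟨ψ, hψ⟩
    by_contra hne
    have h1 : ¬ ((τ : ℕ) + 1 = a) := fun e => hne (Fin.ext (by simp; omega))
    dsimp only [basicCycle] at hψ
    rw [if_neg fun e => h1 e.2] at hψ
    cases hψ
  · obtain ⟨Φ, hE, hS, hli⟩ := exists_basis ha hab hcop h hρ ((β - (r : ℕ)) / k)
    refine ⟨Φ, hE, hli, ?_⟩
    obtain ⟨hfd, hfr⟩ := finiteDimensional_Sol_two ha (b := b) (β := (β - (r : ℕ)) / k)
      (s := (b : ℝ) / a) (p := pt θ₁ ρ) (pt_ne_zero hρ 0)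
    refine Submodule.eq_of_le_of_finrank_le (Submodule.span_le.2 ?_) ?_
    · rintro _ ⟨τ, rfl⟩
      exact hS τ
    · rw [finrank_span_eq_card hli, Fintype.card_fin]
      exact hfr

end

end Hypergeo

/-! ### The main theorem -/

theorem mainTheorem3 (a b k : ℕ) (ha : 1 ≤ a) (hab : a < b) (hcop : Nat.Coprime a b)
    (hk : 1 ≤ k) (hka : 1 < k * a) (β : ℂ) (θ₁ θ₂ : ℝ) :
    (∃ γ : Fin a → Fin k → GeomCycle, IsBasicFamily a b k β θ₁ θ₂ γ) ∧
    ∀ γ : Fin a → Fin k → GeomCycle, IsBasicFamily a b k β θ₁ θ₂ γ →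
    ∃ γt : Fin a → Fin k → (GeomCycle →₀ ℂ),
      -- the new cycles are combinations of admissible geometric cycles
      (∀ τ r, ∀ c ∈ (γt τ r).support, Admissible ![1, k * a, k * b] β θ₁ θ₂ c) ∧
      -- they come from `k`-th roots of the given paths and roots of unity
      (∀ τ r w, γ τ r = GeomCycle.path w → γt τ r ∈ Submodule.span ℂ
        {C | ∃ w' : LogPath, IsRoot k w w' ∧ C = Finsupp.single (GeomCycle.path w') 1}) ∧
      -- they span a space `E` of dimension `k a`, isomorphic to the space of Gevrey solutions
      Module.finrank ℂ (Submodule.span ℂ (Set.range fun i : Fin a × Fin k => γt i.1 i.2))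
        = k * a ∧
      (∀ ρ : ℝ, 0 < ρ → ∀ x₀ : ℂ, ∀ s : ℝ, (b : ℝ) / a ≤ s →
        ∃ G : Submodule.span ℂ (Set.range fun i : Fin a × Fin k => γt i.1 i.2) ≃ₗ[ℂ]
            Sol ![1, k * a, k * b] β s (Fin.cons x₀ (pt θ₁ ρ)),
          ∀ C, HasExpansion ![1, k * a, k * b] β θ₂ C.1 (G C).1) ∧
      ∀ ρ : ℝ, 0 < ρ →
        -- the map `ϖ_β` is well defined
        Set.MapsTo (varpi k (pt θ₁ ρ))
          (Sol ![1, k * a, k * b] β (b / a) (Fin.cons 0 (pt θ₁ ρ)))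
          {v | ∀ ℓ : Fin k, v ℓ ∈ Sol ![a, b] ((β - (ℓ : ℕ)) / k) (b / a) (pt θ₁ ρ)} ∧
        -- the images of the expansions `Φt τ r` of the new cycles
        ∀ (Φ : Fin a → Fin k → HolGerm (pt θ₁ ρ))
          (Φt : Fin a → Fin k → HolGerm (Fin.cons 0 (pt θ₁ ρ) : Fin 2 → ℂ)),
          (∀ (τ : Fin a) (r : Fin k), HasExpansion ![a, b] ((β - (r : ℕ)) / k) θ₂
            (Finsupp.single (γ τ r) 1) (Φ τ r)) →
          (∀ τ r, HasExpansion ![1, k * a, k * b] β θ₂ (γt τ r) (Φt τ r)) →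
          (VarpiIso a b k β (pt θ₁ ρ) →
            (∀ τ r, varpi k (pt θ₁ ρ) (Φt τ r) = Pi.single r ((1 / (k : ℂ)) • Φ τ r)) ∧
            ∀ τ r φ, γ τ r = GeomCycle.ray φ →
              γt τ r - Finsupp.single (GeomCycle.ray (φ / k)) 1 ∈
                Submodule.span ℂ {C | ∃ τ' r', (τ', r') ≠ (τ, r) ∧ C = γt τ' r'}) ∧
          (¬ VarpiIso a b k β (pt θ₁ ρ) →
            ∃ (τ₀ : Fin a) (r₀ : Fin k), (∃ q₀ : ℕ, β = (r₀ : ℕ) + k * q₀) ∧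
              (∀ τ r, Pi.single r (Φ τ r) ∈ Submodule.map (varpi k (pt θ₁ ρ))
                  (Sol ![1, k * a, k * b] β (b / a) (Fin.cons 0 (pt θ₁ ρ))) ↔
                (τ, r) ≠ (τ₀, r₀)) ∧
              (∀ τ r, (τ, r) ≠ (τ₀, r₀) →
                varpi k (pt θ₁ ρ) (Φt τ r) = Pi.single r ((1 / (k : ℂ)) • Φ τ r)) ∧
              ∀ (x₀ : ℂ) (Ψ : HolGerm (Fin.cons x₀ (pt θ₁ ρ) : Fin 2 → ℂ)),
                HasExpansion ![1, k * a, k * b] β θ₂ (γt τ₀ r₀) Ψ → IsPolySeries Ψ) := by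
  refine ⟨exists_basicFamily k ha hab hcop β θ₁ θ₂, fun γ hγ => ?_⟩
  obtain ⟨γt, B, h⟩ := exists_isGoodLift hab hk hka hγ
  refine ⟨γt, h.admissible, h.mem_span, h.isLift.finrank_span hγ hk hka,
    fun ρ hρ x₀ s hs => h.isLift.exists_equiv hγ hk hka hρ x₀ hs,
    fun ρ hρ => ⟨h.isLift.mapsTo hγ hk hka hρ, fun Φ Φt hΦ hΦt => ⟨fun hV => ?_, fun hV => ?_⟩⟩⟩
  · have hB : ∀ i, ¬ B i := fun i hi => h.isLift.not_varpiIso hγ hk hka hρ hi hV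
    exact ⟨fun τ r => h.isLift.good ρ hρ τ r (hB _) _ _ (hΦ τ r) (hΦt τ r), h.ray hB⟩
  · obtain ⟨⟨τ₀, r₀⟩, hB⟩ : ∃ i, B i := by
      by_contra hB
      exact hV (h.isLift.bijOn hγ hk hka hρ (not_exists.1 hB))
    have hiff : ∀ i, B i ↔ i = (τ₀, r₀) :=
      fun i => ⟨fun hi => h.isLift.subsingleton _ _ hi hB, fun hi => hi ▸ hB⟩
    refine ⟨τ₀, r₀, (h.bad τ₀ r₀ hB).1, fun τ r => ?_, fun τ r hi => ?_,
      fun x₀ Ψ hΨ => (h.bad τ₀ r₀ hB).2 ρ hρ x₀ Ψ hΨ⟩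
    · rw [h.isLift.mem_map_iff hγ hk hka hρ hΦ τ r, hiff]
    · exact h.isLift.good ρ hρ τ r (fun hi' => hi ((hiff _).1 hi')) _ _ (hΦ τ r) (hΦt τ r)
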